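/- Let $n>2$. Let $\mathfrak g[1]$ be the graded manifold with coordinates $\xi^a$, $\rho^{ab}=-\rho^{ba}$ ($a,b=1,\dots,n$) of ghost degree $1$, with the presymplectic form $\omega^{\mathfrak g[1]}=\mathcal V_{abc}(\xi)\,d\xi^a d\rho^{bc}$, where $\mathcal V_{abc}(\xi)=\frac1{(n-3)!}\epsilon_{abcb_1\dots b_{n-3}}\xi^{b_1}\cdots\xi^{b_{n-3}}$. Let $M$ be the graded manifold of supermaps from $T_x[1]X$ (with $\dim X=n$ and odd fibre coordinates $\theta^\mu$) to $\mathfrak g[1]$, $$\xi^a(\theta)=\xi^a+e^a_\mu\theta^\mu+\tfrac12\overset{2}{\xi}{}^a_{\mu\nu}\theta^\mu\theta^\nu+\dots,\qquad \rho^{ab}(\theta)=\rho^{ab}+\omega^{ab}_\mu\theta^\mu+\tfrac12\overset{2}{\rho}{}^{ab}_{\mu\nu}\theta^\mu\theta^\nu+\dots,$$ such that the matrix $e^a_\mu$ is invertible; a coefficient of $\theta^{\mu_1}\cdots\theta^{\mu_k}$ is a coordinate on $M$ of degree $1-k$. Equip $M$ with the presymplectic form $\omega^M=\int d^n\theta\,\mathcal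 V_{abc}(\xi(\theta))\,d\xi^a(\theta)\,d\rho^{bc}(\theta)$ of degree $-1$. Then the symplectic quotient $\pi:M\to N$ of $(M,\omega^M)$ by the kernel distribution of $\omega^M$ exists. Let $\omega^N$ be its symplectic form (of degree $-1$, $\pi^*\omega^N=\omega^M$), and let $N_{01}\subset N$ be the submanifold obtained by setting all coordinates of negative degree to zero, i.e. the one whose vanishing ideal is generated by the functions of negative degree. Then: 1. $\pi$ maps the submanifold of $M$ on which all coordinates of negative degree vanish isomorphically onto $N_{01}$; thus $\xi^a,\rho^{ab},e^a_\mu,\omega^{ab}_\mu$ are coordinates on $N_{01}$. 2. $N_{01}$ is a Lagrangian submanifold of $(N,\omega^N)$. 3. There is a symplectomorphism $N\cong T^*[-1]N_{01}$ that restricts on $N_{01}$ to the zero section. In other words, $N$ has Darboux coordinates $$\omega^N=d\xi^a\wedge d\xi^*_a+\sum_{a<b}d\rho^{ab}\wedge d\rho^*_{ab}+de^a_\mu\wedge de^{*\mu}_a+\sum_{a<b}d\omega^{ab}_\mu\wedge d\omega^{*\mu}_{ab}$$ consisting of fields and ghosts, which restrict to the coordinates $\xi^a,\rho^{ab},e^a_\mu,\omega^{ab}_\mu$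 on $N_{01}$, and of their antifields (of degree $-2$ for $\xi^*_a,\rho^*_{ab}$ and $-1$ for $e^{*\mu}_a,\omega^{*\mu}_{ab}$), which vanish on $N_{01}$. -/

import Mathlib

open scoped TensorProduct ContDiff Manifold

noncomputable section

/-! ## Smooth functions on an open subset of a coordinate space -/

/-- The algebra `C^∞(U)` of smooth real functions on an open set `U ⊆ ℝ^κ`. -/
abbrev SmoothFun {κ : Type} [Fintype κ] (U : TopologicalSpace.Opens (κ → ℝ)) : Type :=
  C^∞⟮𝓘(ℝ, κ → ℝ), U; 𝓘(ℝ, ℝ), ℝ⟯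

namespace SmoothFun

variable {κ : Type} [Fintype κ] {U : TopologicalSpace.Opens (κ → ℝ)}

open Classical in
/-- Extension by zero; only its values on `U` matter. -/
def extend (f : SmoothFun U) (x : κ → ℝ) : ℝ := if h : x ∈ U then f ⟨x, h⟩ else 0

theorem extend_coe (f : SmoothFun U) (x : U) : f.extend (x : κ → ℝ) = f x := by
  simp [extend]

theorem contDiffOn_extend (f : SmoothFun U) : ContDiffOn ℝ ∞ f.extend U := by
  rw [← contMDiffOn_iff_contDiffOn]
  intro x hx
  apply ContMDiffAt.contMDiffWithinAt
  have h := contMDiffAt_subtype_iff (I := 𝓘(ℝ, κ → ℝ)) (I' := 𝓘(ℝ, ℝ)) (n := ∞) (U := U)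
    (f := f.extend) (x := ⟨x, hx⟩)
  refine h.1 ?_
  have hf : (fun y : U => f.extend (y : κ → ℝ)) = f := funext f.extend_coe
  rw [hf]
  exact f.contMDiff.contMDiffAt

/-- Restriction to `U` of a function that is smooth on `U`. -/
def ofContDiffOn (g : (κ → ℝ) → ℝ) (hg : ContDiffOn ℝ ∞ g U) : SmoothFun U :=
  ⟨fun x => g x, fun x => contMDiffAt_subtype_iff.2
    ((contMDiffOn_iff_contDiffOn.2 hg).contMDiffAt (U.isOpen.mem_nhds x.2))⟩

/-- The coordinate function `x ↦ x k`. -/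
def coord (U : TopologicalSpace.Opens (κ → ℝ)) (k : κ) : SmoothFun U :=
  ofContDiffOn (fun x => x k) (contDiff_apply ℝ ℝ k).contDiffOn

open Classical in
theorem contDiffOn_partial (f : SmoothFun U) (k : κ) :
    ContDiffOn ℝ ∞ (fun x => fderiv ℝ f.extend x (Pi.single k 1)) U :=
  (f.contDiffOn_extend.fderiv_of_isOpen U.isOpen (by simp)).clm_apply contDiffOn_const

theorem differentiableAt_extend (f : SmoothFun U) (x : U) :
    DifferentiableAt ℝ f.extend (x : κ → ℝ) :=
  (f.contDiffOn_extend.contDiffAt (U.isOpen.mem_nhds x.2)).differentiableAt (by simp)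

open Classical in
/-- The partial derivative `∂/∂x^k` on `C^∞(U)`. -/
def partialDeriv (U : TopologicalSpace.Opens (κ → ℝ)) (k : κ) :
    SmoothFun U →ₗ[ℝ] SmoothFun U where
  toFun f := ofContDiffOn _ (f.contDiffOn_partial k)
  map_add' f g := by
    ext x
    have h : (f + g).extend = f.extend + g.extend := by
      funext y
      by_cases hy : y ∈ U <;> simp [extend, hy]
    change fderiv ℝ (f + g).extend x _ = fderiv ℝ f.extend x _ + fderiv ℝ g.extend x _
    rw [h, fderiv_add (f.differentiableAt_extend x) (g.differentiableAt_extend x)]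
    rfl
  map_smul' c f := by
    ext x
    have h : (c • f).extend = c • f.extend := by
      funext y
      by_cases hy : y ∈ U <;> simp [extend, hy]
    change fderiv ℝ (c • f).extend x _ = c • fderiv ℝ f.extend x _
    rw [h, fderiv_const_smul (f.differentiableAt_extend x)]
    rfl

end SmoothFun

/-! ## Free supercommutative algebras -/

/-- The supercommutative algebra with odd generators `O`, even polynomial generators `E` and
even coefficients `C`. -/
def FreeSuper (O E C : Type) [CommRing C] [Algebra ℝ C] : Type :=
  ExteriorAlgebra ℝ (O →₀ ℝ) ⊗[ℝ] (MvPolynomial E ℝ ⊗[ℝ] C)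

namespace FreeSuper

variable {O E C : Type} [CommRing C] [Algebra ℝ C]

instance : Ring (FreeSuper O E C) :=
  inferInstanceAs (Ring (ExteriorAlgebra ℝ (O →₀ ℝ) ⊗[ℝ] (MvPolynomial E ℝ ⊗[ℝ] C)))

instance : Algebra ℝ (FreeSuper O E C) :=
  inferInstanceAs (Algebra ℝ (ExteriorAlgebra ℝ (O →₀ ℝ) ⊗[ℝ] (MvPolynomial E ℝ ⊗[ℝ] C)))

/-- The identification with the underlying tensor product. -/
def toTensor :
    FreeSuper O E C ≃ₐ[ℝ] ExteriorAlgebra ℝ (O →₀ ℝ) ⊗[ℝ] (MvPolynomial E ℝ ⊗[ℝ] C) :=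
  { Equiv.refl _ with
    map_mul' := fun _ _ => rfl
    map_add' := fun _ _ => rfl
    commutes' := fun _ => rfl }

/-- A linear operator on the underlying tensor product, as an operator on `FreeSuper O E C`. -/
def lift (L : ExteriorAlgebra ℝ (O →₀ ℝ) ⊗[ℝ] (MvPolynomial E ℝ ⊗[ℝ] C) →ₗ[ℝ]
      ExteriorAlgebra ℝ (O →₀ ℝ) ⊗[ℝ] (MvPolynomial E ℝ ⊗[ℝ] C)) :
    FreeSuper O E C →ₗ[ℝ] FreeSuper O E C :=
  toTensor.symm.toLinearMap ∘ₗ L ∘ₗ toTensor.toLinearMap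

/-- An odd generator. -/
def odd (o : O) : FreeSuper O E C :=
  toTensor.symm (ExteriorAlgebra.ι ℝ (Finsupp.single o 1) ⊗ₜ 1)

/-- An even polynomial generator. -/
def even (e : E) : FreeSuper O E C := toTensor.symm (1 ⊗ₜ (MvPolynomial.X e ⊗ₜ 1))

/-- A coefficient. -/
def coeff (c : C) : FreeSuper O E C := toTensor.symm (1 ⊗ₜ (1 ⊗ₜ c))

/-- Left derivative with respect to an odd generator. -/
def oddDeriv (o : O) : FreeSuper O E C →ₗ[ℝ] FreeSuper O E C :=
  lift (LinearMap.rTensor _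
    (CliffordAlgebra.contractLeft (Q := (0 : QuadraticForm ℝ (O →₀ ℝ))) (Finsupp.lapply o)))

/-- Derivative with respect to an even polynomial generator. -/
def evenDeriv (e : E) : FreeSuper O E C →ₗ[ℝ] FreeSuper O E C :=
  lift (LinearMap.lTensor _ (LinearMap.rTensor _ (MvPolynomial.pderiv e).toLinearMap))

/-- Extension to the whole algebra of a linear operator on coefficients. -/
def coeffMap (D : C →ₗ[ℝ] C) : FreeSuper O E C →ₗ[ℝ] FreeSuper O E C :=
  lift (LinearMap.lTensor _ (LinearMap.lTensor _ D))

/-- Adjoining further odd generators `T`. -/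
def adjoin (T : Type) : FreeSuper O E C →ₐ[ℝ] FreeSuper (O ⊕ T) E C :=
  (toTensor.symm.toAlgHom.comp (Algebra.TensorProduct.map
    (ExteriorAlgebra.map (Finsupp.lmapDomain ℝ ℝ Sum.inl)) (AlgHom.id ℝ _))).comp
    toTensor.toAlgHom

/-- Setting the odd generators `T` to zero. -/
def forget (T : Type) : FreeSuper (O ⊕ T) E C →ₐ[ℝ] FreeSuper O E C :=
  (toTensor.symm.toAlgHom.comp (Algebra.TensorProduct.map
    (ExteriorAlgebra.map (Finsupp.lcomapDomain Sum.inl Sum.inl_injective))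
    (AlgHom.id ℝ _))).comp toTensor.toAlgHom

/-- The Berezin integral `∫ dⁿθ` over `n` additional odd generators `θ⁰, …, θⁿ⁻¹`, that is, the
iterated left derivative `∂/∂θⁿ⁻¹ ⋯ ∂/∂θ⁰`. -/
def berezin (n : ℕ) : FreeSuper (O ⊕ Fin n) E C →ₗ[ℝ] FreeSuper O E C :=
  (forget (Fin n)).toLinearMap ∘ₗ
    (List.finRange n).foldl (fun L μ => oddDeriv (Sum.inr μ) ∘ₗ L) LinearMap.id

end FreeSuper

/-! ## Graded manifolds with global coordinates and their differential forms -/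

/-- A `ℤ`-graded manifold with a global coordinate system: coordinates `z^i` (`i : ι`) of integer
(ghost) degree `deg i`, the parity of `z^i` being the parity of `deg i`; the coordinates of degree
zero range over an open subset (the body) of a coordinate space. -/
structure GradedDomain where
  ι : Type
  [fintype : Fintype ι]
  deg : ι → ℤ
  body : TopologicalSpace.Opens ({i : ι // deg i = 0} → ℝ)

namespace GradedDomain

attribute [instance] GradedDomain.fintype

variable (G : GradedDomain)

/-- Odd generators of the algebra of forms: `z^i` with `deg i` odd, `dz^i` with `deg i` even. -/
abbrev OddGen : Type := {i : G.ι // Odd (G.deg i)} ⊕ {i : G.ι // Even (G.deg i)}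

/-- Even polynomial generators of the algebra of forms: `z^i` with `deg i` even and nonzero,
`dz^i` with `deg i` odd. -/
abbrev EvenGen : Type := {i : G.ι // Even (G.deg i) ∧ G.deg i ≠ 0} ⊕ {i : G.ι // Odd (G.deg i)}

/-- The algebra `Ω(G)` of differential forms on `G`, that is, of functions on `T[1]G`: smooth in
the coordinates of degree zero, polynomial in the other generators, and supercommutative, the
parity of `dz^i` being opposite to that of `z^i`. Functions on `G` are the forms of form
degree zero. -/
abbrev Forms : Type := FreeSuper G.OddGen G.EvenGen (SmoothFun G.body)

/-- The coordinate function `z^i`. -/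
def z (i : G.ι) : G.Forms :=
  if h : G.deg i = 0 then FreeSuper.coeff (SmoothFun.coord G.body ⟨i, h⟩)
  else if h' : Even (G.deg i) then FreeSuper.even (Sum.inl ⟨i, h', h⟩)
  else FreeSuper.odd (Sum.inl ⟨i, Int.not_even_iff_odd.1 h'⟩)

/-- The coordinate differential `dz^i`. -/
def dz (i : G.ι) : G.Forms :=
  if h : Even (G.deg i) then FreeSuper.odd (Sum.inr ⟨i, h⟩)
  else FreeSuper.even (Sum.inr ⟨i, Int.not_even_iff_odd.1 h⟩)

/-- The left partial derivative `∂/∂z^i`. -/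
def pd (i : G.ι) : G.Forms →ₗ[ℝ] G.Forms :=
  if h : G.deg i = 0 then FreeSuper.coeffMap (SmoothFun.partialDeriv G.body ⟨i, h⟩)
  else if h' : Even (G.deg i) then FreeSuper.evenDeriv (Sum.inl ⟨i, h', h⟩)
  else FreeSuper.oddDeriv (Sum.inl ⟨i, Int.not_even_iff_odd.1 h'⟩)

/-- The left partial derivative `∂/∂(dz^i)`. -/
def pdd (i : G.ι) : G.Forms →ₗ[ℝ] G.Forms :=
  if h : Even (G.deg i) then FreeSuper.oddDeriv (Sum.inr ⟨i, h⟩)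
  else FreeSuper.evenDeriv (Sum.inr ⟨i, Int.not_even_iff_odd.1 h⟩)

/-- The de Rham differential `d = ∑ dz^i ∂/∂z^i`. -/
def d (α : G.Forms) : G.Forms := ∑ i, G.dz i * G.pd i α

/-- The monomials `f(x) z^{i₁} ⋯ dz^{j₁} ⋯`. The letter `inl i` stands for `z^i` and `inr i`
for `dz^i`. -/
def monomial (f : SmoothFun G.body) (l : List (G.ι ⊕ G.ι)) : G.Forms :=
  FreeSuper.coeff f * (l.map (Sum.elim G.z G.dz)).prod

/-- The forms of form degree `p` and ghost degree `k` (`d` has ghost degree zero). -/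
def homog (p : ℕ) (k : ℤ) : Submodule ℝ G.Forms :=
  Submodule.span ℝ {α | ∃ f l, α = G.monomial f l ∧
    (l.filter (fun a => a.isRight)).length = p ∧ (l.map (Sum.elim G.deg G.deg)).sum = k}

/-- The forms of form degree `p`. -/
def formsOfDegree (p : ℕ) : Submodule ℝ G.Forms := ⨆ k, G.homog p k

/-- The functions on `G`. -/
abbrev functions : Submodule ℝ G.Forms := G.formsOfDegree 0

/-- The vector fields `X = ∑ X^i ∂/∂z^i`, given by their components. -/
def vectorFields : Set (G.ι → G.Forms) := {X | ∀ i, X i ∈ G.functions}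

/-- The action of a vector field on a function. -/
def apply (X : G.ι → G.Forms) (f : G.Forms) : G.Forms := ∑ i, X i * G.pd i f

/-- The interior product `i_X = ∑ X^i ∂/∂(dz^i)`. -/
def contract (X : G.ι → G.Forms) (α : G.Forms) : G.Forms := ∑ i, X i * G.pdd i α

/-- The kernel distribution of a 2-form. -/
def kernel (σ : G.Forms) : Set (G.ι → G.Forms) := {X ∈ G.vectorFields | G.contract X σ = 0}

/-- A symplectic form of ghost degree `k`: a closed 2-form of ghost degree `k` such that
`X ↦ i_X σ` is a bijection from vector fields to 1-forms. -/
structure IsSymplectic (k : ℤ) (σ : G.Forms) : Prop where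
  mem : σ ∈ G.homog 2 k
  closed : G.d σ = 0
  nondegenerate : ∀ α ∈ G.formsOfDegree 1, ∃! X, X ∈ G.vectorFields ∧ G.contract X σ = α

/-- A morphism `G → H` of graded manifolds, given by the pullback of differential forms. -/
structure Hom (G H : GradedDomain) where
  pullback : H.Forms →ₐ[ℝ] G.Forms
  map_homog : ∀ p k, ∀ α ∈ H.homog p k, pullback α ∈ G.homog p k
  map_d : ∀ α, pullback (H.d α) = G.d (pullback α)

/-- Composition of morphisms `G → H → K`. -/
def Hom.comp {G H K : GradedDomain} (ψ : Hom H K) (φ : Hom G H) : Hom G K where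
  pullback := φ.pullback.comp ψ.pullback
  map_homog p k α hα := φ.map_homog p k _ (ψ.map_homog p k α hα)
  map_d α := by
    rw [AlgHom.comp_apply, AlgHom.comp_apply, ψ.map_d, φ.map_d]

/-- `π : M → N` exhibits `(N, σN)` as the symplectic quotient (the space of leaves of the kernel
distribution) of the presymplectic `(M, σ)`, the symplectic form having ghost degree `k`: the
pullback of forms along `π` is injective, the functions on `N` are identified by it with the
functions on `M` that are annihilated by all vector fields in the kernel of `σ`, and the
symplectic form `σN` is pulled back to `σ`. -/
structure IsSymplecticQuotient {M : GradedDomain} (k : ℤ) (σ : M.Forms) (N : GradedDomain)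
    (σN : N.Forms) (π : Hom M N) : Prop where
  symplectic : N.IsSymplectic k σN
  pullback_form : π.pullback σN = σ
  pullback_injective : Function.Injective π.pullback
  invariants : ∀ f ∈ M.functions,
    (∀ X ∈ M.kernel σ, M.apply X f = 0) ↔ ∃ g ∈ N.functions, π.pullback g = f

/-- The ideal of functions generated by the functions of negative degree. Its zero locus is the
submanifold obtained by setting all coordinates of negative degree to zero. -/
def negIdeal : Submodule ℝ G.Forms :=
  Submodule.span ℝ {h | ∃ g ∈ G.functions, ∃ k < 0, ∃ f ∈ G.homog 0 k, h = g * f}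

/-- `j : L → G` is the embedding of a closed submanifold with vanishing ideal `I`. -/
def IsClosedEmbedding {L G : GradedDomain} (j : Hom L G) (I : Submodule ℝ G.Forms) : Prop :=
  (∀ f ∈ L.functions, ∃ g ∈ G.functions, j.pullback g = f) ∧
    ∀ g ∈ G.functions, j.pullback g = 0 ↔ g ∈ I

/-- The vector fields on `G` that are tangent to the submanifold with vanishing ideal `I`. -/
def tangent (I : Submodule ℝ G.Forms) : Set (G.ι → G.Forms) :=
  {X ∈ G.vectorFields | ∀ f ∈ I, G.apply X f ∈ I}

/-- The submanifold with vanishing ideal `I` is Lagrangian: along it, the tangent distribution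
coincides with its own orthogonal complement with respect to `σ`. -/
def IsLagrangian (σ : G.Forms) (I : Submodule ℝ G.Forms) : Prop :=
  ∀ X ∈ G.vectorFields,
    X ∈ G.tangent I ↔ ∀ Y ∈ G.tangent I, G.contract Y (G.contract X σ) ∈ I

/-- The graded manifold that has the coordinates of `G` of nonnegative degree as its coordinates. -/
def nonneg : GradedDomain where
  ι := {i : G.ι // 0 ≤ G.deg i}
  fintype := Fintype.ofFinite _
  deg i := G.deg i
  body := ⟨{x | (fun i : {i : G.ι // G.deg i = 0} =>
      x ⟨⟨i.1, i.2.ge⟩, i.2⟩) ∈ G.body},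
    G.body.isOpen.preimage (by fun_prop)⟩

/-- The morphism `i : G.nonneg → G` is the submanifold obtained by setting all coordinates of
negative degree to zero and keeping the others. -/
def IsNonnegInclusion (i : Hom G.nonneg G) : Prop :=
  (∀ c : G.nonneg.ι, i.pullback (G.z c.1) = G.nonneg.z c) ∧
    ∀ c : G.ι, G.deg c < 0 → i.pullback (G.z c) = 0

/-- The shifted cotangent bundle `T^*[-1]G`: the coordinates are `z^i` (the letter `inl i`), of
degree `deg i`, and the conjugate `z^*_i` (the letter `inr i`), of degree `-1 - deg i`. -/
def shiftedCotangent : GradedDomain where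
  ι := G.ι ⊕ G.ι
  deg := Sum.elim G.deg (fun i => -1 - G.deg i)
  body := ⟨{x | (fun i : {i : G.ι // G.deg i = 0} => x ⟨Sum.inl i.1, i.2⟩) ∈ G.body},
    G.body.isOpen.preimage (by fun_prop)⟩

/-- The canonical form `∑ dz^i ∧ dz^*_i` of `T^*[-1]G`. -/
def canonicalForm : G.shiftedCotangent.Forms :=
  ∑ i : G.ι, G.shiftedCotangent.dz (Sum.inl i) * G.shiftedCotangent.dz (Sum.inr i)

/-- `s : G → T^*[-1]G` is the zero section. -/
def IsZeroSection (s : Hom G G.shiftedCotangent) : Prop :=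
  (∀ i, s.pullback (G.shiftedCotangent.z (Sum.inl i)) = G.z i) ∧
    ∀ i, s.pullback (G.shiftedCotangent.z (Sum.inr i)) = 0

end GradedDomain

/-! ## The presymplectic fiber of the Cartan-Weyl theory -/

namespace CartanWeyl

/-- Labels of the coordinates on `𝔤[1]`, all of degree one: `inl a` for `ξ^a`, and
`inr (a, b)`, `a < b`, for the independent components of `ρ^{ab} = -ρ^{ba}`. -/
abbrev Target (n : ℕ) : Type := Fin n ⊕ {p : Fin n × Fin n // p.1 < p.2}

/-- The labels of the component `e^a_μ` (the pair `(inl a, {μ})`). -/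
def frameIdx {n : ℕ} (a μ : Fin n) :
    {i : Target n × Finset (Fin n) // (1 : ℤ) - (i.2.card : ℤ) = 0} :=
  ⟨(Sum.inl a, {μ}), by simp⟩

/-- The matrix `e^a_μ` at a point of the space with coordinates `e^a_μ, ω^{ab}_μ`. -/
def frame {n : ℕ} (x : {i : Target n × Finset (Fin n) // (1 : ℤ) - (i.2.card : ℤ) = 0} → ℝ) :
    Matrix (Fin n) (Fin n) ℝ := Matrix.of fun a μ => x (frameIdx a μ)

/-- The graded manifold `M` of supermaps `ψ` from `T_x[1]X` (`dim X = n`) to `𝔤[1]` with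
nondegenerate `e^a_μ`. Its coordinates are the coefficients `ψ^A_S`, `S ⊆ {0, …, n-1}`, in
`ψ^A(θ) = ∑_S ψ^A_S θ^S`; the degree of `ψ^A_S` is `1 - |S|`. Thus `ξ^a, ρ^{ab}` are the
coefficients with `|S| = 0` and `e^a_μ, ω^{ab}_μ` those with `|S| = 1`. -/
def fiber (n : ℕ) : GradedDomain where
  ι := Target n × Finset (Fin n)
  deg i := 1 - (i.2.card : ℤ)
  body := ⟨{x | (frame x).det ≠ 0}, by
    refine isOpen_ne_fun ?_ continuous_const
    refine Continuous.matrix_det ?_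
    exact continuous_matrix fun a μ => continuous_apply (frameIdx a μ)⟩

/-- Forms on `M` with coefficients in the functions of `θ⁰, …, θⁿ⁻¹`. -/
abbrev SuperForms (n : ℕ) : Type :=
  FreeSuper ((fiber n).OddGen ⊕ Fin n) (fiber n).EvenGen (SmoothFun (fiber n).body)

/-- `θ^S = θ^{μ₁} ⋯ θ^{μ_k}` for `S = {μ₁ < ⋯ < μ_k}`. -/
def theta {n : ℕ} (S : Finset (Fin n)) : SuperForms n :=
  ((S.sort (· ≤ ·)).map fun μ => FreeSuper.odd (Sum.inr μ)).prod

/-- The generating function `ψ^A(θ)` of the coordinates on `M`. -/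
def psi {n : ℕ} (A : Target n) : SuperForms n :=
  ∑ S : Finset (Fin n), FreeSuper.adjoin (Fin n) ((fiber n).z (A, S)) * theta S

/-- The generating function `dψ^A(θ)` of the coordinate differentials on `M`. -/
def dpsi {n : ℕ} (A : Target n) : SuperForms n :=
  ∑ S : Finset (Fin n), FreeSuper.adjoin (Fin n) ((fiber n).dz (A, S)) * theta S

/-- `dρ^{ab}(θ)`, antisymmetric in `a, b`. -/
def drho {n : ℕ} (a b : Fin n) : SuperForms n :=
  if h : a < b then dpsi (Sum.inr ⟨(a, b), h⟩)
  else if h : b < a then -dpsi (Sum.inr ⟨(b, a), h⟩)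
  else 0

/-- The totally antisymmetric symbol `ε_{v₀ ⋯ v_{n-1}}` with `ε_{0 1 ⋯ n-1} = 1`, for a list of
`n` indices. -/
def levi {n : ℕ} (v : List (Fin n)) : ℝ :=
  (Matrix.of fun i j : Fin n => if v[(i : ℕ)]? = some j then (1 : ℝ) else 0).det

/-- `𝒱_{abc}(ξ(θ)) = 1/(n-3)! ε_{abc b₁ ⋯ b_{n-3}} ξ^{b₁}(θ) ⋯ ξ^{b_{n-3}}(θ)`, for `n ≥ 3`. -/
def vol3 {n : ℕ} (a b c : Fin n) : SuperForms n :=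
  ∑ f : Fin (n - 3) → Fin n,
    (((n - 3).factorial : ℝ)⁻¹ * levi (a :: b :: c :: List.ofFn f)) •
      (List.ofFn fun i => psi (Sum.inl (f i))).prod

/-- The presymplectic form `ω^M = ∫ dⁿθ 𝒱_{abc}(ξ(θ)) dξ^a(θ) dρ^{bc}(θ)` on `M`, for `n ≥ 3`. -/
def omegaM (n : ℕ) : (fiber n).Forms :=
  FreeSuper.berezin n
    (∑ a : Fin n, ∑ b : Fin n, ∑ c : Fin n, vol3 a b c * dpsi (Sum.inl a) * drho b c)

end CartanWeyl

end

/-! Let `V_{bc}` be the volume element `1/n! ε ξ ⋯ ξ` differentiated twice, so that `∂V_{bc}/∂ξ^a =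
V_{abc}`. The chain rule turns the presymplectic form into `ω^M = ∑ dP_{p,S} dρ^p_S`, summed over
pairs `p = (b < c)` and subsets `S`, where `P_{p,S} = ±2 ∫ dⁿθ V_{bc}(ξ(θ)) θ^S` has degree `|S| -
2` (`omegaM_eq`). Everything depends on how many of the functions `P_{p,S}` are independent.

Cut `ξ^a(θ)` off after its quadratic term. As `e^a_μ` is invertible, `e⁻¹` times the truncation is
`θ^μ` up to terms of higher order, so a unipotent change of coordinates on `M` replaces every
`θ`-monomial of degree at least three by the same monomial in these odd functions
(`exists_straightening`). Then `ξ(θ)` is the truncation plus a tail of degree at least three in the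
truncation. Products of more than `n` of the `n` truncated functions vanish. Hence the expansion of
`V_{bc}`, of degree `n - 2`, stops after the term linear in the tail, and only the cubic part of the
tail survives, as one function `C_p` times the volume element (`subst_add_gvol_two`,
`exists_word_flat_mul`). So all `P_{p,S}` come from a space with coordinates `ξ^a`, `e^a_μ`, the
second coefficients of `ξ^a(θ)` (as many as the `ω^{ab}_μ`) and the `C_p` (as many as the `ρ^{ab}`);
see `exists_redProjection`. There the `P_{p,S}` with `|S| ≤ 1` can replace the last two groups
(`exists_redPotential_coordinates`). The invertibility of the Jacobian is linear algebra with
contracted `ε` symbols, and this is where `n > 2` enters decisively: traces produce the factor `n -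
2`.

Consequently `P_{p,S} = F_{p,S}(u)` with `u = (ξ, e, P_{p,∅}, P_{p,μ})` (`nonempty_reduction`), and
`ω^M = ∑ du^j dv_j` with `v_j = ∑ ± (∂_j F_{p,S}) ρ^p_S` (`Reduction.omegaM_eq_sum`). For `j = (p,
S)` with `|S| ≤ 1` the function `v_j` is `ρ^p` or `ω^p_μ` plus terms containing coordinates of
negative degree; for the labels of `ξ, e` it is an antifield. The `u^j` and `v_j` are independent to
first order (`Reduction.eq_zero_of_leads`), so they are the components of a submersion from `M` to
`T^*[-1]N_{01}` that pulls the canonical form back to `ω^M`.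

The geometry of such maps is controlled by the filtration by order in the coordinates of nonzero
degree and the differentials. All degrees are at most one and the ghosts are odd, so in a fixed
bidegree the order is bounded (`filHomog_eq_bot`): Taylor expansions and geometric series are
finite. Thus a map with surjective leading Jacobian and identified bodies has a section, and
functions annihilated by vertical fields descend (`Hom.exists_section`); a submersion onto a shifted
cotangent bundle is therefore the symplectic quotient (`isSymplecticQuotient_shiftedCotangent`).

Where the coordinates of negative degree vanish, antifields are zero by degree and fields restrict
to the coordinates, so this submanifold maps onto the zero section, which is Lagrangian
(`IsZeroSection.isLagrangian`). Any two symplectic quotients are isomorphic over `M`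
(`IsSymplecticQuotient.exists_iso`), which carries the conclusions to every quotient. -/

noncomputable section

/-! ### Generators of free supercommutative algebras, parity, homomorphisms and superderivations. -/

namespace FreeSuper

variable {O E C : Type} [CommRing C] [Algebra ℝ C]

theorem odd_mul_symm (o : O) (x) (y : MvPolynomial E ℝ ⊗[ℝ] C) :
    (odd o : FreeSuper O E C) * toTensor.symm (x ⊗ₜ y) =
      toTensor.symm ((ExteriorAlgebra.ι ℝ (Finsupp.single o 1) * x) ⊗ₜ y) := by
  rw [odd, ← map_mul, Algebra.TensorProduct.tmul_mul_tmul, one_mul]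

theorem even_mul_symm (e : E) (x) (p : MvPolynomial E ℝ) (c : C) :
    (even e : FreeSuper O E C) * toTensor.symm (x ⊗ₜ (p ⊗ₜ c)) =
      toTensor.symm (x ⊗ₜ ((MvPolynomial.X e * p) ⊗ₜ c)) := by
  rw [even, ← map_mul, Algebra.TensorProduct.tmul_mul_tmul, one_mul,
    Algebra.TensorProduct.tmul_mul_tmul, one_mul]

theorem coeff_mul_symm (c' : C) (x) (p : MvPolynomial E ℝ) (c : C) :
    (coeff c' : FreeSuper O E C) * toTensor.symm (x ⊗ₜ (p ⊗ₜ c)) =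
      toTensor.symm (x ⊗ₜ (p ⊗ₜ (c' * c))) := by
  rw [coeff, ← map_mul, Algebra.TensorProduct.tmul_mul_tmul, one_mul,
    Algebra.TensorProduct.tmul_mul_tmul, one_mul]

/-- The inclusion of the coefficients as an algebra homomorphism. -/
def coeffHom : C →ₐ[ℝ] FreeSuper O E C :=
  toTensor.symm.toAlgHom.comp
    (Algebra.TensorProduct.includeRight.comp Algebra.TensorProduct.includeRight)

theorem coeff_add (a b : C) : (coeff (a + b) : FreeSuper O E C) = coeff a + coeff b :=
  map_add coeffHom a b
theorem coeff_mul (a b : C) : (coeff (a * b) : FreeSuper O E C) = coeff a * coeff b :=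
  map_mul coeffHom a b
theorem coeff_smul (r : ℝ) (a : C) : (coeff (r • a) : FreeSuper O E C) = r • coeff a :=
  map_smul coeffHom r a
@[simp] theorem coeff_zero : (coeff (0 : C) : FreeSuper O E C) = 0 := map_zero coeffHom
@[simp] theorem coeff_one : (coeff (1 : C) : FreeSuper O E C) = 1 := map_one coeffHom
theorem coeff_sum {ι : Type*} (s : Finset ι) (f : ι → C) :
    (coeff (∑ i ∈ s, f i) : FreeSuper O E C) = ∑ i ∈ s, coeff (f i) := map_sum coeffHom f s

/-- Induction by left multiplication with generators. -/
theorem induction {P : FreeSuper O E C → Prop} (hc : ∀ c, P (coeff c))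
    (ho : ∀ o a, P a → P (odd o * a)) (he : ∀ e a, P a → P (even e * a))
    (hadd : ∀ a b, P a → P b → P (a + b)) (hsmul : ∀ (r : ℝ) a, P a → P (r • a))
    (a : FreeSuper O E C) : P a := by
  have h0 : P 0 := by simpa using hc 0
  have key : ∀ x y, P (toTensor.symm (x ⊗ₜ y)) := by
    intro x
    induction x using CliffordAlgebra.left_induction with
    | algebraMap r =>
      intro y
      have : toTensor.symm ((algebraMap ℝ (ExteriorAlgebra ℝ (O →₀ ℝ)) r) ⊗ₜ[ℝ] y) =
          r • (toTensor.symm (1 ⊗ₜ y) : FreeSuper O E C) := by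
        rw [← map_smul, Algebra.algebraMap_eq_smul_one, TensorProduct.smul_tmul']
      erw [this]
      clear this
      apply hsmul
      induction y using TensorProduct.induction_on with
      | zero => simpa using h0
      | add y z hy hz => rw [TensorProduct.tmul_add, map_add]; exact hadd _ _ hy hz
      | tmul p c =>
        induction p using MvPolynomial.induction_on with
        | C r =>
          have : (toTensor.symm (1 ⊗ₜ (MvPolynomial.C r ⊗ₜ c)) : FreeSuper O E C) =
              r • coeff c := by
            rw [coeff, ← map_smul, ← TensorProduct.tmul_smul, TensorProduct.smul_tmul',
              MvPolynomial.C_eq_smul_one]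
          rw [this]
          exact hsmul _ _ (hc c)
        | add p q hp hq =>
          rw [TensorProduct.add_tmul, TensorProduct.tmul_add, map_add]; exact hadd _ _ hp hq
        | mul_X p e hp =>
          rw [mul_comm, ← even_mul_symm]; exact he _ _ hp
    | add x y hx hy =>
      intro z
      rw [TensorProduct.add_tmul, map_add]; exact hadd _ _ (hx z) (hy z)
    | ι_mul x m hx =>
      intro y
      induction m using Finsupp.induction_linear with
      | zero => simpa using h0
      | add m m' hm hm' =>
        rw [map_add, add_mul, TensorProduct.add_tmul, map_add]; exact hadd _ _ hm hm'
      | single o r =>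
        have : (toTensor.symm ((CliffordAlgebra.ι 0 (Finsupp.single o r) * x) ⊗ₜ y) :
            FreeSuper O E C) = r • (odd o * toTensor.symm (x ⊗ₜ y)) := by
          rw [odd_mul_symm, ← map_smul, TensorProduct.smul_tmul', ← smul_mul_assoc, ← map_smul,
            Finsupp.smul_single, smul_eq_mul, mul_one]
        erw [this]
        exact hsmul _ _ (ho _ _ (hx y))
  have : ∀ t, P (toTensor.symm t) := by
    intro t
    induction t using TensorProduct.induction_on with
    | zero => simpa using h0
    | add y z hy hz => rw [map_add]; exact hadd _ _ hy hz
    | tmul x y => exact key x y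
  simpa using this (toTensor a)

theorem algHom_ext {B : Type*} [Ring B] [Algebra ℝ B] {f g : FreeSuper O E C →ₐ[ℝ] B}
    (hc : ∀ c, f (coeff c) = g (coeff c)) (ho : ∀ o, f (odd o) = g (odd o))
    (he : ∀ e, f (even e) = g (even e)) : f = g := by
  ext a
  induction a using FreeSuper.induction with
  | hc c => exact hc c
  | ho o a ih => rw [map_mul, map_mul, ho, ih]
  | he o a ih => rw [map_mul, map_mul, he, ih]
  | hadd a b ha hb => rw [map_add, map_add, ha, hb]
  | hsmul r a ha => rw [map_smul, map_smul, ha]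

/-- Induction on elementary tensors. -/
theorem symm_ind {P : FreeSuper O E C → Prop} (h0 : P 0) (hadd : ∀ a b, P a → P b → P (a + b))
    (h : ∀ x p c, P (toTensor.symm (x ⊗ₜ (p ⊗ₜ c)))) (a) : P a := by
  have : ∀ t, P (toTensor.symm t) := by
    intro t
    induction t using TensorProduct.induction_on with
    | zero => simpa using h0
    | add y z hy hz => rw [map_add]; exact hadd _ _ hy hz
    | tmul x y =>
      induction y using TensorProduct.induction_on with
      | zero => simpa using h0
      | add y z hy hz => rw [TensorProduct.tmul_add, map_add]; exact hadd _ _ hy hz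
      | tmul p c => exact h x p c
  simpa using this (toTensor a)

/-! ### Parity -/

/-- The parity involution. -/
def inv : FreeSuper O E C →ₐ[ℝ] FreeSuper O E C :=
  (toTensor.symm.toAlgHom.comp (Algebra.TensorProduct.map
    (CliffordAlgebra.involute (Q := (0 : QuadraticForm ℝ (O →₀ ℝ)))) (AlgHom.id ℝ _))).comp
    toTensor.toAlgHom

theorem inv_symm (x) (y : MvPolynomial E ℝ ⊗[ℝ] C) :
    inv (toTensor.symm (x ⊗ₜ y) : FreeSuper O E C) =
      toTensor.symm (CliffordAlgebra.involute x ⊗ₜ y) := by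
  simp [inv]

@[simp] theorem inv_odd (o : O) : inv (odd o : FreeSuper O E C) = -odd o := by
  rw [odd, inv_symm]
  erw [CliffordAlgebra.involute_ι]
  rw [TensorProduct.neg_tmul, map_neg]

@[simp] theorem inv_even (e : E) : inv (even e : FreeSuper O E C) = even e := by
  rw [even, inv_symm, map_one]

@[simp] theorem inv_coeff (c : C) : inv (coeff c : FreeSuper O E C) = coeff c := by
  rw [coeff, inv_symm, map_one]

@[simp] theorem inv_inv (a : FreeSuper O E C) : inv (inv a) = a := by
  have : (inv.comp inv : FreeSuper O E C →ₐ[ℝ] _) = AlgHom.id ℝ _ :=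
    algHom_ext (by simp) (by simp) (by simp)
  exact DFunLike.congr_fun this a

theorem even_comm (e : E) (a : FreeSuper O E C) : even e * a = a * even e := by
  induction a using symm_ind with
  | h0 => simp
  | hadd a b ha hb => rw [mul_add, add_mul, ha, hb]
  | h x p c =>
    rw [even_mul_symm, even, ← map_mul, Algebra.TensorProduct.tmul_mul_tmul,
      Algebra.TensorProduct.tmul_mul_tmul, mul_one, mul_one, mul_comm]

theorem coeff_comm (c : C) (a : FreeSuper O E C) : coeff c * a = a * coeff c := by
  induction a using symm_ind with
  | h0 => simp
  | hadd a b ha hb => rw [mul_add, add_mul, ha, hb]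
  | h x p c =>
    rw [coeff_mul_symm, coeff, ← map_mul, Algebra.TensorProduct.tmul_mul_tmul,
      Algebra.TensorProduct.tmul_mul_tmul, mul_one, mul_one, mul_comm]

theorem odd_mul_odd (o o' : O) : (odd o : FreeSuper O E C) * odd o' = -(odd o' * odd o) := by
  rw [odd, odd, ← map_mul, ← map_mul, ← map_neg, Algebra.TensorProduct.tmul_mul_tmul,
    Algebra.TensorProduct.tmul_mul_tmul, ← TensorProduct.neg_tmul]
  congr 2
  exact eq_neg_of_add_eq_zero_left (ExteriorAlgebra.ι_add_mul_swap _ _)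

theorem odd_comm (o : O) (a : FreeSuper O E C) : odd o * a = inv a * odd o := by
  induction a using FreeSuper.induction with
  | hc c => rw [inv_coeff, coeff_comm]
  | ho o' a ih =>
    rw [← mul_assoc, odd_mul_odd, map_mul, inv_odd, neg_mul, mul_assoc, ih]; noncomm_ring
  | he e a ih => rw [← mul_assoc, ← even_comm, map_mul, inv_even, mul_assoc, ih, mul_assoc]
  | hadd a b ha hb => rw [mul_add, map_add, add_mul, ha, hb]
  | hsmul r a ha => rw [mul_smul_comm, map_smul, smul_mul_assoc, ha]

/-- The two halves must be proved together: left multiplication by an odd generator exchanges `a +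
inv a` and `a - inv a`, that is, twice the even and twice the odd part. -/
theorem parity_comm (a : FreeSuper O E C) : ∀ b, (a + inv a) * b = b * (a + inv a) ∧
    (a - inv a) * b = inv b * (a - inv a) := by
  induction a using FreeSuper.induction with
  | hc c =>
    intro b
    rw [inv_coeff, sub_self, add_mul, mul_add, coeff_comm]; simp
  | ho o a ih =>
    intro b
    have h1 : odd o * a + inv (odd o * a) = odd o * (a - inv a) := by
      rw [map_mul, inv_odd]; noncomm_ring
    have h2 : odd o * a - inv (odd o * a) = odd o * (a + inv a) := by
      rw [map_mul, inv_odd]; noncomm_ring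
    constructor
    · rw [h1, mul_assoc, (ih b).2, ← mul_assoc, odd_comm, inv_inv, mul_assoc]
    · rw [h2, mul_assoc, (ih b).1, ← mul_assoc, odd_comm, mul_assoc]
  | he e a ih =>
    intro b
    have h1 : even e * a + inv (even e * a) = even e * (a + inv a) := by
      rw [map_mul, inv_even]; noncomm_ring
    have h2 : even e * a - inv (even e * a) = even e * (a - inv a) := by
      rw [map_mul, inv_even]; noncomm_ring
    constructor
    · rw [h1, mul_assoc, (ih b).1, ← mul_assoc, even_comm, mul_assoc]
    · rw [h2, mul_assoc, (ih b).2, ← mul_assoc, even_comm, mul_assoc]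
  | hadd a b ha hb =>
    intro c
    have h1 : a + b + inv (a + b) = (a + inv a) + (b + inv b) := by rw [map_add]; abel
    have h2 : a + b - inv (a + b) = (a - inv a) + (b - inv b) := by rw [map_add]; abel
    constructor
    · rw [h1, add_mul (a + inv a), (ha c).1, (hb c).1, ← mul_add]
    · rw [h2, add_mul (a - inv a), (ha c).2, (hb c).2, ← mul_add]
  | hsmul r a ha =>
    intro c
    rw [map_smul, ← smul_add, ← smul_sub, smul_mul_assoc, smul_mul_assoc, (ha c).1, (ha c).2,
      mul_smul_comm, mul_smul_comm]
    trivial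

/-- The sign `(-1)^k`. -/
def sg (k : ℤ) : ℝ := if Even k then 1 else -1

theorem sg_even {k : ℤ} (h : Even k) : sg k = 1 := if_pos h
theorem sg_odd {k : ℤ} (h : ¬ Even k) : sg k = -1 := if_neg h
@[simp] theorem sg_zero : sg 0 = 1 := sg_even (by simp)

theorem sg_add (j k : ℤ) : sg (j + k) = sg j * sg k := by
  unfold sg
  by_cases hj : Even j <;> by_cases hk : Even k <;> simp [hj, hk, Int.even_add]

theorem sg_mul_self (k : ℤ) : sg k * sg k = 1 := by
  unfold sg; split_ifs <;> norm_num

theorem sg_ne_zero (k : ℤ) : sg k ≠ 0 := by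
  unfold sg; split_ifs <;> norm_num

theorem sg_congr {j k : ℤ} (h : Even (j - k)) : sg j = sg k := by
  have := sg_add (j - k) k
  rw [sub_add_cancel, sg_even h, one_mul] at this
  exact this

/-- The `k`-th power of the parity involution. -/
def tw (k : ℤ) : FreeSuper O E C →ₐ[ℝ] FreeSuper O E C :=
  if Even k then AlgHom.id ℝ _ else inv

theorem tw_even {k : ℤ} (h : Even k) (a : FreeSuper O E C) : tw k a = a := by simp [tw, h]
theorem tw_odd {k : ℤ} (h : ¬ Even k) (a : FreeSuper O E C) : tw k a = inv a := by simp [tw, h]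
@[simp] theorem tw_zero (a : FreeSuper O E C) : tw 0 a = a := tw_even (by simp) a
@[simp] theorem tw_one (a : FreeSuper O E C) : tw 1 a = inv a := tw_odd (by simp) a

theorem tw_add (j k : ℤ) (a : FreeSuper O E C) : tw (j + k) a = tw j (tw k a) := by
  by_cases hj : Even j <;> by_cases hk : Even k <;> simp [tw, hj, hk, Int.even_add]

theorem tw_tw (k : ℤ) (a : FreeSuper O E C) : tw k (tw k a) = a := by
  rw [← tw_add, tw_even (Even.add_self k)]

theorem tw_congr {j k : ℤ} (h : Even (j - k)) (a : FreeSuper O E C) : tw j a = tw k a := by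
  have := tw_add (j - k) k a
  rw [sub_add_cancel, tw_even h] at this
  exact this

@[simp] theorem tw_coeff (k : ℤ) (c : C) : tw k (coeff c : FreeSuper O E C) = coeff c := by
  unfold tw; split_ifs <;> simp
@[simp] theorem tw_even_gen (k : ℤ) (e : E) : tw k (even e : FreeSuper O E C) = even e := by
  unfold tw; split_ifs <;> simp

/-- `a` has parity `k`. -/
def IsPar (k : ℤ) (a : FreeSuper O E C) : Prop := inv a = sg k • a

theorem IsPar.tw {k : ℤ} {a : FreeSuper O E C} (h : IsPar k a) (j : ℤ) :
    tw j a = sg (j * k) • a := by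
  by_cases hj : Even j
  · rw [tw_even hj, sg_even (hj.mul_right k), one_smul]
  · rw [tw_odd hj, h]
    congr 1
    unfold sg
    simp [Int.even_mul, hj]

theorem IsPar.congr {j k : ℤ} {a : FreeSuper O E C} (h : IsPar j a) (hjk : Even (j - k)) :
    IsPar k a := by
  unfold IsPar; rw [← sg_congr hjk]; exact h

theorem isPar_zero (k : ℤ) : IsPar k (0 : FreeSuper O E C) := by simp [IsPar]

theorem IsPar.add {k : ℤ} {a b : FreeSuper O E C} (ha : IsPar k a) (hb : IsPar k b) :
    IsPar k (a + b) := by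
  unfold IsPar at *; rw [map_add, ha, hb, smul_add]

theorem IsPar.smul {k : ℤ} {a : FreeSuper O E C} (r : ℝ) (ha : IsPar k a) :
    IsPar k (r • a) := by
  unfold IsPar at *; rw [map_smul, ha, smul_comm]

theorem IsPar.sum {k : ℤ} {ι : Type*} {s : Finset ι} {a : ι → FreeSuper O E C}
    (h : ∀ i ∈ s, IsPar k (a i)) : IsPar k (∑ i ∈ s, a i) := by
  unfold IsPar at *; rw [map_sum, Finset.smul_sum]; exact Finset.sum_congr rfl h

theorem IsPar.mul {j k : ℤ} {a b : FreeSuper O E C} (ha : IsPar j a) (hb : IsPar k b) :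
    IsPar (j + k) (a * b) := by
  unfold IsPar at *
  rw [map_mul, ha, hb, smul_mul_smul_comm, sg_add]

theorem isPar_coeff (c : C) : IsPar 0 (coeff c : FreeSuper O E C) := by simp [IsPar]
theorem isPar_one : IsPar 0 (1 : FreeSuper O E C) := by simp [IsPar]
theorem isPar_even (e : E) : IsPar 0 (even e : FreeSuper O E C) := by simp [IsPar]
theorem isPar_odd (o : O) : IsPar 1 (odd o : FreeSuper O E C) := by
  simp [IsPar, sg_odd (show ¬ Even (1 : ℤ) by decide)]

/-- An element of definite parity equals its even or its odd part, so one half of `parity_comm`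
applies after division by two. -/
theorem IsPar.comm {k : ℤ} {a : FreeSuper O E C} (ha : IsPar k a) (b : FreeSuper O E C) :
    a * b = FreeSuper.tw k b * a := by
  have h := parity_comm a b
  unfold IsPar at ha
  by_cases hk : Even k
  · rw [sg_even hk, one_smul] at ha
    rw [tw_even hk]
    have := h.1
    rw [ha, ← two_smul ℝ, smul_mul_assoc, mul_smul_comm] at this
    exact smul_right_injective _ two_ne_zero this
  · rw [sg_odd hk, neg_one_smul] at ha
    rw [tw_odd hk]
    have := h.2
    rw [ha, sub_neg_eq_add, ← two_smul ℝ, smul_mul_assoc, mul_smul_comm] at this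
    exact smul_right_injective _ two_ne_zero this

theorem IsPar.comm_isPar {j k : ℤ} {a b : FreeSuper O E C} (ha : IsPar j a) (hb : IsPar k b) :
    a * b = sg (j * k) • (b * a) := by
  rw [ha.comm, hb.tw, smul_mul_assoc]

theorem IsPar.comm_even {k : ℤ} {a : FreeSuper O E C} (ha : IsPar k a) (hk : Even k)
    (b : FreeSuper O E C) : a * b = b * a := by
  rw [ha.comm, tw_even hk]

theorem IsPar.sq_zero {k : ℤ} {a : FreeSuper O E C} (ha : IsPar k a) (hk : ¬ Even k) :
    a * a = 0 := by
  have h := ha.comm_isPar ha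
  rw [sg_odd (by simp [Int.even_mul, hk]), neg_one_smul] at h
  have h2 : (2 : ℝ) • (a * a) = 0 := by
    rw [two_smul]; nth_rewrite 2 [h]; exact add_neg_cancel _
  exact (smul_eq_zero.1 h2).resolve_left two_ne_zero

/-! ### Homomorphisms out of a free supercommutative algebra -/

/-- The parity-preserving homomorphism with prescribed values on the generators. -/
def liftHom {O' E' C' : Type} [CommRing C'] [Algebra ℝ C'] (fo : O → FreeSuper O' E' C')
    (fe : E → FreeSuper O' E' C') (fc : C →ₐ[ℝ] FreeSuper O' E' C')
    (ho : ∀ o, IsPar 1 (fo o)) (he : ∀ e, IsPar 0 (fe e)) (hc : ∀ c, IsPar 0 (fc c)) :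
    FreeSuper O E C →ₐ[ℝ] FreeSuper O' E' C' :=
  let Z := Subalgebra.center ℝ (FreeSuper O' E' C')
  -- Even elements are central. Corestricting to the centre supplies the commutative target that
  -- polynomial evaluation and `productMap` require.
  have hz : ∀ {a : FreeSuper O' E' C'}, IsPar 0 a → a ∈ Z := fun h =>
    Subalgebra.mem_center_iff.2 fun b => (h.comm_even (by simp) b).symm
  let fe' : MvPolynomial E ℝ →ₐ[ℝ] Z := MvPolynomial.aeval fun e => ⟨fe e, hz (he e)⟩
  let fc' : C →ₐ[ℝ] Z := fc.codRestrict Z fun c => hz (hc c)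
  let fl : (O →₀ ℝ) →ₗ[ℝ] FreeSuper O' E' C' := Finsupp.lsum ℝ fun o => LinearMap.toSpanSingleton ℝ _ (fo o)
  have hfl : ∀ v, IsPar 1 (fl v) := fun v => by
    simp only [fl, Finsupp.lsum_apply]
    exact IsPar.sum fun o _ => (ho o).smul _
  let f1 : ExteriorAlgebra ℝ (O →₀ ℝ) →ₐ[ℝ] FreeSuper O' E' C' :=
    ExteriorAlgebra.lift ℝ ⟨fl, fun v => (hfl v).sq_zero (by decide)⟩
  let f2 : MvPolynomial E ℝ ⊗[ℝ] C →ₐ[ℝ] FreeSuper O' E' C' :=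
    Z.val.comp (Algebra.TensorProduct.productMap fe' fc')
  (Algebra.TensorProduct.lift f1 f2 fun x y =>
    Subalgebra.mem_center_iff.1 (Algebra.TensorProduct.productMap fe' fc' y).2 (f1 x)).comp
    toTensor.toAlgHom

section liftHom

variable {O' E' C' : Type} [CommRing C'] [Algebra ℝ C'] {fo : O → FreeSuper O' E' C'}
    {fe : E → FreeSuper O' E' C'} {fc : C →ₐ[ℝ] FreeSuper O' E' C'}
    {ho : ∀ o, IsPar 1 (fo o)} {he : ∀ e, IsPar 0 (fe e)} {hc : ∀ c, IsPar 0 (fc c)}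

@[simp] theorem liftHom_odd (o : O) : liftHom fo fe fc ho he hc (odd o) = fo o := by
  simp only [liftHom, odd, AlgHom.comp_apply]
  erw [Algebra.TensorProduct.lift_tmul]
  simp

@[simp] theorem liftHom_even (e : E) : liftHom fo fe fc ho he hc (even e) = fe e := by
  simp only [liftHom, even, AlgHom.comp_apply]
  erw [Algebra.TensorProduct.lift_tmul]
  simp

@[simp] theorem liftHom_coeff (c : C) : liftHom fo fe fc ho he hc (coeff c) = fc c := by
  simp only [liftHom, coeff, AlgHom.comp_apply]
  erw [Algebra.TensorProduct.lift_tmul]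
  simp

end liftHom

/-! ### Superderivations -/

/-- A superderivation of parity `k` along an algebra homomorphism. -/
def IsDer {O' E' C' : Type} [CommRing C'] [Algebra ℝ C'] (φ : FreeSuper O E C →ₐ[ℝ] FreeSuper O' E' C')
    (k : ℤ) (D : FreeSuper O E C →ₗ[ℝ] FreeSuper O' E' C') : Prop :=
  ∀ a b, D (a * b) = D a * φ b + tw k (φ a) * D b

theorem IsDer.map_one {O' E' C' : Type} [CommRing C'] [Algebra ℝ C']
    {φ : FreeSuper O E C →ₐ[ℝ] FreeSuper O' E' C'} {k : ℤ}
    {D : FreeSuper O E C →ₗ[ℝ] FreeSuper O' E' C'} (hD : IsDer φ k D) : D 1 = 0 := by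
  have := hD 1 1
  simpa using this

/-- Leibniz rule from the rule for left multiplication by generators. -/
theorem IsDer.of_gen {k : ℤ} {D : FreeSuper O E C →ₗ[ℝ] FreeSuper O E C}
    (hc : ∀ c b, D (coeff c * b) = D (coeff c) * b + coeff c * D b)
    (ho : ∀ o b, D (odd o * b) = D (odd o) * b + tw k (odd o) * D b)
    (he : ∀ e b, D (even e * b) = D (even e) * b + even e * D b) :
    IsDer (AlgHom.id ℝ _) k D := by
  intro a
  simp only [AlgHom.id_apply]
  induction a using FreeSuper.induction with
  | hc c => intro b; rw [hc, tw_coeff]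
  | ho o a ih => intro b; rw [mul_assoc, ho, ih, ho, map_mul]; noncomm_ring
  | he o a ih => intro b; rw [mul_assoc, he, ih, he, map_mul, tw_even_gen]; noncomm_ring
  | hadd a b ha hb => intro c; rw [add_mul, map_add, ha, hb, map_add, map_add]; noncomm_ring
  | hsmul r a ha =>
    intro c
    rw [smul_mul_assoc, map_smul, ha, map_smul, map_smul, smul_mul_assoc, smul_mul_assoc, smul_add]

theorem lift_symm (L : ExteriorAlgebra ℝ (O →₀ ℝ) ⊗[ℝ] (MvPolynomial E ℝ ⊗[ℝ] C) →ₗ[ℝ]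
      ExteriorAlgebra ℝ (O →₀ ℝ) ⊗[ℝ] (MvPolynomial E ℝ ⊗[ℝ] C)) (t) :
    lift L (toTensor.symm t) = toTensor.symm (L t) := by
  simp [lift]

theorem oddDeriv_symm (o : O) (x) (y : MvPolynomial E ℝ ⊗[ℝ] C) :
    oddDeriv o (toTensor.symm (x ⊗ₜ y) : FreeSuper O E C) =
      toTensor.symm (CliffordAlgebra.contractLeft
        (Q := (0 : QuadraticForm ℝ (O →₀ ℝ))) (Finsupp.lapply o) x ⊗ₜ y) := by
  rw [oddDeriv, lift_symm, LinearMap.rTensor_tmul]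

theorem evenDeriv_symm (e : E) (x) (p : MvPolynomial E ℝ) (c : C) :
    evenDeriv e (toTensor.symm (x ⊗ₜ (p ⊗ₜ c)) : FreeSuper O E C) =
      toTensor.symm (x ⊗ₜ (MvPolynomial.pderiv e p ⊗ₜ c)) := by
  rw [evenDeriv, lift_symm, LinearMap.lTensor_tmul, LinearMap.rTensor_tmul]; rfl

theorem coeffMap_symm (D : C →ₗ[ℝ] C) (x) (p : MvPolynomial E ℝ) (c : C) :
    coeffMap D (toTensor.symm (x ⊗ₜ (p ⊗ₜ c)) : FreeSuper O E C) =
      toTensor.symm (x ⊗ₜ (p ⊗ₜ D c)) := by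
  rw [coeffMap, lift_symm, LinearMap.lTensor_tmul, LinearMap.lTensor_tmul]

@[simp] theorem oddDeriv_coeff (o : O) (c : C) : oddDeriv o (coeff c : FreeSuper O E C) = 0 := by
  rw [coeff, oddDeriv_symm, CliffordAlgebra.contractLeft_one, TensorProduct.zero_tmul, map_zero]
@[simp] theorem oddDeriv_even (o : O) (e : E) : oddDeriv o (even e : FreeSuper O E C) = 0 := by
  rw [even, oddDeriv_symm, CliffordAlgebra.contractLeft_one, TensorProduct.zero_tmul, map_zero]
theorem oddDeriv_odd [DecidableEq O] (o o' : O) :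
    oddDeriv o (odd o' : FreeSuper O E C) = if o' = o then 1 else 0 := by
  rw [odd, oddDeriv_symm]
  erw [CliffordAlgebra.contractLeft_ι]
  rw [Finsupp.lapply_apply, Finsupp.single_apply]
  split_ifs
  · rw [map_one]; rfl
  · rw [map_zero, TensorProduct.zero_tmul, map_zero]

@[simp] theorem evenDeriv_coeff (o : E) (c : C) : evenDeriv o (coeff c : FreeSuper O E C) = 0 := by
  rw [coeff, evenDeriv_symm, Derivation.map_one_eq_zero, TensorProduct.zero_tmul,
    TensorProduct.tmul_zero, map_zero]
@[simp] theorem evenDeriv_odd (o : E) (c : O) : evenDeriv o (odd c : FreeSuper O E C) = 0 := by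
  rw [odd, Algebra.TensorProduct.one_def, evenDeriv_symm, Derivation.map_one_eq_zero,
    TensorProduct.zero_tmul, TensorProduct.tmul_zero, map_zero]
theorem evenDeriv_even [DecidableEq E] (e e' : E) :
    evenDeriv e (even e' : FreeSuper O E C) = if e' = e then 1 else 0 := by
  rw [even, evenDeriv_symm, MvPolynomial.pderiv_X]
  split_ifs with h
  · subst h; rw [Pi.single_eq_same]; rfl
  · rw [Pi.single_eq_of_ne h, TensorProduct.zero_tmul, TensorProduct.tmul_zero, map_zero]

@[simp] theorem coeffMap_coeff (D : C →ₗ[ℝ] C) (c : C) :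
    coeffMap D (coeff c : FreeSuper O E C) = coeff (D c) := by
  rw [coeff, coeffMap_symm]; rfl
theorem coeffMap_odd (D : C →ₗ[ℝ] C) (hD : D 1 = 0) (o : O) :
    coeffMap D (odd o : FreeSuper O E C) = 0 := by
  rw [odd, Algebra.TensorProduct.one_def, coeffMap_symm, hD, TensorProduct.tmul_zero,
    TensorProduct.tmul_zero, map_zero]
theorem coeffMap_even (D : C →ₗ[ℝ] C) (hD : D 1 = 0) (o : E) :
    coeffMap D (even o : FreeSuper O E C) = 0 := by
  rw [even, coeffMap_symm, hD, TensorProduct.tmul_zero, TensorProduct.tmul_zero, map_zero]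

theorem isDer_oddDeriv {k : ℤ} (hk : ¬ Even k) (o : O) :
    IsDer (AlgHom.id ℝ (FreeSuper O E C)) k (oddDeriv o) := by
  classical
  apply IsDer.of_gen
  · intro c b
    induction b using symm_ind with
    | h0 => simp
    | hadd a b ha hb => simp only [mul_add, map_add, ha, hb]; abel
    | h x p c' => rw [coeff_mul_symm, oddDeriv_symm, oddDeriv_symm, coeff_mul_symm]; simp
  · intro o' b
    rw [tw_odd hk, inv_odd, oddDeriv_odd]
    induction b using symm_ind with
    | h0 => simp
    | hadd a b ha hb => rw [mul_add, map_add, ha, hb, map_add, mul_add, mul_add]; abel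
    | h x p c' =>
      rw [odd_mul_symm, oddDeriv_symm, oddDeriv_symm, neg_mul, odd_mul_symm]
      erw [CliffordAlgebra.contractLeft_ι_mul]
      rw [TensorProduct.sub_tmul, map_sub, Finsupp.lapply_apply, Finsupp.single_apply,
        ← sub_eq_add_neg]
      congr 1
      split_ifs
      · rw [one_smul, one_mul]
      · rw [zero_smul, TensorProduct.zero_tmul, map_zero, zero_mul]
  · intro c b
    induction b using symm_ind with
    | h0 => simp
    | hadd a b ha hb => simp only [mul_add, map_add, ha, hb]; abel
    | h x p c' => rw [even_mul_symm, oddDeriv_symm, oddDeriv_symm, even_mul_symm]; simp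

theorem isDer_evenDeriv {k : ℤ} (hk : Even k) (o : E) :
    IsDer (AlgHom.id ℝ (FreeSuper O E C)) k (evenDeriv o) := by
  classical
  apply IsDer.of_gen
  · intro c b
    induction b using symm_ind with
    | h0 => simp
    | hadd a b ha hb => simp only [mul_add, map_add, ha, hb]; abel
    | h x p c' => rw [coeff_mul_symm, evenDeriv_symm, evenDeriv_symm, coeff_mul_symm]; simp
  · intro o' b
    rw [tw_even hk]
    induction b using symm_ind with
    | h0 => simp
    | hadd a b ha hb => simp only [mul_add, map_add, ha, hb]; abel
    | h x p c' => rw [odd_mul_symm, evenDeriv_symm, evenDeriv_symm, odd_mul_symm]; simp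
  · intro o' b
    rw [evenDeriv_even]
    induction b using symm_ind with
    | h0 => simp
    | hadd a b ha hb => rw [mul_add, map_add, ha, hb, map_add, mul_add, mul_add]; abel
    | h x p c' =>
      rw [even_mul_symm, evenDeriv_symm, evenDeriv_symm, even_mul_symm, Derivation.leibniz,
        TensorProduct.add_tmul, TensorProduct.tmul_add, map_add, MvPolynomial.pderiv_X, add_comm,
        smul_eq_mul, smul_eq_mul]
      congr 1
      split_ifs with h
      · subst h; rw [Pi.single_eq_same, one_mul, mul_one]
      · rw [Pi.single_eq_of_ne h, zero_mul, mul_zero, TensorProduct.zero_tmul,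
          TensorProduct.tmul_zero, map_zero]

theorem isDer_coeffMap {k : ℤ} (hk : Even k) (D : C →ₗ[ℝ] C)
    (hD : ∀ a b, D (a * b) = D a * b + a * D b) :
    IsDer (AlgHom.id ℝ (FreeSuper O E C)) k (coeffMap D) := by
  have hD1 : D 1 = 0 := by simpa using hD 1 1
  apply IsDer.of_gen
  · intro c b
    rw [coeffMap_coeff]
    induction b using symm_ind with
    | h0 => simp
    | hadd a b ha hb => rw [mul_add, map_add, ha, hb, map_add, mul_add, mul_add]; abel
    | h x p c' =>
      rw [coeff_mul_symm, coeffMap_symm, coeffMap_symm, coeff_mul_symm, coeff_mul_symm, hD,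
        TensorProduct.tmul_add, TensorProduct.tmul_add, map_add]
  · intro o' b
    rw [tw_even hk, coeffMap_odd _ hD1]
    induction b using symm_ind with
    | h0 => simp
    | hadd a b ha hb => simp only [mul_add, map_add, ha, hb]; abel
    | h x p c' => rw [odd_mul_symm, coeffMap_symm, coeffMap_symm, odd_mul_symm]; simp
  · intro o' b
    rw [coeffMap_even _ hD1]
    induction b using symm_ind with
    | h0 => simp
    | hadd a b ha hb => simp only [mul_add, map_add, ha, hb]; abel
    | h x p c' => rw [even_mul_symm, coeffMap_symm, coeffMap_symm, even_mul_symm]; simp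

end FreeSuper

/-! ### Calculus of smooth functions on an open set. -/

namespace SmoothFun

variable {κ : Type} [Fintype κ] {U : TopologicalSpace.Opens (κ → ℝ)}

theorem ext_iff' {f g : SmoothFun U} : f = g ↔ ∀ x, f x = g x := ContMDiffMap.ext_iff

@[simp] theorem mul_apply (f g : SmoothFun U) (x : U) : (f * g) x = f x * g x := rfl
@[simp] theorem add_apply (f g : SmoothFun U) (x : U) : (f + g) x = f x + g x := rfl
@[simp] theorem one_apply (x : U) : (1 : SmoothFun U) x = 1 := rfl
@[simp] theorem zero_apply (x : U) : (0 : SmoothFun U) x = 0 := rfl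
@[simp] theorem smul_apply (c : ℝ) (f : SmoothFun U) (x : U) : (c • f) x = c * f x := rfl
@[simp] theorem coord_apply (k : κ) (x : U) : coord U k x = (x : κ → ℝ) k := rfl

open Classical in
theorem partialDeriv_apply (k : κ) (f : SmoothFun U) (x : U) :
    partialDeriv U k f x = fderiv ℝ f.extend x (Pi.single k 1) := rfl

/-- Evaluation at a point. -/
def eval (x : U) : SmoothFun U →ₐ[ℝ] ℝ where
  toFun f := f x
  map_one' := rfl
  map_mul' _ _ := rfl
  map_zero' := rfl
  map_add' _ _ := rfl
  commutes' _ := rfl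

@[simp] theorem eval_apply (x : U) (f : SmoothFun U) : eval x f = f x := rfl

/-- Differentiation at a point of `U` is local, so the extension by zero may be replaced by any
function with the same values on `U`. -/
theorem eventuallyEq_extend {f : SmoothFun U} {g : (κ → ℝ) → ℝ} (x : U)
    (h : ∀ y : U, f y = g y) : f.extend =ᶠ[nhds (x : κ → ℝ)] g := by
  filter_upwards [U.isOpen.mem_nhds x.2] with y hy
  rw [← h ⟨y, hy⟩, ← extend_coe]

open Classical in
theorem partialDeriv_eq {f : SmoothFun U} {g : (κ → ℝ) → ℝ} (k : κ) (x : U)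
    (h : ∀ y : U, f y = g y) : partialDeriv U k f x = fderiv ℝ g x (Pi.single k 1) := by
  rw [partialDeriv_apply, (eventuallyEq_extend x h).fderiv_eq]

theorem partialDeriv_mul (k : κ) (f g : SmoothFun U) :
    partialDeriv U k (f * g) = partialDeriv U k f * g + f * partialDeriv U k g := by
  classical
  rw [ext_iff']
  intro x
  rw [partialDeriv_eq (g := fun y => f.extend y * g.extend y) k x
    (fun y => by rw [extend_coe, extend_coe, mul_apply]),
    fderiv_fun_mul (f.differentiableAt_extend x) (g.differentiableAt_extend x)]
  simp only [add_apply, mul_apply, partialDeriv_apply, extend_coe, _root_.add_apply,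
    _root_.smul_apply, smul_eq_mul]
  ring

open Classical in
theorem partialDeriv_coord (k l : κ) :
    partialDeriv U k (coord U l) = if l = k then 1 else 0 := by
  rw [ext_iff']
  intro x
  rw [partialDeriv_eq (g := fun y => y l) k x (fun y => rfl)]
  have : fderiv ℝ (fun y : κ → ℝ => y l) x = ContinuousLinearMap.proj l :=
    (ContinuousLinearMap.proj (R := ℝ) (φ := fun _ : κ => ℝ) l).fderiv
  rw [this, ContinuousLinearMap.proj_apply]
  split_ifs with h
  · subst h; rw [Pi.single_eq_same]; rfl
  · rw [Pi.single_eq_of_ne h]; rfl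

theorem partialDeriv_comm (k l : κ) (f : SmoothFun U) :
    partialDeriv U k (partialDeriv U l f) = partialDeriv U l (partialDeriv U k f) := by
  classical
  have hs : ∀ x : U, ContDiffAt ℝ ∞ f.extend x := fun x =>
    f.contDiffOn_extend.contDiffAt (U.isOpen.mem_nhds x.2)
  have key : ∀ (a b : κ) (x : U), partialDeriv U a (partialDeriv U b f) x =
      fderiv ℝ (fderiv ℝ f.extend) x (Pi.single a 1) (Pi.single b 1) := by
    intro a b x
    rw [partialDeriv_eq (g := fun y => fderiv ℝ f.extend y (Pi.single b 1)) a x (fun y => rfl)]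
    have hd : DifferentiableAt ℝ (fderiv ℝ f.extend) x :=
      ((hs x).fderiv_right (m := 1) (by norm_cast)).differentiableAt (by simp)
    rw [fderiv_clm_apply hd (differentiableAt_const _)]
    simp
  rw [ext_iff']
  intro x
  rw [key, key]
  have : IsSymmSndFDerivAt ℝ f.extend (x : κ → ℝ) :=
    (hs x).isSymmSndFDerivAt (by simp; norm_cast)
  exact this _ _

variable {κ' : Type} [Fintype κ'] {V : TopologicalSpace.Opens (κ' → ℝ)}

/-- The pullback of functions along the linear map `x ↦ x ∘ r`. -/
def comap (r : κ → κ') (h : ∀ x ∈ V, x ∘ r ∈ U) : SmoothFun U →ₐ[ℝ] SmoothFun V where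
  toFun f := ofContDiffOn (fun x => f.extend (x ∘ r)) (f.contDiffOn_extend.comp
    (contDiff_pi.2 fun k => contDiff_apply ℝ ℝ (r k)).contDiffOn h)
  map_one' := by
    rw [ext_iff']; intro x; exact extend_coe (1 : SmoothFun U) ⟨_, h x x.2⟩
  map_zero' := by
    rw [ext_iff']; intro x; exact extend_coe (0 : SmoothFun U) ⟨_, h x x.2⟩
  map_mul' f g := by
    rw [ext_iff']; intro x
    have := fun f : SmoothFun U => extend_coe f ⟨_, h x x.2⟩
    change (f * g).extend (x ∘ r) = f.extend (x ∘ r) * g.extend (x ∘ r)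
    rw [this, this, this]; rfl
  map_add' f g := by
    rw [ext_iff']; intro x
    have := fun f : SmoothFun U => extend_coe f ⟨_, h x x.2⟩
    change (f + g).extend (x ∘ r) = f.extend (x ∘ r) + g.extend (x ∘ r)
    rw [this, this, this]; rfl
  commutes' c := by
    rw [ext_iff']; intro x; exact extend_coe (algebraMap ℝ (SmoothFun U) c) ⟨_, h x x.2⟩

theorem comap_apply (r : κ → κ') (h : ∀ x ∈ V, x ∘ r ∈ U) (f : SmoothFun U) (x : V) :
    comap r h f x = f ⟨x ∘ r, h x x.2⟩ := extend_coe f ⟨_, h x x.2⟩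

theorem comap_coord (r : κ → κ') (h : ∀ x ∈ V, x ∘ r ∈ U) (k : κ) :
    comap r h (coord U k) = coord V (r k) := by
  rw [ext_iff']; intro x; rw [comap_apply]; rfl

theorem comap_id (h : ∀ x ∈ U, x ∘ id ∈ U) (f : SmoothFun U) : comap id h f = f := by
  rw [ext_iff']; intro x; rw [comap_apply]; rfl

theorem comap_comap {κ₂ : Type} [Fintype κ₂] {W : TopologicalSpace.Opens (κ₂ → ℝ)}
    (r : κ → κ') (h : ∀ x ∈ V, x ∘ r ∈ U) (r' : κ' → κ₂) (h' : ∀ x ∈ W, x ∘ r' ∈ V)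
    (f : SmoothFun U) :
    comap r' h' (comap r h f) =
      comap (r' ∘ r) (fun x hx => h _ (h' x hx)) f := by
  rw [ext_iff']; intro x; rw [comap_apply, comap_apply, comap_apply]; rfl

open Classical in
theorem partialDeriv_comap (r : κ → κ') (h : ∀ x ∈ V, x ∘ r ∈ U)
    (l : κ') (f : SmoothFun U) :
    partialDeriv V l (comap r h f) =
      ∑ k, if r k = l then comap r h (partialDeriv U k f) else 0 := by
  rw [ext_iff']
  intro x
  let L : (κ' → ℝ) →L[ℝ] (κ → ℝ) :=
    ContinuousLinearMap.pi fun k => ContinuousLinearMap.proj (r k)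
  rw [partialDeriv_eq (g := f.extend ∘ L) l x (fun y => rfl),
    fderiv_comp (x : κ' → ℝ) (f.differentiableAt_extend ⟨_, h x x.2⟩) L.differentiableAt,
    L.fderiv,
    ContinuousLinearMap.comp_apply]
  have h1 : L (Pi.single l 1) = ∑ k, (if r k = l then (1 : ℝ) else 0) • Pi.single k (1 : ℝ) := by
    ext j
    rw [Finset.sum_apply, Finset.sum_eq_single j]
    · rw [Pi.smul_apply, Pi.single_eq_same, smul_eq_mul, mul_one]
      exact Pi.single_apply l (1 : ℝ) (r j)
    · intro b _ hb
      rw [Pi.smul_apply, Pi.single_eq_of_ne hb.symm, smul_zero]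
    · simp
  rw [h1, map_sum]
  have h2 : ∀ (s : Finset κ) (g : κ → SmoothFun V), (∑ k ∈ s, g k) x = ∑ k ∈ s, g k x :=
    fun s g => map_sum (eval x) g s
  rw [h2]
  refine Finset.sum_congr rfl fun k _ => ?_
  rw [map_smul]
  split_ifs
  · rw [one_smul, comap_apply]; rfl
  · simp

theorem isUnit_of_ne_zero (f : SmoothFun U) (h : ∀ x, f x ≠ 0) : IsUnit f := by
  refine IsUnit.of_mul_eq_one (ofContDiffOn (fun x => (f.extend x)⁻¹)
    (f.contDiffOn_extend.inv fun x hx => ?_)) ?_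
  · rw [show f.extend x = f ⟨x, hx⟩ from extend_coe f ⟨x, hx⟩]; exact h _
  · rw [ext_iff']; intro x
    change f x * (f.extend x)⁻¹ = 1
    rw [extend_coe, mul_inv_cancel₀ (h x)]

/-- A matrix of smooth functions whose rows are independent at each point has a right inverse. -/
theorem exists_right_inverse {I J : Type} [Fintype I] [Fintype J] [DecidableEq J]
    (A : Matrix J I (SmoothFun U))
    (hA : ∀ x (c : J → ℝ), (∀ i, ∑ j, c j * A j i x = 0) → c = 0) :
    ∃ B : Matrix I J (SmoothFun U), A * B = 1 := by
  -- The Gram matrix is invertible at every point, because `v A Aᵀ = 0` forces `|v A|² = 0`. Its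
  -- inverse is smooth, and `Aᵀ (A Aᵀ)⁻¹` is a right inverse.
  have hdet : IsUnit (A * A.transpose).det := by
    apply isUnit_of_ne_zero
    intro x
    let A' : Matrix J I ℝ := A.map (eval x)
    have h1 : (A * A.transpose).det x = (A' * A'.transpose).det := by
      change eval x _ = _
      rw [AlgHom.map_det]
      congr 1
      change (A * A.transpose).map (eval x) = _
      rw [Matrix.map_mul, ← Matrix.transpose_map]
    rw [h1]
    intro h0
    obtain ⟨v, hv, hv0⟩ := Matrix.exists_vecMul_eq_zero_iff.2 h0
    apply hv
    apply hA x
    have h2 : Matrix.vecMul v A' = 0 := by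
      have h3 : (Matrix.vecMul v A') ⬝ᵥ (Matrix.vecMul v A') = 0 := by
        have h4 : (Matrix.vecMul v (A' * A'.transpose)) ⬝ᵥ v = 0 := by rw [hv0, zero_dotProduct]
        rw [← Matrix.vecMul_vecMul, Matrix.vecMul_transpose, dotProduct_comm,
          Matrix.dotProduct_mulVec] at h4
        exact h4
      exact dotProduct_self_eq_zero.1 h3
    intro i
    exact congrFun h2 i
  exact ⟨A.transpose * (A * A.transpose)⁻¹, by
    rw [← Matrix.mul_assoc, Matrix.mul_nonsing_inv _ hdet]⟩

end SmoothFun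

namespace FreeSuper

variable {O E C : Type} [CommRing C] [Algebra ℝ C]

/-- A superderivation shifts parity by `k` everywhere as soon as it does so on generators and
coefficients; this is applied to the de Rham differential. -/
theorem IsDer.inv_comm {k : ℤ} {D : FreeSuper O E C →ₗ[ℝ] FreeSuper O E C}
    (hD : IsDer (AlgHom.id ℝ _) k D) (hc : ∀ c, IsPar k (D (coeff c)))
    (ho : ∀ o, IsPar (k + 1) (D (odd o))) (he : ∀ e, IsPar k (D (even e)))
    (a : FreeSuper O E C) : D (inv a) = sg k • inv (D a) := by
  induction a using FreeSuper.induction with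
  | hc c => rw [inv_coeff, (hc c), smul_smul, sg_mul_self, one_smul]
  | ho o a ih =>
    rw [map_mul, hD, hD, ih, map_add, map_mul, map_mul, (ho o), inv_odd, map_neg]
    simp only [AlgHom.id_apply]
    rw [sg_add, sg_odd (show ¬ Even (1 : ℤ) by decide), (isPar_odd o).tw, map_neg,
      (isPar_odd o).tw, map_smul, inv_odd]
    simp only [smul_mul_assoc, mul_smul_comm, smul_add, smul_smul, smul_neg, neg_mul]
    congr 1
    rw [show sg k * (sg k * -1) = -(sg k * sg k) by ring, sg_mul_self, neg_one_smul]
  | he e a ih =>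
    rw [map_mul, hD, hD, ih, map_add, map_mul, map_mul, (he e), inv_even]
    simp only [AlgHom.id_apply, tw_even_gen, inv_even]
    simp only [smul_mul_assoc, mul_smul_comm, smul_add, smul_smul, sg_mul_self, one_smul]
  | hadd a b ha hb => simp only [map_add, ha, hb, smul_add]
  | hsmul r a ha => simp only [map_smul, ha]; rw [smul_comm]

end FreeSuper

/-! ### Coordinates, differentials and their partial derivatives. -/

namespace GradedDomain

open FreeSuper

variable {G : GradedDomain}

theorem z_of_zero {i : G.ι} (h : G.deg i = 0) : G.z i = coeff (SmoothFun.coord G.body ⟨i, h⟩) := by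
  simp [z, h]

theorem z_of_odd {i : G.ι} (h : Odd (G.deg i)) : G.z i = odd (Sum.inl ⟨i, h⟩) := by
  have h0 : G.deg i ≠ 0 := by rintro h0; rw [h0] at h; exact absurd h (by decide)
  simp [z, h0, Int.not_even_iff_odd.2 h]

theorem z_of_even {i : G.ι} (h : Even (G.deg i)) (h0 : G.deg i ≠ 0) :
    G.z i = even (Sum.inl ⟨i, h, h0⟩) := by
  simp [z, h0, h]

theorem dz_of_even {i : G.ι} (h : Even (G.deg i)) : G.dz i = odd (Sum.inr ⟨i, h⟩) := by
  simp [dz, h]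

theorem dz_of_odd {i : G.ι} (h : Odd (G.deg i)) : G.dz i = even (Sum.inr ⟨i, h⟩) := by
  simp [dz, Int.not_even_iff_odd.2 h]

theorem isPar_z (i : G.ι) : IsPar (G.deg i) (G.z i) := by
  by_cases h0 : G.deg i = 0
  · rw [z_of_zero h0, h0]; exact isPar_coeff _
  · by_cases h : Even (G.deg i)
    · rw [z_of_even h h0]; exact (isPar_even _).congr (by simpa using h)
    · rw [z_of_odd (Int.not_even_iff_odd.1 h)]
      exact (isPar_odd _).congr (by simpa [Int.even_sub] using h)

theorem isPar_dz (i : G.ι) : IsPar (G.deg i + 1) (G.dz i) := by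
  by_cases h : Even (G.deg i)
  · rw [dz_of_even h]; exact (isPar_odd _).congr (by simpa [Int.even_sub, Int.even_add] using h)
  · rw [dz_of_odd (Int.not_even_iff_odd.1 h)]
    exact (isPar_even _).congr (by simpa [Int.even_add] using h)

theorem forms_induction {P : G.Forms → Prop} (hc : ∀ f, P (coeff f))
    (hz : ∀ i a, P a → P (G.z i * a)) (hdz : ∀ i a, P a → P (G.dz i * a))
    (hadd : ∀ a b, P a → P b → P (a + b)) (hsmul : ∀ (r : ℝ) a, P a → P (r • a))
    (a : G.Forms) : P a := by
  induction a using FreeSuper.induction with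
  | hc c => exact hc c
  | ho o a ih =>
    rcases o with ⟨i, hi⟩ | ⟨i, hi⟩
    · rw [← z_of_odd hi]; exact hz i a ih
    · rw [← dz_of_even hi]; exact hdz i a ih
  | he o a ih =>
    rcases o with ⟨i, hi, hi0⟩ | ⟨i, hi⟩
    · rw [← z_of_even hi hi0]; exact hz i a ih
    · rw [← dz_of_odd hi]; exact hdz i a ih
  | hadd a b ha hb => exact hadd a b ha hb
  | hsmul r a ha => exact hsmul r a ha

theorem forms_algHom_ext {B : Type*} [Ring B] [Algebra ℝ B] {f g : G.Forms →ₐ[ℝ] B}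
    (hc : ∀ c, f (coeff c) = g (coeff c)) (hz : ∀ i, f (G.z i) = g (G.z i))
    (hdz : ∀ i, f (G.dz i) = g (G.dz i)) : f = g := by
  ext a
  induction a using forms_induction with
  | hc c => exact hc c
  | hz o a ih => rw [map_mul, map_mul, hz, ih]
  | hdz o a ih => rw [map_mul, map_mul, hdz, ih]
  | hadd a b ha hb => rw [map_add, map_add, ha, hb]
  | hsmul r a ha => rw [map_smul, map_smul, ha]

theorem der_ext {O' E' C' : Type} [CommRing C'] [Algebra ℝ C']
    {φ : G.Forms →ₐ[ℝ] FreeSuper O' E' C'} {k : ℤ}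
    {D D' : G.Forms →ₗ[ℝ] FreeSuper O' E' C'} (hD : IsDer φ k D) (hD' : IsDer φ k D')
    (hc : ∀ c, D (coeff c) = D' (coeff c)) (hz : ∀ i, D (G.z i) = D' (G.z i))
    (hdz : ∀ i, D (G.dz i) = D' (G.dz i)) (a : G.Forms) : D a = D' a := by
  induction a using forms_induction with
  | hc c => exact hc c
  | hz o a ih => rw [hD, hD', hz, ih]
  | hdz o a ih => rw [hD, hD', hdz, ih]
  | hadd a b ha hb => rw [map_add, map_add, ha, hb]
  | hsmul r a ha => rw [map_smul, map_smul, ha]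

theorem isDer_pd (i : G.ι) : IsDer (AlgHom.id ℝ G.Forms) (G.deg i) (G.pd i) := by
  unfold pd
  split_ifs with h h'
  · exact isDer_coeffMap (by rw [h]; exact Even.zero) _ (SmoothFun.partialDeriv_mul _)
  · exact isDer_evenDeriv h' _
  · exact isDer_oddDeriv h' _

theorem isDer_pdd (i : G.ι) : IsDer (AlgHom.id ℝ G.Forms) (G.deg i + 1) (G.pdd i) := by
  unfold pdd
  split_ifs with h
  · exact isDer_oddDeriv (by simpa [Int.even_add] using h) _
  · exact isDer_evenDeriv (by simpa [Int.even_add] using h) _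

theorem pd_mul (i : G.ι) (a b : G.Forms) :
    G.pd i (a * b) = G.pd i a * b + tw (G.deg i) a * G.pd i b := isDer_pd i a b

theorem pdd_mul (i : G.ι) (a b : G.Forms) :
    G.pdd i (a * b) = G.pdd i a * b + tw (G.deg i + 1) a * G.pdd i b := isDer_pdd i a b

theorem pd_coeff_zero {i : G.ι} (h : G.deg i = 0) (f : SmoothFun G.body) :
    G.pd i (coeff f) = coeff (SmoothFun.partialDeriv G.body ⟨i, h⟩ f) := by
  simp [pd, h]

theorem pd_coeff_ne {i : G.ι} (h : G.deg i ≠ 0) (f : SmoothFun G.body) :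
    G.pd i (coeff f) = 0 := by
  unfold pd; rw [dif_neg h]; split_ifs <;> simp

@[simp] theorem pdd_coeff (i : G.ι) (f : SmoothFun G.body) : G.pdd i (coeff f) = 0 := by
  unfold pdd; split_ifs <;> simp

theorem partialDeriv_one {κ : Type} [Fintype κ] {U : TopologicalSpace.Opens (κ → ℝ)} (k : κ) :
    SmoothFun.partialDeriv U k 1 = 0 := by
  simpa using SmoothFun.partialDeriv_mul (U := U) k 1 1

open Classical in
theorem pd_z (i j : G.ι) : G.pd i (G.z j) = if j = i then 1 else 0 := by
  by_cases hj0 : G.deg j = 0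
  · rw [z_of_zero hj0]
    by_cases hi0 : G.deg i = 0
    · rw [pd_coeff_zero hi0, SmoothFun.partialDeriv_coord]
      by_cases h : j = i
      · simp [h]
      · simp [h]
    · rw [pd_coeff_ne hi0, if_neg]
      rintro rfl; exact hi0 hj0
  · by_cases hj : Even (G.deg j)
    · rw [z_of_even hj hj0]
      unfold pd
      split_ifs with h1 h2 h3 h4 h5
      · subst h2; exact absurd h1 hj0
      · exact coeffMap_even _ (partialDeriv_one _) _
      · subst h4; rw [evenDeriv_even, if_pos rfl]
      · rw [evenDeriv_even, if_neg (by simpa using h4)]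
      · subst h5; exact absurd hj h3
      · simp
    · rw [z_of_odd (Int.not_even_iff_odd.1 hj)]
      unfold pd
      split_ifs with h1 h2 h3 h4 h5
      · subst h2; exact absurd h1 hj0
      · exact coeffMap_odd _ (partialDeriv_one _) _
      · subst h4; exact absurd h3 hj
      · simp
      · subst h5; rw [oddDeriv_odd, if_pos rfl]
      · rw [oddDeriv_odd, if_neg (by simpa using h5)]

theorem pd_dz (i j : G.ι) : G.pd i (G.dz j) = 0 := by
  classical
  by_cases hj : Even (G.deg j)
  · rw [dz_of_even hj]
    unfold pd
    split_ifs with h1 h2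
    · exact coeffMap_odd _ (partialDeriv_one _) _
    · simp
    · rw [oddDeriv_odd, if_neg (by simp)]
  · rw [dz_of_odd (Int.not_even_iff_odd.1 hj)]
    unfold pd
    split_ifs with h1 h2
    · exact coeffMap_even _ (partialDeriv_one _) _
    · rw [evenDeriv_even, if_neg (by simp)]
    · simp

theorem pdd_z (i j : G.ι) : G.pdd i (G.z j) = 0 := by
  classical
  by_cases hj0 : G.deg j = 0
  · rw [z_of_zero hj0, pdd_coeff]
  · by_cases hj : Even (G.deg j)
    · rw [z_of_even hj hj0]
      unfold pdd
      split_ifs with h1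
      · simp
      · rw [evenDeriv_even, if_neg (by simp)]
    · rw [z_of_odd (Int.not_even_iff_odd.1 hj)]
      unfold pdd
      split_ifs with h1
      · rw [oddDeriv_odd, if_neg (by simp)]
      · simp

open Classical in
theorem pdd_dz (i j : G.ι) : G.pdd i (G.dz j) = if j = i then 1 else 0 := by
  by_cases hj : Even (G.deg j)
  · rw [dz_of_even hj]
    unfold pdd
    split_ifs with h1 h2 h3
    · subst h2; rw [oddDeriv_odd, if_pos rfl]
    · rw [oddDeriv_odd, if_neg (by simpa using h2)]
    · subst h3; exact absurd hj h1
    · simp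
  · rw [dz_of_odd (Int.not_even_iff_odd.1 hj)]
    unfold pdd
    split_ifs with h1 h2 h3
    · subst h2; exact absurd h1 hj
    · simp
    · subst h3; rw [evenDeriv_even, if_pos rfl]
    · rw [evenDeriv_even, if_neg (by simpa using h3)]

/-! ### The de Rham differential -/

/-- The de Rham differential as a linear map. -/
def dLin (G : GradedDomain) : G.Forms →ₗ[ℝ] G.Forms :=
  ∑ i, LinearMap.mulLeft ℝ (G.dz i) ∘ₗ G.pd i

theorem dLin_apply (a : G.Forms) : G.dLin a = G.d a := by simp [dLin, d]

theorem d_add (a b : G.Forms) : G.d (a + b) = G.d a + G.d b := by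
  simp only [← dLin_apply, map_add]
theorem d_smul (r : ℝ) (a : G.Forms) : G.d (r • a) = r • G.d a := by
  simp only [← dLin_apply, map_smul]
theorem d_sub (a b : G.Forms) : G.d (a - b) = G.d a - G.d b := by
  simp only [← dLin_apply, map_sub]
theorem d_sum {ι : Type*} (s : Finset ι) (f : ι → G.Forms) :
    G.d (∑ i ∈ s, f i) = ∑ i ∈ s, G.d (f i) := by
  simp only [← dLin_apply, map_sum]
@[simp] theorem d_zero : G.d (0 : G.Forms) = 0 := by
  simp only [← dLin_apply, map_zero]

/-- Since `dz^i` has the parity opposite to that of `∂/∂z^i`, moving it past `a` turns the twist by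
`deg i` into a twist by one, whatever `i` is. -/
theorem d_mul (a b : G.Forms) : G.d (a * b) = G.d a * b + inv a * G.d b := by
  unfold d
  rw [Finset.sum_mul, Finset.mul_sum, ← Finset.sum_add_distrib]
  refine Finset.sum_congr rfl fun i _ => ?_
  rw [pd_mul, mul_add, ← mul_assoc, ← mul_assoc, (isPar_dz i).comm (tw _ a), ← tw_add,
    tw_congr (k := 1) (by rw [show G.deg i + 1 + G.deg i - 1 = G.deg i + G.deg i by ring]; exact Even.add_self _),
    tw_one, mul_assoc (inv a)]

theorem isDer_d : IsDer (AlgHom.id ℝ G.Forms) 1 G.dLin := fun a b => by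
  rw [dLin_apply, dLin_apply, dLin_apply, d_mul]; simp

theorem d_z (i : G.ι) : G.d (G.z i) = G.dz i := by
  classical
  unfold d
  rw [Finset.sum_eq_single i]
  · rw [pd_z, if_pos rfl, mul_one]
  · intro j _ hj; rw [pd_z, if_neg hj.symm, mul_zero]
  · simp

theorem d_dz (i : G.ι) : G.d (G.dz i) = 0 := by
  unfold d
  exact Finset.sum_eq_zero fun j _ => by rw [pd_dz, mul_zero]

theorem sum_deg_zero {B : Type*} [AddCommMonoid B] (g : G.ι → B)
    (hg : ∀ i, G.deg i ≠ 0 → g i = 0) :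
    ∑ i, g i = ∑ k : {i : G.ι // G.deg i = 0}, g k.1 := by
  classical
  rw [← Finset.sum_filter_of_ne (p := fun i => G.deg i = 0) fun i _ h => by
    by_contra h'; exact h (hg i h')]
  exact Finset.sum_subtype _ (by simp) g

theorem d_coeff (f : SmoothFun G.body) : G.d (coeff f) =
    ∑ k : {i : G.ι // G.deg i = 0}, G.dz k.1 * coeff (SmoothFun.partialDeriv G.body k f) := by
  unfold d
  rw [sum_deg_zero _ fun i hi => by rw [pd_coeff_ne hi, mul_zero]]
  exact Finset.sum_congr rfl fun k _ => by rw [pd_coeff_zero k.2]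

theorem isPar_d_coeff (f : SmoothFun G.body) : IsPar 1 (G.d (coeff f)) := by
  rw [d_coeff]
  refine IsPar.sum fun k _ => ?_
  have := (isPar_dz k.1).mul (isPar_coeff (O := G.OddGen) (E := G.EvenGen) (SmoothFun.partialDeriv G.body k f))
  rw [k.2] at this
  simpa using this

theorem d_inv (a : G.Forms) : G.d (inv a) = -inv (G.d a) := by
  have := isDer_d.inv_comm (k := 1) (D := G.dLin) (fun c => ?_) (fun o => ?_) (fun o => ?_) a
  · rw [dLin_apply, dLin_apply, sg_odd (by decide)] at this
    simpa using this
  · rw [dLin_apply]; exact isPar_d_coeff c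
  · rw [dLin_apply]
    rcases o with ⟨i, hi⟩ | ⟨i, hi⟩
    · rw [← z_of_odd hi, d_z]
      exact (isPar_dz i).congr (by have := hi.sub_odd (by decide : Odd (1 : ℤ)); ring_nf at this ⊢; exact this)
    · rw [← dz_of_even hi, d_dz]; exact isPar_zero _
  · rw [dLin_apply]
    rcases o with ⟨i, hi, hi0⟩ | ⟨i, hi⟩
    · rw [← z_of_even hi hi0, d_z]
      exact (isPar_dz i).congr (by simpa using hi)
    · rw [← dz_of_odd hi, d_dz]; exact isPar_zero _

theorem IsPar.d {k : ℤ} {a : G.Forms} (h : IsPar k a) : IsPar (k + 1) (G.d a) := by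
  have := d_inv a
  unfold IsPar at *
  rw [h, d_smul, eq_neg_iff_add_eq_zero, add_comm] at this
  rw [sg_add, sg_odd (show ¬ Even (1 : ℤ) by decide), mul_neg_one, neg_smul]
  exact eq_neg_of_add_eq_zero_left this

/-- On functions of the body, second derivatives are symmetric while the `dz^k` anticommute, so the
double sum equals its own negative. The Leibniz rule carries this to all products. -/
theorem d_d (a : G.Forms) : G.d (G.d a) = 0 := by
  induction a using forms_induction with
  | hc f =>
    rw [d_coeff, d_sum]
    have h1 : ∀ k : {i : G.ι // G.deg i = 0},
        G.d (G.dz k.1 * coeff (SmoothFun.partialDeriv G.body k f)) =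
        ∑ l : {i : G.ι // G.deg i = 0}, -(G.dz k.1 * G.dz l.1 *
          coeff (SmoothFun.partialDeriv G.body l (SmoothFun.partialDeriv G.body k f))) := by
      intro k
      rw [d_mul, d_dz, zero_mul, zero_add, d_coeff, Finset.mul_sum]
      refine Finset.sum_congr rfl fun l _ => ?_
      rw [(isPar_dz k.1 : inv _ = _), k.2, sg_odd (by decide), neg_one_smul, neg_mul, mul_assoc]
    rw [Finset.sum_congr rfl fun k _ => h1 k]
    have h2 : ∀ S : G.Forms, S = -S → S = 0 := fun S h => by
      have h2 : (2 : ℝ) • S = 0 := by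
        rw [two_smul]; nth_rewrite 2 [h]; exact add_neg_cancel _
      exact (smul_eq_zero.1 h2).resolve_left two_ne_zero
    apply h2
    rw [← Finset.sum_neg_distrib]
    nth_rewrite 1 [Finset.sum_comm]
    refine Finset.sum_congr rfl fun k _ => ?_
    rw [← Finset.sum_neg_distrib]
    refine Finset.sum_congr rfl fun l _ => ?_
    rw [(isPar_dz l.1).comm_isPar (isPar_dz k.1), SmoothFun.partialDeriv_comm, k.2, l.2,
      sg_odd (by decide), neg_one_smul, neg_mul]
  | hz i a ih =>
    rw [d_mul, d_add, d_mul, d_mul, d_z, d_dz, ih, d_inv, d_z, FreeSuper.inv_inv]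
    simp
  | hdz i a ih =>
    rw [d_mul, d_add, d_mul, d_mul, d_dz, ih, d_inv, d_dz]
    simp
  | hadd a b ha hb => rw [d_add, d_add, ha, hb, add_zero]
  | hsmul r a ha => rw [d_smul, d_smul, ha, smul_zero]

/-! ### Monomials and homogeneous forms -/

/-- The generator labelled by a letter. -/
def gen (G : GradedDomain) : G.ι ⊕ G.ι → G.Forms := Sum.elim G.z G.dz

/-- The ghost degree of a letter. -/
def ldeg (G : GradedDomain) : G.ι ⊕ G.ι → ℤ := Sum.elim G.deg G.deg

/-- The form degree of a letter. -/
def fdeg (G : GradedDomain) : G.ι ⊕ G.ι → ℕ := Sum.elim (fun _ => 0) (fun _ => 1)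

theorem isPar_gen (a : G.ι ⊕ G.ι) : IsPar (G.fdeg a + G.ldeg a) (G.gen a) := by
  rcases a with i | i
  · simpa [fdeg, ldeg, gen] using isPar_z i
  · simpa [fdeg, ldeg, gen, add_comm] using isPar_dz i

@[simp] theorem monomial_nil (f : SmoothFun G.body) : G.monomial f [] = coeff f := by
  simp [monomial]

theorem monomial_cons (f : SmoothFun G.body) (a : G.ι ⊕ G.ι) (l : List (G.ι ⊕ G.ι)) :
    G.monomial f (a :: l) = G.gen a * G.monomial f l := by
  simp only [monomial, List.map_cons, List.prod_cons, ← mul_assoc]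
  rw [coeff_comm]
  rfl

theorem monomial_mul (f g : SmoothFun G.body) (l l' : List (G.ι ⊕ G.ι)) :
    G.monomial f l * G.monomial g l' = G.monomial (f * g) (l ++ l') := by
  simp only [monomial, List.map_append, List.prod_append, coeff_mul]
  rw [mul_assoc, ← mul_assoc _ (coeff g), ← coeff_comm g]
  simp only [mul_assoc]

theorem length_filter_isRight (l : List (G.ι ⊕ G.ι)) :
    (l.filter (fun a => a.isRight)).length = (l.map G.fdeg).sum := by
  induction l with
  | nil => simp
  | cons a l ih =>
    rw [List.filter_cons, List.map_cons, List.sum_cons, ← ih]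
    rcases a with i | i <;> simp [fdeg, add_comm]

theorem monomial_mem (f : SmoothFun G.body) (l : List (G.ι ⊕ G.ι)) :
    G.monomial f l ∈ G.homog (l.map G.fdeg).sum (l.map G.ldeg).sum :=
  Submodule.subset_span ⟨f, l, rfl, length_filter_isRight l, rfl⟩

theorem homog_le {p : ℕ} {k : ℤ} {S : Submodule ℝ G.Forms}
    (h : ∀ f l, (l.map G.fdeg).sum = p → (l.map G.ldeg).sum = k → G.monomial f l ∈ S) :
    G.homog p k ≤ S := by
  refine Submodule.span_le.2 ?_
  rintro _ ⟨f, l, rfl, hp, hk⟩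
  exact h f l (by rw [← length_filter_isRight]; exact hp) hk

theorem homog_mul {p q : ℕ} {j k : ℤ} {a b : G.Forms} (ha : a ∈ G.homog p j)
    (hb : b ∈ G.homog q k) : a * b ∈ G.homog (p + q) (j + k) := by
  have h1 : ∀ f l, (l.map G.fdeg).sum = p → (l.map G.ldeg).sum = j →
      G.homog q k ≤ (G.homog (p + q) (j + k)).comap (LinearMap.mulLeft ℝ (G.monomial f l)) := by
    intro f l hp hj
    apply homog_le
    intro g m hq hk
    rw [Submodule.mem_comap, LinearMap.mulLeft_apply, monomial_mul, ← hp, ← hj, ← hq, ← hk,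
      ← List.sum_append, ← List.sum_append, ← List.map_append, ← List.map_append]
    exact monomial_mem _ _
  have h2 : G.homog p j ≤ (G.homog (p + q) (j + k)).comap (LinearMap.mulRight ℝ b) :=
    homog_le fun f l hp hj => h1 f l hp hj hb
  exact h2 ha

theorem coeff_mem_homog (f : SmoothFun G.body) : coeff f ∈ G.homog 0 0 := by
  simpa using monomial_mem f []

theorem one_mem_homog : (1 : G.Forms) ∈ G.homog 0 0 := by
  simpa using coeff_mem_homog (1 : SmoothFun G.body)

theorem gen_mem_homog (a : G.ι ⊕ G.ι) : G.gen a ∈ G.homog (G.fdeg a) (G.ldeg a) := by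
  have := monomial_mem (1 : SmoothFun G.body) [a]
  rw [monomial_cons] at this
  simpa using this

theorem z_mem_homog (i : G.ι) : G.z i ∈ G.homog 0 (G.deg i) := gen_mem_homog (Sum.inl i)

theorem dz_mem_homog (i : G.ι) : G.dz i ∈ G.homog 1 (G.deg i) := gen_mem_homog (Sum.inr i)

theorem isPar_of_mem_homog {p : ℕ} {k : ℤ} {a : G.Forms} (ha : a ∈ G.homog p k) :
    IsPar (p + k) a := by
  let S : Submodule ℝ G.Forms := LinearMap.ker ((inv : G.Forms →ₐ[ℝ] _).toLinearMap - sg (p + k) • LinearMap.id)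
  have hS : ∀ x, x ∈ S ↔ IsPar (p + k) x := by
    intro x
    simp [S, IsPar, sub_eq_zero]
  refine (hS a).1 (homog_le (fun f l hp hk => ?_) ha)
  rw [hS]
  subst hp hk
  clear ha hS S
  induction l with
  | nil => simpa using isPar_coeff f
  | cons a l ih =>
    rw [monomial_cons]
    refine ((isPar_gen a).mul ih).congr ?_
    simp only [List.map_cons, List.sum_cons, Nat.cast_add]
    ring_nf
    exact Even.zero

theorem tw_mem_homog {p : ℕ} {k : ℤ} {a : G.Forms} (ha : a ∈ G.homog p k) (j : ℤ) :
    tw j a ∈ G.homog p k := by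
  rw [(isPar_of_mem_homog ha).tw]; exact Submodule.smul_mem _ _ ha

theorem pd_mem_homog (i : G.ι) {p : ℕ} {k : ℤ} {a : G.Forms} (ha : a ∈ G.homog p k) :
    G.pd i a ∈ G.homog p (k - G.deg i) := by
  classical
  refine homog_le (S := (G.homog p (k - G.deg i)).comap (G.pd i)) (fun f l hp hk => ?_) ha
  rw [Submodule.mem_comap]
  subst hp hk
  clear ha
  induction l with
  | nil =>
    rw [monomial_nil]
    by_cases hi : G.deg i = 0
    · rw [pd_coeff_zero hi]; simpa [hi] using coeff_mem_homog (G := G) _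
    · rw [pd_coeff_ne hi]; exact zero_mem _
  | cons a l ih =>
    rw [monomial_cons, pd_mul]
    refine add_mem ?_ ?_
    · rcases a with j | j
      · simp only [gen, Sum.elim_inl, pd_z]
        split_ifs with h
        · subst h
          rw [one_mul]
          have := monomial_mem f l
          simpa [fdeg, ldeg] using this
        · simp
      · simp [gen, pd_dz]
    · have := homog_mul (tw_mem_homog (gen_mem_homog a) (G.deg i)) ih
      simpa only [List.map_cons, List.sum_cons, add_sub_assoc] using this

theorem d_mem_homog {p : ℕ} {k : ℤ} {a : G.Forms} (ha : a ∈ G.homog p k) :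
    G.d a ∈ G.homog (p + 1) k := by
  unfold d
  refine sum_mem fun i _ => ?_
  have := homog_mul (dz_mem_homog i) (pd_mem_homog i ha)
  rwa [add_comm, add_sub_cancel] at this

/-! ### Functions -/

theorem homog_le_formsOfDegree (p : ℕ) (k : ℤ) : G.homog p k ≤ G.formsOfDegree p :=
  le_iSup (G.homog p) k

theorem formsOfDegree_mul {p q : ℕ} {a b : G.Forms} (ha : a ∈ G.formsOfDegree p)
    (hb : b ∈ G.formsOfDegree q) : a * b ∈ G.formsOfDegree (p + q) := by
  induction ha using Submodule.iSup_induction' with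
  | mem j a ha =>
    induction hb using Submodule.iSup_induction' with
    | mem k b hb => exact homog_le_formsOfDegree _ _ (homog_mul ha hb)
    | zero => simp
    | add x y _ _ hx hy => rw [mul_add]; exact add_mem hx hy
  | zero => simp
  | add x y _ _ hx hy => rw [add_mul]; exact add_mem hx hy

theorem functions_mul {a b : G.Forms} (ha : a ∈ G.functions) (hb : b ∈ G.functions) :
    a * b ∈ G.functions := by
  have h := formsOfDegree_mul ha hb
  rwa [Nat.add_zero] at h

theorem coeff_mem_functions (f : SmoothFun G.body) : coeff f ∈ G.functions :=
  homog_le_formsOfDegree _ _ (coeff_mem_homog f)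
theorem one_mem_functions : (1 : G.Forms) ∈ G.functions :=
  homog_le_formsOfDegree _ _ one_mem_homog
theorem z_mem_functions (i : G.ι) : G.z i ∈ G.functions :=
  homog_le_formsOfDegree _ _ (z_mem_homog i)
theorem dz_mem_formsOfDegree (i : G.ι) : G.dz i ∈ G.formsOfDegree 1 :=
  homog_le_formsOfDegree _ _ (dz_mem_homog i)

theorem tw_mem_formsOfDegree {p : ℕ} {a : G.Forms} (ha : a ∈ G.formsOfDegree p) (j : ℤ) :
    tw j a ∈ G.formsOfDegree p := by
  induction ha using Submodule.iSup_induction' with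
  | mem k a ha => exact homog_le_formsOfDegree _ _ (tw_mem_homog ha j)
  | zero => simp
  | add x y _ _ hx hy => rw [map_add]; exact add_mem hx hy

theorem pd_mem_formsOfDegree (i : G.ι) {p : ℕ} {a : G.Forms} (ha : a ∈ G.formsOfDegree p) :
    G.pd i a ∈ G.formsOfDegree p := by
  induction ha using Submodule.iSup_induction' with
  | mem k a ha => exact homog_le_formsOfDegree _ _ (pd_mem_homog i ha)
  | zero => simp
  | add x y _ _ hx hy => rw [map_add]; exact add_mem hx hy

theorem functions_induction {P : G.Forms → Prop} (hc : ∀ f, P (coeff f))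
    (hz : ∀ i a, a ∈ G.functions → P a → P (G.z i * a))
    (hadd : ∀ a b, P a → P b → P (a + b)) (hsmul : ∀ (r : ℝ) a, P a → P (r • a))
    (a : G.Forms) (ha : a ∈ G.functions) : P a := by
  have h0 : P 0 := by simpa using hc 0
  induction ha using Submodule.iSup_induction' with
  | mem k a ha =>
    let S : Submodule ℝ G.Forms :=
      { carrier := {x | P x}
        add_mem' := fun {a b} => hadd a b
        zero_mem' := h0
        smul_mem' := hsmul }
    refine homog_le (S := S) (fun f l hp hk => ?_) ha
    change P _
    clear ha hk
    induction l with
    | nil => simpa using hc f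
    | cons a l ih =>
      rw [List.map_cons, List.sum_cons, Nat.add_eq_zero_iff] at hp
      rw [monomial_cons]
      rcases a with i | i
      · refine hz i _ ?_ (ih hp.2)
        have := monomial_mem f l
        rw [hp.2] at this
        exact homog_le_formsOfDegree _ _ this
      · simp [fdeg] at hp
  | zero => exact h0
  | add x y _ _ hx hy => exact hadd _ _ hx hy

theorem pdd_function (i : G.ι) {a : G.Forms} (ha : a ∈ G.functions) : G.pdd i a = 0 := by
  refine functions_induction (P := fun a => G.pdd i a = 0) ?_ ?_ ?_ ?_ a ha
  · simp
  · intro j a _ h; rw [pdd_mul, pdd_z, h]; simp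
  · intro a b ha hb; rw [map_add, ha, hb, add_zero]
  · intro r a ha; rw [map_smul, ha, smul_zero]

theorem pdd_mul_function (i : G.ι) (a : G.Forms) {f : G.Forms} (hf : f ∈ G.functions) :
    G.pdd i (a * f) = G.pdd i a * f := by
  rw [pdd_mul, pdd_function i hf, mul_zero, add_zero]

theorem pdd_d (i : G.ι) {f : G.Forms} (hf : f ∈ G.functions) : G.pdd i (G.d f) = G.pd i f := by
  classical
  unfold d
  rw [map_sum, Finset.sum_eq_single i]
  · rw [pdd_mul_function _ _ (pd_mem_formsOfDegree i hf), pdd_dz, if_pos rfl, one_mul]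
  · intro j _ hj
    rw [pdd_mul_function _ _ (pd_mem_formsOfDegree j hf), pdd_dz, if_neg hj, zero_mul]
  · simp

theorem pdd_sum_dz (i : G.ι) {g : G.ι → G.Forms} (hg : ∀ j, g j ∈ G.functions) :
    G.pdd i (∑ j, G.dz j * g j) = g i := by
  classical
  rw [map_sum, Finset.sum_eq_single i]
  · rw [pdd_mul_function _ _ (hg i), pdd_dz, if_pos rfl, one_mul]
  · intro j _ hj
    rw [pdd_mul_function _ _ (hg j), pdd_dz, if_neg hj, zero_mul]
  · simp

/-! ### Contraction with vector fields -/

/-- Contraction with a vector field as a linear map. -/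
def contractLin (X : G.ι → G.Forms) : G.Forms →ₗ[ℝ] G.Forms :=
  ∑ i, LinearMap.mulLeft ℝ (X i) ∘ₗ G.pdd i

theorem contractLin_apply (X : G.ι → G.Forms) (a : G.Forms) :
    contractLin X a = G.contract X a := by simp [contractLin, contract]

theorem contract_add (X : G.ι → G.Forms) (a b : G.Forms) :
    G.contract X (a + b) = G.contract X a + G.contract X b := by
  simp only [← contractLin_apply, map_add]
theorem contract_smul (X : G.ι → G.Forms) (r : ℝ) (a : G.Forms) :
    G.contract X (r • a) = r • G.contract X a := by
  simp only [← contractLin_apply, map_smul]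
theorem contract_sum (X : G.ι → G.Forms) {ι : Type*} (s : Finset ι) (f : ι → G.Forms) :
    G.contract X (∑ i ∈ s, f i) = ∑ i ∈ s, G.contract X (f i) := by
  simp only [← contractLin_apply, map_sum]
@[simp] theorem contract_zero (X : G.ι → G.Forms) : G.contract X 0 = 0 := by
  simp only [← contractLin_apply, map_zero]

theorem contract_dz (X : G.ι → G.Forms) (j : G.ι) : G.contract X (G.dz j) = X j := by
  classical
  unfold contract
  rw [Finset.sum_eq_single j]
  · rw [pdd_dz, if_pos rfl, mul_one]
  · intro i _ hi; rw [pdd_dz, if_neg hi.symm, mul_zero]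
  · simp

theorem contract_mul_function (X : G.ι → G.Forms) (a : G.Forms) {f : G.Forms}
    (hf : f ∈ G.functions) : G.contract X (a * f) = G.contract X a * f := by
  unfold contract
  rw [Finset.sum_mul]
  exact Finset.sum_congr rfl fun i _ => by rw [pdd_mul_function _ _ hf, mul_assoc]

theorem contract_d (X : G.ι → G.Forms) {f : G.Forms} (hf : f ∈ G.functions) :
    G.contract X (G.d f) = G.apply X f :=
  Finset.sum_congr rfl fun i _ => by rw [pdd_d i hf]

theorem apply_mem_functions {X : G.ι → G.Forms} (hX : X ∈ G.vectorFields) {f : G.Forms}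
    (hf : f ∈ G.functions) : G.apply X f ∈ G.functions :=
  sum_mem fun i _ => functions_mul (hX i) (pd_mem_formsOfDegree i hf)

/-- Contraction with a homogeneous vector field is a superderivation. -/
theorem contract_mul {X : G.ι → G.Forms} {k : ℤ} (hX : ∀ i, IsPar (G.deg i + k) (X i))
    (a b : G.Forms) :
    G.contract X (a * b) = G.contract X a * b + tw (k + 1) a * G.contract X b := by
  unfold contract
  rw [Finset.sum_mul, Finset.mul_sum, ← Finset.sum_add_distrib]
  refine Finset.sum_congr rfl fun i _ => ?_
  rw [pdd_mul, mul_add, ← mul_assoc, ← mul_assoc, (hX i).comm (tw _ a), ← tw_add,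
    tw_congr (j := G.deg i + k + (G.deg i + 1)) (k := k + 1), mul_assoc (tw _ a)]
  rw [show G.deg i + k + (G.deg i + 1) - (k + 1) = G.deg i + G.deg i by ring]
  exact Even.add_self _

end GradedDomain

/-- By independence, an element of `V i` that decomposes along the smaller subspaces `W j` has no
component outside index `i`. This is how a grading is intersected with a compatible subspace. -/
theorem mem_of_iSupIndep {ι R M : Type*} [Ring R] [AddCommGroup M] [Module R M]
    {V W : ι → Submodule R M} (hV : iSupIndep V) (hW : ∀ i, W i ≤ V i) {x : M} {i : ι}
    (hx : x ∈ V i) (hx' : x ∈ ⨆ j, W j) : x ∈ W i := by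
  rw [iSup_split_single _ i, Submodule.mem_sup] at hx'
  obtain ⟨a, ha, b, hb, rfl⟩ := hx'
  have h1 : b ∈ V i := by
    have := sub_mem hx (hW i ha)
    rwa [add_sub_cancel_left] at this
  have h2 : b ∈ ⨆ j, ⨆ (_ : j ≠ i), V j :=
    (iSup_mono fun j => iSup_mono fun _ => hW j) hb
  have : b = 0 := by
    have := (hV i).le_bot ⟨h1, h2⟩
    simpa using this
  rw [this, add_zero]; exact ha

/-! ### The part of order zero of an element. -/

namespace FreeSuper

variable {O E C : Type} [CommRing C] [Algebra ℝ C]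

/-- Setting all generators to zero. -/
def ord0 : FreeSuper O E C →ₐ[ℝ] C :=
  (Algebra.TensorProduct.lift ((Algebra.ofId ℝ C).comp ExteriorAlgebra.algebraMapInv)
    (Algebra.TensorProduct.productMap (MvPolynomial.aeval fun _ : E => (0 : C)) (AlgHom.id ℝ C))
    fun _ _ => Commute.all _ _).comp toTensor.toAlgHom

@[simp] theorem ord0_coeff (c : C) : ord0 (coeff c : FreeSuper O E C) = c := by
  simp only [ord0, coeff, AlgHom.comp_apply]
  erw [Algebra.TensorProduct.lift_tmul]
  simp

@[simp] theorem ord0_odd (o : O) : ord0 (odd o : FreeSuper O E C) = 0 := by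
  simp only [ord0, odd, AlgHom.comp_apply]
  erw [Algebra.TensorProduct.lift_tmul]
  simp [ExteriorAlgebra.algebraMapInv]

@[simp] theorem ord0_even (e : E) : ord0 (even e : FreeSuper O E C) = 0 := by
  simp only [ord0, even, AlgHom.comp_apply]
  erw [Algebra.TensorProduct.lift_tmul]
  simp

end FreeSuper

namespace GradedDomain

open FreeSuper

variable {G : GradedDomain}

/-! ### Weight gradings -/

/-- The Euler operator with weights `w`. -/
def euler (w : G.ι ⊕ G.ι → ℝ) : G.Forms →ₗ[ℝ] G.Forms :=
  ∑ i, (w (Sum.inl i) • (LinearMap.mulLeft ℝ (G.z i) ∘ₗ G.pd i) +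
    w (Sum.inr i) • (LinearMap.mulLeft ℝ (G.dz i) ∘ₗ G.pdd i))

theorem euler_apply (w : G.ι ⊕ G.ι → ℝ) (a : G.Forms) : euler w a =
    ∑ i, (w (Sum.inl i) • (G.z i * G.pd i a) + w (Sum.inr i) • (G.dz i * G.pdd i a)) := by
  simp [euler]

/-- Each summand `z^i ∂/∂z^i` or `dz^i ∂/∂(dz^i)` is even, so the two twists cancel and no sign
remains. -/
theorem euler_mul (w : G.ι ⊕ G.ι → ℝ) (a b : G.Forms) :
    euler w (a * b) = euler w a * b + a * euler w b := by
  simp only [euler_apply]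
  rw [Finset.sum_mul, Finset.mul_sum, ← Finset.sum_add_distrib]
  refine Finset.sum_congr rfl fun i _ => ?_
  have h1 : G.z i * (tw (G.deg i) a * G.pd i b) = a * (G.z i * G.pd i b) := by
    rw [← mul_assoc, (isPar_z i).comm, tw_tw, mul_assoc]
  have h2 : G.dz i * (tw (G.deg i + 1) a * G.pdd i b) = a * (G.dz i * G.pdd i b) := by
    rw [← mul_assoc, (isPar_dz i).comm, tw_tw, mul_assoc]
  rw [pd_mul, pdd_mul, mul_add, mul_add, h1, h2]
  simp only [smul_add, add_mul, mul_add, smul_mul_assoc, mul_smul_comm, mul_assoc]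
  abel

theorem euler_gen (w : G.ι ⊕ G.ι → ℝ) (a : G.ι ⊕ G.ι) : euler w (G.gen a) = w a • G.gen a := by
  classical
  rw [euler_apply]
  rcases a with j | j
  · rw [Finset.sum_eq_single j]
    · simp [gen, pd_z, pdd_z]
    · intro i _ hi; simp [gen, pd_z, pdd_z, hi.symm]
    · simp
  · rw [Finset.sum_eq_single j]
    · simp [gen, pd_dz, pdd_dz]
    · intro i _ hi; simp [gen, pd_dz, pdd_dz, hi.symm]
    · simp

/-- Coordinates of degree zero must have weight zero, because they also enter through the smooth
coefficient, on which `z^i ∂/∂z^i` is not diagonal. -/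
theorem euler_monomial (w : G.ι ⊕ G.ι → ℝ) (hw : ∀ i, G.deg i = 0 → w (Sum.inl i) = 0)
    (f : SmoothFun G.body) (l : List (G.ι ⊕ G.ι)) :
    euler w (G.monomial f l) = (l.map w).sum • G.monomial f l := by
  induction l with
  | nil =>
    rw [monomial_nil, euler_apply, List.map_nil, List.sum_nil, zero_smul]
    refine Finset.sum_eq_zero fun i _ => ?_
    by_cases hi : G.deg i = 0
    · simp [hw i hi]
    · simp [pd_coeff_ne hi]
  | cons a l ih =>
    rw [monomial_cons, euler_mul, euler_gen, ih, List.map_cons, List.sum_cons, add_smul,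
      smul_mul_assoc, mul_smul_comm]

/-- The span of the monomials that satisfy a condition on the letters. -/
def mspan (P : List (G.ι ⊕ G.ι) → Prop) : Submodule ℝ G.Forms :=
  Submodule.span ℝ {x | ∃ f l, P l ∧ x = G.monomial f l}

theorem monomial_mem_mspan {P : List (G.ι ⊕ G.ι) → Prop} (f : SmoothFun G.body)
    {l : List (G.ι ⊕ G.ι)} (h : P l) : G.monomial f l ∈ mspan P :=
  Submodule.subset_span ⟨f, l, h, rfl⟩

theorem mspan_le {P : List (G.ι ⊕ G.ι) → Prop} {S : Submodule ℝ G.Forms}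
    (h : ∀ f l, P l → G.monomial f l ∈ S) : mspan P ≤ S := by
  refine Submodule.span_le.2 ?_
  rintro _ ⟨f, l, hl, rfl⟩
  exact h f l hl

theorem mspan_mono {P Q : List (G.ι ⊕ G.ι) → Prop} (h : ∀ l, P l → Q l) :
    mspan P ≤ mspan (G := G) Q :=
  mspan_le fun _ _ hl => monomial_mem_mspan _ (h _ hl)

theorem mem_mspan_true (a : G.Forms) : a ∈ mspan (G := G) fun _ => True := by
  have hmul : ∀ (x : G.ι ⊕ G.ι) (a : G.Forms), a ∈ mspan (G := G) (fun _ => True) →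
      G.gen x * a ∈ mspan (G := G) fun _ => True := by
    intro x a ha
    refine mspan_le (S := (mspan (G := G) fun _ => True).comap (LinearMap.mulLeft ℝ (G.gen x)))
      (fun f l _ => ?_) ha
    rw [Submodule.mem_comap, LinearMap.mulLeft_apply, ← monomial_cons]
    exact monomial_mem_mspan _ trivial
  induction a using forms_induction with
  | hc f => rw [← monomial_nil]; exact monomial_mem_mspan _ trivial
  | hz i a ih => exact hmul (Sum.inl i) a ih
  | hdz i a ih => exact hmul (Sum.inr i) a ih
  | hadd a b ha hb => exact add_mem ha hb
  | hsmul r a ha => exact Submodule.smul_mem _ r ha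

theorem mem_mspan_mul {P Q R : List (G.ι ⊕ G.ι) → Prop} (h : ∀ l l', P l → Q l' → R (l ++ l'))
    {a b : G.Forms} (ha : a ∈ mspan P) (hb : b ∈ mspan Q) : a * b ∈ mspan R := by
  have h1 : ∀ f l, P l → mspan Q ≤ (mspan R).comap (LinearMap.mulLeft ℝ (G.monomial f l)) := by
    intro f l hl
    apply mspan_le
    intro g m hm
    rw [Submodule.mem_comap, LinearMap.mulLeft_apply, monomial_mul]
    exact monomial_mem_mspan _ (h _ _ hl hm)
  have h2 : mspan P ≤ (mspan R).comap (LinearMap.mulRight ℝ b) :=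
    mspan_le fun f l hl => h1 f l hl hb
  exact h2 ha

theorem mspan_le_eigenspace (w : G.ι ⊕ G.ι → ℝ) (hw : ∀ i, G.deg i = 0 → w (Sum.inl i) = 0)
    (r : ℝ) : mspan (fun l => (l.map w).sum = r) ≤ Module.End.eigenspace (euler w) r :=
  mspan_le fun f l hl => by
    rw [Module.End.mem_eigenspace_iff, euler_monomial w hw, hl]

theorem homog_eq_mspan (p : ℕ) (k : ℤ) :
    G.homog p k = mspan fun l => (l.map G.fdeg).sum = p ∧ (l.map G.ldeg).sum = k :=
  le_antisymm (homog_le fun f l hp hk => monomial_mem_mspan f ⟨hp, hk⟩)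
    (mspan_le fun f l h => by rw [← h.1, ← h.2]; exact monomial_mem f l)

/-- Weights that separate the bidegrees. -/
def bidegWeight (a : G.ι ⊕ G.ι) : ℝ := G.fdeg a + √2 * G.ldeg a

theorem sum_bidegWeight (l : List (G.ι ⊕ G.ι)) :
    (l.map bidegWeight).sum = ((l.map G.fdeg).sum : ℕ) + √2 * ((l.map G.ldeg).sum : ℤ) := by
  induction l with
  | nil => simp
  | cons a l ih =>
    simp only [List.map_cons, List.sum_cons, ih, bidegWeight]
    push_cast
    ring

/-- Irrationality of `√2`: one real eigenvalue remembers both degrees, so a single Euler operator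
separates all bidegrees. -/
theorem bideg_injective : Function.Injective fun pk : ℕ × ℤ => (pk.1 : ℝ) + √2 * pk.2 := by
  rintro ⟨p, k⟩ ⟨q, j⟩ h
  simp only at h
  have hk : k = j := by
    by_contra hkj
    have h1 : √2 = (((q : ℚ) - p) / (k - j) : ℚ) := by
      have : (k : ℝ) - j ≠ 0 := by
        rw [sub_ne_zero]; exact_mod_cast hkj
      push_cast
      rw [eq_div_iff this]
      linarith
    exact irrational_sqrt_two ⟨_, h1.symm⟩
  subst hk
  have : (p : ℝ) = q := by linarith
  rw [Prod.mk.injEq]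
  exact ⟨by exact_mod_cast this, rfl⟩

theorem homog_le_eigenspace (p : ℕ) (k : ℤ) :
    G.homog p k ≤ Module.End.eigenspace (euler (G := G) bidegWeight) ((p : ℝ) + √2 * k) := by
  rw [homog_eq_mspan]
  refine (mspan_mono fun l hl => ?_).trans (mspan_le_eigenspace _ (fun i hi => ?_) _)
  · rw [sum_bidegWeight, hl.1, hl.2]
  · simp [bidegWeight, fdeg, ldeg, hi]

theorem homog_iSupIndep : iSupIndep fun pk : ℕ × ℤ => G.homog pk.1 pk.2 :=
  ((Module.End.eigenspaces_iSupIndep (euler (G := G) bidegWeight)).comp bideg_injective).mono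
    fun pk => homog_le_eigenspace pk.1 pk.2

theorem iSup_homog : ⨆ pk : ℕ × ℤ, G.homog pk.1 pk.2 = ⊤ := by
  rw [eq_top_iff]
  intro a _
  refine mspan_le (fun f l _ => ?_) (mem_mspan_true a)
  exact Submodule.mem_iSup_of_mem (⟨_, _⟩ : ℕ × ℤ) (monomial_mem f l)

/-! ### The order filtration -/

/-- The order of a letter. -/
def lord (G : GradedDomain) : G.ι ⊕ G.ι → ℕ :=
  Sum.elim (fun i => if G.deg i = 0 then 0 else 1) (fun _ => 1)

/-- The forms of order at least `m` in the generators. -/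
def Fil (G : GradedDomain) (m : ℕ) : Submodule ℝ G.Forms := mspan fun l => m ≤ (l.map G.lord).sum

theorem monomial_mem_Fil (f : SmoothFun G.body) (l : List (G.ι ⊕ G.ι)) :
    G.monomial f l ∈ G.Fil (l.map G.lord).sum := monomial_mem_mspan f le_rfl

theorem Fil_le {m n : ℕ} (h : m ≤ n) : G.Fil n ≤ G.Fil m := mspan_mono fun _ hl => h.trans hl

theorem Fil_zero (a : G.Forms) : a ∈ G.Fil 0 :=
  mspan_mono (fun _ _ => Nat.zero_le _) (mem_mspan_true a)

theorem Fil_mul {m n : ℕ} {a b : G.Forms} (ha : a ∈ G.Fil m) (hb : b ∈ G.Fil n) :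
    a * b ∈ G.Fil (m + n) :=
  mem_mspan_mul (fun l l' hl hl' => by simpa using add_le_add hl hl') ha hb

theorem Fil_mul_le {k m n : ℕ} (h : k ≤ m + n) {a b : G.Forms} (ha : a ∈ G.Fil m)
    (hb : b ∈ G.Fil n) : a * b ∈ G.Fil k := Fil_le h (Fil_mul ha hb)

theorem Fil_mul_left {m : ℕ} (a : G.Forms) {b : G.Forms} (hb : b ∈ G.Fil m) :
    a * b ∈ G.Fil m := by simpa using Fil_mul (Fil_zero a) hb

theorem Fil_mul_right {m : ℕ} {a : G.Forms} (ha : a ∈ G.Fil m) (b : G.Forms) :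
    a * b ∈ G.Fil m := by simpa using Fil_mul ha (Fil_zero b)

theorem gen_mem_Fil (a : G.ι ⊕ G.ι) : G.gen a ∈ G.Fil (G.lord a) := by
  have := monomial_mem_Fil (1 : SmoothFun G.body) [a]
  rw [monomial_cons] at this
  simpa using this

theorem z_mem_Fil {i : G.ι} (h : G.deg i ≠ 0) : G.z i ∈ G.Fil 1 := by
  simpa [gen, lord, h] using gen_mem_Fil (Sum.inl i)

theorem dz_mem_Fil (i : G.ι) : G.dz i ∈ G.Fil 1 := gen_mem_Fil (Sum.inr i)

theorem inv_gen (a : G.ι ⊕ G.ι) : inv (G.gen a) = sg (G.fdeg a + G.ldeg a) • G.gen a := isPar_gen a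

theorem d_mem_Fil {m : ℕ} {a : G.Forms} (ha : a ∈ G.Fil m) : G.d a ∈ G.Fil m := by
  have key : ∀ f l, G.d (G.monomial f l) ∈ G.Fil (l.map G.lord).sum := by
    intro f l
    induction l with
    | nil => exact Fil_zero _
    | cons a l ih =>
      rw [monomial_cons, d_mul, List.map_cons, List.sum_cons]
      refine add_mem (Fil_mul ?_ (monomial_mem_Fil f l)) (Fil_mul ?_ ih)
      · rcases a with i | i
        · simp only [gen, Sum.elim_inl, d_z]
          refine Fil_le ?_ (dz_mem_Fil i)
          simp only [lord, Sum.elim_inl]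
          split_ifs <;> simp
        · simp [gen, d_dz]
      · rw [inv_gen]; exact Submodule.smul_mem _ _ (gen_mem_Fil a)
  have : G.Fil m ≤ (G.Fil m).comap G.dLin := mspan_le fun f l hl => by
    rw [Submodule.mem_comap, dLin_apply]; exact Fil_le hl (key f l)
  have h := this ha
  rwa [Submodule.mem_comap, dLin_apply] at h

/-- The homogeneous forms of order at least `m`. -/
def filHomog (p : ℕ) (k : ℤ) (m : ℕ) : Submodule ℝ G.Forms :=
  mspan fun l => ((l.map G.fdeg).sum = p ∧ (l.map G.ldeg).sum = k) ∧ m ≤ (l.map G.lord).sum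

theorem filHomog_le_homog (p : ℕ) (k : ℤ) (m : ℕ) : filHomog p k m ≤ G.homog p k := by
  rw [homog_eq_mspan]; exact mspan_mono fun _ h => h.1

theorem Fil_le_iSup_filHomog (m : ℕ) :
    G.Fil m ≤ ⨆ pk : ℕ × ℤ, filHomog pk.1 pk.2 m :=
  mspan_le fun f _ hl => Submodule.mem_iSup_of_mem (⟨_, _⟩ : ℕ × ℤ)
    (monomial_mem_mspan f ⟨⟨rfl, rfl⟩, hl⟩)

/-- The filtration is spanned by homogeneous monomials, hence compatible with the bigrading. -/
theorem mem_filHomog {p : ℕ} {k : ℤ} {m : ℕ} {a : G.Forms} (ha : a ∈ G.homog p k)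
    (ha' : a ∈ G.Fil m) : a ∈ filHomog p k m :=
  mem_of_iSupIndep (i := (p, k)) homog_iSupIndep (W := fun pk : ℕ × ℤ => filHomog pk.1 pk.2 m)
    (fun _ => filHomog_le_homog _ _ _) ha (Fil_le_iSup_filHomog m ha')

theorem gen_mul_monomial_eq_zero (a : G.ι ⊕ G.ι) (ha : ¬ Even (G.fdeg a + G.ldeg a))
    (f : SmoothFun G.body) (l : List (G.ι ⊕ G.ι)) (h : a ∈ l) :
    G.gen a * G.monomial f l = 0 := by
  induction l with
  | nil => simp at h
  | cons b l ih =>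
    rw [monomial_cons, ← mul_assoc]
    rcases List.mem_cons.1 h with rfl | h
    · rw [(isPar_gen a).sq_zero ha, zero_mul]
    · rw [(isPar_gen a).comm_isPar (isPar_gen b), smul_mul_assoc, mul_assoc, ih h, mul_zero,
        smul_zero]

/-- The letters of ghosts. -/
def isGhost (G : GradedDomain) (a : G.ι ⊕ G.ι) : Bool := a.isLeft && decide (G.ldeg a = 1)

/-- Ghosts are odd, so a repeated one annihilates the monomial. The number of ghost letters is
thereby bounded by the number of coordinates. -/
theorem nodup_ghosts {f : SmoothFun G.body} {l : List (G.ι ⊕ G.ι)} (h : G.monomial f l ≠ 0) :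
    (l.filter G.isGhost).Nodup := by
  induction l with
  | nil => simp
  | cons a l ih =>
    rw [monomial_cons] at h
    have h1 : G.monomial f l ≠ 0 := fun h' => h (by rw [h', mul_zero])
    rw [List.filter_cons]
    split_ifs with ha
    · refine List.nodup_cons.2 ⟨fun hm => ?_, ih h1⟩
      apply h
      apply gen_mul_monomial_eq_zero _ _ _ _ (List.mem_filter.1 hm).1
      rcases a with i | i
      · simp only [isGhost, Bool.and_eq_true, decide_eq_true_eq] at ha
        rw [ha.2]
        simp [fdeg]
      · simp [isGhost] at ha
    · exact ih h1

/-- The inequality holds letter by letter: a coordinate of negative degree pays for its order by its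
degree, a differential by its form degree, and a ghost, of degree one, by the extra term. -/
theorem lord_sum_le (hG : ∀ i, G.deg i ≤ 1) (l : List (G.ι ⊕ G.ι)) :
    ((l.map G.lord).sum : ℤ) ≤ 2 * (l.filter G.isGhost).length + 2 * (l.map G.fdeg).sum -
      (l.map G.ldeg).sum := by
  induction l with
  | nil => simp
  | cons a l ih =>
    have key : ((G.lord a : ℕ) : ℤ) ≤ 2 * (if G.isGhost a then 1 else 0) + 2 * (G.fdeg a : ℕ) -
        G.ldeg a := by
      rcases a with i | i
      · have := hG i
        by_cases h0 : G.deg i = 0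
        · simp [isGhost, lord, fdeg, ldeg, h0]
        · by_cases h1 : G.deg i = 1
          · simp [isGhost, lord, fdeg, ldeg, h1]
          · simp only [isGhost, lord, fdeg, ldeg, Sum.elim_inl, h0, h1]
            simp
            omega
      · have := hG i
        simp only [isGhost, lord, fdeg, ldeg, Sum.elim_inr]
        simp
        omega
    have h2 : ((List.filter G.isGhost (a :: l)).length : ℤ) =
        (if G.isGhost a then 1 else 0) + (l.filter G.isGhost).length := by
      rw [List.filter_cons]
      split_ifs
      · rw [List.length_cons]; push_cast; ring
      · ring
    rw [h2, List.map_cons, List.map_cons, List.map_cons, List.sum_cons, List.sum_cons,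
      List.sum_cons, Nat.cast_add, Nat.cast_add]
    linarith

/-- Homogeneous forms of high order vanish when all degrees are at most one. -/
theorem filHomog_eq_bot (hG : ∀ i, G.deg i ≤ 1) {p : ℕ} {k : ℤ} {m : ℕ}
    (hm : 2 * (Fintype.card (G.ι ⊕ G.ι) : ℤ) + 2 * p - k < m) :
    filHomog (G := G) p k m = ⊥ := by
  rw [eq_bot_iff]
  refine mspan_le fun f l hl => ?_
  rw [Submodule.mem_bot]
  by_contra h0
  classical
  have h1 := (nodup_ghosts h0).length_le_card
  have h2 := lord_sum_le hG l
  rw [hl.1.1, hl.1.2] at h2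
  have h3 := hl.2
  have h1' : ((l.filter G.isGhost).length : ℤ) ≤ Fintype.card (G.ι ⊕ G.ι) := by exact_mod_cast h1
  have h3' : (m : ℤ) ≤ (l.map G.lord).sum := by exact_mod_cast h3
  omega

theorem exists_filHomog_eq_bot (hG : ∀ i, G.deg i ≤ 1) (s : Finset (ℕ × ℤ)) :
    ∃ m, ∀ pk ∈ s, ∀ m' ≥ m, filHomog (G := G) pk.1 pk.2 m' = ⊥ := by
  classical
  induction s using Finset.induction_on with
  | empty => exact ⟨0, by simp⟩
  | insert a s ha ih =>
    obtain ⟨m, hm⟩ := ih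
    refine ⟨max m (2 * (Fintype.card (G.ι ⊕ G.ι) : ℤ) + 2 * a.1 - a.2 + 1).toNat,
      fun pk hpk m' hm' => ?_⟩
    rcases Finset.mem_insert.1 hpk with rfl | hpk
    · apply filHomog_eq_bot hG
      have := le_of_max_le_right hm'
      omega
    · exact hm pk hpk m' (le_of_max_le_left hm')

/-- Only finitely many bidegrees occur in `a`, and beyond some order all of them are exhausted. An
element of such an order lies in the sum of the remaining bidegrees, which is independent of the
former. -/
theorem eq_zero_of_mem_Fil (hG : ∀ i, G.deg i ≤ 1) {a : G.Forms} (h : ∀ m, a ∈ G.Fil m) :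
    a = 0 := by
  classical
  have ha : a ∈ ⨆ pk : ℕ × ℤ, G.homog pk.1 pk.2 := by rw [iSup_homog]; trivial
  obtain ⟨s, hs⟩ := Submodule.mem_iSup_iff_exists_finset.1 ha
  obtain ⟨m, hm⟩ := exists_filHomog_eq_bot hG s
  have h1 := Fil_le_iSup_filHomog m (h m)
  have h2 : a ∈ ⨆ pk ∈ (s : Set (ℕ × ℤ))ᶜ, G.homog pk.1 pk.2 := by
    have hle : (⨆ pk : ℕ × ℤ, filHomog (G := G) pk.1 pk.2 m) ≤
        ⨆ pk ∈ (s : Set (ℕ × ℤ))ᶜ, G.homog pk.1 pk.2 := iSup_le fun pk => ?_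
    · exact hle h1
    by_cases hpk : pk ∈ s
    · rw [hm pk hpk m le_rfl]; exact bot_le
    · exact (filHomog_le_homog _ _ _).trans
        (le_iSup₂_of_le (f := fun (pk : ℕ × ℤ) (_ : pk ∈ (s : Set (ℕ × ℤ))ᶜ) => G.homog pk.1 pk.2)
          pk (by simpa using hpk) le_rfl)
  have h3 := (homog_iSupIndep (G := G)).disjoint_biSup_biSup (s := (s : Set (ℕ × ℤ)))
    (t := (s : Set (ℕ × ℤ))ᶜ) disjoint_compl_right
  have := h3.le_bot ⟨hs, h2⟩
  simpa using this

/-! ### Leading terms -/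

theorem ord0_z_ne {i : G.ι} (h : G.deg i ≠ 0) : ord0 (G.z i) = 0 := by
  by_cases h' : Even (G.deg i)
  · rw [z_of_even h' h, ord0_even]
  · rw [z_of_odd (Int.not_even_iff_odd.1 h'), ord0_odd]

theorem ord0_z_zero {i : G.ι} (h : G.deg i = 0) :
    ord0 (G.z i) = SmoothFun.coord G.body ⟨i, h⟩ := by
  rw [z_of_zero h, ord0_coeff]

theorem ord0_dz (i : G.ι) : ord0 (G.dz i) = 0 := by
  by_cases h' : Even (G.deg i)
  · rw [dz_of_even h', ord0_odd]
  · rw [dz_of_odd (Int.not_even_iff_odd.1 h'), ord0_even]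

theorem ord0_gen {a : G.ι ⊕ G.ι} (h : G.lord a ≠ 0) : ord0 (G.gen a) = 0 := by
  rcases a with i | i
  · refine ord0_z_ne fun hi => h ?_
    simp [lord, hi]
  · exact ord0_dz i

theorem ord0_monomial (f : SmoothFun G.body) {l : List (G.ι ⊕ G.ι)}
    (h : (l.map G.lord).sum ≠ 0) : ord0 (G.monomial f l) = 0 := by
  induction l with
  | nil => simp at h
  | cons a l ih =>
    rw [monomial_cons, map_mul]
    by_cases ha : G.lord a = 0
    · rw [ih (by simpa [ha] using h), mul_zero]
    · rw [ord0_gen ha, zero_mul]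

theorem ord0_eq_zero {a : G.Forms} (ha : a ∈ G.Fil 1) : ord0 a = 0 := by
  have : G.Fil 1 ≤ LinearMap.ker (ord0 (O := G.OddGen) (E := G.EvenGen)
      (C := SmoothFun G.body)).toLinearMap :=
    mspan_le fun f l hl => ord0_monomial f (by omega)
  exact this ha

theorem ord0_homog {p : ℕ} {k : ℤ} (hk : k ≠ 0) {a : G.Forms} (ha : a ∈ G.homog p k) :
    ord0 a = 0 := by
  apply ord0_eq_zero
  refine homog_le (fun f l hp hl => ?_) ha
  refine Fil_le ?_ (monomial_mem_Fil f l)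
  by_contra h
  apply hk
  rw [← hl]
  have h0 : (l.map G.lord).sum = 0 := by omega
  clear hl ha h hp
  induction l with
  | nil => simp
  | cons a l ih =>
    rw [List.map_cons, List.sum_cons, Nat.add_eq_zero_iff] at h0
    rw [List.map_cons, List.sum_cons, ih h0.2, add_zero]
    rcases a with i | i
    · by_contra hi
      simp [lord] at h0
      exact hi h0.1
    · simp [lord] at h0

theorem sub_ord0_mem_Fil (a : G.Forms) : a - coeff (ord0 a) ∈ G.Fil 1 := by
  have hmul : ∀ (x : G.ι ⊕ G.ι) (a : G.Forms), a - coeff (ord0 a) ∈ G.Fil 1 →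
      G.gen x * a - coeff (ord0 (G.gen x * a)) ∈ G.Fil 1 := by
    intro x a ha
    by_cases hx : G.lord x = 0
    · rcases x with i | i
      · have hi : G.deg i = 0 := by
          by_contra hi; simp [lord, hi] at hx
        rw [map_mul, coeff_mul]
        have : G.gen (Sum.inl i) = coeff (ord0 (G.gen (Sum.inl i))) := by
          simp only [gen, Sum.elim_inl]
          rw [ord0_z_zero hi, z_of_zero hi]
        rw [← this, ← mul_sub]
        exact Fil_mul_left _ ha
      · simp [lord] at hx
    · rw [map_mul, ord0_gen hx, zero_mul, coeff_zero, sub_zero]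
      refine Fil_mul_right (Fil_le ?_ (gen_mem_Fil x)) _
      omega
  induction a using forms_induction with
  | hc f => simp
  | hz i a ih => exact hmul (Sum.inl i) a ih
  | hdz i a ih => exact hmul (Sum.inr i) a ih
  | hadd a b ha hb =>
    rw [map_add, coeff_add, add_sub_add_comm]; exact add_mem ha hb
  | hsmul r a ha => rw [map_smul, coeff_smul, ← smul_sub]; exact Submodule.smul_mem _ _ ha

theorem mem_Fil_one {a : G.Forms} (ha : ord0 a = 0) : a ∈ G.Fil 1 := by
  simpa [ha] using sub_ord0_mem_Fil a

/-- The Euler operator that counts the order. -/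
def orderEuler (G : GradedDomain) : G.Forms →ₗ[ℝ] G.Forms := euler fun a => (G.lord a : ℝ)

theorem orderEuler_monomial (f : SmoothFun G.body) (l : List (G.ι ⊕ G.ι)) :
    G.orderEuler (G.monomial f l) = ((l.map G.lord).sum : ℝ) • G.monomial f l := by
  have h : ∀ l : List (G.ι ⊕ G.ι),
      (l.map fun a => (G.lord a : ℝ)).sum = ((l.map G.lord).sum : ℕ) := by
    intro l
    induction l with
    | nil => simp
    | cons a l ih => simp only [List.map_cons, List.sum_cons, ih]; push_cast; rfl
  rw [orderEuler, euler_monomial _ (fun i hi => by simp [lord, hi]), h]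

/-- Monomials of order exactly `m` are eigenvectors with eigenvalue `m`; the others already have
higher order. -/
theorem orderEuler_sub_mem_Fil {m : ℕ} {a : G.Forms} (ha : a ∈ G.Fil m) :
    G.orderEuler a - (m : ℝ) • a ∈ G.Fil (m + 1) := by
  have h : G.Fil m ≤ (G.Fil (m + 1)).comap (G.orderEuler - (m : ℝ) • LinearMap.id) := by
    refine mspan_le fun f l hl => ?_
    rw [Submodule.mem_comap, LinearMap.sub_apply, LinearMap.smul_apply, LinearMap.id_apply,
      orderEuler_monomial, ← sub_smul]
    rcases hl.eq_or_lt with h | h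
    · rw [← h, sub_self, zero_smul]; exact zero_mem _
    · exact Submodule.smul_mem _ _ (Fil_le h (monomial_mem_Fil f l))
  exact h ha

theorem orderEuler_function {a : G.Forms} (ha : a ∈ G.functions) :
    G.orderEuler a = ∑ i, if G.deg i = 0 then 0 else G.z i * G.pd i a := by
  rw [orderEuler, euler_apply]
  refine Finset.sum_congr rfl fun i _ => ?_
  rw [pdd_function i ha, mul_zero, smul_zero, add_zero]
  by_cases hi : G.deg i = 0
  · simp [lord, hi]
  · simp [lord, hi]

theorem coeff_mem_functions' (a : G.Forms) : (coeff (ord0 a) : G.Forms) ∈ G.functions :=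
  coeff_mem_functions _

theorem linear_part_sub_mem_Fil (a : G.Forms) :
    (∑ i, (if G.deg i = 0 then 0 else G.z i * G.pd i (a - coeff (ord0 a)))) -
      (∑ i, (if G.deg i = 0 then 0 else G.z i * coeff (ord0 (G.pd i a)))) ∈ G.Fil 2 := by
  rw [← Finset.sum_sub_distrib]
  refine sum_mem fun i _ => ?_
  split_ifs with hi
  · rw [sub_zero]; exact zero_mem _
  · rw [map_sub, pd_coeff_ne hi, sub_zero, ← mul_sub]
    exact Fil_mul_le (by norm_num) (z_mem_Fil hi) (sub_ord0_mem_Fil (G.pd i a))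

/-- A function agrees to first order with its linear part. -/
theorem lead_mem_Fil {a : G.Forms} (ha : a ∈ G.functions) :
    a - coeff (ord0 a) - ∑ i, (if G.deg i = 0 then 0 else G.z i * coeff (ord0 (G.pd i a))) ∈
      G.Fil 2 := by
  -- Euler's identity: modulo order two, a function without constant term is its own image under the
  -- Euler operator, that is, `∑ z^i ∂_i a`.
  have h1 := orderEuler_sub_mem_Fil (sub_ord0_mem_Fil a)
  rw [orderEuler_function (sub_mem ha (coeff_mem_functions' a)), Nat.cast_one,
    one_smul] at h1
  have h2 := linear_part_sub_mem_Fil a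
  have h3 := sub_mem h2 h1
  generalize (∑ i, (if G.deg i = 0 then 0 else G.z i * G.pd i (a - coeff (ord0 a)))) = S at h3
  rwa [sub_sub_sub_cancel_left] at h3

/-- Functions of degree zero and positive order have order at least two. -/
theorem mem_Fil_two {a : G.Forms} (ha : a ∈ G.homog 0 0) (h : ord0 a = 0) : a ∈ G.Fil 2 := by
  -- A linear term would be a coordinate of nonzero degree times a function on the body, which
  -- cannot have total degree zero.
  have := lead_mem_Fil (homog_le_formsOfDegree _ _ ha)
  rw [h, coeff_zero, sub_zero, Finset.sum_eq_zero, sub_zero] at this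
  · exact this
  · intro i _
    split_ifs with hi
    · rfl
    · rw [ord0_homog _ (pd_mem_homog i ha), coeff_zero, mul_zero]
      simpa using hi

/-- A function without constant term whose derivatives have order at least `m` has order at least
`m + 1`. -/
theorem mem_Fil_succ {m : ℕ} {f : G.Forms} (hf : f ∈ G.functions) (h0 : ord0 f = 0)
    (h : ∀ i, G.pd i f ∈ G.Fil m) : f ∈ G.Fil (m + 1) := by
  have hE : G.orderEuler f ∈ G.Fil (m + 1) := by
    rw [orderEuler_function hf]
    refine sum_mem fun i _ => ?_
    split_ifs with hi
    · exact zero_mem _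
    · rw [add_comm]; exact Fil_mul (z_mem_Fil hi) (h i)
  -- The order is raised one step at a time: modulo order `q + 2`, `(q + 1) f` equals the Euler
  -- operator on `f`, which has order `m + 1` already.
  have key : ∀ q ≤ m, f ∈ G.Fil (q + 1) := by
    intro q
    induction q with
    | zero => exact fun _ => mem_Fil_one h0
    | succ q ih =>
      intro hq
      have h1 := sub_mem (Fil_le (by omega) hE)
        (orderEuler_sub_mem_Fil (ih (by omega)))
      rw [sub_sub_cancel] at h1
      exact (Submodule.smul_mem_iff _ (by positivity)).1 h1
  exact key m le_rfl

end GradedDomain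

namespace GradedDomain

open FreeSuper

variable {G H : GradedDomain}

/-! ### Morphisms from their components -/

/-- The components of a morphism `G → H` whose map of bodies is the relabelling of coordinates
along `r`. -/
structure Components (G H : GradedDomain) where
  r : {j : H.ι // H.deg j = 0} → {i : G.ι // G.deg i = 0}
  body : ∀ x ∈ G.body, x ∘ r ∈ H.body
  fn : H.ι → G.Forms
  mem : ∀ j, fn j ∈ G.homog 0 (H.deg j)
  sub_mem : ∀ j : {j : H.ι // H.deg j = 0}, fn j - G.z (r j) ∈ G.Fil 1

namespace Components

variable (c : Components G H)

/-- The nilpotent part of a component of degree zero. -/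
def nil (k : {j : H.ι // H.deg j = 0}) : G.Forms := c.fn k - G.z (c.r k)

theorem nil_mem (k : {j : H.ι // H.deg j = 0}) : c.nil k ∈ G.homog 0 0 := by
  have h1 := c.mem k
  have h2 := z_mem_homog (G := G) (c.r k)
  rw [k.2] at h1
  rw [(c.r k).2] at h2
  exact Submodule.sub_mem _ h1 h2

theorem nil_even (k : {j : H.ι // H.deg j = 0}) : IsPar 0 (c.nil k) := by
  simpa using isPar_of_mem_homog (c.nil_mem k)

theorem nil_comm (k : {j : H.ι // H.deg j = 0}) (a : G.Forms) : c.nil k * a = a * c.nil k :=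
  (c.nil_even k).comm_even (by simp) a

/-- The terms of the Taylor expansion of the pullback of a function on the body. -/
def taylor : ℕ → SmoothFun H.body →ₗ[ℝ] G.Forms
  | 0 => (coeffHom.comp (SmoothFun.comap c.r c.body)).toLinearMap
  | m + 1 => ((m : ℝ) + 1)⁻¹ • ∑ k : {j : H.ι // H.deg j = 0},
      LinearMap.mulLeft ℝ (c.nil k) ∘ₗ taylor m ∘ₗ SmoothFun.partialDeriv H.body k

theorem taylor_zero (f : SmoothFun H.body) :
    c.taylor 0 f = coeff (SmoothFun.comap c.r c.body f) := rfl

theorem taylor_succ (m : ℕ) (f : SmoothFun H.body) : ((m : ℝ) + 1) • c.taylor (m + 1) f =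
    ∑ k : {j : H.ι // H.deg j = 0},
      c.nil k * c.taylor m (SmoothFun.partialDeriv H.body k f) := by
  rw [taylor, LinearMap.smul_apply, smul_inv_smul₀ (by positivity)]
  simp

theorem taylor_mem_homog (m : ℕ) (f : SmoothFun H.body) : c.taylor m f ∈ G.homog 0 0 := by
  induction m generalizing f with
  | zero => rw [taylor_zero]; exact coeff_mem_homog _
  | succ m ih =>
    rw [← Submodule.smul_mem_iff _ (show (m : ℝ) + 1 ≠ 0 by positivity), taylor_succ]
    refine sum_mem fun k _ => ?_
    simpa using homog_mul (c.nil_mem k) (ih (SmoothFun.partialDeriv H.body k f))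

theorem taylor_mem_Fil (m : ℕ) (f : SmoothFun H.body) : c.taylor m f ∈ G.Fil m := by
  induction m generalizing f with
  | zero => exact Fil_zero _
  | succ m ih =>
    rw [← Submodule.smul_mem_iff _ (show (m : ℝ) + 1 ≠ 0 by positivity), taylor_succ]
    refine sum_mem fun k _ => ?_
    exact Fil_mul_le (add_comm _ _).le (c.sub_mem k) (ih _)

theorem taylor_one_mem (m : ℕ) : c.taylor (m + 1) 1 = 0 := by
  have h : ((m : ℝ) + 1) • c.taylor (m + 1) 1 = 0 := by
    rw [taylor_succ]
    exact Finset.sum_eq_zero fun k _ => by rw [partialDeriv_one, map_zero, mul_zero]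
  exact (smul_eq_zero.1 h).resolve_left (by positivity)

/-- The terms are divided powers of the operator `∑ nil_k ∂_k`, so they obey the Leibniz formula
without binomials. After multiplication by `m + 1`, this factor is split as `p.1 + p.2` and each
part is absorbed by one recursion. -/
theorem taylor_mul (m : ℕ) (f g : SmoothFun H.body) : c.taylor m (f * g) =
    ∑ p ∈ Finset.HasAntidiagonal.antidiagonal m, c.taylor p.1 f * c.taylor p.2 g := by
  induction m generalizing f g with
  | zero => simp [taylor_zero, coeff_mul]
  | succ m ih =>
    have hm : (m : ℝ) + 1 ≠ 0 := by positivity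
    apply smul_right_injective _ hm
    simp only
    rw [taylor_succ, Finset.smul_sum]
    have h1 : ∀ p ∈ Finset.HasAntidiagonal.antidiagonal (m + 1),
        ((m : ℝ) + 1) • (c.taylor p.1 f * c.taylor p.2 g) =
          (p.1 : ℝ) • c.taylor p.1 f * c.taylor p.2 g +
          c.taylor p.1 f * ((p.2 : ℝ) • c.taylor p.2 g) := by
      intro p hp
      rw [Finset.HasAntidiagonal.mem_antidiagonal] at hp
      have : (m : ℝ) + 1 = p.1 + p.2 := by exact_mod_cast hp.symm
      rw [this, add_smul, smul_mul_assoc, mul_smul_comm]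
    rw [Finset.sum_congr rfl h1, Finset.sum_add_distrib, Finset.Nat.sum_antidiagonal_succ]
    rw [Finset.Nat.sum_antidiagonal_succ']
    simp only [Nat.cast_zero, zero_smul, zero_mul, mul_zero, zero_add, Nat.cast_add, Nat.cast_one,
      taylor_succ]
    rw [← Finset.sum_add_distrib]
    simp only [Finset.sum_mul, Finset.mul_sum, ← Finset.sum_add_distrib]
    rw [Finset.sum_comm]
    refine Finset.sum_congr rfl fun k _ => ?_
    rw [SmoothFun.partialDeriv_mul, map_add, ih, ih, ← Finset.sum_add_distrib, Finset.mul_sum]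
    refine Finset.sum_congr rfl fun p _ => ?_
    rw [mul_add, ← mul_assoc, ← mul_assoc, c.nil_comm k (c.taylor p.1 f), mul_assoc _ (c.nil k)]

theorem d_taylor_zero (f : SmoothFun H.body) : G.d (c.taylor 0 f) =
    ∑ k : {j : H.ι // H.deg j = 0},
      G.dz (c.r k) * c.taylor 0 (SmoothFun.partialDeriv H.body k f) := by
  classical
  rw [taylor_zero, d_coeff]
  simp only [SmoothFun.partialDeriv_comap, coeff_sum, Finset.mul_sum, taylor_zero]
  rw [Finset.sum_comm]
  refine Finset.sum_congr rfl fun k _ => ?_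
  rw [Finset.sum_eq_single (c.r k)]
  · rw [if_pos rfl]
  · intro l _ hl; rw [if_neg hl.symm, coeff_zero, mul_zero]
  · simp

/-- The chain rule order by order: `d` acts on the point of expansion and on the nilpotent parts.
The nilpotent parts give equal terms, whose number cancels one factor of the factorial; hence the
induction first multiplies by the integer by which the recursion divides. -/
theorem d_taylor_succ (m : ℕ) (f : SmoothFun H.body) : G.d (c.taylor (m + 1) f) =
    ∑ k : {j : H.ι // H.deg j = 0},
      (G.dz (c.r k) * c.taylor (m + 1) (SmoothFun.partialDeriv H.body k f) +
      G.d (c.nil k) * c.taylor m (SmoothFun.partialDeriv H.body k f)) := by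
  have hinv : ∀ k, inv (c.nil k) = c.nil k := fun k => by
    have := c.nil_even k
    simpa [IsPar] using this
  have hcomm : ∀ k l, c.nil k * G.dz (c.r l) = G.dz (c.r l) * c.nil k := fun k l => c.nil_comm _ _
  have hcomm' : ∀ k l, c.nil k * G.d (c.nil l) = G.d (c.nil l) * c.nil k :=
    fun k l => c.nil_comm _ _
  induction m generalizing f with
  | zero =>
    have h1 := fun f => c.taylor_succ 0 f
    simp only [Nat.cast_zero, zero_add, one_smul] at h1
    rw [zero_add, h1, d_sum]
    simp only [d_mul, hinv, d_taylor_zero, Finset.sum_add_distrib, h1, Finset.mul_sum]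
    rw [add_comm, Finset.sum_comm]
    congr 1
    refine Finset.sum_congr rfl fun k _ => Finset.sum_congr rfl fun l _ => ?_
    rw [← mul_assoc, hcomm, mul_assoc, SmoothFun.partialDeriv_comm]
  | succ m ih =>
    have hm : ((m + 1 : ℕ) : ℝ) + 1 ≠ 0 := by positivity
    apply smul_right_injective _ hm
    simp only
    rw [← d_smul, taylor_succ, d_sum]
    simp only [d_mul, hinv, ih, Finset.sum_add_distrib, Finset.mul_sum, mul_add, smul_add,
      Finset.smul_sum, ← mul_smul_comm]
    have h1 : ∀ k, ((m + 1 : ℕ) + 1 : ℝ) • c.taylor (m + 1 + 1)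
        (SmoothFun.partialDeriv H.body k f) = ∑ l : {j : H.ι // H.deg j = 0}, c.nil l *
          c.taylor (m + 1) (SmoothFun.partialDeriv H.body l (SmoothFun.partialDeriv H.body k f)) :=
      fun k => c.taylor_succ (m + 1) _
    have h2 : ∀ k, ((m + 1 : ℕ) + 1 : ℝ) • c.taylor (m + 1) (SmoothFun.partialDeriv H.body k f) =
        c.taylor (m + 1) (SmoothFun.partialDeriv H.body k f) +
        ∑ l : {j : H.ι // H.deg j = 0}, c.nil l *
          c.taylor m (SmoothFun.partialDeriv H.body l (SmoothFun.partialDeriv H.body k f)) := by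
      intro k
      rw [← c.taylor_succ m, add_smul, one_smul, add_comm]
      push_cast
      rfl
    simp only [h1, h2, mul_add, Finset.mul_sum, Finset.sum_add_distrib]
    rw [add_comm, add_assoc, add_comm (∑ k, ∑ l, _ * (G.d _ * _))]
    congr 1
    · rw [Finset.sum_comm]
      refine Finset.sum_congr rfl fun k _ => Finset.sum_congr rfl fun l _ => ?_
      rw [← mul_assoc, hcomm, mul_assoc, SmoothFun.partialDeriv_comm]
    · congr 1
      rw [Finset.sum_comm]
      refine Finset.sum_congr rfl fun k _ => Finset.sum_congr rfl fun l _ => ?_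
      rw [← mul_assoc, hcomm', mul_assoc, SmoothFun.partialDeriv_comm]

/-- An order beyond which the Taylor expansion vanishes. -/
theorem exists_order (hG : ∀ i, G.deg i ≤ 1) :
    ∃ K, ∀ m ≥ K, ∀ f, c.taylor m f = 0 := by
  obtain ⟨K, hK⟩ := exists_filHomog_eq_bot hG {(0, 0)}
  refine ⟨K, fun m hm f => ?_⟩
  have h := mem_filHomog (c.taylor_mem_homog m f) (c.taylor_mem_Fil m f)
  rw [hK (0, 0) (by simp) m hm] at h
  simpa using h

/-- The sum of the Taylor expansion. -/
def taylorSum (K : ℕ) : SmoothFun H.body →ₗ[ℝ] G.Forms := ∑ m ∈ Finset.range K, c.taylor m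

theorem taylorSum_apply (K : ℕ) (f : SmoothFun H.body) :
    c.taylorSum K f = ∑ m ∈ Finset.range K, c.taylor m f := by simp [taylorSum]

theorem taylorSum_eq {K : ℕ} (hK : ∀ m ≥ K, ∀ f, c.taylor m f = 0) {L : ℕ} (h : K ≤ L)
    (f : SmoothFun H.body) : c.taylorSum L f = c.taylorSum K f := by
  rw [taylorSum_apply, taylorSum_apply]
  refine (Finset.sum_subset (Finset.range_mono h) fun m _ hm => hK m ?_ f).symm
  simpa using hm

/-- The left side is extended to `K + K` terms, so that its antidiagonals contain all pairs of
indices below `K`; the additional pairs contain a vanishing factor. -/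
theorem taylorSum_mul {K : ℕ} (hK : ∀ m ≥ K, ∀ f, c.taylor m f = 0) (f g : SmoothFun H.body) :
    c.taylorSum K (f * g) = c.taylorSum K f * c.taylorSum K g := by
  rw [← c.taylorSum_eq hK (show K ≤ K + K by omega), taylorSum_apply, taylorSum_apply,
    taylorSum_apply, Finset.sum_mul_sum, ← Finset.sum_product',
    ← Finset.sum_fiberwise_of_maps_to (s := Finset.range K ×ˢ Finset.range K) (t := Finset.range (K + K)) (g := fun p => p.1 + p.2)]
  · refine Finset.sum_congr rfl fun m _ => ?_
    rw [taylor_mul]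
    refine (Finset.sum_subset ?_ ?_).symm
    · intro p hp
      rw [Finset.mem_filter] at hp
      exact Finset.HasAntidiagonal.mem_antidiagonal.2 hp.2
    · intro p hp hp'
      rw [Finset.HasAntidiagonal.mem_antidiagonal] at hp
      simp only [Finset.mem_filter, Finset.mem_product, Finset.mem_range, not_and_or, not_lt] at hp'
      rcases hp' with (h | h) | h
      · rw [hK _ h, zero_mul]
      · rw [hK _ h, mul_zero]
      · exact absurd hp h
  · intro p hp
    simp only [Finset.mem_product, Finset.mem_range] at hp ⊢
    omega

theorem taylorSum_one (K : ℕ) : c.taylorSum (K + 1) 1 = 1 := by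
  rw [taylorSum_apply, Finset.sum_range_succ', Finset.sum_eq_zero fun m _ => c.taylor_one_mem m,
    zero_add, taylor_zero, map_one, coeff_one]

/-- The pullback of functions on the body. -/
def pullCoeff {K : ℕ} (hK : ∀ m ≥ K, ∀ f, c.taylor m f = 0) : SmoothFun H.body →ₐ[ℝ] G.Forms :=
  AlgHom.ofLinearMap (c.taylorSum K)
    (by rw [← c.taylorSum_eq hK (Nat.le_succ K), taylorSum_one]) (c.taylorSum_mul hK)

theorem pullCoeff_apply {K : ℕ} (hK : ∀ m ≥ K, ∀ f, c.taylor m f = 0) (f : SmoothFun H.body) :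
    c.pullCoeff hK f = ∑ m ∈ Finset.range K, c.taylor m f := c.taylorSum_apply K f

theorem pullCoeff_mem_homog {K : ℕ} (hK : ∀ m ≥ K, ∀ f, c.taylor m f = 0)
    (f : SmoothFun H.body) : c.pullCoeff hK f ∈ G.homog 0 0 := by
  rw [pullCoeff_apply]
  exact sum_mem fun m _ => c.taylor_mem_homog m f

theorem taylor_coord_add_two (m : ℕ) (k : {j : H.ι // H.deg j = 0}) :
    c.taylor (m + 2) (SmoothFun.coord H.body k) = 0 := by
  classical
  have h : (((m + 1 : ℕ) : ℝ) + 1) • c.taylor (m + 1 + 1) (SmoothFun.coord H.body k) = 0 := by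
    rw [taylor_succ]
    refine Finset.sum_eq_zero fun l _ => ?_
    rw [SmoothFun.partialDeriv_coord]
    split_ifs
    · rw [taylor_one_mem, mul_zero]
    · rw [map_zero, mul_zero]
  exact (smul_eq_zero.1 h).resolve_left (by positivity)

theorem pullCoeff_coord {K : ℕ} (hK : ∀ m ≥ K, ∀ f, c.taylor m f = 0)
    (k : {j : H.ι // H.deg j = 0}) : c.pullCoeff hK (SmoothFun.coord H.body k) = c.fn k := by
  classical
  -- The expansion of a coordinate consists of the terms of order zero and one. Passing to `K + 2`
  -- makes both of them visible even when `K < 2`.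
  have h := c.taylorSum_eq hK (show K ≤ K + 2 by omega) (SmoothFun.coord H.body k)
  have h1 : c.taylor 1 (SmoothFun.coord H.body k) = c.nil k := by
    have := c.taylor_succ 0 (SmoothFun.coord H.body k)
    rw [Nat.cast_zero, zero_add, one_smul, zero_add] at this
    rw [this, Finset.sum_eq_single k]
    · rw [SmoothFun.partialDeriv_coord, if_pos rfl, taylor_zero, map_one, coeff_one, mul_one]
    · intro l _ hl
      rw [SmoothFun.partialDeriv_coord, if_neg hl.symm, map_zero, mul_zero]
    · simp
  change c.taylorSum K _ = _
  rw [← h, taylorSum_apply, Finset.sum_range_succ', Finset.sum_range_succ',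
    Finset.sum_eq_zero fun m _ => c.taylor_coord_add_two m k, zero_add, h1, taylor_zero,
    SmoothFun.comap_coord, nil, z_of_zero (c.r k).2]
  exact sub_add_cancel _ _

theorem d_pullCoeff {K : ℕ} (hK : ∀ m ≥ K, ∀ f, c.taylor m f = 0) (f : SmoothFun H.body) :
    G.d (c.pullCoeff hK f) = ∑ k : {j : H.ι // H.deg j = 0},
      G.d (c.fn k) * c.pullCoeff hK (SmoothFun.partialDeriv H.body k f) := by
  have e1 : ∀ f, c.pullCoeff hK f = c.taylor 0 f + ∑ m ∈ Finset.range K, c.taylor (m + 1) f := by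
    intro f
    have h := c.taylorSum_eq hK (show K ≤ K + 1 by omega) f
    change c.taylorSum K _ = _
    rw [← h, taylorSum_apply, Finset.sum_range_succ', add_comm]
  have e2 : ∀ k : {j : H.ι // H.deg j = 0}, G.d (c.fn k) = G.dz (c.r k) + G.d (c.nil k) := by
    intro k
    rw [nil, d_sub, d_z, add_sub_cancel]
  rw [e1, d_add, d_sum]
  simp only [d_taylor_zero, d_taylor_succ, e2, add_mul, Finset.sum_add_distrib]
  rw [← add_assoc]
  congr 1
  · simp only [e1, mul_add, Finset.sum_add_distrib, Finset.mul_sum]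
    rw [Finset.sum_comm (s := Finset.range K)]
  · simp only [pullCoeff_apply, Finset.mul_sum]
    rw [Finset.sum_comm]

/-- The pullback of forms along the morphism with given components. -/
def pull {K : ℕ} (hK : ∀ m ≥ K, ∀ f, c.taylor m f = 0) : H.Forms →ₐ[ℝ] G.Forms :=
  liftHom (Sum.elim (fun j => c.fn j.1) fun j => G.d (c.fn j.1))
    (Sum.elim (fun j => c.fn j.1) fun j => G.d (c.fn j.1)) (c.pullCoeff hK)
    (by
      have h : ∀ j, IsPar (H.deg j) (c.fn j) := fun j => by
        simpa using isPar_of_mem_homog (c.mem j)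
      rintro (⟨j, hj⟩ | ⟨j, hj⟩)
      · exact (h j).congr (hj.sub_odd odd_one)
      · exact (IsPar.d (h j)).congr (by simpa using hj))
    (by
      have h : ∀ j, IsPar (H.deg j) (c.fn j) := fun j => by
        simpa using isPar_of_mem_homog (c.mem j)
      rintro (⟨j, hj⟩ | ⟨j, hj⟩)
      · exact (h j).congr (by simpa using hj.1)
      · exact (IsPar.d (h j)).congr (by simpa using hj.add_odd odd_one))
    (fun f => by simpa using isPar_of_mem_homog (c.pullCoeff_mem_homog hK f))

variable {K : ℕ} (hK : ∀ m ≥ K, ∀ f, c.taylor m f = 0)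

theorem pull_coeff (f : SmoothFun H.body) : c.pull hK (coeff f) = c.pullCoeff hK f :=
  liftHom_coeff _

theorem pull_z (j : H.ι) : c.pull hK (H.z j) = c.fn j := by
  by_cases h0 : H.deg j = 0
  · rw [z_of_zero h0, pull_coeff, pullCoeff_coord]
  · by_cases h : Even (H.deg j)
    · rw [z_of_even h h0]; exact liftHom_even _
    · rw [z_of_odd (Int.not_even_iff_odd.1 h)]; exact liftHom_odd _

theorem pull_dz (j : H.ι) : c.pull hK (H.dz j) = G.d (c.fn j) := by
  by_cases h : Even (H.deg j)
  · rw [dz_of_even h]; exact liftHom_odd _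
  · rw [dz_of_odd (Int.not_even_iff_odd.1 h)]; exact liftHom_even _

theorem pull_mem_homog {p : ℕ} {k : ℤ} {a : H.Forms} (ha : a ∈ H.homog p k) :
    c.pull hK a ∈ G.homog p k := by
  have key : ∀ f (l : List (H.ι ⊕ H.ι)), c.pull hK (H.monomial f l) ∈
      G.homog (l.map H.fdeg).sum (l.map H.ldeg).sum := by
    intro f l
    induction l with
    | nil => rw [monomial_nil, pull_coeff]; exact c.pullCoeff_mem_homog hK f
    | cons a l ih =>
      rw [monomial_cons, map_mul, List.map_cons, List.sum_cons, List.map_cons, List.sum_cons]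
      refine homog_mul ?_ ih
      rcases a with j | j
      · simp only [gen, fdeg, ldeg, Sum.elim_inl, pull_z]; exact c.mem j
      · simp only [gen, fdeg, ldeg, Sum.elim_inr, pull_dz]; exact d_mem_homog (c.mem j)
  have : H.homog p k ≤ (G.homog p k).comap (c.pull hK).toLinearMap :=
    homog_le fun f l hp hk => by rw [← hp, ← hk]; exact key f l
  exact this ha

end Components

/-- A homomorphism of forms that preserves the parities of the generators preserves parity. -/
theorem algHom_inv {φ : H.Forms →ₐ[ℝ] G.Forms} (hc : ∀ f, IsPar 0 (φ (coeff f)))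
    (hz : ∀ j, IsPar (H.deg j) (φ (H.z j))) (hdz : ∀ j, IsPar (H.deg j + 1) (φ (H.dz j)))
    (a : H.Forms) : φ (inv a) = inv (φ a) := by
  have h : φ.comp inv = inv.comp φ := by
    refine forms_algHom_ext (fun f => ?_) (fun j => ?_) fun j => ?_
    · rw [AlgHom.comp_apply, AlgHom.comp_apply, inv_coeff, (hc f : inv _ = _), sg_zero, one_smul]
    · rw [AlgHom.comp_apply, AlgHom.comp_apply, (isPar_z j : inv _ = _), (hz j : inv _ = _),
        map_smul]
    · rw [AlgHom.comp_apply, AlgHom.comp_apply, (isPar_dz j : inv _ = _), (hdz j : inv _ = _),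
        map_smul]
  exact DFunLike.congr_fun h a

/-- A homomorphism of forms that commutes with `d` on coordinates and on functions on the body
commutes with `d`. -/
theorem algHom_map_d {φ : H.Forms →ₐ[ℝ] G.Forms} (hinv : ∀ a, φ (inv a) = inv (φ a))
    (hc : ∀ f, φ (H.d (coeff f)) = G.d (φ (coeff f))) (hz : ∀ j, φ (H.dz j) = G.d (φ (H.z j)))
    (a : H.Forms) : φ (H.d a) = G.d (φ a) := by
  -- Both composites are superderivations along `φ`, so they need only be compared on coefficients
  -- and generators.
  have h1 : IsDer φ 1 (φ.toLinearMap ∘ₗ H.dLin) := fun a b => by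
    simp [dLin_apply, d_mul, hinv]
  have h2 : IsDer φ 1 (G.dLin ∘ₗ φ.toLinearMap) := fun a b => by
    simp [dLin_apply, d_mul]
  have := der_ext h1 h2 (fun f => ?_) (fun j => ?_) (fun j => ?_) a
  · simpa [dLin_apply] using this
  · simpa [dLin_apply] using hc f
  · simpa [dLin_apply, d_z] using hz j
  · simp [dLin_apply, d_dz, hz, d_d]

/-- The morphism with given components. -/
theorem Components.exists_hom (c : Components G H) (hG : ∀ i, G.deg i ≤ 1) :
    ∃ φ : Hom G H, (∀ j, φ.pullback (H.z j) = c.fn j) ∧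
      ∀ f, ∃ K, φ.pullback (coeff f) = coeff (SmoothFun.comap c.r c.body f) +
        ∑ m ∈ Finset.range K, c.taylor (m + 1) f := by
  obtain ⟨K, hK⟩ := c.exists_order hG
  refine ⟨⟨c.pull hK, fun p k a ha => c.pull_mem_homog hK ha, algHom_map_d ?_ ?_ ?_⟩, c.pull_z hK,
    fun f => ⟨K, ?_⟩⟩
  · refine algHom_inv (fun f => ?_) (fun j => ?_) fun j => ?_
    · rw [c.pull_coeff]; simpa using isPar_of_mem_homog (c.pullCoeff_mem_homog hK f)
    · rw [c.pull_z]; simpa using isPar_of_mem_homog (c.mem j)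
    · rw [c.pull_dz]
      have : IsPar (H.deg j) (c.fn j) := by simpa using isPar_of_mem_homog (c.mem j)
      exact IsPar.d this
  · intro f
    rw [d_coeff, map_sum, c.pull_coeff, c.d_pullCoeff]
    exact Finset.sum_congr rfl fun k _ => by rw [map_mul, c.pull_dz, c.pull_coeff]
  · intro j; rw [c.pull_dz, c.pull_z]
  · have h := c.taylorSum_eq hK (show K ≤ K + 1 by omega) f
    change c.pull hK (coeff f) = _
    rw [c.pull_coeff]
    change c.taylorSum K _ = _
    rw [← h, c.taylorSum_apply, Finset.sum_range_succ', add_comm, c.taylor_zero]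

end GradedDomain

namespace GradedDomain

open FreeSuper

variable {G H K : GradedDomain}

/-! ### Properties of morphisms -/

theorem fdeg_le_lord (l : List (G.ι ⊕ G.ι)) : (l.map G.fdeg).sum ≤ (l.map G.lord).sum := by
  induction l with
  | nil => simp
  | cons a l ih =>
    simp only [List.map_cons, List.sum_cons]
    refine add_le_add ?_ ih
    rcases a with i | i <;> simp [fdeg, lord]

theorem homog_le_Fil (p : ℕ) (k : ℤ) : G.homog p k ≤ G.Fil p :=
  homog_le fun f l hp _ => Fil_le (hp ▸ fdeg_le_lord l) (monomial_mem_Fil f l)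

theorem mem_Fil_of_homog {p : ℕ} {k : ℤ} (hk : k ≠ 0) {a : G.Forms} (ha : a ∈ G.homog p k) :
    a ∈ G.Fil 1 := mem_Fil_one (ord0_homog hk ha)

/-- Pullback preserves bidegrees, and an element of nonzero ghost degree or positive form degree has
no constant term. -/
theorem Hom.map_gen_mem_Fil (φ : Hom G H) (a : H.ι ⊕ H.ι) :
    φ.pullback (H.gen a) ∈ G.Fil (H.lord a) := by
  rcases a with j | j
  · by_cases hj : H.deg j = 0
    · simp only [lord, Sum.elim_inl, hj, if_true]; exact Fil_zero _
    · simp only [lord, Sum.elim_inl, hj, if_false]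
      exact mem_Fil_of_homog hj (φ.map_homog _ _ _ (z_mem_homog j))
  · exact homog_le_Fil _ _ (φ.map_homog _ _ _ (dz_mem_homog j))

theorem Hom.map_Fil (φ : Hom G H) {m : ℕ} {a : H.Forms} (ha : a ∈ H.Fil m) :
    φ.pullback a ∈ G.Fil m := by
  have key : ∀ f (l : List (H.ι ⊕ H.ι)), φ.pullback (H.monomial f l) ∈
      G.Fil (l.map H.lord).sum := by
    intro f l
    induction l with
    | nil => exact Fil_zero _
    | cons a l ih =>
      rw [monomial_cons, map_mul, List.map_cons, List.sum_cons]
      exact Fil_mul (φ.map_gen_mem_Fil a) ih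
  have : H.Fil m ≤ (G.Fil m).comap φ.pullback.toLinearMap :=
    mspan_le fun f l hl => Fil_le hl (key f l)
  exact this ha

theorem Hom.map_functions (φ : Hom G H) {p : ℕ} {a : H.Forms} (ha : a ∈ H.formsOfDegree p) :
    φ.pullback a ∈ G.formsOfDegree p := by
  have : H.formsOfDegree p ≤ (G.formsOfDegree p).comap φ.pullback.toLinearMap :=
    iSup_le fun k a ha => homog_le_formsOfDegree _ _ (φ.map_homog p k a ha)
  exact this ha

theorem Hom.isPar (φ : Hom G H) {p : ℕ} {k : ℤ} {a : H.Forms} (ha : a ∈ H.homog p k) :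
    IsPar (p + k) (φ.pullback a) := isPar_of_mem_homog (φ.map_homog _ _ _ ha)

theorem Hom.isPar_z (φ : Hom G H) (j : H.ι) : IsPar (H.deg j) (φ.pullback (H.z j)) := by
  simpa using φ.isPar (z_mem_homog j)

theorem Hom.isPar_dz (φ : Hom G H) (j : H.ι) : IsPar (H.deg j + 1) (φ.pullback (H.dz j)) := by
  simpa [add_comm] using φ.isPar (dz_mem_homog j)

theorem Hom.map_inv (φ : Hom G H) (a : H.Forms) : φ.pullback (inv a) = inv (φ.pullback a) :=
  algHom_inv (fun f => by simpa using φ.isPar (coeff_mem_homog f)) φ.isPar_z φ.isPar_dz a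

theorem Hom.map_tw (φ : Hom G H) (k : ℤ) (a : H.Forms) :
    φ.pullback (tw k a) = tw k (φ.pullback a) := by
  by_cases h : Even k
  · rw [tw_even h, tw_even h]
  · rw [tw_odd h, tw_odd h, φ.map_inv]

theorem Hom.map_dz (φ : Hom G H) (j : H.ι) : φ.pullback (H.dz j) = G.d (φ.pullback (H.z j)) := by
  rw [← φ.map_d, d_z]

/-- The images of the bidegrees of `H` lie in those of `G`, which are independent. So the
decomposition of `φ.pullback a` has one component only, and injectivity lifts this to `a`. -/
theorem Hom.mem_homog_of_injective (φ : Hom G H) (hφ : Function.Injective φ.pullback) {p : ℕ}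
    {k : ℤ} {a : H.Forms} (ha : φ.pullback a ∈ G.homog p k) : a ∈ H.homog p k := by
  have h := mem_of_iSupIndep (i := (p, k)) (homog_iSupIndep (G := G))
    (W := fun pk : ℕ × ℤ => (H.homog pk.1 pk.2).map φ.pullback.toLinearMap)
    (fun pk => Submodule.map_le_iff_le_comap.2 fun a ha => φ.map_homog _ _ a ha) ha (by
      rw [← Submodule.map_iSup, iSup_homog]
      exact ⟨a, trivial, rfl⟩)
  obtain ⟨b, hb, hab⟩ := h
  rwa [← hφ hab]

/-- The inverse of a morphism whose pullback is bijective. -/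
def Hom.symm (φ : Hom G H) (hφ : Function.Bijective φ.pullback) : Hom H G where
  pullback := (AlgEquiv.ofBijective φ.pullback hφ).symm.toAlgHom
  map_homog p k a ha := by
    apply φ.mem_homog_of_injective hφ.1
    have : φ.pullback ((AlgEquiv.ofBijective φ.pullback hφ).symm a) = a :=
      (AlgEquiv.ofBijective φ.pullback hφ).apply_symm_apply a
    exact this.symm ▸ ha
  map_d a := by
    apply hφ.1
    have : ∀ a, φ.pullback ((AlgEquiv.ofBijective φ.pullback hφ).symm a) = a :=
      (AlgEquiv.ofBijective φ.pullback hφ).apply_symm_apply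
    refine (this _).trans ?_
    rw [φ.map_d]
    exact congrArg _ (this a).symm

theorem Hom.pullback_symm (φ : Hom G H) (hφ : Function.Bijective φ.pullback) (a : G.Forms) :
    φ.pullback ((φ.symm hφ).pullback a) = a :=
  (AlgEquiv.ofBijective φ.pullback hφ).apply_symm_apply a

theorem Hom.symm_pullback (φ : Hom G H) (hφ : Function.Bijective φ.pullback) (a : H.Forms) :
    (φ.symm hφ).pullback (φ.pullback a) = a :=
  (AlgEquiv.ofBijective φ.pullback hφ).symm_apply_apply a

theorem Hom.comp_apply (ψ : Hom H K) (φ : Hom G H) (a : K.Forms) :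
    (ψ.comp φ).pullback a = φ.pullback (ψ.pullback a) := rfl

/-! ### The chain rule -/

/-- The Jacobian matrix of a morphism. -/
def Hom.jac (φ : Hom G H) (i : G.ι) (j : H.ι) : G.Forms := G.pd i (φ.pullback (H.z j))

theorem Hom.jac_mem_homog (φ : Hom G H) (i : G.ι) (j : H.ι) :
    φ.jac i j ∈ G.homog 0 (H.deg j - G.deg i) :=
  pd_mem_homog i (φ.map_homog _ _ _ (z_mem_homog j))

theorem Hom.pdd_map_dz (φ : Hom G H) (i : G.ι) (j : H.ι) :
    G.pdd i (φ.pullback (H.dz j)) = φ.jac i j := by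
  rw [φ.map_dz, pdd_d i (φ.map_functions (z_mem_functions j)), jac]

theorem Hom.map_dz_eq (φ : Hom G H) (j : H.ι) :
    φ.pullback (H.dz j) = ∑ i, G.dz i * φ.jac i j := φ.map_dz j

/-- Both sides are superderivations along the pullback with the same parity: the twist by the degree
of the Jacobian entry converts the parity of `∂/∂(dz^j)` into that of `∂/∂(dz^i)`. On generators
only `dz^j` contributes. -/
theorem Hom.pdd_pullback (φ : Hom G H) (i : G.ι) (a : H.Forms) :
    G.pdd i (φ.pullback a) = ∑ j, φ.jac i j * φ.pullback (H.pdd j a) := by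
  classical
  have h1 : IsDer φ.pullback (G.deg i + 1) (G.pdd i ∘ₗ φ.pullback.toLinearMap) := fun a b => by
    simp [pdd_mul]
  have h2 : IsDer φ.pullback (G.deg i + 1)
      (∑ j, LinearMap.mulLeft ℝ (φ.jac i j) ∘ₗ φ.pullback.toLinearMap ∘ₗ H.pdd j) := by
    intro a b
    simp only [LinearMap.sum_apply, LinearMap.comp_apply, LinearMap.mulLeft_apply,
      AlgHom.toLinearMap_apply, Finset.sum_mul, Finset.mul_sum]
    rw [← Finset.sum_add_distrib]
    refine Finset.sum_congr rfl fun j _ => ?_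
    have hp : IsPar (H.deg j - G.deg i) (φ.jac i j) := by
      simpa using isPar_of_mem_homog (φ.jac_mem_homog i j)
    rw [pdd_mul, map_add, map_mul, map_mul, mul_add, φ.map_tw, ← mul_assoc, ← mul_assoc,
      hp.comm (tw (H.deg j + 1) _), ← tw_add,
      tw_congr (j := H.deg j - G.deg i + (H.deg j + 1)) (k := G.deg i + 1), mul_assoc (tw _ _)]
    rw [show H.deg j - G.deg i + (H.deg j + 1) - (G.deg i + 1) =
      (H.deg j - G.deg i) + (H.deg j - G.deg i) by ring]
    exact Even.add_self _
  have := der_ext h1 h2 (fun f => ?_) (fun j => ?_) (fun j => ?_) a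
  · simpa using this
  · simp [pdd_function i (φ.map_functions (coeff_mem_functions f))]
  · simp [pdd_function i (φ.map_functions (z_mem_functions j)), pdd_z]
  · simp only [LinearMap.sum_apply, LinearMap.comp_apply, LinearMap.mulLeft_apply,
      AlgHom.toLinearMap_apply, pdd_dz]
    rw [Finset.sum_eq_single j]
    · rw [if_pos rfl, map_one, mul_one, φ.pdd_map_dz]
    · intro l _ hl; rw [if_neg hl.symm, map_zero, mul_zero]
    · simp

/-- On functions `∂/∂z^i` is `∂/∂(dz^i)` after `d`, so the rule for forms applies and no Taylor
series has to be differentiated. -/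
theorem Hom.pd_pullback (φ : Hom G H) (i : G.ι) {f : H.Forms} (hf : f ∈ H.functions) :
    G.pd i (φ.pullback f) = ∑ j, φ.jac i j * φ.pullback (H.pd j f) := by
  rw [← pdd_d i (φ.map_functions hf), ← φ.map_d, φ.pdd_pullback]
  exact Finset.sum_congr rfl fun j _ => by rw [pdd_d j hf]

theorem Hom.contract_pullback (φ : Hom G H) (X : G.ι → G.Forms) (a : H.Forms) :
    G.contract X (φ.pullback a) =
      ∑ j, G.contract X (φ.pullback (H.dz j)) * φ.pullback (H.pdd j a) := by
  unfold contract
  simp only [φ.pdd_pullback _ a, φ.pdd_map_dz, Finset.mul_sum, Finset.sum_mul, mul_assoc]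
  exact Finset.sum_comm

/-! ### Morphisms over a relabelling of the coordinates of degree zero -/

/-- The map of bodies underlying `φ` is the relabelling along `r`. -/
def Hom.Over (φ : Hom G H) (r : {j : H.ι // H.deg j = 0} → {i : G.ι // G.deg i = 0})
    (h : ∀ x ∈ G.body, x ∘ r ∈ H.body) : Prop :=
  ∀ f, ord0 (φ.pullback (coeff f)) = SmoothFun.comap r h f

theorem Hom.Over.ord0 {φ : Hom G H} {r : {j : H.ι // H.deg j = 0} → {i : G.ι // G.deg i = 0}}
    {h : ∀ x ∈ G.body, x ∘ r ∈ H.body} (hφ : φ.Over r h) (a : H.Forms) :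
    ord0 (φ.pullback a) = SmoothFun.comap r h (FreeSuper.ord0 a) := by
  have h1 := ord0_eq_zero (φ.map_Fil (sub_ord0_mem_Fil a))
  rw [map_sub, map_sub, hφ, sub_eq_zero] at h1
  exact h1

theorem Hom.Over.sub_mem_Fil {φ : Hom G H}
    {r : {j : H.ι // H.deg j = 0} → {i : G.ι // G.deg i = 0}}
    {h : ∀ x ∈ G.body, x ∘ r ∈ H.body} (hφ : φ.Over r h) (f : SmoothFun H.body) :
    φ.pullback (coeff f) - coeff (SmoothFun.comap r h f) ∈ G.Fil 2 := by
  apply mem_Fil_two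
  · exact sub_mem (φ.map_homog _ _ _ (coeff_mem_homog f)) (coeff_mem_homog _)
  · rw [map_sub, hφ, ord0_coeff, sub_self]

theorem Hom.Over.comp {ψ : Hom H K} {φ : Hom G H}
    {r : {j : H.ι // H.deg j = 0} → {i : G.ι // G.deg i = 0}}
    {h : ∀ x ∈ G.body, x ∘ r ∈ H.body}
    {r' : {j : K.ι // K.deg j = 0} → {i : H.ι // H.deg i = 0}}
    {h' : ∀ x ∈ H.body, x ∘ r' ∈ K.body} (hψ : ψ.Over r' h') (hφ : φ.Over r h) :
    (ψ.comp φ).Over (r ∘ r') (fun x hx => h' _ (h x hx)) := fun f => by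
  rw [Hom.comp_apply, hφ.ord0, hψ.ord0, ord0_coeff, SmoothFun.comap_comap]

theorem Components.exists_over (c : Components G H) (hG : ∀ i, G.deg i ≤ 1) :
    ∃ φ : Hom G H, (∀ j, φ.pullback (H.z j) = c.fn j) ∧ φ.Over c.r c.body := by
  obtain ⟨φ, h1, h2⟩ := c.exists_hom hG
  refine ⟨φ, h1, fun f => ?_⟩
  obtain ⟨K, hK⟩ := h2 f
  rw [hK, map_add, ord0_coeff, map_sum, Finset.sum_eq_zero, add_zero]
  exact fun m _ => ord0_eq_zero (Fil_le (by omega) (c.taylor_mem_Fil (m + 1) f))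

theorem Hom.Over.sub_z_mem {φ : Hom G H}
    {r : {j : H.ι // H.deg j = 0} → {i : G.ι // G.deg i = 0}}
    {h : ∀ x ∈ G.body, x ∘ r ∈ H.body} (hφ : φ.Over r h) (j : {j : H.ι // H.deg j = 0}) :
    φ.pullback (H.z j) - G.z (r j) ∈ G.Fil 2 := by
  have := hφ.sub_mem_Fil (SmoothFun.coord H.body j)
  rwa [SmoothFun.comap_coord, ← z_of_zero j.2, ← z_of_zero (r j).2] at this

/-! ### Unipotent endomorphisms -/

/-- An endomorphism is unipotent if it is the identity to first order. -/
structure Hom.Unipotent (φ : Hom G G) : Prop where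
  coeff_sub : ∀ f, φ.pullback (coeff f) - coeff f ∈ G.Fil 2
  z_sub : ∀ i, φ.pullback (G.z i) - G.z i ∈ G.Fil 2

/-- On generators the difference from the identity gains one order; on products it is distributed as
`(φa - a) φb + a (φb - b)`. -/
theorem Hom.Unipotent.sub_mem {φ : Hom G G} (hφ : φ.Unipotent) {m : ℕ} {a : G.Forms}
    (ha : a ∈ G.Fil m) : φ.pullback a - a ∈ G.Fil (m + 1) := by
  have hgen : ∀ a : G.ι ⊕ G.ι, φ.pullback (G.gen a) - G.gen a ∈ G.Fil (G.lord a + 1) := by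
    intro a
    have hl : G.lord a + 1 ≤ 2 := by
      rcases a with i | i
      · simp only [lord, Sum.elim_inl]; split_ifs <;> omega
      · simp [lord]
    refine Fil_le hl ?_
    rcases a with i | i
    · exact hφ.z_sub i
    · have := d_mem_Fil (hφ.z_sub i)
      rwa [d_sub, ← φ.map_d, d_z] at this
  have key : ∀ f (l : List (G.ι ⊕ G.ι)), φ.pullback (G.monomial f l) - G.monomial f l ∈
      G.Fil ((l.map G.lord).sum + 1) := by
    intro f l
    induction l with
    | nil => rw [monomial_nil]; exact Fil_le (by simp) (hφ.coeff_sub f)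
    | cons a l ih =>
      rw [monomial_cons, map_mul, List.map_cons, List.sum_cons,
        show φ.pullback (G.gen a) * φ.pullback (G.monomial f l) - G.gen a * G.monomial f l =
          (φ.pullback (G.gen a) - G.gen a) * φ.pullback (G.monomial f l) +
          G.gen a * (φ.pullback (G.monomial f l) - G.monomial f l) by
          rw [sub_mul, mul_sub]; abel]
      refine add_mem ?_ ?_
      · exact Fil_mul_le (by omega) (hgen a) (φ.map_Fil (monomial_mem_Fil f l))
      · exact Fil_mul_le (by omega) (gen_mem_Fil a) ih
  have : G.Fil m ≤ (G.Fil (m + 1)).comap (φ.pullback.toLinearMap - LinearMap.id) :=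
    mspan_le fun f l hl => Fil_le (by omega) (key f l)
  exact this ha

/-- The operator `1 - φ` preserves bidegrees and raises the order, so it is nilpotent on each
bidegree and a finite geometric series inverts `φ` there. An element of the kernel has arbitrarily
high order. -/
theorem Hom.Unipotent.bijective {φ : Hom G G} (hφ : φ.Unipotent) (hG : ∀ i, G.deg i ≤ 1) :
    Function.Bijective φ.pullback := by
  constructor
  · refine (injective_iff_map_eq_zero φ.pullback).2 fun a ha => eq_zero_of_mem_Fil hG fun m => ?_
    induction m with
    | zero => exact Fil_zero a
    | succ m ih =>
      have := hφ.sub_mem ih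
      rw [ha, zero_sub] at this
      simpa using Submodule.neg_mem _ this
  · rw [← AlgHom.coe_toLinearMap, ← LinearMap.range_eq_top, eq_top_iff, ← iSup_homog]
    refine iSup_le fun pk a ha => ?_
    let x : Module.End ℝ G.Forms := LinearMap.id - φ.pullback.toLinearMap
    have hx : ∀ m, (x ^ m) a ∈ G.homog pk.1 pk.2 ∧ (x ^ m) a ∈ G.Fil m := by
      intro m
      induction m with
      | zero => exact ⟨ha, Fil_zero _⟩
      | succ m ih =>
        rw [pow_succ', Module.End.mul_apply]
        refine ⟨Submodule.sub_mem _ ih.1 (φ.map_homog _ _ _ ih.1), ?_⟩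
        have := Submodule.neg_mem _ (hφ.sub_mem ih.2)
        rwa [neg_sub] at this
    obtain ⟨m, hm⟩ := exists_filHomog_eq_bot hG {pk}
    have h0 : (x ^ m) a = 0 := by
      have := mem_filHomog (hx m).1 (hx m).2
      rw [hm pk (by simp) m le_rfl] at this
      simpa using this
    have h1 := LinearMap.congr_fun (mul_neg_geom_sum x m) a
    rw [LinearMap.sub_apply, h0, sub_zero] at h1
    refine ⟨(∑ i ∈ Finset.range m, x ^ i) a, ?_⟩
    have h2 : (1 - x : Module.End ℝ G.Forms) = φ.pullback.toLinearMap := by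
      simp only [x]; ext; simp
    rw [h2] at h1
    exact h1

theorem Hom.Over.unipotent {φ : Hom G G} {h : ∀ x ∈ G.body, x ∘ id ∈ G.body} (hφ : φ.Over id h)
    (hz : ∀ i, G.deg i ≠ 0 → φ.pullback (G.z i) - G.z i ∈ G.Fil 2) : φ.Unipotent where
  coeff_sub f := by simpa [SmoothFun.comap_id] using hφ.sub_mem_Fil f
  z_sub i := by
    by_cases hi : G.deg i = 0
    · exact hφ.sub_z_mem ⟨i, hi⟩
    · exact hz i hi

end GradedDomain

namespace GradedDomain

open FreeSuper

variable {M N : GradedDomain}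

/-! ### Submersions -/

/-- The matrix of leading terms of the Jacobian. -/
def Hom.lead (φ : Hom M N) : Matrix N.ι M.ι (SmoothFun M.body) :=
  Matrix.of fun j i => ord0 (φ.jac i j)

theorem Hom.lead_eq_zero (φ : Hom M N) {j : N.ι} {i : M.ι} (h : N.deg j ≠ M.deg i) :
    φ.lead j i = 0 :=
  ord0_homog (sub_ne_zero.2 h) (φ.jac_mem_homog i j)

/-- The leading Jacobian is block diagonal with respect to the degree. The blocks of a pointwise
right inverse that do not preserve the degree can therefore be discarded, which is needed for `B` to
define morphisms and vector fields of the correct degrees. -/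
theorem Hom.exists_right_inverse (φ : Hom M N)
    (h : ∀ (x : M.body) (c : N.ι → ℝ), (∀ i, ∑ j, c j * φ.lead j i x = 0) → c = 0) :
    ∃ B : Matrix M.ι N.ι (SmoothFun M.body), (∀ i j, M.deg i ≠ N.deg j → B i j = 0) ∧
      ∀ j l, ∑ i, φ.lead j i * B i l = open Classical in if j = l then 1 else 0 := by
  classical
  obtain ⟨B, hB⟩ := SmoothFun.exists_right_inverse φ.lead h
  refine ⟨Matrix.of fun i j => if M.deg i = N.deg j then B i j else 0,
    fun i j hij => by simp [hij], fun j l => ?_⟩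
  have hjl := congrFun (congrFun hB j) l
  rw [Matrix.mul_apply, Matrix.one_apply] at hjl
  by_cases hd : N.deg j = N.deg l
  · rw [← hjl]
    refine Finset.sum_congr rfl fun i _ => ?_
    rw [Matrix.of_apply]
    split_ifs with hi
    · rfl
    · rw [φ.lead_eq_zero (by rw [hd]; exact fun h => hi h.symm), zero_mul, zero_mul]
  · rw [if_neg (fun h => hd (by rw [h]))]
    refine Finset.sum_eq_zero fun i _ => ?_
    rw [Matrix.of_apply]
    split_ifs with hi
    · rw [φ.lead_eq_zero (by rw [hi]; exact hd), zero_mul]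
    · rw [mul_zero]

/-- A morphism whose leading Jacobian has a right inverse has a section up to a unipotent
endomorphism. -/
theorem Hom.exists_unipotent_section (hN : ∀ j, N.deg j ≤ 1) (φ : Hom M N)
    (e : {j : N.ι // N.deg j = 0} ≃ {i : M.ι // M.deg i = 0})
    (h : ∀ x ∈ M.body, x ∘ e ∈ N.body) (h' : ∀ x ∈ N.body, x ∘ e.symm ∈ M.body)
    (hφ : φ.Over e h) {B : Matrix M.ι N.ι (SmoothFun M.body)}
    (hB : ∀ i j, M.deg i ≠ N.deg j → B i j = 0)
    (hAB : ∀ j l, ∑ i, φ.lead j i * B i l = open Classical in if j = l then 1 else 0) :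
    ∃ σ : Hom N M, σ.Over e.symm h' ∧ (φ.comp σ).Unipotent := by
  classical
  let R := SmoothFun.comap e.symm h'
  -- The candidate section relabels the coordinates of degree zero and is linear with matrix `B` in
  -- the others. The composite with `φ` then has linear part `lead · B = 1`.
  let c : Components N M :=
    { r := e.symm
      body := h'
      fn := fun i => if hi : M.deg i = 0 then N.z (e.symm ⟨i, hi⟩) else
        ∑ j, N.z j * coeff (R (B i j))
      mem := fun i => by
        split_ifs with hi
        · have := z_mem_homog (G := N) (e.symm ⟨i, hi⟩).1
          rw [(e.symm ⟨i, hi⟩).2] at this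
          rwa [hi]
        · refine sum_mem fun j _ => ?_
          by_cases hij : M.deg i = N.deg j
          · rw [hij]; simpa using homog_mul (z_mem_homog j) (coeff_mem_homog (R (B i j)))
          · rw [hB i j hij, map_zero, coeff_zero, mul_zero]; exact zero_mem _
      sub_mem := fun i => by
        rw [dif_pos i.2, sub_self]; exact zero_mem _ }
  obtain ⟨σ, hσz, hσ⟩ := c.exists_over hN
  refine ⟨σ, hσ, ?_⟩
  have hov : (φ.comp σ).Over id (fun x hx => hx) := fun f => by
    rw [hφ.comp hσ f]
    congr 2
    funext j
    exact e.symm_apply_apply j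
  refine hov.unipotent fun j hj => ?_
  have h0 : ord0 (φ.pullback (N.z j)) = 0 := ord0_homog hj (φ.map_homog _ _ _ (z_mem_homog j))
  have h1 := σ.map_Fil (lead_mem_Fil (φ.map_functions (z_mem_functions j)))
  rw [h0, coeff_zero, sub_zero, map_sub, map_sum] at h1
  have h2 : (∑ i, σ.pullback (if M.deg i = 0 then 0 else
      M.z i * coeff (ord0 (M.pd i (φ.pullback (N.z j)))))) - N.z j ∈ N.Fil 2 := by
    have h3 : N.z j = ∑ i, ∑ l, N.z l * coeff (R (B i l) * R (φ.lead j i)) := by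
      rw [Finset.sum_comm]
      simp only [← Finset.mul_sum, ← coeff_sum, ← map_mul, ← map_sum]
      have : ∀ l, ∑ i, B i l * φ.lead j i = if j = l then 1 else 0 := fun l => by
        rw [← hAB j l]
        exact Finset.sum_congr rfl fun i _ => mul_comm _ _
      simp only [this]
      rw [Finset.sum_eq_single j]
      · rw [if_pos rfl, map_one, coeff_one, mul_one]
      · intro l _ hl; rw [if_neg hl.symm, map_zero, coeff_zero, mul_zero]
      · simp
    have h3' : ∀ a, a - N.z j = a - ∑ i, ∑ l, N.z l * coeff (R (B i l) * R (φ.lead j i)) :=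
      fun a => by rw [← h3]
    rw [h3', ← Finset.sum_sub_distrib]
    refine sum_mem fun i _ => ?_
    split_ifs with hi
    · have : φ.lead j i = 0 := φ.lead_eq_zero (by rw [hi]; exact hj)
      simp only [this, map_zero, mul_zero, coeff_zero, Finset.sum_const_zero, sub_zero]
      exact zero_mem _
    · rw [map_mul, hσz]
      simp only [c, dif_neg hi]
      rw [Finset.sum_mul, ← Finset.sum_sub_distrib]
      refine sum_mem fun l _ => ?_
      by_cases hil : M.deg i = N.deg l
      · have := Fil_mul_left (N.z l * coeff (R (B i l))) (hσ.sub_mem_Fil (φ.lead j i))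
        rwa [mul_sub, mul_assoc (N.z l) _ (coeff _), ← coeff_mul] at this
      · rw [hB i l hil]
        simp only [map_zero, zero_mul, coeff_zero, mul_zero, sub_zero]
        exact zero_mem _
  have h4 := add_mem h1 h2
  rwa [sub_add_sub_cancel] at h4

/-- Vector fields dual to the components of a morphism. -/
theorem Hom.exists_dual (hM : ∀ i, M.deg i ≤ 1) (φ : Hom M N)
    {B : Matrix M.ι N.ι (SmoothFun M.body)} (hB : ∀ i j, M.deg i ≠ N.deg j → B i j = 0)
    (hAB : ∀ j l, ∑ i, φ.lead j i * B i l = open Classical in if j = l then 1 else 0) :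
    ∃ W : N.ι → M.ι → M.Forms, (∀ l i, W l i ∈ M.homog 0 (M.deg i - N.deg l)) ∧
      ∀ l j, ∑ i, W l i * φ.jac i j = open Classical in if l = j then 1 else 0 := by
  classical
  let J : Matrix M.ι N.ι M.Forms := Matrix.of φ.jac
  let B0 : Matrix N.ι M.ι M.Forms := Matrix.of fun l i => coeff (B i l)
  -- `B0` inverts `J` to leading order, so `x` has entries of positive order and of fixed degrees.
  -- It is nilpotent, and `(∑ x^k) B0` is an exact left inverse of `J`.
  let x : Matrix N.ι N.ι M.Forms := 1 - B0 * J
  have hB0 : ∀ l i, B0 l i ∈ M.homog 0 (M.deg i - N.deg l) := by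
    intro l i
    by_cases h : M.deg i = N.deg l
    · rw [h, sub_self]; exact coeff_mem_homog _
    · simp only [B0, Matrix.of_apply, hB i l h, coeff_zero]; exact zero_mem _
  have hmul : ∀ {a b c : ℤ} {u v : M.Forms}, u ∈ M.homog 0 (b - a) → v ∈ M.homog 0 (c - b) →
      u * v ∈ M.homog 0 (c - a) := by
    intro a b c u v hu hv
    have := homog_mul hu hv
    rwa [show b - a + (c - b) = c - a by ring] at this
  have h1 : ∀ l j, (1 : Matrix N.ι N.ι M.Forms) l j ∈ M.homog 0 (N.deg j - N.deg l) := by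
    intro l j
    rw [Matrix.one_apply]
    split_ifs with h
    · rw [h, sub_self]; exact one_mem_homog
    · exact zero_mem _
  have hx : ∀ l j, x l j ∈ M.homog 0 (N.deg j - N.deg l) := by
    intro l j
    refine sub_mem (h1 l j) ?_
    rw [Matrix.mul_apply]
    exact sum_mem fun i _ => hmul (hB0 l i) (φ.jac_mem_homog i j)
  have hx1 : ∀ l j, x l j ∈ M.Fil 1 := by
    intro l j
    apply mem_Fil_one
    simp only [x, Matrix.sub_apply, Matrix.mul_apply, map_sub, map_sum, map_mul]
    have h2 : ∑ i, ord0 (B0 l i) * ord0 (J i j) = if j = l then 1 else 0 := by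
      rw [← hAB j l]
      refine Finset.sum_congr rfl fun i _ => ?_
      simp only [B0, J, Matrix.of_apply, ord0_coeff, Hom.lead]
      exact mul_comm _ _
    rw [h2, Matrix.one_apply]
    by_cases h : l = j
    · rw [if_pos h, if_pos h.symm, map_one, sub_self]
    · rw [if_neg h, if_neg (Ne.symm h), map_zero, sub_zero]
  have hpow : ∀ m l j, (x ^ m) l j ∈ M.homog 0 (N.deg j - N.deg l) ∧ (x ^ m) l j ∈ M.Fil m := by
    intro m
    induction m with
    | zero => exact fun l j => ⟨by rw [pow_zero]; exact h1 l j, Fil_zero _⟩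
    | succ m ih =>
      intro l j
      rw [pow_succ, Matrix.mul_apply]
      exact ⟨sum_mem fun i _ => hmul (ih l i).1 (hx i j),
        sum_mem fun i _ => Fil_mul (ih l i).2 (hx1 i j)⟩
  obtain ⟨m, hm⟩ := exists_filHomog_eq_bot hM
    ((Finset.univ : Finset (N.ι × N.ι)).image fun p => (0, N.deg p.2 - N.deg p.1))
  have hx0 : x ^ m = 0 := by
    ext l j
    have := mem_filHomog (hpow m l j).1 (hpow m l j).2
    rw [hm (0, N.deg j - N.deg l) (Finset.mem_image.2 ⟨(l, j), by simp, rfl⟩) m le_rfl] at this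
    simpa using this
  refine ⟨(∑ k ∈ Finset.range m, x ^ k) * B0, fun l i => ?_, fun l j => ?_⟩
  · rw [Matrix.mul_apply]
    refine sum_mem fun j _ => hmul (b := N.deg j) ?_ (hB0 j i)
    rw [Matrix.sum_apply]
    exact sum_mem fun k _ => (hpow k l j).1
  · have h2 : ((∑ k ∈ Finset.range m, x ^ k) * B0) * J = 1 := by
      rw [Matrix.mul_assoc, show B0 * J = 1 - x by simp only [x, sub_sub_cancel],
        geom_sum_mul_neg, hx0, sub_zero]
    have := congrFun (congrFun h2 l) j
    rw [Matrix.mul_apply, Matrix.one_apply] at this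
    exact this

/-- Functions on the source of a submersion whose differential is a combination of the
differentials of the components, and that vanish on a section, vanish. -/
theorem Hom.mem_Fil_of_basic (φ : Hom M N) (s : Hom N M)
    (hs : ∀ a, s.pullback (φ.pullback a) = a)
    (hord : ∀ a, s.pullback a = 0 → FreeSuper.ord0 a = 0)
    {W : N.ι → M.ι → M.Forms} (hW : ∀ l i, W l i ∈ M.homog 0 (M.deg i - N.deg l))
    (hWJ : ∀ l j, ∑ i, W l i * φ.jac i j = open Classical in if l = j then 1 else 0) (m : ℕ) :
    ∀ f ∈ M.functions, ∀ g : N.ι → M.Forms, (∀ j, g j ∈ M.functions) →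
      M.d f = ∑ j, φ.pullback (N.dz j) * g j → s.pullback f = 0 → f ∈ M.Fil m := by
  classical
  induction m with
  | zero => exact fun f _ _ _ _ _ => Fil_zero f
  | succ m ih =>
    intro f hf g hg hdf hsf
    have hcW : ∀ l j, M.contract (W l) (φ.pullback (N.dz j)) = if l = j then 1 else 0 := by
      intro l j
      rw [← hWJ l j]
      exact Finset.sum_congr rfl fun i _ => by rw [φ.pdd_map_dz]
    -- the components of `df` vanish on the section
    have hsg : ∀ j, s.pullback (g j) = 0 := by
      intro j
      have h := s.map_d f
      rw [hsf, d_zero, hdf, map_sum] at h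
      simp only [map_mul, hs] at h
      rw [← pdd_sum_dz j (g := fun j => s.pullback (g j)) fun j => s.map_functions (hg j), h,
        map_zero]
    -- the vector fields annihilating the components
    let X : M.ι → M.ι → M.Forms := fun i k =>
      (if k = i then 1 else 0) - ∑ l, φ.jac i l * W l k
    have hXh : ∀ i k, X i k ∈ M.homog 0 (M.deg k - M.deg i) := by
      intro i k
      refine sub_mem ?_ (sum_mem fun l _ => ?_)
      · split_ifs with h
        · rw [h, sub_self]; exact one_mem_homog
        · exact zero_mem _
      · have := homog_mul (φ.jac_mem_homog i l) (hW l k)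
        rwa [show N.deg l - M.deg i + (M.deg k - N.deg l) = M.deg k - M.deg i by ring] at this
    have hXc : ∀ i a, M.contract (X i) a = M.pdd i a - ∑ l, φ.jac i l * M.contract (W l) a := by
      intro i a
      simp only [contract, X, sub_mul, ite_mul, one_mul, zero_mul, Finset.sum_sub_distrib,
        Finset.sum_ite_eq', Finset.mem_univ, if_true, Finset.sum_mul, Finset.mul_sum, mul_assoc]
      rw [Finset.sum_comm]
    have hXφ : ∀ i j, M.contract (X i) (φ.pullback (N.dz j)) = 0 := by
      intro i j
      rw [hXc, φ.pdd_map_dz]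
      simp only [hcW, mul_ite, mul_one, mul_zero, Finset.sum_ite_eq', Finset.mem_univ, if_true,
        sub_self]
    have hXp : ∀ i k, IsPar (M.deg k + -M.deg i) (X i k) := by
      intro i k
      simpa [sub_eq_add_neg] using isPar_of_mem_homog (hXh i k)
    have hXf : ∀ i j, M.contract (X i) (M.d (g j)) ∈ M.functions := by
      intro i j
      rw [contract_d _ (hg j)]
      exact apply_mem_functions (fun k => homog_le_formsOfDegree _ _ (hXh i k)) (hg j)
    have hddf : ∑ j, sg (N.deg j + 1) • (φ.pullback (N.dz j) * M.d (g j)) = 0 := by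
      have h := d_d f
      rw [hdf, d_sum] at h
      rw [← h]
      refine Finset.sum_congr rfl fun j _ => ?_
      rw [d_mul, ← φ.map_d, d_dz, map_zero, zero_mul, zero_add, (φ.isPar_dz j : inv _ = _),
        smul_mul_assoc]
    -- Contract `d(df) = 0` with the vertical field `X i` and then with the dual field `W j`:
    -- verticality removes the derivatives of the components, and duality isolates the index `j`.
    have hX0 : ∀ i j, M.contract (X i) (M.d (g j)) = 0 := by
      intro i j
      have h := congrArg (M.contract (W j)) (congrArg (M.contract (X i)) hddf)
      rw [contract_zero, contract_zero, contract_sum, contract_sum, Finset.sum_eq_single j] at h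
      · rw [contract_smul, contract_smul, contract_mul (hXp i), hXφ, zero_mul, zero_add,
          IsPar.tw (φ.isPar_dz j), smul_mul_assoc, contract_smul,
          contract_mul_function _ _ (hXf i j), hcW, if_pos rfl, one_mul, smul_smul] at h
        exact (smul_eq_zero.1 h).resolve_left (mul_ne_zero (sg_ne_zero _) (sg_ne_zero _))
      · intro l _ hl
        rw [contract_smul, contract_smul, contract_mul (hXp i), hXφ, zero_mul, zero_add,
          IsPar.tw (φ.isPar_dz l), smul_mul_assoc, contract_smul,
          contract_mul_function _ _ (hXf i l), hcW, if_neg hl.symm, zero_mul, smul_zero,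
          smul_zero]
      · simp
    have hWg : ∀ l j, M.contract (W l) (M.d (g j)) ∈ M.functions := by
      intro l j
      rw [contract_d _ (hg j)]
      exact apply_mem_functions (fun k => homog_le_formsOfDegree _ _ (hW l k)) (hg j)
    -- Thus each `g j` satisfies the hypotheses imposed on `f`: its differential is a combination of
    -- the same differentials, and it vanishes on the section. The induction applies to it.
    have hdg : ∀ j, M.d (g j) = ∑ l, φ.pullback (N.dz l) * M.contract (W l) (M.d (g j)) := by
      intro j
      have h : ∀ i, M.pd i (g j) = ∑ l, φ.jac i l * M.contract (W l) (M.d (g j)) := by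
        intro i
        have := hX0 i j
        rwa [hXc, pdd_d i (hg j), sub_eq_zero] at this
      conv_lhs => rw [d]
      simp only [h, φ.map_dz_eq, Finset.mul_sum, Finset.sum_mul, mul_assoc]
      exact Finset.sum_comm
    refine mem_Fil_succ hf (hord f hsf) fun i => ?_
    rw [← pdd_d i hf, hdf, map_sum]
    refine sum_mem fun j _ => ?_
    rw [pdd_mul_function _ _ (hg j)]
    exact Fil_mul_left _ (ih (g j) (hg j) _ (fun l => hWg l j) (hdg j) (hsg j))

/-- A morphism is a submersion with connected fibres near the bodies: it has a section, and the
functions that are annihilated by the vertical vector fields come from the base. -/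
theorem Hom.exists_section (hM : ∀ i, M.deg i ≤ 1) (hN : ∀ j, N.deg j ≤ 1) (φ : Hom M N)
    (e : {j : N.ι // N.deg j = 0} ≃ {i : M.ι // M.deg i = 0})
    (h : ∀ x ∈ M.body, x ∘ e ∈ N.body) (h' : ∀ x ∈ N.body, x ∘ e.symm ∈ M.body)
    (hφ : φ.Over e h)
    (hA : ∀ (x : M.body) (c : N.ι → ℝ), (∀ i, ∑ j, c j * φ.lead j i x = 0) → c = 0) :
    ∃ s : Hom N M, (∀ a, s.pullback (φ.pullback a) = a) ∧
      (∀ g : N.ι → M.Forms, (∀ j, g j ∈ M.functions) →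
        ∑ j, φ.pullback (N.dz j) * g j = 0 → ∀ j, g j = 0) ∧
      ∀ f ∈ M.functions, (∀ X ∈ M.vectorFields, (∀ j, M.contract X (φ.pullback (N.dz j)) = 0) →
        M.apply X f = 0) → φ.pullback (s.pullback f) = f := by
  classical
  obtain ⟨B, hB, hAB⟩ := φ.exists_right_inverse hA
  obtain ⟨σ, hσ, hU⟩ := φ.exists_unipotent_section hN e h h' hφ hB hAB
  obtain ⟨W, hW, hWJ⟩ := φ.exists_dual hM hB hAB
  have hb := hU.bijective hN
  -- An approximate section becomes exact after composition with the inverse of the unipotent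
  -- endomorphism `φ ∘ σ`.
  let s : Hom N M := σ.comp ((φ.comp σ).symm hb)
  have hs : ∀ a, s.pullback (φ.pullback a) = a := fun a => (φ.comp σ).symm_pullback hb a
  -- The section covers the identification of the bodies, so a function that vanishes on it has no
  -- part of order zero.
  have hord : ∀ a, s.pullback a = 0 → ord0 a = 0 := by
    intro a ha
    have h1 : σ.pullback a = 0 := by
      rw [← (φ.comp σ).pullback_symm hb (σ.pullback a)]
      change (φ.comp σ).pullback (s.pullback a) = 0
      rw [ha, map_zero]
    have h2 := hσ.ord0 a
    rw [h1, map_zero] at h2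
    rw [SmoothFun.ext_iff']
    intro x
    have h3 := SmoothFun.ext_iff'.1 h2 ⟨_, h x x.2⟩
    rw [SmoothFun.comap_apply] at h3
    rw [SmoothFun.zero_apply] at h3 ⊢
    rw [h3]
    congr 1
    apply Subtype.ext
    funext i
    simp
  have hWv : ∀ l, W l ∈ M.vectorFields := fun l k => homog_le_formsOfDegree _ _ (hW l k)
  have hcW : ∀ l j, M.contract (W l) (φ.pullback (N.dz j)) = if l = j then 1 else 0 := by
    intro l j
    rw [← hWJ l j]
    exact Finset.sum_congr rfl fun i _ => by rw [φ.pdd_map_dz]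
  refine ⟨s, hs, fun g hg h0 j => ?_, fun f hf hX => ?_⟩
  · rw [← contract_zero (W j), ← h0, contract_sum, Finset.sum_eq_single j]
    · rw [contract_mul_function _ _ (hg j), hcW, if_pos rfl, one_mul]
    · intro l _ hl; rw [contract_mul_function _ _ (hg l), hcW, if_neg hl.symm, zero_mul]
    · simp
  -- Subtracting from `∂/∂z^i` its projection along the dual fields leaves a vertical field, which
  -- annihilates `f`.
  have hpd : ∀ i, M.pd i f = ∑ l, φ.jac i l * M.apply (W l) f := by
    intro i
    let X : M.ι → M.Forms := fun k => (if k = i then 1 else 0) - ∑ l, φ.jac i l * W l k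
    have hXv : X ∈ M.vectorFields := by
      intro k
      refine sub_mem ?_ (sum_mem fun l _ => functions_mul
        (homog_le_formsOfDegree _ _ (φ.jac_mem_homog i l)) (hWv l k))
      split_ifs
      · exact one_mem_functions
      · exact zero_mem _
    have hXc : ∀ a, M.contract X a = M.pdd i a - ∑ l, φ.jac i l * M.contract (W l) a := by
      intro a
      simp only [contract, X, sub_mul, ite_mul, one_mul, zero_mul, Finset.sum_sub_distrib,
        Finset.sum_ite_eq', Finset.mem_univ, if_true, Finset.sum_mul, Finset.mul_sum, mul_assoc]
      rw [Finset.sum_comm]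
    have h1 := hX X hXv fun j => by
      rw [hXc, φ.pdd_map_dz]
      simp only [hcW, mul_ite, mul_one, mul_zero, Finset.sum_ite_eq', Finset.mem_univ, if_true,
        sub_self]
    rw [← contract_d _ hf, hXc, pdd_d i hf, sub_eq_zero] at h1
    rw [h1]
    exact Finset.sum_congr rfl fun l _ => by rw [contract_d _ hf]
  have hsf := s.map_functions hf
  have hpf := φ.map_functions hsf
  have hd : M.d (f - φ.pullback (s.pullback f)) = ∑ j, φ.pullback (N.dz j) *
      (M.apply (W j) f - φ.pullback (N.pd j (s.pullback f))) := by
    simp only [mul_sub, Finset.sum_sub_distrib]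
    rw [d_sub]
    congr 1
    · conv_lhs => rw [d]
      simp only [hpd, φ.map_dz_eq, Finset.mul_sum, Finset.sum_mul, mul_assoc]
      exact Finset.sum_comm
    · rw [← φ.map_d]
      conv_lhs => rw [d]
      rw [map_sum]
      simp only [map_mul]
  -- The difference of `f` and the pullback of its restriction to the section vanishes on the
  -- section and has a basic differential, hence is of every order.
  refine (sub_eq_zero.1 (eq_zero_of_mem_Fil hM fun m => ?_)).symm
  refine φ.mem_Fil_of_basic s hs hord hW hWJ m _ (sub_mem hf hpf) _ (fun j => ?_) hd ?_
  · exact sub_mem (apply_mem_functions (hWv j) hf)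
      (φ.map_functions (pd_mem_formsOfDegree j hsf))
  · rw [map_sub, hs, sub_self]

/-- A submersion between graded domains of the same dimension is an isomorphism. -/
theorem Hom.bijective_of_card (hM : ∀ i, M.deg i ≤ 1) (hN : ∀ j, N.deg j ≤ 1) (φ : Hom M N)
    (e : {j : N.ι // N.deg j = 0} ≃ {i : M.ι // M.deg i = 0})
    (h : ∀ x ∈ M.body, x ∘ e ∈ N.body) (h' : ∀ x ∈ N.body, x ∘ e.symm ∈ M.body)
    (hφ : φ.Over e h)
    (hA : ∀ (x : M.body) (c : N.ι → ℝ), (∀ i, ∑ j, c j * φ.lead j i x = 0) → c = 0)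
    (hcard : Fintype.card M.ι = Fintype.card N.ι) : Function.Bijective φ.pullback := by
  classical
  obtain ⟨s, hs, -, hs'⟩ := φ.exists_section hM hN e h h' hφ hA
  refine ⟨fun a b hab => by rw [← hs a, hab, hs], ?_⟩
  obtain ⟨B, hB, hAB⟩ := φ.exists_right_inverse hA
  -- For equal dimensions the right inverse of the leading Jacobian is also a left inverse.
  have hBA : B * φ.lead = 1 := by
    rw [← Matrix.mul_eq_one_comm_of_card_eq (A := φ.lead) (B := B) (eq := hcard.symm)]
    ext1 j l
    rw [Matrix.mul_apply, Matrix.one_apply]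
    exact hAB j l
  have hX0 : ∀ X : M.ι → M.Forms, (∀ j, M.contract X (φ.pullback (N.dz j)) = 0) → X = 0 := by
    intro X hX
    -- A vertical field vanishes: applying `B` to `∑ X_i J_{ij} = 0` writes `X_k` as a combination
    -- of the `X_i` with coefficients of positive order, so the order of the components can be
    -- raised indefinitely.
    have key : ∀ m k, X k ∈ M.Fil m := by
      intro m
      induction m with
      | zero => exact fun k => Fil_zero _
      | succ m ih =>
        intro k
        have h1 : ∀ j, ∑ i, X i * φ.jac i j = 0 := fun j => by
          rw [← hX j]
          exact Finset.sum_congr rfl fun i _ => by rw [φ.pdd_map_dz]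
        have h2 : ∑ j, (∑ i, X i * φ.jac i j) * coeff (B k j) = 0 :=
          Finset.sum_eq_zero fun j _ => by rw [h1, zero_mul]
        simp only [Finset.sum_mul, mul_assoc] at h2
        rw [Finset.sum_comm] at h2
        simp only [← Finset.mul_sum] at h2
        have h3 : X k = ∑ i, X i * coeff (if k = i then 1 else 0) := by
          rw [Finset.sum_eq_single k]
          · simp
          · intro i _ hi; rw [if_neg hi.symm, coeff_zero, mul_zero]
          · simp
        rw [← sub_zero (X k), ← h2]
        nth_rewrite 1 [h3]
        rw [← Finset.sum_sub_distrib]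
        refine sum_mem fun i _ => ?_
        rw [← mul_sub]
        refine Fil_mul (ih i) (mem_Fil_one ?_)
        rw [map_sub, ord0_coeff, map_sum]
        have := congrFun (congrFun hBA k) i
        rw [Matrix.mul_apply, Matrix.one_apply] at this
        rw [← this, sub_eq_zero]
        refine Finset.sum_congr rfl fun j _ => ?_
        rw [map_mul, ord0_coeff, mul_comm]
        rfl
    funext k
    exact eq_zero_of_mem_Fil hM fun m => key m k
  have hfun : ∀ f ∈ M.functions, φ.pullback (s.pullback f) = f := fun f hf =>
    hs' f hf fun X _ hX => by
      rw [hX0 X hX]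
      exact Finset.sum_eq_zero fun i _ => by rw [Pi.zero_apply, zero_mul]
  have hall : φ.pullback.comp s.pullback = AlgHom.id ℝ _ := by
    refine forms_algHom_ext (fun f => hfun _ (coeff_mem_functions f))
      (fun i => hfun _ (z_mem_functions i)) fun i => ?_
    have := congrArg M.d (hfun _ (z_mem_functions i))
    rw [← φ.map_d, ← s.map_d, d_z] at this
    exact this
  exact fun a => ⟨s.pullback a, DFunLike.congr_fun hall a⟩

end GradedDomain

namespace GradedDomain

open FreeSuper

variable {G H : GradedDomain}

/-! ### One-forms -/

/-- For `p = 0` the truncated subtraction is harmless, because `pdd` annihilates functions. -/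
theorem pdd_mem_homog (i : G.ι) {p : ℕ} {k : ℤ} {a : G.Forms} (ha : a ∈ G.homog p k) :
    G.pdd i a ∈ G.homog (p - 1) (k - G.deg i) := by
  classical
  refine homog_le (S := (G.homog (p - 1) (k - G.deg i)).comap (G.pdd i)) (fun f l hp hk => ?_) ha
  rw [Submodule.mem_comap]
  subst hp hk
  clear ha
  induction l with
  | nil => rw [monomial_nil, pdd_coeff]; exact zero_mem _
  | cons a l ih =>
    have hm := monomial_mem f l
    rw [monomial_cons, pdd_mul]
    refine add_mem ?_ ?_
    · rcases a with j | j
      · simp [gen, pdd_z]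
      · simp only [gen, Sum.elim_inr, pdd_dz]
        split_ifs with h
        · subst h
          rw [one_mul]
          simpa [fdeg, ldeg] using hm
        · simp
    · rcases Nat.eq_zero_or_pos (l.map G.fdeg).sum with h0 | h0
      · rw [h0] at hm
        rw [pdd_function i (homog_le_formsOfDegree _ _ hm), mul_zero]
        exact zero_mem _
      · have := homog_mul (tw_mem_homog (gen_mem_homog a) (G.deg i + 1)) ih
        rw [List.map_cons, List.sum_cons, List.map_cons, List.sum_cons, add_sub_assoc,
          Nat.add_sub_assoc h0]
        exact this

theorem pdd_mem_functions (i : G.ι) {a : G.Forms} (ha : a ∈ G.formsOfDegree 1) :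
    G.pdd i a ∈ G.functions := by
  have : G.formsOfDegree 1 ≤ G.functions.comap (G.pdd i) :=
    iSup_le fun k a ha => by
      have h := pdd_mem_homog i ha
      rw [Nat.sub_self] at h
      exact homog_le_formsOfDegree _ _ h
  exact this ha

/-- Euler's identity for the operator that counts the differentials; one-forms have eigenvalue one.
-/
theorem oneForm_eq {a : G.Forms} (ha : a ∈ G.formsOfDegree 1) :
    a = ∑ i, G.dz i * G.pdd i a := by
  let w : G.ι ⊕ G.ι → ℝ := fun a => (G.fdeg a : ℝ)
  have h1 : ∀ l : List (G.ι ⊕ G.ι), (l.map w).sum = ((l.map G.fdeg).sum : ℕ) := by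
    intro l
    induction l with
    | nil => simp
    | cons a l ih => simp only [List.map_cons, List.sum_cons, ih, w]; push_cast; rfl
  have h2 : G.formsOfDegree 1 ≤ LinearMap.ker (euler w - LinearMap.id) := by
    refine iSup_le fun k => homog_le fun f l hp _ => ?_
    rw [LinearMap.mem_ker, LinearMap.sub_apply, LinearMap.id_apply,
      euler_monomial w (fun i _ => by simp [w, fdeg]), h1, hp, Nat.cast_one, one_smul, sub_self]
  have h3 := h2 ha
  rw [LinearMap.mem_ker, LinearMap.sub_apply, LinearMap.id_apply, sub_eq_zero, euler_apply] at h3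
  conv_lhs => rw [← h3]
  exact Finset.sum_congr rfl fun i _ => by simp [w, fdeg]

theorem oneForm_ext {a b : G.Forms} (ha : a ∈ G.formsOfDegree 1) (hb : b ∈ G.formsOfDegree 1)
    (h : ∀ i, G.pdd i a = G.pdd i b) : a = b := by
  rw [oneForm_eq ha, oneForm_eq hb]
  exact Finset.sum_congr rfl fun i _ => by rw [h]

/-! ### The shifted cotangent bundle -/

variable (L : GradedDomain)

/-- The label of a coordinate. -/
def q (i : L.ι) : L.shiftedCotangent.ι := Sum.inl i

/-- The label of a conjugate coordinate. -/
def qs (i : L.ι) : L.shiftedCotangent.ι := Sum.inr i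

theorem deg_q (i : L.ι) : L.shiftedCotangent.deg (L.q i) = L.deg i := rfl
theorem deg_qs (i : L.ι) : L.shiftedCotangent.deg (L.qs i) = -1 - L.deg i := rfl

theorem sum_shiftedCotangent {B : Type*} [AddCommMonoid B] (f : L.shiftedCotangent.ι → B) :
    ∑ j, f j = ∑ i, f (L.q i) + ∑ i, f (L.qs i) := Fintype.sum_sum_type f

theorem forall_shiftedCotangent {P : L.shiftedCotangent.ι → Prop} :
    (∀ j, P j) ↔ (∀ i, P (L.q i)) ∧ ∀ i, P (L.qs i) := Sum.forall

theorem canonicalForm_eq : L.canonicalForm =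
    ∑ i : L.ι, L.shiftedCotangent.dz (L.q i) * L.shiftedCotangent.dz (L.qs i) := rfl

theorem q_inj (i j : L.ι) : L.q i = L.q j ↔ i = j := Sum.inl_injective.eq_iff
theorem qs_inj (i j : L.ι) : L.qs i = L.qs j ↔ i = j := Sum.inr_injective.eq_iff
theorem q_ne_qs (i j : L.ι) : L.q i ≠ L.qs j := Sum.inl_ne_inr
theorem qs_ne_q (i j : L.ι) : L.qs i ≠ L.q j := Sum.inr_ne_inl

theorem pdd_q_canonicalForm (i : L.ι) : L.shiftedCotangent.pdd (L.q i) L.canonicalForm =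
    L.shiftedCotangent.dz (L.qs i) := by
  classical
  rw [canonicalForm_eq, map_sum, Finset.sum_eq_single i]
  · rw [pdd_mul, pdd_dz, pdd_dz, if_pos rfl, if_neg (L.qs_ne_q _ _), one_mul, mul_zero, add_zero]
  · intro j _ hj
    rw [pdd_mul, pdd_dz, pdd_dz, if_neg (fun h => hj ((L.q_inj _ _).1 h)),
      if_neg (L.qs_ne_q _ _), zero_mul, mul_zero, add_zero]
  · simp

/-- Interchanging `dz^i` and the derivative costs the sign `(-1)^{deg i (deg i + 1)}`, which is
trivial because one of two consecutive integers is even. -/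
theorem pdd_qs_canonicalForm (i : L.ι) : L.shiftedCotangent.pdd (L.qs i) L.canonicalForm =
    L.shiftedCotangent.dz (L.q i) := by
  classical
  rw [canonicalForm_eq, map_sum, Finset.sum_eq_single i]
  · rw [pdd_mul, pdd_dz, pdd_dz, if_pos rfl, if_neg (L.q_ne_qs _ _), zero_mul, mul_one, zero_add,
      (isPar_dz _).tw, deg_qs, deg_q, sg_even, one_smul]
    rw [show (-1 - L.deg i + 1) * (L.deg i + 1) = -(L.deg i * (L.deg i + 1)) by ring, even_neg]
    exact Int.even_mul_succ_self _
  · intro j _ hj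
    rw [pdd_mul, pdd_dz, pdd_dz, if_neg (fun h => hj ((L.qs_inj _ _).1 h)),
      if_neg (L.q_ne_qs _ _), zero_mul, mul_zero, add_zero]
  · simp

theorem mul_dz (a : G.Forms) (i : G.ι) : a * G.dz i = G.dz i * tw (G.deg i + 1) a := by
  rw [(isPar_dz i).comm, tw_tw]

theorem contract_canonicalForm (X : L.shiftedCotangent.ι → L.shiftedCotangent.Forms) :
    L.shiftedCotangent.contract X L.canonicalForm =
      ∑ i, L.shiftedCotangent.dz (L.qs i) * tw (L.deg i) (X (L.q i)) +
      ∑ i, L.shiftedCotangent.dz (L.q i) * tw (L.deg i + 1) (X (L.qs i)) := by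
  unfold contract
  rw [sum_shiftedCotangent]
  congr 1
  · refine Finset.sum_congr rfl fun i _ => ?_
    rw [pdd_q_canonicalForm, mul_dz, deg_qs, tw_congr (k := L.deg i)]
    rw [show -1 - L.deg i + 1 - L.deg i = -(L.deg i + L.deg i) by ring, even_neg]
    exact Even.add_self _
  · refine Finset.sum_congr rfl fun i _ => ?_
    rw [pdd_qs_canonicalForm, mul_dz, deg_q]

theorem contract_canonicalForm_mem {X : L.shiftedCotangent.ι → L.shiftedCotangent.Forms}
    (hX : X ∈ L.shiftedCotangent.vectorFields) :
    L.shiftedCotangent.contract X L.canonicalForm ∈ L.shiftedCotangent.formsOfDegree 1 := by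
  rw [contract_canonicalForm]
  refine add_mem (sum_mem fun i _ => ?_)
    (sum_mem fun i _ => ?_) <;>
  simpa using formsOfDegree_mul (dz_mem_formsOfDegree _) (tw_mem_formsOfDegree (hX _) _)

theorem pdd_contract_canonicalForm {X : L.shiftedCotangent.ι → L.shiftedCotangent.Forms}
    (hX : X ∈ L.shiftedCotangent.vectorFields) (i : L.ι) :
    L.shiftedCotangent.pdd (L.q i) (L.shiftedCotangent.contract X L.canonicalForm) =
      tw (L.deg i + 1) (X (L.qs i)) ∧
    L.shiftedCotangent.pdd (L.qs i) (L.shiftedCotangent.contract X L.canonicalForm) =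
      tw (L.deg i) (X (L.q i)) := by
  let g : L.shiftedCotangent.ι → L.shiftedCotangent.Forms :=
    Sum.elim (fun i => tw (L.deg i + 1) (X (L.qs i))) fun i => tw (L.deg i) (X (L.q i))
  have hg : ∀ j, g j ∈ L.shiftedCotangent.functions :=
    L.forall_shiftedCotangent.2 ⟨fun i => tw_mem_formsOfDegree (hX _) _,
      fun i => tw_mem_formsOfDegree (hX _) _⟩
  have h : L.shiftedCotangent.contract X L.canonicalForm =
      ∑ j, L.shiftedCotangent.dz j * g j := by
    rw [contract_canonicalForm, sum_shiftedCotangent, add_comm]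
    rfl
  rw [h, pdd_sum_dz _ hg, pdd_sum_dz _ hg]
  exact ⟨rfl, rfl⟩

/-- Contraction with the canonical form exchanges the components along `q` and `qs`, up to twists
that are involutions; applying the same twists to the components of a one-form inverts it. -/
theorem isSymplectic_canonicalForm : L.shiftedCotangent.IsSymplectic (-1) L.canonicalForm where
  mem := by
    rw [canonicalForm_eq]
    refine sum_mem fun i _ => ?_
    have := homog_mul (dz_mem_homog (L.q i)) (dz_mem_homog (L.qs i))
    rwa [deg_q, deg_qs, show L.deg i + (-1 - L.deg i) = -1 by ring] at this
  closed := by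
    rw [canonicalForm_eq, d_sum]
    exact Finset.sum_eq_zero fun i _ => by rw [d_mul, d_dz, d_dz, zero_mul, mul_zero, add_zero]
  nondegenerate := by
    intro α hα
    let X : L.shiftedCotangent.ι → L.shiftedCotangent.Forms :=
      Sum.elim (fun i => tw (L.deg i) (L.shiftedCotangent.pdd (L.qs i) α))
        fun i => tw (L.deg i + 1) (L.shiftedCotangent.pdd (L.q i) α)
    have hX : X ∈ L.shiftedCotangent.vectorFields :=
      L.forall_shiftedCotangent.2 ⟨fun i => tw_mem_formsOfDegree (pdd_mem_functions _ hα) _,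
        fun i => tw_mem_formsOfDegree (pdd_mem_functions _ hα) _⟩
    refine ⟨X, ⟨hX, oneForm_ext (L.contract_canonicalForm_mem hX) hα ?_⟩, ?_⟩
    · refine L.forall_shiftedCotangent.2 ⟨fun i => ?_, fun i => ?_⟩
      · rw [(L.pdd_contract_canonicalForm hX i).1]; exact tw_tw _ _
      · rw [(L.pdd_contract_canonicalForm hX i).2]; exact tw_tw _ _
    · rintro Y ⟨hY, hYα⟩
      funext j
      revert j
      refine L.forall_shiftedCotangent.2 ⟨fun i => ?_, fun i => ?_⟩
      · rw [← tw_tw (L.deg i) (Y (L.q i)), ← (L.pdd_contract_canonicalForm hY i).2, hYα]; rfl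
      · rw [← tw_tw (L.deg i + 1) (Y (L.qs i)), ← (L.pdd_contract_canonicalForm hY i).1, hYα]; rfl

variable {L}

/-- A submersion onto a shifted cotangent bundle is the symplectic quotient of the pulled back
canonical form. -/
theorem isSymplecticQuotient_shiftedCotangent {M : GradedDomain} (hM : ∀ i, M.deg i ≤ 1)
    (hN : ∀ j, L.shiftedCotangent.deg j ≤ 1) (π : Hom M L.shiftedCotangent)
    (e : {j : L.shiftedCotangent.ι // L.shiftedCotangent.deg j = 0} ≃ {i : M.ι // M.deg i = 0})
    (h : ∀ x ∈ M.body, x ∘ e ∈ L.shiftedCotangent.body)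
    (h' : ∀ x ∈ L.shiftedCotangent.body, x ∘ e.symm ∈ M.body) (hπ : π.Over e h)
    (hA : ∀ (x : M.body) (c : L.shiftedCotangent.ι → ℝ),
      (∀ i, ∑ j, c j * π.lead j i x = 0) → c = 0) :
    IsSymplecticQuotient (-1) (π.pullback L.canonicalForm) L.shiftedCotangent L.canonicalForm π := by
  obtain ⟨s, hs, hind, hs'⟩ := π.exists_section hM hN e h h' hπ hA
  refine ⟨L.isSymplectic_canonicalForm, rfl, fun a b hab => by rw [← hs a, hab, hs],
    fun f hf => ⟨fun hX => ?_, ?_⟩⟩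
  -- Vertical fields lie in the kernel of a pulled back form, so an invariant function is
  -- annihilated by them and descends.
  · refine ⟨s.pullback f, s.map_functions hf, hs' f hf fun X hXv hX0 => hX X ⟨hXv, ?_⟩⟩
    rw [π.contract_pullback]
    exact Finset.sum_eq_zero fun j _ => by rw [hX0, zero_mul]
  · rintro ⟨g, hg, rfl⟩ X ⟨hXv, hX⟩
    have hcf : ∀ j, M.contract X (π.pullback (L.shiftedCotangent.dz j)) ∈ M.functions := by
      intro j
      rw [π.map_dz, contract_d _ (π.map_functions (z_mem_functions j))]
      exact apply_mem_functions hXv (π.map_functions (z_mem_functions j))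
    -- Conversely a field in the kernel is vertical: the contraction of the canonical form expands
    -- in the pulled back differentials, which are independent, and its coefficients are the
    -- components of the field along the base up to a twist.
    have hzero : ∀ j, M.contract X (π.pullback (L.shiftedCotangent.dz j)) = 0 := by
      let g : L.shiftedCotangent.ι → M.Forms := Sum.elim
        (fun i => tw (L.deg i + 1) (M.contract X (π.pullback (L.shiftedCotangent.dz (L.qs i)))))
        fun i => tw (L.deg i) (M.contract X (π.pullback (L.shiftedCotangent.dz (L.q i))))
      have hswap : ∀ (j : L.shiftedCotangent.ι) (a : M.Forms),
          a * π.pullback (L.shiftedCotangent.dz j) =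
          π.pullback (L.shiftedCotangent.dz j) * tw (L.shiftedCotangent.deg j + 1) a := by
        intro j a
        rw [(π.isPar_dz j).comm, tw_tw]
      have h0 := hind g (L.forall_shiftedCotangent.2
        ⟨fun i => tw_mem_formsOfDegree (hcf _) _, fun i => tw_mem_formsOfDegree (hcf _) _⟩) (by
          rw [← hX, π.contract_pullback, sum_shiftedCotangent, sum_shiftedCotangent, add_comm]
          congr 1
          · refine Finset.sum_congr rfl fun i _ => ?_
            rw [pdd_q_canonicalForm, hswap, deg_qs, tw_congr (k := L.deg i)]
            · rfl
            · rw [show -1 - L.deg i + 1 - L.deg i = -(L.deg i + L.deg i) by ring, even_neg]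
              exact Even.add_self _
          · refine Finset.sum_congr rfl fun i _ => ?_
            rw [pdd_qs_canonicalForm, hswap, deg_q]
            rfl)
      refine L.forall_shiftedCotangent.2 ⟨fun i => ?_, fun i => ?_⟩
      · have := congrArg (tw (L.deg i)) (h0 (L.qs i))
        rw [map_zero] at this
        rw [← this]
        exact (tw_tw _ _).symm
      · have := congrArg (tw (L.deg i + 1)) (h0 (L.q i))
        rw [map_zero] at this
        rw [← this]
        exact (tw_tw _ _).symm
    rw [← contract_d _ (π.map_functions hg), ← π.map_d, π.contract_pullback]
    exact Finset.sum_eq_zero fun j _ => by rw [hzero, zero_mul]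

/-! ### Uniqueness of morphisms -/

/-- By the chain rule, a derivative of the difference is a combination of such differences for the
partial derivatives of `f`, with equal Jacobians. Each round thus raises the order by one, the body
parts being equal from the start. -/
theorem Hom.Over.coeff_eq {G H : GradedDomain} (hG : ∀ i, G.deg i ≤ 1) {φ ψ : Hom G H}
    {r : {j : H.ι // H.deg j = 0} → {i : G.ι // G.deg i = 0}}
    {h : ∀ x ∈ G.body, x ∘ r ∈ H.body} (hφ : φ.Over r h) (hψ : ψ.Over r h)
    (hz : ∀ j, H.deg j = 0 → φ.pullback (H.z j) = ψ.pullback (H.z j)) (f : SmoothFun H.body) :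
    φ.pullback (coeff f) = ψ.pullback (coeff f) := by
  have key : ∀ m f, φ.pullback (coeff f) - ψ.pullback (coeff f) ∈ G.Fil m := by
    intro m
    induction m with
    | zero => exact fun f => Fil_zero _
    | succ m ih =>
      intro f
      have hf := coeff_mem_functions (G := H) f
      refine mem_Fil_succ (sub_mem (φ.map_functions hf) (ψ.map_functions hf))
        (by rw [map_sub, hφ, hψ, sub_self]) fun i => ?_
      rw [map_sub, φ.pd_pullback i hf, ψ.pd_pullback i hf, ← Finset.sum_sub_distrib]
      refine sum_mem fun j _ => ?_
      by_cases hj : H.deg j = 0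
      · rw [pd_coeff_zero hj, jac, jac, hz j hj, ← mul_sub]
        exact Fil_mul_left _ (ih _)
      · rw [pd_coeff_ne hj, map_zero, map_zero, mul_zero, mul_zero, sub_zero]
        exact zero_mem _
  exact sub_eq_zero.1 (eq_zero_of_mem_Fil hG fun m => key m f)

/-- Two morphisms over the same map of bodies that agree on coordinates are equal. -/
theorem Hom.Over.pullback_eq {G H : GradedDomain} (hG : ∀ i, G.deg i ≤ 1) {φ ψ : Hom G H}
    {r : {j : H.ι // H.deg j = 0} → {i : G.ι // G.deg i = 0}}
    {h : ∀ x ∈ G.body, x ∘ r ∈ H.body} (hφ : φ.Over r h) (hψ : ψ.Over r h)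
    (hz : ∀ j, φ.pullback (H.z j) = ψ.pullback (H.z j)) : φ.pullback = ψ.pullback :=
  forms_algHom_ext (fun f => hφ.coeff_eq hG hψ (fun j _ => hz j) f) hz fun j => by
    rw [φ.map_dz, ψ.map_dz, hz]

/-- The identity morphism. -/
def Hom.id (G : GradedDomain) : Hom G G := ⟨AlgHom.id ℝ _, fun _ _ _ h => h, fun _ => rfl⟩

theorem Hom.over_id (G : GradedDomain) : (Hom.id G).Over _root_.id (fun _ hx => hx) := fun f => by
  rw [SmoothFun.comap_id]; exact ord0_coeff f

end GradedDomain

namespace GradedDomain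

open FreeSuper

/-! ### The zero section of a shifted cotangent bundle -/

section ZeroSection

variable {G : GradedDomain}

theorem negIdeal_le_functions : G.negIdeal ≤ G.functions := by
  refine Submodule.span_le.2 ?_
  rintro _ ⟨g, hg, k, -, f, hf, rfl⟩
  exact functions_mul hg (homog_le_formsOfDegree _ _ hf)

theorem mul_mem_negIdeal {g f : G.Forms} (hg : g ∈ G.functions) (hf : f ∈ G.negIdeal) :
    g * f ∈ G.negIdeal := by
  have : G.negIdeal ≤ G.negIdeal.comap (LinearMap.mulLeft ℝ g) := by
    refine Submodule.span_le.2 ?_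
    rintro _ ⟨g', hg', k, hk, f, hf, rfl⟩
    refine Submodule.subset_span ⟨g * g', functions_mul hg hg', k, hk, f, hf, ?_⟩
    rw [LinearMap.mulLeft_apply, mul_assoc]
  exact this hf

theorem mem_negIdeal_of_homog {k : ℤ} (hk : k < 0) {f : G.Forms} (hf : f ∈ G.homog 0 k) :
    f ∈ G.negIdeal := Submodule.subset_span ⟨1, one_mem_functions, k, hk, f, hf, (one_mul f).symm⟩

theorem Hom.map_negIdeal {H : GradedDomain} (φ : Hom G H) {a : H.Forms} (ha : a ∈ H.negIdeal) :
    φ.pullback a ∈ G.negIdeal := by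
  have : H.negIdeal ≤ G.negIdeal.comap φ.pullback.toLinearMap := by
    refine Submodule.span_le.2 ?_
    rintro _ ⟨g, hg, k, hk, f, hf, rfl⟩
    exact Submodule.subset_span ⟨_, φ.map_functions hg, k, hk, _, φ.map_homog _ _ _ hf,
      map_mul φ.pullback g f⟩
  exact this ha

theorem homog_eq_bot_of_neg (hG : ∀ i, 0 ≤ G.deg i) {p : ℕ} {k : ℤ} (hk : k < 0) :
    G.homog p k = ⊥ := by
  rw [eq_bot_iff]
  refine homog_le fun f l _ hl => ?_
  exfalso
  have : 0 ≤ (l.map G.ldeg).sum := by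
    apply List.sum_nonneg
    intro x hx
    obtain ⟨a, -, rfl⟩ := List.mem_map.1 hx
    rcases a with i | i <;> exact hG i
  omega

theorem Hom.map_negIdeal_eq_zero {H : GradedDomain} (hG : ∀ i, 0 ≤ G.deg i) (φ : Hom G H)
    {a : H.Forms} (ha : a ∈ H.negIdeal) : φ.pullback a = 0 := by
  have h := φ.map_negIdeal ha
  have : G.negIdeal ≤ ⊥ := by
    refine Submodule.span_le.2 ?_
    rintro _ ⟨g, -, k, hk, f, hf, rfl⟩
    rw [homog_eq_bot_of_neg hG hk, Submodule.mem_bot] at hf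
    rw [hf, mul_zero]; exact zero_mem _
  simpa using this h

variable {L : GradedDomain}

/-- The coordinates of degree zero of a shifted cotangent bundle. -/
def degZeroEquiv (hL : ∀ i, 0 ≤ L.deg i) : {i : L.ι // L.deg i = 0} ≃
    {j : L.shiftedCotangent.ι // L.shiftedCotangent.deg j = 0} :=
  Equiv.ofBijective (fun i => ⟨L.q i.1, i.2⟩) ⟨fun i j h => Subtype.ext
    ((L.q_inj _ _).1 (congrArg Subtype.val h)), by
      rintro ⟨i | i, hi⟩
      · exact ⟨⟨i, hi⟩, rfl⟩
      · exact absurd hi (by have := hL i; change ¬ (-1 - L.deg i = 0); omega)⟩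

theorem degZeroEquiv_apply (hL : ∀ i, 0 ≤ L.deg i) (i : {i : L.ι // L.deg i = 0}) :
    (degZeroEquiv hL i : L.shiftedCotangent.ι) = L.q i := rfl

theorem comp_degZeroEquiv_mem (hL : ∀ i, 0 ≤ L.deg i) :
    ∀ x ∈ L.shiftedCotangent.body, x ∘ degZeroEquiv hL ∈ L.body := fun _ hx => hx

theorem comp_degZeroEquiv_symm_mem (hL : ∀ i, 0 ≤ L.deg i) :
    ∀ x ∈ L.body, x ∘ (degZeroEquiv hL).symm ∈ L.shiftedCotangent.body := by
  intro x hx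
  change (x ∘ (degZeroEquiv hL).symm) ∘ degZeroEquiv hL ∈ L.body
  rwa [Function.comp_assoc, Equiv.symm_comp_self, Function.comp_id]

theorem shiftedCotangent_deg_le (hL : ∀ i, 0 ≤ L.deg i) (hL' : ∀ i, L.deg i ≤ 1) :
    ∀ j, L.shiftedCotangent.deg j ≤ 1 :=
  L.forall_shiftedCotangent.2 ⟨hL', fun i => by have := hL i; rw [deg_qs]; omega⟩

theorem exists_projection (hL : ∀ i, 0 ≤ L.deg i) (hL' : ∀ i, L.deg i ≤ 1) :
    ∃ p : Hom L.shiftedCotangent L,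
      (∀ i, p.pullback (L.z i) = L.shiftedCotangent.z (L.q i)) ∧
      p.Over (degZeroEquiv hL) (comp_degZeroEquiv_mem hL) := by
  let c : Components L.shiftedCotangent L :=
    { r := degZeroEquiv hL
      body := comp_degZeroEquiv_mem hL
      fn := fun i => L.shiftedCotangent.z (L.q i)
      mem := fun i => z_mem_homog (L.q i)
      sub_mem := fun i => by
        rw [degZeroEquiv_apply, sub_self]; exact zero_mem _ }
  exact c.exists_over (shiftedCotangent_deg_le hL hL')

/-- The bundle projection `p` satisfies `p ∘ s = id`, which makes restriction to the section
surjective. For every function `g`, the difference `g - p^* s^* g` lies in the ideal of the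
conjugate coordinates, all of negative degree; hence the kernel of restriction is that ideal. -/
theorem IsZeroSection.isClosedEmbedding (hL : ∀ i, 0 ≤ L.deg i) (hL' : ∀ i, L.deg i ≤ 1)
    {s : Hom L L.shiftedCotangent} (hs : L.IsZeroSection s)
    (hs' : s.Over (degZeroEquiv hL).symm (comp_degZeroEquiv_symm_mem hL)) :
    IsClosedEmbedding s L.shiftedCotangent.negIdeal := by
  obtain ⟨p, hp, hpo⟩ := exists_projection hL hL'
  have h1 : (p.comp s).Over id (fun _ hx => hx) := fun f => by
    rw [hpo.comp hs' f]
    congr 2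
    exact (degZeroEquiv hL).symm_comp_self
  have h2 : (s.comp p).Over id (fun _ hx => hx) := fun f => by
    rw [hs'.comp hpo f]
    congr 2
    exact (degZeroEquiv hL).self_comp_symm
  have hsp : ∀ a, s.pullback (p.pullback a) = a := fun a =>
    DFunLike.congr_fun (h1.pullback_eq hL' (Hom.over_id L)
      fun j => by rw [Hom.comp_apply, hp]; exact hs.1 j) a
  have hps : ∀ f, p.pullback (s.pullback (coeff f)) = coeff f := fun f => by
    refine h2.coeff_eq (shiftedCotangent_deg_le hL hL') (Hom.over_id _) (fun j hj => ?_) f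
    obtain ⟨i, hi⟩ := (degZeroEquiv hL).surjective ⟨j, hj⟩
    have : j = L.q i := (congrArg Subtype.val hi).symm
    rw [this, Hom.comp_apply]
    exact (congrArg p.pullback (hs.1 i)).trans (hp i)
  refine ⟨fun f hf => ⟨p.pullback f, p.map_functions hf, hsp f⟩, fun g hg =>
    ⟨fun h0 => ?_, fun h => s.map_negIdeal_eq_zero hL h⟩⟩
  have key : g - p.pullback (s.pullback g) ∈ L.shiftedCotangent.negIdeal := by
    refine functions_induction (P := fun g => g - p.pullback (s.pullback g) ∈
      L.shiftedCotangent.negIdeal) ?_ ?_ ?_ ?_ g hg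
    · intro f; rw [hps, sub_self]; exact zero_mem _
    · intro j a ha ih
      revert j
      refine L.forall_shiftedCotangent.2 ⟨fun i => ?_, fun i => ?_⟩
      · have : p.pullback (s.pullback (L.shiftedCotangent.z (L.q i))) =
            L.shiftedCotangent.z (L.q i) := (congrArg p.pullback (hs.1 i)).trans (hp i)
        rw [map_mul, map_mul, this, ← mul_sub]
        exact mul_mem_negIdeal (z_mem_functions _) ih
      · have : s.pullback (L.shiftedCotangent.z (L.qs i)) = 0 := hs.2 i
        rw [map_mul, this, zero_mul, map_zero, sub_zero, (isPar_z _).comm]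
        refine mul_mem_negIdeal (tw_mem_formsOfDegree ha _) (mem_negIdeal_of_homog ?_
          (z_mem_homog _))
        rw [deg_qs]
        have := hL i
        omega
    · intro a b ha hb
      rw [map_add, map_add, add_sub_add_comm]; exact add_mem ha hb
    · intro r a ha
      rw [map_smul, map_smul, ← smul_sub]; exact Submodule.smul_mem _ r ha
  rwa [h0, map_zero, sub_zero] at key

/-- Applying a tangent field to the conjugate coordinates shows that its components along them
vanish on the section. Conversely, a function that vanishes on the section has vanishing derivatives
there along the base coordinates, by the chain rule for `s`. -/
theorem IsZeroSection.mem_tangent_iff (hL : ∀ i, 0 ≤ L.deg i) (hL' : ∀ i, L.deg i ≤ 1)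
    {s : Hom L L.shiftedCotangent} (hs : L.IsZeroSection s)
    (hs' : s.Over (degZeroEquiv hL).symm (comp_degZeroEquiv_symm_mem hL))
    {X : L.shiftedCotangent.ι → L.shiftedCotangent.Forms}
    (hX : X ∈ L.shiftedCotangent.vectorFields) :
    X ∈ L.shiftedCotangent.tangent L.shiftedCotangent.negIdeal ↔
      ∀ i, s.pullback (X (L.qs i)) = 0 := by
  classical
  have hI := (IsZeroSection.isClosedEmbedding hL hL' hs hs').2
  constructor
  · intro h i
    have h1 := h.2 (L.shiftedCotangent.z (L.qs i)) (mem_negIdeal_of_homog (by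
      rw [deg_qs]
      have := hL i
      omega) (z_mem_homog _))
    have h2 : L.shiftedCotangent.apply X (L.shiftedCotangent.z (L.qs i)) = X (L.qs i) := by
      rw [← contract_d _ (z_mem_functions _), d_z, contract_dz]
    rw [h2] at h1
    exact s.map_negIdeal_eq_zero hL h1
  · intro h
    refine ⟨hX, fun f hf => ?_⟩
    have hff := negIdeal_le_functions hf
    rw [← hI _ (apply_mem_functions hX hff)]
    have hs0 := s.map_negIdeal_eq_zero hL hf
    unfold apply
    rw [sum_shiftedCotangent, map_add, map_sum, map_sum, Finset.sum_eq_zero,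
      Finset.sum_eq_zero, add_zero]
    · intro i _; rw [map_mul, h, zero_mul]
    · intro i _
      have h1 := s.pd_pullback i hff
      rw [hs0, map_zero, sum_shiftedCotangent] at h1
      have h2 : ∀ j, s.jac i (L.q j) = if j = i then 1 else 0 := fun j => by
        rw [Hom.jac, show s.pullback (L.shiftedCotangent.z (L.q j)) = L.z j from hs.1 j, pd_z]
      have h3 : ∀ j, s.jac i (L.qs j) = 0 := fun j => by
        rw [Hom.jac, show s.pullback (L.shiftedCotangent.z (L.qs j)) = 0 from hs.2 j, map_zero]
      simp only [h2, h3, zero_mul, Finset.sum_const_zero, add_zero, ite_mul, one_mul,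
        Finset.sum_ite_eq', Finset.mem_univ, if_true] at h1
      rw [map_mul, ← h1, mul_zero]

/-- Every term of the pairing contains a conjugate component of `X` or of `Y`, so tangent fields are
orthogonal. In the other direction, pairing with the tangent field `∂/∂q_i` recovers the conjugate
component of `X` with index `i`. -/
theorem IsZeroSection.isLagrangian (hL : ∀ i, 0 ≤ L.deg i) (hL' : ∀ i, L.deg i ≤ 1)
    {s : Hom L L.shiftedCotangent} (hs : L.IsZeroSection s)
    (hs' : s.Over (degZeroEquiv hL).symm (comp_degZeroEquiv_symm_mem hL)) :
    L.shiftedCotangent.IsLagrangian L.canonicalForm L.shiftedCotangent.negIdeal := by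
  classical
  have hI := (IsZeroSection.isClosedEmbedding hL hL' hs hs').2
  intro X hX
  have hT := fun {X} hX =>
    IsZeroSection.mem_tangent_iff (X := X) hL hL' hs hs' hX
  have key : ∀ Y, L.shiftedCotangent.contract Y (L.shiftedCotangent.contract X L.canonicalForm) =
      ∑ i, Y (L.qs i) * tw (L.deg i) (X (L.q i)) +
      ∑ i, Y (L.q i) * tw (L.deg i + 1) (X (L.qs i)) := by
    intro Y
    rw [contract_canonicalForm, contract_add, contract_sum, contract_sum]
    congr 1 <;>
    · refine Finset.sum_congr rfl fun i _ => ?_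
      rw [contract_mul_function _ _ (tw_mem_formsOfDegree (hX _) _), contract_dz]
  constructor
  · intro hXt Y hYt
    rw [← hI, key, map_add, map_sum, map_sum, Finset.sum_eq_zero, Finset.sum_eq_zero, add_zero]
    · intro i _
      rw [map_mul, s.map_tw, (hT hX).1 hXt i, map_zero, mul_zero]
    · intro i _
      rw [map_mul, (hT hYt.1).1 hYt i, zero_mul]
    · rw [key]
      exact Submodule.add_mem _
        (sum_mem fun i _ => functions_mul (hYt.1 _) (tw_mem_formsOfDegree (hX _) _))
        (sum_mem fun i _ => functions_mul (hYt.1 _) (tw_mem_formsOfDegree (hX _) _))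
  · intro h
    rw [hT hX]
    intro i
    let Y : L.shiftedCotangent.ι → L.shiftedCotangent.Forms :=
      Sum.elim (fun j => if j = i then 1 else 0) fun _ => 0
    have hY : Y ∈ L.shiftedCotangent.vectorFields := by
      refine L.forall_shiftedCotangent.2 ⟨fun j => ?_, fun j => zero_mem _⟩
      change (if j = i then (1 : L.shiftedCotangent.Forms) else 0) ∈ _
      split_ifs
      · exact one_mem_functions
      · exact zero_mem _
    have hYt := (hT hY).2 fun j => map_zero _
    have h1 := s.map_negIdeal_eq_zero hL (h Y hYt)
    rw [key, Finset.sum_eq_zero (fun j _ => zero_mul _), zero_add, Finset.sum_eq_single i] at h1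
    · have h2 : Y (L.q i) = 1 := if_pos rfl
      rw [h2, one_mul, s.map_tw] at h1
      rw [← tw_tw (L.deg i + 1) (s.pullback _), h1, map_zero]
    · intro j _ hj
      have h2 : Y (L.q j) = 0 := if_neg hj
      rw [h2, zero_mul]
    · simp

end ZeroSection

/-! ### Comparison of symplectic quotients -/

/-- The functions in the image of either pullback are the invariant functions on `M`. The range of
`π'` is a subalgebra stable under `d`, so it also contains the pullbacks of the differentials. -/
theorem IsSymplecticQuotient.exists_range {M N N' : GradedDomain} {k : ℤ} {σ : M.Forms}
    {σN : N.Forms} {σN' : N'.Forms} {π : Hom M N} {π' : Hom M N'}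
    (Q : IsSymplecticQuotient k σ N σN π) (Q' : IsSymplecticQuotient k σ N' σN' π')
    (a : N.Forms) : π.pullback a ∈ π'.pullback.range := by
  have hfun : ∀ f ∈ N.functions, ∃ g ∈ N'.functions, π'.pullback g = π.pullback f := fun f hf =>
    (Q'.invariants _ (π.map_functions hf)).1
      ((Q.invariants _ (π.map_functions hf)).2 ⟨f, hf, rfl⟩)
  induction a using forms_induction with
  | hc f =>
    obtain ⟨g, -, hg⟩ := hfun _ (coeff_mem_functions f)
    exact ⟨g, hg⟩
  | hz i a ih =>
    obtain ⟨g, -, hg⟩ := hfun _ (z_mem_functions i)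
    rw [map_mul]
    exact Subalgebra.mul_mem _ ⟨g, hg⟩ ih
  | hdz i a ih =>
    obtain ⟨g, -, hg⟩ := hfun _ (z_mem_functions i)
    rw [map_mul]
    refine Subalgebra.mul_mem _ ⟨N'.d g, ?_⟩ ih
    change π'.pullback (N'.d g) = _
    rw [π'.map_d, hg, ← π.map_d, d_z]
  | hadd a b ha hb => rw [map_add]; exact Subalgebra.add_mem _ ha hb
  | hsmul r a ha => rw [map_smul]; exact Subalgebra.smul_mem _ ha r

/-- Any two symplectic quotients are isomorphic. -/
theorem IsSymplecticQuotient.exists_iso {M N N' : GradedDomain} {k : ℤ} {σ : M.Forms}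
    {σN : N.Forms} {σN' : N'.Forms} {π : Hom M N} {π' : Hom M N'}
    (Q : IsSymplecticQuotient k σ N σN π) (Q' : IsSymplecticQuotient k σ N' σN' π') :
    ∃ Φ : Hom N' N, Function.Bijective Φ.pullback ∧
      (∀ a, π'.pullback (Φ.pullback a) = π.pullback a) ∧ Φ.pullback σN = σN' := by
  let E := AlgEquiv.ofInjective π'.pullback Q'.pullback_injective
  let F : N.Forms →ₐ[ℝ] N'.Forms :=
    E.symm.toAlgHom.comp (π.pullback.codRestrict π'.pullback.range (Q.exists_range Q'))
  have hF : ∀ a, π'.pullback (F a) = π.pullback a := by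
    intro a
    have h := E.apply_symm_apply
      (π.pullback.codRestrict π'.pullback.range (Q.exists_range Q') a)
    exact congrArg Subtype.val h
  let Φ : Hom N' N :=
    { pullback := F
      map_homog := fun p k a ha => π'.mem_homog_of_injective Q'.pullback_injective (by
        rw [hF]; exact π.map_homog p k a ha)
      map_d := fun a => Q'.pullback_injective (by
        rw [hF, π'.map_d, hF, π.map_d]) }
  -- Surjectivity is the inclusion of ranges with the roles of the two quotients exchanged. The
  -- symplectic forms correspond because both pull back to `σ` and the pullback is injective.
  refine ⟨Φ, ⟨fun a b h => Q.pullback_injective ?_, fun b => ?_⟩, hF, Q'.pullback_injective ?_⟩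
  · rw [← hF a, ← hF b]; exact congrArg _ h
  · obtain ⟨a, ha⟩ := Q'.exists_range Q b
    exact ⟨a, Q'.pullback_injective ((hF a).trans ha)⟩
  · rw [Q'.pullback_form, ← Q.pullback_form]; exact hF _

section Transport

variable {N N' : GradedDomain} {Φ : Hom N' N}

theorem Hom.mem_negIdeal_iff (hΦ : Function.Bijective Φ.pullback)
    (a : N.Forms) : Φ.pullback a ∈ N'.negIdeal ↔ a ∈ N.negIdeal :=
  ⟨fun h => by
    have := (Φ.symm hΦ).map_negIdeal h
    rwa [Φ.symm_pullback hΦ] at this, Φ.map_negIdeal⟩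

/-- Transport of vector fields along an isomorphism. -/
def Hom.transport (hΦ : Function.Bijective Φ.pullback)
    (X : N'.ι → N'.Forms) (j : N.ι) : N.Forms :=
  (Φ.symm hΦ).pullback (N'.contract X (Φ.pullback (N.dz j)))

theorem Hom.contract_transport (hΦ : Function.Bijective Φ.pullback)
    (X : N'.ι → N'.Forms) (a : N.Forms) :
    N'.contract X (Φ.pullback a) = Φ.pullback (N.contract (Φ.transport hΦ X) a) := by
  rw [Φ.contract_pullback, contract, map_sum]
  exact Finset.sum_congr rfl fun j _ => by rw [map_mul, transport, Φ.pullback_symm]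

theorem Hom.transport_mem (hΦ : Function.Bijective Φ.pullback)
    {X : N'.ι → N'.Forms} (hX : X ∈ N'.vectorFields) :
    Φ.transport hΦ X ∈ N.vectorFields := fun j => by
  refine (Φ.symm hΦ).map_functions ?_
  rw [Φ.map_dz, contract_d _ (Φ.map_functions (z_mem_functions j))]
  exact apply_mem_functions hX (Φ.map_functions (z_mem_functions j))

theorem Hom.exists_transport (hΦ : Function.Bijective Φ.pullback)
    {Y : N.ι → N.Forms} (hY : Y ∈ N.vectorFields) :
    ∃ X ∈ N'.vectorFields, Φ.transport hΦ X = Y := by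
  have hS : Function.Bijective (Φ.symm hΦ).pullback :=
    ⟨fun a b h => by rw [← Φ.pullback_symm hΦ a, h, Φ.pullback_symm],
      fun a => ⟨Φ.pullback a, Φ.symm_pullback hΦ a⟩⟩
  refine ⟨_, (Φ.symm hΦ).transport_mem hS hY, ?_⟩
  funext j
  rw [transport, ← (Φ.symm hΦ).contract_transport hS, Φ.symm_pullback, contract_dz]

theorem Hom.apply_transport (hΦ : Function.Bijective Φ.pullback)
    (X : N'.ι → N'.Forms) {f : N.Forms} (hf : f ∈ N.functions) :
    N'.apply X (Φ.pullback f) = Φ.pullback (N.apply (Φ.transport hΦ X) f) := by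
  rw [← contract_d _ (Φ.map_functions hf), ← Φ.map_d, Φ.contract_transport hΦ, contract_d _ hf]

theorem Hom.transport_mem_tangent_iff (hΦ : Function.Bijective Φ.pullback)
    {X : N'.ι → N'.Forms} (hX : X ∈ N'.vectorFields) :
    Φ.transport hΦ X ∈ N.tangent N.negIdeal ↔ X ∈ N'.tangent N'.negIdeal := by
  constructor
  · refine fun h => ⟨hX, fun f hf => ?_⟩
    obtain ⟨g, rfl⟩ := hΦ.2 f
    rw [Hom.mem_negIdeal_iff hΦ] at hf
    rw [Φ.apply_transport hΦ X (negIdeal_le_functions hf), Hom.mem_negIdeal_iff hΦ]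
    exact h.2 g hf
  · refine fun h => ⟨Φ.transport_mem hΦ hX, fun f hf => ?_⟩
    rw [← Hom.mem_negIdeal_iff hΦ, ← Φ.apply_transport hΦ X (negIdeal_le_functions hf)]
    exact h.2 _ (Φ.map_negIdeal hf)

theorem IsLagrangian.transport (hΦ : Function.Bijective Φ.pullback)
    {σ : N.Forms} (h : N.IsLagrangian σ N.negIdeal) :
    N'.IsLagrangian (Φ.pullback σ) N'.negIdeal := by
  intro X hX
  rw [← Φ.transport_mem_tangent_iff hΦ hX, h _ (Φ.transport_mem hΦ hX)]
  constructor
  · intro h' Y hY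
    rw [Φ.contract_transport hΦ, Φ.contract_transport hΦ, Hom.mem_negIdeal_iff hΦ]
    exact h' _ ((Φ.transport_mem_tangent_iff hΦ hY.1).2 hY)
  · intro h' Y hY
    obtain ⟨Z, hZ, rfl⟩ := Φ.exists_transport hΦ hY.1
    have := h' Z ((Φ.transport_mem_tangent_iff hΦ hZ).1 hY)
    rwa [Φ.contract_transport hΦ, Φ.contract_transport hΦ, Hom.mem_negIdeal_iff hΦ] at this

theorem IsClosedEmbedding.transport (hΦ : Function.Bijective Φ.pullback)
    {L : GradedDomain} {s : Hom L N} {s' : Hom L N'}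
    (hs : ∀ a, s'.pullback (Φ.pullback a) = s.pullback a)
    (h : IsClosedEmbedding s N.negIdeal) : IsClosedEmbedding s' N'.negIdeal := by
  refine ⟨fun f hf => ?_, fun g hg => ?_⟩
  · obtain ⟨g, hg, rfl⟩ := h.1 f hf
    exact ⟨Φ.pullback g, Φ.map_functions hg, hs g⟩
  · rw [← Φ.pullback_symm hΦ g, hs, h.2 _ ((Φ.symm hΦ).map_functions hg),
      Hom.mem_negIdeal_iff hΦ]

end Transport

end GradedDomain

namespace FreeSuper

variable {O E C T : Type} [CommRing C] [Algebra ℝ C]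

/-! ### Adjoining odd generators -/

@[simp] theorem adjoin_odd (o : O) : adjoin T (odd o : FreeSuper O E C) = odd (Sum.inl o) := by
  simp only [adjoin, odd, AlgHom.comp_apply]
  erw [Algebra.TensorProduct.map_tmul]
  simp
  rfl

@[simp] theorem adjoin_even (e : E) : adjoin T (even e : FreeSuper O E C) = even e := by
  simp only [adjoin, even, AlgHom.comp_apply]
  erw [Algebra.TensorProduct.map_tmul]
  simp
  rfl

@[simp] theorem adjoin_coeff (c : C) : adjoin T (coeff c : FreeSuper O E C) = coeff c := by
  simp only [adjoin, coeff, AlgHom.comp_apply]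
  erw [Algebra.TensorProduct.map_tmul]
  simp
  rfl

@[simp] theorem forget_odd_inl (o : O) :
    forget T (odd (Sum.inl o) : FreeSuper (O ⊕ T) E C) = odd o := by
  simp only [forget, odd, AlgHom.comp_apply]
  erw [Algebra.TensorProduct.map_tmul]
  simp
  rfl

@[simp] theorem forget_even (e : E) : forget T (even e : FreeSuper (O ⊕ T) E C) = even e := by
  simp only [forget, even, AlgHom.comp_apply]
  erw [Algebra.TensorProduct.map_tmul]
  simp
  rfl

@[simp] theorem forget_coeff (c : C) : forget T (coeff c : FreeSuper (O ⊕ T) E C) = coeff c := by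
  simp only [forget, coeff, AlgHom.comp_apply]
  erw [Algebra.TensorProduct.map_tmul]
  simp
  rfl

@[simp] theorem forget_adjoin (a : FreeSuper O E C) : forget T (adjoin T a) = a := by
  have : (forget T).comp (adjoin T) = AlgHom.id ℝ (FreeSuper O E C) :=
    algHom_ext (fun c => by simp) (fun o => by simp) fun e => by simp
  exact DFunLike.congr_fun this a

theorem adjoin_inv (a : FreeSuper O E C) : adjoin T (inv a) = inv (adjoin T a) := by
  have : (adjoin T).comp inv = inv.comp (adjoin T : FreeSuper O E C →ₐ[ℝ] _) :=
    algHom_ext (fun c => by simp) (fun o => by simp) fun e => by simp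
  exact DFunLike.congr_fun this a

theorem adjoin_tw (k : ℤ) (a : FreeSuper O E C) : adjoin T (tw k a) = tw k (adjoin T a) := by
  by_cases h : Even k
  · rw [tw_even h, tw_even h]
  · rw [tw_odd h, tw_odd h, adjoin_inv]

theorem IsPar.adjoin {k : ℤ} {a : FreeSuper O E C} (h : IsPar k a) : IsPar k (adjoin T a) := by
  unfold IsPar at *
  rw [← adjoin_inv, h, map_smul]

/-! ### Monomials in the adjoined generators -/

/-- The product of odd elements along a list. -/
def word {I A : Type} [Ring A] (y : I → A) (l : List I) : A := (l.map y).prod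

section word

variable {I A : Type} [Ring A]

@[simp] theorem word_nil (y : I → A) : word y [] = 1 := rfl
@[simp] theorem word_cons (y : I → A) (a : I) (l : List I) : word y (a :: l) = y a * word y l := by
  simp [word]
theorem word_append (y : I → A) (l l' : List I) : word y (l ++ l') = word y l * word y l' := by
  simp [word]
theorem map_word {B F : Type} [Ring B] [FunLike F A B] [MonoidHomClass F A B] (φ : F) (y : I → A)
    (l : List I) : φ (word y l) = word (fun i => φ (y i)) l := by
  simp [word, map_list_prod, Function.comp_def]

end word

theorem IsPar.word {I : Type} {y : I → FreeSuper O E C} (hy : ∀ i, IsPar 1 (y i)) (l : List I) :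
    IsPar l.length (word y l) := by
  induction l with
  | nil => exact isPar_one
  | cons a l ih =>
    rw [word_cons, List.length_cons]
    have := (hy a).mul ih
    rwa [add_comm] at this

theorem word_eq_zero {I : Type} {y : I → FreeSuper O E C} (hy : ∀ i, IsPar 1 (y i)) {l : List I}
    (hl : ¬ l.Nodup) : word y l = 0 := by
  have key : ∀ (a : I) (l : List I), a ∈ l → y a * word y l = 0 := by
    intro a l
    induction l with
    | nil => simp
    | cons b l ih =>
      intro h
      rw [word_cons, ← mul_assoc]
      rcases List.mem_cons.1 h with rfl | h
      · rw [(hy a).sq_zero (by decide), zero_mul]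
      · rw [(hy a).comm_isPar (hy b), smul_mul_assoc, mul_assoc, ih h, mul_zero, smul_zero]
  induction l with
  | nil => simp at hl
  | cons a l ih =>
    rw [word_cons]
    rw [List.nodup_cons, not_and_or, not_not] at hl
    rcases hl with h | h
    · exact key a l h
    · rw [ih h, mul_zero]

theorem word_mul_self {I : Type} {y : I → FreeSuper O E C} (hy : ∀ i, IsPar 1 (y i)) {a : I}
    {l : List I} (h : a ∈ l) : y a * word y l = 0 := by
  rw [← word_cons]
  exact word_eq_zero hy fun h' => (List.nodup_cons.1 h').1 h

variable {n : ℕ}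

/-- An adjoined generator. -/
def th (μ : Fin n) : FreeSuper (O ⊕ Fin n) E C := odd (Sum.inr μ)

theorem isPar_th (μ : Fin n) : IsPar 1 (th μ : FreeSuper (O ⊕ Fin n) E C) := isPar_odd _

/-- The monomial of a finite set in the adjoined generators. -/
def thetaSet (S : Finset (Fin n)) : FreeSuper (O ⊕ Fin n) E C := word th (S.sort (· ≤ ·))

theorem isPar_thetaSet (S : Finset (Fin n)) :
    IsPar S.card (thetaSet S : FreeSuper (O ⊕ Fin n) E C) := by
  have := IsPar.word (isPar_th (O := O) (E := E) (C := C)) (S.sort (· ≤ ·))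
  rwa [Finset.length_sort] at this

theorem word_perm {I : Type} {y : I → FreeSuper O E C} (hy : ∀ i, IsPar 1 (y i)) {l l' : List I}
    (h : l.Perm l') : ∃ ε : ℝ, ε * ε = 1 ∧ word y l = ε • word y l' := by
  induction h with
  | nil => exact ⟨1, by simp, by simp⟩
  | cons a _ ih =>
    obtain ⟨ε, h1, h2⟩ := ih
    exact ⟨ε, h1, by rw [word_cons, word_cons, h2, mul_smul_comm]⟩
  | swap a b l =>
    refine ⟨-1, by norm_num, ?_⟩
    rw [word_cons, word_cons, word_cons, word_cons, ← mul_assoc, ← mul_assoc,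
      (hy b).comm_isPar (hy a), smul_mul_assoc, sg_odd (by decide)]
  | trans _ _ ih1 ih2 =>
    obtain ⟨ε, h1, h2⟩ := ih1
    obtain ⟨ε', h1', h2'⟩ := ih2
    exact ⟨ε * ε', by rw [mul_mul_mul_comm, h1, h1', one_mul], by rw [h2, h2', smul_smul]⟩

theorem exists_word_eq (l : List (Fin n)) : ∃ (ε : ℝ) (S : Finset (Fin n)),
    (word th l : FreeSuper (O ⊕ Fin n) E C) = ε • thetaSet S ∧ (ε ≠ 0 → S = l.toFinset ∧
      l.length = S.card) := by
  by_cases hl : l.Nodup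
  · have hp : l.Perm (l.toFinset.sort (· ≤ ·)) := by
      rw [List.perm_ext_iff_of_nodup hl (Finset.sort_nodup _ _)]
      intro a; simp
    obtain ⟨ε, -, h⟩ := word_perm (isPar_th (O := O) (E := E) (C := C)) hp
    exact ⟨ε, _, h, fun _ => ⟨rfl, (List.toFinset_card_of_nodup hl).symm⟩⟩
  -- A word with a repeated letter vanishes; the set is then a dummy, about which nothing is
  -- claimed.
  · exact ⟨0, ∅, by rw [word_eq_zero isPar_th hl, zero_smul], fun h => absurd rfl h⟩

/-- No separate case for scalars is needed, because they are absorbed into the coefficient `a`. -/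
theorem theta_induction {P : FreeSuper (O ⊕ Fin n) E C → Prop}
    (h : ∀ a S, P (adjoin (Fin n) a * thetaSet S)) (hadd : ∀ x y, P x → P y → P (x + y))
    (x : FreeSuper (O ⊕ Fin n) E C) : P x := by
  have key : x ∈ Submodule.span ℝ {x : FreeSuper (O ⊕ Fin n) E C |
      ∃ a S, x = adjoin (Fin n) a * thetaSet S} := by
    have hmul : ∀ (u : FreeSuper (O ⊕ Fin n) E C),
        (∀ a S, u * (adjoin (Fin n) a * thetaSet S) ∈ Submodule.span ℝ
          {x : FreeSuper (O ⊕ Fin n) E C | ∃ a S, x = adjoin (Fin n) a * thetaSet S}) →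
        ∀ x ∈ Submodule.span ℝ
          {x : FreeSuper (O ⊕ Fin n) E C | ∃ a S, x = adjoin (Fin n) a * thetaSet S}, u * x ∈
          Submodule.span ℝ
          {x : FreeSuper (O ⊕ Fin n) E C | ∃ a S, x = adjoin (Fin n) a * thetaSet S} := by
      intro u hu x hx
      induction hx using Submodule.span_induction with
      | mem x hx => obtain ⟨a, S, rfl⟩ := hx; exact hu a S
      | zero => rw [mul_zero]; exact zero_mem _
      | add x y _ _ hx hy => rw [mul_add]; exact add_mem hx hy
      | smul r x _ hx => rw [mul_smul_comm]; exact Submodule.smul_mem _ r hx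
    induction x using FreeSuper.induction with
    | hc c =>
      exact Submodule.subset_span ⟨coeff c, ∅, by simp [thetaSet]⟩
    | ho o x ih =>
      refine hmul _ (fun a S => ?_) _ ih
      rcases o with o | μ
      · rw [← mul_assoc, ← adjoin_odd, ← map_mul]
        exact Submodule.subset_span ⟨_, S, rfl⟩
      · obtain ⟨ε, S', h, -⟩ := exists_word_eq (O := O) (E := E) (C := C) (μ :: S.sort (· ≤ ·))
        rw [← mul_assoc, odd_comm, ← adjoin_inv, mul_assoc]
        change _ * (th μ * thetaSet S) ∈ _
        rw [thetaSet, ← word_cons, h, mul_smul_comm]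
        exact Submodule.smul_mem _ _ (Submodule.subset_span ⟨_, _, rfl⟩)
    | he e x ih =>
      refine hmul _ (fun a S => ?_) _ ih
      rw [← mul_assoc, ← adjoin_even (T := Fin n) (O := O), ← map_mul]
      exact Submodule.subset_span ⟨_, S, rfl⟩
    | hadd x y hx hy => exact add_mem hx hy
    | hsmul r x hx => exact Submodule.smul_mem _ r hx
  have key2 : ∀ r : ℝ, P (r • x) := by
    induction key using Submodule.span_induction with
    | mem x hx =>
      obtain ⟨a, S, rfl⟩ := hx
      intro r
      rw [← smul_mul_assoc, ← map_smul]
      exact h _ _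
    | zero => intro r; have := h 0 ∅; rwa [map_zero, zero_mul, ← smul_zero r] at this
    | add x y _ _ hx hy => intro r; rw [smul_add]; exact hadd _ _ (hx r) (hy r)
    | smul r x _ hx => intro r'; rw [smul_smul]; exact hx _
  have := key2 1
  rwa [one_smul] at this

/-! ### The Berezin integral -/

theorem oddDeriv_inr_adjoin (μ : Fin n) (a : FreeSuper O E C) :
    oddDeriv (Sum.inr μ) (adjoin (Fin n) a) = 0 := by
  classical
  induction a using FreeSuper.induction with
  | hc c => simp
  | ho o a ih =>
    rw [map_mul, isDer_oddDeriv (k := 1) (by decide), ih, mul_zero, add_zero, adjoin_odd,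
      oddDeriv_odd, if_neg (by simp), zero_mul]
  | he e a ih =>
    rw [map_mul, isDer_oddDeriv (k := 1) (by decide), ih, mul_zero, add_zero, adjoin_even,
      oddDeriv_even, zero_mul]
  | hadd a b ha hb => rw [map_add, map_add, ha, hb, add_zero]
  | hsmul r a ha => rw [map_smul, map_smul, ha, smul_zero]

/-- The iterated derivative along a list. -/
def derivList (l : List (Fin n)) : FreeSuper (O ⊕ Fin n) E C →ₗ[ℝ] FreeSuper (O ⊕ Fin n) E C :=
  l.foldl (fun L μ => oddDeriv (Sum.inr μ) ∘ₗ L) LinearMap.id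

theorem foldl_oddDeriv (l : List (Fin n))
    (L : FreeSuper (O ⊕ Fin n) E C →ₗ[ℝ] FreeSuper (O ⊕ Fin n) E C) :
    l.foldl (fun L μ => oddDeriv (Sum.inr μ) ∘ₗ L) L = derivList l ∘ₗ L := by
  unfold derivList
  induction l generalizing L with
  | nil => rfl
  | cons μ l ih =>
    rw [List.foldl_cons, List.foldl_cons, ih, ih (oddDeriv (Sum.inr μ) ∘ₗ LinearMap.id)]
    rfl

theorem derivList_cons (μ : Fin n) (l : List (Fin n)) (x : FreeSuper (O ⊕ Fin n) E C) :
    derivList (μ :: l) x = derivList l (oddDeriv (Sum.inr μ) x) := by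
  rw [derivList, List.foldl_cons, foldl_oddDeriv]
  rfl

theorem berezin_apply (x : FreeSuper (O ⊕ Fin n) E C) :
    berezin n x = forget (Fin n) (derivList (List.finRange n) x) := rfl

theorem derivList_adjoin_mul (l : List (Fin n)) (a : FreeSuper O E C)
    (x : FreeSuper (O ⊕ Fin n) E C) :
    derivList l (adjoin (Fin n) a * x) = adjoin (Fin n) (tw l.length a) * derivList l x := by
  induction l generalizing a x with
  | nil => simp [derivList]
  | cons μ l ih =>
    rw [derivList_cons, isDer_oddDeriv (k := 1) (by decide), oddDeriv_inr_adjoin, zero_mul,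
      zero_add, tw_one, AlgHom.id_apply, ← adjoin_inv, ih, derivList_cons, List.length_cons,
      Nat.cast_succ, tw_add, tw_one]

theorem derivList_mul_adjoin (l : List (Fin n)) (a : FreeSuper O E C)
    (x : FreeSuper (O ⊕ Fin n) E C) :
    derivList l (x * adjoin (Fin n) a) = derivList l x * adjoin (Fin n) a := by
  induction l generalizing x with
  | nil => simp [derivList]
  | cons μ l ih =>
    rw [derivList_cons, isDer_oddDeriv (k := 1) (by decide), oddDeriv_inr_adjoin, mul_zero,
      add_zero, AlgHom.id_apply, ih, derivList_cons]

theorem berezin_adjoin_mul (a : FreeSuper O E C) (x : FreeSuper (O ⊕ Fin n) E C) :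
    berezin n (adjoin (Fin n) a * x) = tw n a * berezin n x := by
  rw [berezin_apply, derivList_adjoin_mul, map_mul, forget_adjoin, List.length_finRange,
    berezin_apply]

theorem berezin_mul_adjoin (a : FreeSuper O E C) (x : FreeSuper (O ⊕ Fin n) E C) :
    berezin n (x * adjoin (Fin n) a) = berezin n x * a := by
  rw [berezin_apply, derivList_mul_adjoin, map_mul, forget_adjoin, berezin_apply]

theorem oddDeriv_word_of_notMem (μ : Fin n) {l : List (Fin n)} (h : μ ∉ l) :
    oddDeriv (Sum.inr μ) (word th l : FreeSuper (O ⊕ Fin n) E C) = 0 := by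
  classical
  induction l with
  | nil => exact (isDer_oddDeriv (k := 1) (by decide) _).map_one
  | cons ν l ih =>
    rw [List.mem_cons, not_or] at h
    rw [word_cons, isDer_oddDeriv (k := 1) (by decide), ih h.2, mul_zero, add_zero, th,
      oddDeriv_odd, if_neg (by simpa using Ne.symm h.1), zero_mul]

theorem derivList_word (l : List (Fin n)) (hl : l.Nodup) :
    derivList l (word th l : FreeSuper (O ⊕ Fin n) E C) = 1 := by
  classical
  induction l with
  | nil => simp [derivList]
  | cons μ l ih =>
    rw [List.nodup_cons] at hl
    rw [derivList_cons, word_cons, isDer_oddDeriv (k := 1) (by decide),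
      oddDeriv_word_of_notMem μ hl.1, mul_zero, add_zero, th, oddDeriv_odd, if_pos rfl, one_mul,
      AlgHom.id_apply, ih hl.2]

/-- The span of the words without `θ^μ` is stable under all derivatives and annihilated by `∂/∂θ^μ`,
which occurs somewhere in the list. -/
theorem derivList_word_of_notMem {μ : Fin n} {l m : List (Fin n)} (hl : μ ∈ l) (hm : μ ∉ m) :
    derivList l (word th m : FreeSuper (O ⊕ Fin n) E C) = 0 := by
  classical
  let V : Submodule ℝ (FreeSuper (O ⊕ Fin n) E C) :=
    Submodule.span ℝ {x | ∃ m : List (Fin n), μ ∉ m ∧ x = word th m}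
  have hmul : ∀ a ≠ μ, ∀ x ∈ V, th a * x ∈ V := by
    intro a ha x hx
    induction hx using Submodule.span_induction with
    | mem x hx =>
      obtain ⟨m, hm, rfl⟩ := hx
      refine Submodule.subset_span ⟨a :: m, ?_, (word_cons _ _ _).symm⟩
      simp [ha.symm, hm]
    | zero => rw [mul_zero]; exact V.zero_mem
    | add x y _ _ hx hy => rw [mul_add]; exact V.add_mem hx hy
    | smul r x _ hx => rw [mul_smul_comm]; exact V.smul_mem r hx
  have hword : ∀ (ν : Fin n) (m : List (Fin n)), μ ∉ m →
      oddDeriv (Sum.inr ν) (word th m) ∈ V := by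
    intro ν m
    induction m with
    | nil =>
      intro _
      rw [word_nil, (isDer_oddDeriv (k := 1) (by decide) _).map_one]
      exact V.zero_mem
    | cons a m ih =>
      intro h
      rw [List.mem_cons, not_or] at h
      rw [word_cons, isDer_oddDeriv (k := 1) (by decide), AlgHom.id_apply, AlgHom.id_apply,
        (isPar_th a).tw]
      refine V.add_mem ?_ ?_
      · rw [th, oddDeriv_odd, ite_mul, one_mul, zero_mul]
        split_ifs
        · exact Submodule.subset_span ⟨m, h.2, rfl⟩
        · exact V.zero_mem
      · rw [smul_mul_assoc]
        exact V.smul_mem _ (hmul a (Ne.symm h.1) _ (ih h.2))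
  have hV : ∀ ν, ∀ x ∈ V, oddDeriv (Sum.inr ν) x ∈ V := by
    intro ν x hx
    induction hx using Submodule.span_induction with
    | mem x hx => obtain ⟨m, hm, rfl⟩ := hx; exact hword ν m hm
    | zero => rw [map_zero]; exact V.zero_mem
    | add x y _ _ hx hy => rw [map_add]; exact V.add_mem hx hy
    | smul r x _ hx => rw [map_smul]; exact V.smul_mem r hx
  have hμ : ∀ x ∈ V, oddDeriv (Sum.inr μ) x = 0 := by
    intro x hx
    induction hx using Submodule.span_induction with
    | mem x hx => obtain ⟨m, hm, rfl⟩ := hx; exact oddDeriv_word_of_notMem μ hm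
    | zero => rw [map_zero]
    | add x y _ _ hx hy => rw [map_add, hx, hy, add_zero]
    | smul r x _ hx => rw [map_smul, hx, smul_zero]
  have key : ∀ l : List (Fin n), μ ∈ l → ∀ x ∈ V, derivList l x = 0 := by
    intro l
    induction l with
    | nil => intro h; simp at h
    | cons ν l ih =>
      intro h x hx
      rw [derivList_cons]
      rcases List.mem_cons.1 h with rfl | h
      · rw [hμ x hx, map_zero]
      · exact ih h _ (hV ν x hx)
  exact key l hl _ (Submodule.subset_span ⟨m, hm, rfl⟩)

theorem berezin_word_of_notMem {μ : Fin n} {m : List (Fin n)} (hm : μ ∉ m) :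
    berezin n (word th m : FreeSuper (O ⊕ Fin n) E C) = 0 := by
  rw [berezin_apply, derivList_word_of_notMem (List.mem_finRange μ) hm, map_zero]

theorem berezin_finRange :
    berezin n (word th (List.finRange n) : FreeSuper (O ⊕ Fin n) E C) = 1 := by
  rw [berezin_apply, derivList_word _ (List.nodup_finRange n), map_one]

/-! ### Components with respect to the adjoined generators -/

/-- The sorted letters of `U` followed by those of its complement are a permutation of all the
letters. The resulting sign normalizes the extraction of coefficients by integration against the
complementary monomial. -/
theorem exists_complement_sign (U : Finset (Fin n)) : ∃ ε : ℝ, ε * ε = 1 ∧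
    ε • berezin n (thetaSet U * thetaSet Uᶜ : FreeSuper (O ⊕ Fin n) E C) = 1 := by
  have hp : (U.sort (· ≤ ·) ++ Uᶜ.sort (· ≤ ·)).Perm (List.finRange n) := by
    rw [List.perm_ext_iff_of_nodup _ (List.nodup_finRange n)]
    · intro a
      simp [em]
    · refine List.Nodup.append (Finset.sort_nodup _ _) (Finset.sort_nodup _ _) ?_
      intro a h h'
      simp only [Finset.mem_sort, Finset.mem_compl] at h h'
      exact h' h
  obtain ⟨ε, h1, h2⟩ := word_perm (isPar_th (O := O) (E := E) (C := C)) hp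
  refine ⟨ε, h1, ?_⟩
  rw [thetaSet, thetaSet, ← word_append, h2, map_smul, smul_smul, h1, one_smul, berezin_finRange]

/-- The coefficient of the monomial of `U`. -/
def comp (U : Finset (Fin n)) : FreeSuper (O ⊕ Fin n) E C →ₗ[ℝ] FreeSuper O E C :=
  (exists_complement_sign (O := O) (E := E) (C := C) U).choose •
    ((tw n).toLinearMap ∘ₗ berezin n ∘ₗ LinearMap.mulRight ℝ (thetaSet Uᶜ))

theorem comp_adjoin_mul_thetaSet (U V : Finset (Fin n)) (a : FreeSuper O E C) :
    comp U (adjoin (Fin n) a * thetaSet V) = if V = U then a else 0 := by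
  have hs := (exists_complement_sign (O := O) (E := E) (C := C) U).choose_spec
  simp only [comp, LinearMap.smul_apply, LinearMap.comp_apply, LinearMap.mulRight_apply,
    AlgHom.toLinearMap_apply]
  generalize (exists_complement_sign (O := O) (E := E) (C := C) U).choose = ε at hs ⊢
  rw [mul_assoc, berezin_adjoin_mul, map_mul, tw_tw]
  split_ifs with h
  · subst h
    rw [← mul_smul_comm, ← map_smul, hs.2, map_one, mul_one]
  · suffices berezin n (thetaSet V * thetaSet Uᶜ : FreeSuper (O ⊕ Fin n) E C) = 0 by
      rw [this, map_zero, mul_zero, smul_zero]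
    rw [thetaSet, thetaSet, ← word_append]
    -- If `V` is a proper subset of `U`, some letter is missing and the integral vanishes; otherwise
    -- a letter is repeated and the product itself vanishes.
    by_cases hVU : V ⊆ U
    · obtain ⟨μ, hU, hV⟩ := Finset.exists_of_ssubset (hVU.ssubset_of_ne h)
      exact berezin_word_of_notMem (μ := μ) (by simp [hU, hV])
    · obtain ⟨μ, hV, hU⟩ := Finset.not_subset.1 hVU
      rw [word_eq_zero isPar_th, map_zero]
      intro hn
      exact (List.nodup_append.1 hn).2.2 μ (by simpa using hV) μ (by simpa using hU) rfl

theorem sum_comp (x : FreeSuper (O ⊕ Fin n) E C) :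
    ∑ U, adjoin (Fin n) (comp U x) * thetaSet U = x := by
  induction x using theta_induction with
  | h a S =>
    rw [Finset.sum_eq_single S]
    · rw [comp_adjoin_mul_thetaSet, if_pos rfl]
    · intro U _ hU
      rw [comp_adjoin_mul_thetaSet, if_neg hU.symm, map_zero, zero_mul]
    · simp
  | hadd x y hx hy =>
    simp only [map_add, add_mul, Finset.sum_add_distrib, hx, hy]

theorem comp_sum (a : Finset (Fin n) → FreeSuper O E C) (U : Finset (Fin n)) :
    comp U (∑ V, adjoin (Fin n) (a V) * thetaSet V) = a U := by
  simp [map_sum, comp_adjoin_mul_thetaSet]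

theorem berezin_eq_comp (x : FreeSuper (O ⊕ Fin n) E C) :
    berezin n x = tw n (comp Finset.univ x) := by
  induction x using theta_induction with
  | h a S =>
    rw [berezin_adjoin_mul, comp_adjoin_mul_thetaSet]
    split_ifs with h
    · have hsort : (Finset.univ : Finset (Fin n)).sort (· ≤ ·) = List.finRange n :=
        Fin.sort_univ n
      rw [h, thetaSet, hsort, berezin_finRange, mul_one]
    · obtain ⟨μ, -, hS⟩ := Finset.exists_of_ssubset ((Finset.subset_univ S).ssubset_of_ne h)
      rw [thetaSet, berezin_word_of_notMem (μ := μ) (by simpa using hS), mul_zero, map_zero]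
  | hadd x y hx hy => rw [map_add, map_add, map_add, hx, hy]

theorem thetaSet_mul_adjoin (U : Finset (Fin n)) (a : FreeSuper O E C) :
    thetaSet U * adjoin (Fin n) a = adjoin (Fin n) (tw U.card a) * thetaSet U := by
  rw [(isPar_thetaSet U).comm, adjoin_tw]

theorem adjoin_thetaSet_mul (U V : Finset (Fin n)) (a b : FreeSuper O E C) :
    (adjoin (Fin n) a * thetaSet U) * (adjoin (Fin n) b * thetaSet V) =
      adjoin (Fin n) (a * tw U.card b) * (thetaSet U * thetaSet V) := by
  rw [mul_assoc, ← mul_assoc (thetaSet U), thetaSet_mul_adjoin, map_mul]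
  simp only [mul_assoc]

theorem exists_thetaSet_mul (U V : Finset (Fin n)) : ∃ (ε : ℝ) (S : Finset (Fin n)),
    (thetaSet U * thetaSet V : FreeSuper (O ⊕ Fin n) E C) = ε • thetaSet S ∧
      (ε ≠ 0 → S.card = U.card + V.card) := by
  obtain ⟨ε, S, h, h'⟩ := exists_word_eq (O := O) (E := E) (C := C)
    (U.sort (· ≤ ·) ++ V.sort (· ≤ ·))
  refine ⟨ε, S, by rw [← h, word_append]; rfl, fun hε => ?_⟩
  rw [← (h' hε).2, List.length_append, Finset.length_sort, Finset.length_sort]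

/-- The elements whose coefficient at `S` is in `X |S|`. -/
def thetaSpan (X : ℕ → Submodule ℝ (FreeSuper O E C)) :
    Submodule ℝ (FreeSuper (O ⊕ Fin n) E C) :=
  Submodule.span ℝ {x | ∃ S, ∃ a ∈ X S.card, x = adjoin (Fin n) a * thetaSet S}

theorem adjoin_mul_mem_thetaSpan {X : ℕ → Submodule ℝ (FreeSuper O E C)} (S : Finset (Fin n))
    {a : FreeSuper O E C} (ha : a ∈ X S.card) : adjoin (Fin n) a * thetaSet S ∈ thetaSpan X :=
  Submodule.subset_span ⟨S, a, ha, rfl⟩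

theorem comp_mem {X : ℕ → Submodule ℝ (FreeSuper O E C)} {x : FreeSuper (O ⊕ Fin n) E C}
    (hx : x ∈ thetaSpan X) (U : Finset (Fin n)) : comp U x ∈ X U.card := by
  induction hx using Submodule.span_induction with
  | mem x hx =>
    obtain ⟨S, a, ha, rfl⟩ := hx
    rw [comp_adjoin_mul_thetaSet]
    split_ifs with h
    · exact h ▸ ha
    · exact zero_mem _
  | zero => rw [map_zero]; exact zero_mem _
  | add x y _ _ hx hy => rw [map_add]; exact add_mem hx hy
  | smul r x _ hx => rw [map_smul]; exact Submodule.smul_mem _ r hx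

theorem mul_mem_thetaSpan {X Y Z : ℕ → Submodule ℝ (FreeSuper O E C)}
    (h : ∀ i j, ∀ a ∈ X i, ∀ b ∈ Y j, a * tw i b ∈ Z (i + j)) {x y : FreeSuper (O ⊕ Fin n) E C}
    (hx : x ∈ thetaSpan X) (hy : y ∈ thetaSpan Y) : x * y ∈ thetaSpan Z := by
  induction hx using Submodule.span_induction with
  | mem x hx =>
    obtain ⟨U, a, ha, rfl⟩ := hx
    induction hy using Submodule.span_induction with
    | mem y hy =>
      obtain ⟨V, b, hb, rfl⟩ := hy
      obtain ⟨ε, S, hS, hc⟩ := exists_thetaSet_mul (O := O) (E := E) (C := C) U V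
      rw [adjoin_thetaSet_mul, hS, mul_smul_comm]
      by_cases hε : ε = 0
      · rw [hε, zero_smul]; exact zero_mem _
      · refine Submodule.smul_mem _ _ (adjoin_mul_mem_thetaSpan S ?_)
        rw [hc hε]
        exact h _ _ a ha b hb
    | zero => rw [mul_zero]; exact zero_mem _
    | add x y _ _ hx hy => rw [mul_add]; exact add_mem hx hy
    | smul r x _ hx => rw [mul_smul_comm]; exact Submodule.smul_mem _ r hx
  | zero => rw [zero_mul]; exact zero_mem _
  | add x y _ _ hx hy => rw [add_mul]; exact add_mem hx hy
  | smul r x _ hx => rw [smul_mul_assoc]; exact Submodule.smul_mem _ r hx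

/-! ### Extending operators to the adjoined generators -/

section extend

variable {O' E' C' : Type} [CommRing C'] [Algebra ℝ C']

/-- The coefficientwise extension of an algebra morphism that preserves the parity. -/
def extHom (n : ℕ) (φ : FreeSuper O E C →ₐ[ℝ] FreeSuper O' E' C')
    (hφ : ∀ a, φ (inv a) = inv (φ a)) :
    FreeSuper (O ⊕ Fin n) E C →ₐ[ℝ] FreeSuper (O' ⊕ Fin n) E' C' :=
  liftHom (Sum.elim (fun o => adjoin (Fin n) (φ (odd o))) th) (fun e => adjoin (Fin n) (φ (even e)))
    ((adjoin (Fin n)).comp (φ.comp coeffHom))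
    (by
      rintro (o | μ)
      · refine IsPar.adjoin ?_
        have h := hφ (odd o)
        rw [inv_odd, map_neg] at h
        rw [IsPar, sg_odd (by decide), ← h, neg_one_smul]
      · exact isPar_th μ)
    (fun e => IsPar.adjoin (by
      have h := hφ (even e)
      rw [inv_even] at h
      rw [IsPar, sg_zero, ← h, one_smul]))
    (fun c => show IsPar 0 (((adjoin (Fin n)).comp (φ.comp coeffHom)) c) from
      IsPar.adjoin (a := φ (coeff c)) (by
        have h := hφ (coeff c)
        rw [inv_coeff] at h
        rw [IsPar, sg_zero, one_smul]
        exact h.symm))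

variable {φ : FreeSuper O E C →ₐ[ℝ] FreeSuper O' E' C'} (hφ : ∀ a, φ (inv a) = inv (φ a))

theorem extHom_adjoin (a : FreeSuper O E C) :
    extHom n φ hφ (adjoin (Fin n) a) = adjoin (Fin n) (φ a) := by
  have : (extHom n φ hφ).comp (adjoin (Fin n)) = (adjoin (Fin n)).comp φ := by
    refine algHom_ext (fun c => ?_) (fun o => ?_) fun e => ?_
    · rw [AlgHom.comp_apply, adjoin_coeff, extHom, liftHom_coeff]; rfl
    · rw [AlgHom.comp_apply, adjoin_odd, extHom, liftHom_odd]; rfl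
    · rw [AlgHom.comp_apply, adjoin_even, extHom, liftHom_even]; rfl
  exact DFunLike.congr_fun this a

theorem extHom_th (μ : Fin n) : extHom n φ hφ (th μ) = th μ := by
  rw [th, extHom, liftHom_odd]; rfl

theorem extHom_thetaSet (S : Finset (Fin n)) : extHom n φ hφ (thetaSet S) = thetaSet S := by
  rw [thetaSet, map_word, thetaSet]
  simp only [extHom_th]

theorem comp_extHom (x : FreeSuper (O ⊕ Fin n) E C) (U : Finset (Fin n)) :
    comp U (extHom n φ hφ x) = φ (comp U x) := by
  induction x using theta_induction with
  | h a S =>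
    rw [map_mul, extHom_adjoin, extHom_thetaSet, comp_adjoin_mul_thetaSet,
      comp_adjoin_mul_thetaSet]
    split_ifs <;> simp
  | hadd x y hx hy => simp only [map_add, hx, hy]

theorem berezin_extHom (x : FreeSuper (O ⊕ Fin n) E C) :
    berezin n (extHom n φ hφ x) = φ (berezin n x) := by
  rw [berezin_eq_comp, berezin_eq_comp, comp_extHom]
  by_cases h : Even (n : ℤ)
  · rw [tw_even h, tw_even h]
  · rw [tw_odd h, tw_odd h, hφ]

/-- The coefficientwise extension of a linear operator. -/
def extLin (n : ℕ) (D : FreeSuper O E C →ₗ[ℝ] FreeSuper O E C) :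
    FreeSuper (O ⊕ Fin n) E C →ₗ[ℝ] FreeSuper (O ⊕ Fin n) E C :=
  ∑ U, LinearMap.mulRight ℝ (thetaSet U) ∘ₗ (adjoin (Fin n)).toLinearMap ∘ₗ D ∘ₗ comp U

theorem extLin_apply (D : FreeSuper O E C →ₗ[ℝ] FreeSuper O E C)
    (x : FreeSuper (O ⊕ Fin n) E C) :
    extLin n D x = ∑ U, adjoin (Fin n) (D (comp U x)) * thetaSet U := by
  simp [extLin, LinearMap.sum_apply]

theorem extLin_adjoin_mul_thetaSet (D : FreeSuper O E C →ₗ[ℝ] FreeSuper O E C)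
    (a : FreeSuper O E C) (S : Finset (Fin n)) :
    extLin n D (adjoin (Fin n) a * thetaSet S) = adjoin (Fin n) (D a) * thetaSet S := by
  rw [extLin_apply, Finset.sum_eq_single S]
  · rw [comp_adjoin_mul_thetaSet, if_pos rfl]
  · intro U _ hU
    rw [comp_adjoin_mul_thetaSet, if_neg hU.symm, map_zero, map_zero, zero_mul]
  · simp

theorem extLin_adjoin_mul (D : FreeSuper O E C →ₗ[ℝ] FreeSuper O E C)
    (a : FreeSuper O E C) (l : List (Fin n)) :
    extLin n D (adjoin (Fin n) a * word th l) = adjoin (Fin n) (D a) * word th l := by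
  obtain ⟨ε, S, h, -⟩ := exists_word_eq (O := O) (E := E) (C := C) l
  rw [h, mul_smul_comm, mul_smul_comm, map_smul, extLin_adjoin_mul_thetaSet]

theorem inv_thetaSet (S : Finset (Fin n)) :
    inv (thetaSet S : FreeSuper (O ⊕ Fin n) E C) = sg S.card • thetaSet S := isPar_thetaSet S

/-- Passing the odd operator across `θ^U` costs `(-1)^{|U|}`, which is the sign contributed by `θ^U`
to the parity involution of the first factor. -/
theorem extLin_mul {D : FreeSuper O E C →ₗ[ℝ] FreeSuper O E C}
    (hD : IsDer (AlgHom.id ℝ _) 1 D) (hinv : ∀ a, D (inv a) = -inv (D a))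
    (x y : FreeSuper (O ⊕ Fin n) E C) :
    extLin n D (x * y) = extLin n D x * y + inv x * extLin n D y := by
  have htw : ∀ (k : ℤ) a, D (tw k a) = sg k • tw k (D a) := by
    intro k a
    by_cases h : Even k
    · rw [tw_even h, tw_even h, sg_even h, one_smul]
    · rw [tw_odd h, tw_odd h, sg_odd h, hinv, neg_one_smul]
  induction x using theta_induction with
  | h a U =>
    induction y using theta_induction with
    | h b V =>
      have h1 : extLin n D (adjoin (Fin n) (a * tw U.card b) * (thetaSet U * thetaSet V)) =
          adjoin (Fin n) (D (a * tw U.card b)) * (thetaSet U * thetaSet V) := by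
        rw [thetaSet, thetaSet, ← word_append, extLin_adjoin_mul]
      rw [adjoin_thetaSet_mul, h1, hD, extLin_adjoin_mul_thetaSet, extLin_adjoin_mul_thetaSet,
        map_mul inv, ← adjoin_inv, inv_thetaSet, mul_smul_comm, smul_mul_assoc,
        adjoin_thetaSet_mul, adjoin_thetaSet_mul, AlgHom.id_apply, AlgHom.id_apply, tw_one, htw,
        mul_smul_comm, map_add, map_smul, add_mul, smul_mul_assoc]
    | hadd x y hx hy => simp only [mul_add, map_add, hx, hy]; abel
  | hadd x x' hx hx' => simp only [add_mul, map_add, hx, hx']; abel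

theorem berezin_extLin {D : FreeSuper O E C →ₗ[ℝ] FreeSuper O E C}
    (hinv : ∀ a, D (inv a) = -inv (D a)) (x : FreeSuper (O ⊕ Fin n) E C) :
    berezin n (extLin n D x) = sg n • D (berezin n x) := by
  rw [berezin_eq_comp, berezin_eq_comp, extLin_apply, comp_sum]
  by_cases h : Even (n : ℤ)
  · rw [tw_even h, tw_even h, sg_even h, one_smul]
  · rw [tw_odd h, tw_odd h, sg_odd h, hinv, smul_neg, neg_one_smul, neg_neg]

end extend

end FreeSuper

/-! ## Contractions of the volume element of a Grassmann algebra -/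

namespace CartanWeyl

open FreeSuper

variable {n : ℕ}

theorem levi_ofFn (f : Fin n → Fin n) :
    levi (List.ofFn f) = (Matrix.of fun i j : Fin n => if f i = j then (1 : ℝ) else 0).det := by
  rw [levi]
  congr 1
  ext i j
  simp

/-- The two determinants differ by an interchange of two adjacent rows. -/
theorem levi_swap (I J : List (Fin n)) (a b : Fin n) (h : I.length + (J.length + 2) = n) :
    levi (I ++ a :: b :: J) = -levi (I ++ b :: a :: J) := by
  let p : Fin n := ⟨I.length, by omega⟩
  let q : Fin n := ⟨I.length + 1, by omega⟩
  have hpq : p ≠ q := by simp [p, q, Fin.ext_iff]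
  have hM : (Matrix.of fun i j : Fin n =>
        if (I ++ a :: b :: J)[(i : ℕ)]? = some j then (1 : ℝ) else 0) =
      (Matrix.of fun i j : Fin n =>
        if (I ++ b :: a :: J)[(i : ℕ)]? = some j then (1 : ℝ) else 0).submatrix
          (Equiv.swap p q) id := by
    ext i j
    simp only [Matrix.of_apply, Matrix.submatrix_apply, id]
    suffices (I ++ a :: b :: J)[(i : ℕ)]? = (I ++ b :: a :: J)[(Equiv.swap p q i : ℕ)]? by
      rw [this]
    by_cases hp : i = p
    · subst hp
      rw [Equiv.swap_apply_left]
      simp [p, q]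
    by_cases hq : i = q
    · subst hq
      rw [Equiv.swap_apply_right]
      simp [p, q]
    rw [Equiv.swap_apply_of_ne_of_ne hp hq]
    have hp' : (i : ℕ) ≠ I.length := fun h => hp (Fin.ext h)
    have hq' : (i : ℕ) ≠ I.length + 1 := fun h => hq (Fin.ext h)
    rw [List.getElem?_append, List.getElem?_append]
    split_ifs with hi
    · rfl
    · obtain ⟨k, hk⟩ : ∃ k, (i : ℕ) - I.length = k + 2 := ⟨i - I.length - 2, by omega⟩
      rw [hk]
      rfl
  rw [levi, hM, Matrix.det_permute, levi, Equiv.Perm.sign_swap hpq]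
  simp

/-- The Grassmann algebra on `n` generators. -/
abbrev Gr (n : ℕ) : Type := FreeSuper (Fin n) Empty ℝ

/-- The sum `∑ ε_{I b₁ ⋯ b_k} y^{b₁} ⋯ y^{b_k}`. -/
def epsSum (k : ℕ) (I : List (Fin n)) : Gr n :=
  ∑ f : Fin k → Fin n, levi (I ++ List.ofFn f) • word odd (List.ofFn f)

theorem epsSum_zero (I : List (Fin n)) : epsSum 0 I = levi I • (1 : Gr n) := by
  simp [epsSum]

theorem epsSum_succ (k : ℕ) (I : List (Fin n)) :
    epsSum (k + 1) I = ∑ a, odd a * epsSum k (I ++ [a]) := by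
  rw [epsSum, ← (Fin.consEquiv fun _ => Fin n).sum_comp, Fintype.sum_prod_type]
  refine Finset.sum_congr rfl fun a _ => ?_
  rw [epsSum, Finset.mul_sum]
  refine Finset.sum_congr rfl fun f _ => ?_
  change levi (I ++ List.ofFn (Fin.cons a f : Fin (k + 1) → Fin n)) •
    word odd (List.ofFn (Fin.cons a f : Fin (k + 1) → Fin n)) = _
  rw [List.ofFn_cons, word_cons, mul_smul_comm, List.append_assoc,
    List.singleton_append]

theorem epsSum_swap {k : ℕ} (I J : List (Fin n)) (a b : Fin n)
    (h : I.length + (J.length + 2) + k = n) :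
    epsSum k (I ++ a :: b :: J) = -epsSum k (I ++ b :: a :: J) := by
  rw [epsSum, epsSum, ← Finset.sum_neg_distrib]
  refine Finset.sum_congr rfl fun f _ => ?_
  rw [← neg_smul, List.append_assoc, List.append_assoc, List.cons_append, List.cons_append,
    List.cons_append, List.cons_append, levi_swap]
  simp; omega

/-- The derivative either hits the first factor or passes it with a sign. In the second case the
antisymmetry of `ε` moves `d` back past the index of that factor and compensates the sign, so all
`k` positions contribute equally. -/
theorem oddDeriv_epsSum (d : Fin n) (k : ℕ) : ∀ I : List (Fin n), I.length + k = n →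
    oddDeriv d (epsSum k I) = (k : ℝ) • epsSum (k - 1) (I ++ [d]) := by
  induction k with
  | zero =>
    intro I _
    rw [epsSum_zero, map_smul, (isDer_oddDeriv (k := 1) (by decide) d).map_one]
    simp
  | succ k ih =>
    intro I hI
    have h1 : ∀ a, oddDeriv d (odd a * epsSum k (I ++ [a])) =
        (if a = d then epsSum k (I ++ [a]) else 0) -
          (k : ℝ) • (odd a * epsSum (k - 1) (I ++ [a] ++ [d])) := by
      intro a
      rw [isDer_oddDeriv (k := 1) (by decide), AlgHom.id_apply, AlgHom.id_apply, tw_one, inv_odd,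
        oddDeriv_odd, ih (I ++ [a]) (by simp; omega), ite_mul, one_mul, zero_mul, neg_mul,
        mul_smul_comm, sub_eq_add_neg]
    rw [epsSum_succ, map_sum, Finset.sum_congr rfl fun a _ => h1 a, Finset.sum_sub_distrib,
      Finset.sum_ite_eq' Finset.univ d, if_pos (Finset.mem_univ d), ← Finset.smul_sum]
    rcases k with _ | k
    · simp
    · have h2 : ∑ a, odd a * epsSum k (I ++ [a] ++ [d]) = -epsSum (k + 1) (I ++ [d]) := by
        rw [epsSum_succ, ← Finset.sum_neg_distrib]
        refine Finset.sum_congr rfl fun a _ => ?_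
        have := epsSum_swap (k := k) I [] a d (by simp; omega)
        rw [List.append_assoc, List.append_assoc, List.singleton_append, List.singleton_append,
          this, mul_neg]
      rw [Nat.add_sub_cancel, Nat.add_sub_cancel, h2]
      push_cast
      module

/-- The contraction `1/k! ε_{I b₁ ⋯ b_k} y^{b₁} ⋯ y^{b_k}` of the volume element. -/
def gvol (k : ℕ) (I : List (Fin n)) : Gr n := ((k.factorial : ℝ)⁻¹) • epsSum k I

theorem oddDeriv_gvol (d : Fin n) (k : ℕ) (I : List (Fin n)) (h : I.length + (k + 1) = n) :
    oddDeriv d (gvol (k + 1) I) = gvol k (I ++ [d]) := by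
  rw [gvol, map_smul, oddDeriv_epsSum d (k + 1) I h, smul_smul, gvol, Nat.add_sub_cancel,
    Nat.factorial_succ]
  congr 1
  have : (k.factorial : ℝ) ≠ 0 := by positivity
  have : ((k : ℝ) + 1) ≠ 0 := by positivity
  push_cast
  field_simp

theorem gvol_swap {k : ℕ} (I J : List (Fin n)) (a b : Fin n)
    (h : I.length + (J.length + 2) + k = n) :
    gvol k (I ++ a :: b :: J) = -gvol k (I ++ b :: a :: J) := by
  rw [gvol, epsSum_swap I J a b h, smul_neg, gvol]

theorem gvol_mem_span (k : ℕ) (I : List (Fin n)) :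
    gvol k I ∈ Submodule.span ℝ {x : Gr n | ∃ l : List (Fin n), l.length = k ∧ x = word odd l} := by
  refine Submodule.smul_mem _ _ (sum_mem fun f _ => Submodule.smul_mem _ _
    (Submodule.subset_span ⟨List.ofFn f, by simp, rfl⟩))

theorem word_odd_eq (l : List (Fin n)) : (word odd l : Gr n) = toTensor.symm
    ((l.map fun i => ExteriorAlgebra.ι ℝ (Finsupp.single i (1 : ℝ))).prod ⊗ₜ 1) := by
  induction l with
  | nil => rfl
  | cons a l ih => rw [word_cons, ih, odd_mul_symm, List.map_cons, List.prod_cons]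

/-- For a permutation both the word and the determinant produce its sign; otherwise a letter is
repeated, two rows agree, and both sides vanish. -/
theorem word_ofFn (f : Fin n → Fin n) :
    (word odd (List.ofFn f) : Gr n) = levi (List.ofFn f) • word odd (List.finRange n) := by
  by_cases hf : Function.Injective f
  · let σ : Equiv.Perm (Fin n) := Equiv.ofBijective f (Finite.injective_iff_bijective.1 hf)
    have h1 : levi (List.ofFn f) = (Equiv.Perm.sign σ : ℤ) := by
      rw [levi_ofFn, ← Matrix.det_permutation σ]
      congr 1
      ext i j
      simp [σ, Equiv.toPEquiv, PEquiv.toMatrix_apply]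
    have h2 : ∀ g : Fin n → Fin n, (word odd (List.ofFn g) : Gr n) = toTensor.symm
        (ExteriorAlgebra.ιMulti ℝ n (fun i => Finsupp.single (g i) (1 : ℝ)) ⊗ₜ 1) := by
      intro g
      rw [word_odd_eq, ExteriorAlgebra.ιMulti_apply, List.map_ofFn]
      rfl
    have h3 := (ExteriorAlgebra.ιMulti ℝ n (M := Fin n →₀ ℝ)).map_perm
      (fun i => Finsupp.single i (1 : ℝ)) σ
    have h4 : (fun i => Finsupp.single (f i) (1 : ℝ)) =
      (fun i => Finsupp.single i (1 : ℝ)) ∘ σ := rfl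
    have h5 : List.finRange n = List.ofFn (id : Fin n → Fin n) := (List.ofFn_id n).symm
    rw [h5, h2, h2, h4, h3, h1]
    rcases Int.units_eq_one_or (Equiv.Perm.sign σ) with h | h
    · rw [h]; simp
    · rw [h]; simp [TensorProduct.neg_tmul]
  · rw [word_eq_zero isPar_odd (by rwa [List.nodup_ofFn])]
    have : levi (List.ofFn f) = 0 := by
      rw [levi_ofFn]
      rw [Function.Injective] at hf
      push Not at hf
      obtain ⟨i, j, hij, hne⟩ := hf
      exact Matrix.det_zero_of_row_eq hne (by ext k; simp [hij])
    rw [this, zero_smul]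

/-- Only `c ≠ 0` is needed, so the permutations are not counted: up to the factorial, `c` is a sum
of squares in which the identity contributes one. -/
theorem exists_gvol_eq : ∃ c : ℝ, c ≠ 0 ∧ gvol n [] = c • (word odd (List.finRange n) : Gr n) := by
  refine ⟨((n.factorial : ℝ)⁻¹) * ∑ f : Fin n → Fin n, levi (List.ofFn f) * levi (List.ofFn f),
    ?_, ?_⟩
  · have h1 : levi (List.ofFn (id : Fin n → Fin n)) = 1 := by
      rw [levi_ofFn]
      have : (Matrix.of fun i j : Fin n => if id i = j then (1 : ℝ) else 0) = 1 := by
        ext i j; simp [Matrix.one_apply]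
      rw [this, Matrix.det_one]
    have h2 : 0 < ∑ f : Fin n → Fin n, levi (List.ofFn f) * levi (List.ofFn f) :=
      Finset.sum_pos' (fun f _ => mul_self_nonneg _) ⟨id, Finset.mem_univ _, by rw [h1]; norm_num⟩
    have h3 : (0 : ℝ) < n.factorial := by positivity
    positivity
  · rw [gvol, epsSum, mul_smul, Finset.sum_smul]
    congr 1
    refine Finset.sum_congr rfl fun f _ => ?_
    rw [List.nil_append, word_ofFn, smul_smul]

theorem odd_mul_gvol_nil (d : Fin n) : odd d * gvol n [] = 0 := by
  obtain ⟨c, -, h⟩ := exists_gvol_eq (n := n)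
  rw [h, mul_smul_comm, word_mul_self isPar_odd (List.mem_finRange d), smul_zero]

/-- The Clifford relation between multiplication and differentiation. It drives the contraction
identities below, starting from the volume element, which every generator annihilates. -/
theorem odd_mul_oddDeriv (a d : Fin n) (x : Gr n) :
    odd d * oddDeriv a x = (if d = a then 1 else 0 : ℝ) • x - oddDeriv a (odd d * x) := by
  rw [isDer_oddDeriv (k := 1) (by decide), AlgHom.id_apply, AlgHom.id_apply, tw_one, inv_odd,
    oddDeriv_odd, ite_mul, one_mul, zero_mul, ite_smul, one_smul, zero_smul]
  simp

theorem odd_mul_gvol_one (hn : 2 < n) (d a : Fin n) :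
    odd d * gvol (n - 1) [a] = (if d = a then 1 else 0 : ℝ) • gvol n [] := by
  have h := oddDeriv_gvol a (n - 1) [] (by simp; omega)
  rw [show n - 1 + 1 = n by omega] at h
  rw [← List.nil_append [a], ← h, odd_mul_oddDeriv, odd_mul_gvol_nil, map_zero, sub_zero]

theorem odd_mul_gvol_two (hn : 2 < n) (d a b : Fin n) :
    odd d * gvol (n - 2) [a, b] = (if d = b then 1 else 0 : ℝ) • gvol (n - 1) [a] -
      (if d = a then 1 else 0 : ℝ) • gvol (n - 1) [b] := by
  have h := oddDeriv_gvol b (n - 2) [a] (by simp; omega)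
  rw [show n - 2 + 1 = n - 1 by omega] at h
  have h' := oddDeriv_gvol b (n - 1) [] (by simp; omega)
  rw [show n - 1 + 1 = n by omega] at h'
  rw [show [a, b] = [a] ++ [b] from rfl, ← h, odd_mul_oddDeriv, odd_mul_gvol_one hn, map_smul, h',
    List.nil_append]

/-- Write the contraction with three indices as a derivative of the one with two, commute the
generator through that derivative, and apply the previous identity. -/
theorem odd_mul_gvol_three (hn : 2 < n) (d a b c : Fin n) :
    odd d * gvol (n - 3) [a, b, c] = (if d = c then 1 else 0 : ℝ) • gvol (n - 2) [a, b] -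
      (if d = b then 1 else 0 : ℝ) • gvol (n - 2) [a, c] +
      (if d = a then 1 else 0 : ℝ) • gvol (n - 2) [b, c] := by
  have h := oddDeriv_gvol c (n - 3) [a, b] (by simp; omega)
  rw [show n - 3 + 1 = n - 2 by omega] at h
  have h' := fun a => oddDeriv_gvol c (n - 2) [a] (by simp; omega)
  rw [show n - 2 + 1 = n - 1 by omega] at h'
  rw [show [a, b, c] = [a, b] ++ [c] from rfl, ← h, odd_mul_oddDeriv, odd_mul_gvol_two hn, map_sub,
    map_smul, map_smul, h', h']
  simp only [List.singleton_append]
  abel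

/-- The generalized Kronecker symbol. -/
def kron3 (d f g a b c : Fin n) : ℝ :=
  (if g = c then 1 else 0) * ((if f = b then 1 else 0) * (if d = a then 1 else 0) -
      (if f = a then 1 else 0) * (if d = b then 1 else 0)) -
    (if g = b then 1 else 0) * ((if f = c then 1 else 0) * (if d = a then 1 else 0) -
      (if f = a then 1 else 0) * (if d = c then 1 else 0)) +
    (if g = a then 1 else 0) * ((if f = c then 1 else 0) * (if d = b then 1 else 0) -
      (if f = b then 1 else 0) * (if d = c then 1 else 0))

theorem word_mul_gvol_three (hn : 2 < n) (d f g a b c : Fin n) :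
    word odd [d, f, g] * gvol (n - 3) [a, b, c] = kron3 d f g a b c • gvol n [] := by
  simp only [word_cons, word_nil, mul_one, mul_assoc]
  rw [odd_mul_gvol_three hn]
  simp only [mul_add, mul_sub, mul_smul_comm, odd_mul_gvol_two hn, odd_mul_gvol_one hn, kron3]
  module

/-! ## Substitution of odd elements -/

section subst

variable {O E C : Type} [CommRing C] [Algebra ℝ C] (y : Fin n → FreeSuper O E C)
  (hy : ∀ a, IsPar 1 (y a))

/-- The substitution of odd elements for the generators of the Grassmann algebra. -/
def subst : Gr n →ₐ[ℝ] FreeSuper O E C :=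
  liftHom y Empty.elim (Algebra.ofId ℝ _) hy (fun e => e.elim)
    (fun c => by
      rw [IsPar, sg_zero, one_smul, Algebra.ofId_apply, Algebra.algebraMap_eq_smul_one, map_smul,
        map_one])

theorem subst_odd (a : Fin n) : subst y hy (odd a) = y a := liftHom_odd a

theorem subst_word (l : List (Fin n)) : subst y hy (word odd l) = word y l := by
  rw [map_word]
  simp only [subst_odd]

theorem subst_congr {y y' : Fin n → FreeSuper O E C} {hy : ∀ a, IsPar 1 (y a)}
    {hy' : ∀ a, IsPar 1 (y' a)} (h : ∀ a, y a = y' a) : subst y hy = subst y' hy' := by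
  obtain rfl : y = y' := funext h
  rfl

theorem gr_coeff (r : ℝ) : (coeff r : Gr n) = r • 1 := by
  rw [← coeff_one, ← coeff_smul, smul_eq_mul, mul_one]

theorem gr_induction {P : Gr n → Prop} (h1 : P 1) (ho : ∀ o a, P a → P (odd o * a))
    (hadd : ∀ a b, P a → P b → P (a + b)) (hsmul : ∀ (r : ℝ) a, P a → P (r • a)) (a : Gr n) :
    P a := by
  refine FreeSuper.induction (fun c => ?_) ho (fun e => e.elim) hadd hsmul a
  rw [gr_coeff]
  exact hsmul c 1 h1

theorem algHom_comp_subst {O' E' C' : Type} [CommRing C'] [Algebra ℝ C']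
    (φ : FreeSuper O E C →ₐ[ℝ] FreeSuper O' E' C') (hφy : ∀ a, IsPar 1 (φ (y a))) (x : Gr n) :
    φ (subst y hy x) = subst (fun a => φ (y a)) hφy x := by
  induction x using gr_induction with
  | h1 => simp
  | ho o a ih => rw [map_mul, map_mul, map_mul, ih, subst_odd, subst_odd]
  | hadd a b ha hb => rw [map_add, map_add, map_add, ha, hb]
  | hsmul r a ha => rw [map_smul, map_smul, map_smul, ha]

theorem inv_subst (x : Gr n) : subst y hy (inv x) = inv (subst y hy x) := by
  induction x using gr_induction with
  | h1 => simp
  | ho o a ih =>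
    rw [map_mul, map_mul, map_mul, map_mul, ih, subst_odd, inv_odd, map_neg, subst_odd, hy o,
      sg_odd (by decide), neg_one_smul]
  | hadd a b ha hb => simp only [map_add, ha, hb]
  | hsmul r a ha => simp only [map_smul, ha]

/-- The chain rule for polynomials in odd elements. The values `D (y a)` are even, so they can be
collected on the left without signs. -/
theorem derivation_subst {D : FreeSuper O E C →ₗ[ℝ] FreeSuper O E C}
    (hD : ∀ a b, D (a * b) = D a * b + inv a * D b) (hDy : ∀ a, IsPar 0 (D (y a))) (x : Gr n) :
    D (subst y hy x) = ∑ a, D (y a) * subst y hy (oddDeriv a x) := by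
  have hD1 : D 1 = 0 := by
    have := hD 1 1
    simpa using this
  induction x using gr_induction with
  | h1 =>
    rw [map_one, hD1, Finset.sum_eq_zero]
    intro a _
    rw [(isDer_oddDeriv (k := 1) (by decide) a).map_one, map_zero, mul_zero]
  | ho o x ih =>
    have h1 : ∀ a, D (y a) * subst y hy (oddDeriv a (odd o * x)) =
        (if o = a then D (y a) * subst y hy x else 0) -
          y o * (D (y a) * subst y hy (oddDeriv a x)) := by
      intro a
      rw [isDer_oddDeriv (k := 1) (by decide), AlgHom.id_apply, AlgHom.id_apply, tw_one, inv_odd,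
        oddDeriv_odd, map_add, map_mul, map_mul, map_neg, subst_odd, mul_add, ← mul_assoc (y o),
        ← (hDy a).comm_even (by decide) (y o)]
      split_ifs
      · rw [map_one, one_mul, neg_mul, mul_neg, ← sub_eq_add_neg, mul_assoc]
      · rw [map_zero, zero_mul, mul_zero, neg_mul, mul_neg, ← sub_eq_add_neg, mul_assoc]
    rw [map_mul, subst_odd, hD, ih, Finset.sum_congr rfl fun a _ => h1 a,
      Finset.sum_sub_distrib, Finset.sum_ite_eq, if_pos (Finset.mem_univ o), hy o,
      sg_odd (by decide), neg_one_smul, neg_mul, Finset.mul_sum, sub_eq_add_neg]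
  | hadd a b ha hb => simp only [map_add, mul_add, Finset.sum_add_distrib, ha, hb]
  | hsmul r a ha => simp only [map_smul, mul_smul_comm, ha, Finset.smul_sum]

/-- The left ideal generated by the monomials of length at least `m`. -/
def wordIdeal (m : ℕ) : Submodule ℝ (FreeSuper O E C) :=
  Submodule.span ℝ {x | ∃ (a : FreeSuper O E C) (l : List (Fin n)), m ≤ l.length ∧
    x = a * word y l}

variable {y}

theorem word_mem_wordIdeal {l : List (Fin n)} {m : ℕ} (h : m ≤ l.length) (a : FreeSuper O E C) :
    a * word y l ∈ wordIdeal y m :=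
  Submodule.subset_span ⟨a, l, h, rfl⟩

theorem wordIdeal_le {m m' : ℕ} (h : m ≤ m') : wordIdeal y m' ≤ wordIdeal y m := by
  refine Submodule.span_mono ?_
  rintro x ⟨a, l, hl, rfl⟩
  exact ⟨a, l, h.trans hl, rfl⟩

theorem mul_mem_wordIdeal {m : ℕ} (a : FreeSuper O E C) {x : FreeSuper O E C}
    (hx : x ∈ wordIdeal y m) : a * x ∈ wordIdeal y m := by
  induction hx using Submodule.span_induction with
  | mem x hx =>
    obtain ⟨b, l, hl, rfl⟩ := hx
    rw [← mul_assoc]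
    exact word_mem_wordIdeal hl _
  | zero => rw [mul_zero]; exact zero_mem _
  | add x y _ _ hx hy => rw [mul_add]; exact add_mem hx hy
  | smul r x _ hx => rw [mul_smul_comm]; exact Submodule.smul_mem _ r hx

theorem wordIdeal_mul (hy : ∀ a, IsPar 1 (y a)) {k m m' : ℕ} (hk : k ≤ m + m')
    {x x' : FreeSuper O E C} (hx : x ∈ wordIdeal y m) (hx' : x' ∈ wordIdeal y m') :
    x * x' ∈ wordIdeal y k := by
  induction hx using Submodule.span_induction with
  | mem x hx =>
    obtain ⟨b, l, hl, rfl⟩ := hx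
    induction hx' using Submodule.span_induction with
    | mem x hx =>
      obtain ⟨b', l', hl', rfl⟩ := hx
      have : b * word y l * (b' * word y l') =
          b * FreeSuper.tw l.length b' * word y (l ++ l') := by
        rw [word_append, mul_assoc, ← mul_assoc (word y l), (IsPar.word hy l).comm b']
        simp only [mul_assoc]
      rw [this]
      exact word_mem_wordIdeal (by rw [List.length_append]; omega) _
    | zero => rw [mul_zero]; exact zero_mem _
    | add x y _ _ hx hy => rw [mul_add]; exact add_mem hx hy
    | smul r x _ hx => rw [mul_smul_comm]; exact Submodule.smul_mem _ r hx
  | zero => rw [zero_mul]; exact zero_mem _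
  | add x y _ _ hx hy => rw [add_mul]; exact add_mem hx hy
  | smul r x _ hx => rw [smul_mul_assoc]; exact Submodule.smul_mem _ r hx

/-- Pigeonhole: a word of more than `n` letters in `n` odd elements repeats a letter. -/
theorem eq_zero_of_mem_wordIdeal (hy : ∀ a, IsPar 1 (y a)) {m : ℕ} (hm : n < m)
    {x : FreeSuper O E C} (hx : x ∈ wordIdeal y m) : x = 0 := by
  induction hx using Submodule.span_induction with
  | mem x hx =>
    obtain ⟨b, l, hl, rfl⟩ := hx
    rw [word_eq_zero hy, mul_zero]
    intro h
    have := h.length_le_card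
    simp at this
    omega
  | zero => rfl
  | add x y _ _ hx hy => rw [hx, hy, add_zero]
  | smul r x _ hx => rw [hx, smul_zero]

theorem self_mem_wordIdeal (a : Fin n) : y a ∈ wordIdeal y 1 := by
  have := word_mem_wordIdeal (y := y) (l := [a]) (m := 1) le_rfl 1
  simpa using this

theorem subst_oddDeriv_word_mem (hy : ∀ a, IsPar 1 (y a)) (b : Fin n) (l : List (Fin n)) :
    subst y hy (oddDeriv b (word odd l)) ∈ wordIdeal y (l.length - 1) := by
  induction l with
  | nil =>
    rw [word_nil, (isDer_oddDeriv (k := 1) (by decide) b).map_one, map_zero]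
    exact zero_mem _
  | cons a l ih =>
    rw [word_cons, isDer_oddDeriv (k := 1) (by decide), AlgHom.id_apply, AlgHom.id_apply, tw_one,
      inv_odd, oddDeriv_odd, map_add, map_mul, map_mul, map_neg, subst_odd, subst_word]
    refine add_mem (word_mem_wordIdeal (by simp) _) ?_
    rw [neg_mul]
    refine Submodule.neg_mem _ ?_
    rcases l with _ | ⟨c, l⟩
    · rw [word_nil, (isDer_oddDeriv (k := 1) (by decide) b).map_one, map_zero, mul_zero]
      exact zero_mem _
    · exact wordIdeal_mul hy (by simp only [List.length_cons]; omega) (self_mem_wordIdeal a) ih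

/-- Replacing one `y` by `k` gains at least two letters, since `k` is at least cubic. The terms of
second order in `k`, which make up the error, therefore gain at least four. -/
theorem subst_add_word (hy : ∀ a, IsPar 1 (y a)) {k : Fin n → FreeSuper O E C}
    (hk : ∀ a, k a ∈ wordIdeal y 3) (hkp : ∀ a, IsPar 1 (k a)) (l : List (Fin n)) :
    word (fun a => y a + k a) l - word y l -
      ∑ b, k b * subst y hy (oddDeriv b (word odd l)) ∈ wordIdeal y (l.length + 4) := by
  induction l with
  | nil =>
    rw [word_nil, word_nil, word_nil, sub_self, zero_sub, Finset.sum_eq_zero, neg_zero]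
    · exact zero_mem _
    · intro b _
      rw [(isDer_oddDeriv (k := 1) (by decide) b).map_one, map_zero, mul_zero]
  | cons a l ih =>
    set K := ∑ b, k b * subst y hy (oddDeriv b (word odd l)) with hK
    have hsum : ∑ b, k b * subst y hy (oddDeriv b (word odd (a :: l))) =
        k a * word y l + y a * K := by
      have h1 : ∀ b, k b * subst y hy (oddDeriv b (word odd (a :: l))) =
          (if a = b then k b * word y l else 0) +
            y a * (k b * subst y hy (oddDeriv b (word odd l))) := by
        intro b
        rw [word_cons, isDer_oddDeriv (k := 1) (by decide), AlgHom.id_apply, AlgHom.id_apply,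
          tw_one, inv_odd, oddDeriv_odd, map_add, map_mul, map_mul, map_neg, subst_odd, subst_word,
          mul_add, ← mul_assoc (y a), (hy a).comm_isPar (hkp b), sg_odd (by decide)]
        split_ifs
        · rw [map_one, one_mul, neg_mul, mul_neg, neg_one_smul, neg_mul, mul_assoc]
        · rw [map_zero, zero_mul, mul_zero, neg_mul, mul_neg, neg_one_smul, neg_mul, mul_assoc]
      rw [Finset.sum_congr rfl fun b _ => h1 b, Finset.sum_add_distrib, Finset.sum_ite_eq,
        if_pos (Finset.mem_univ a), ← Finset.mul_sum]
    have hKm : K ∈ wordIdeal y (l.length + 2) := by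
      rw [hK]
      refine sum_mem fun b _ => ?_
      rcases l with _ | ⟨c, l⟩
      · rw [word_nil, (isDer_oddDeriv (k := 1) (by decide) b).map_one, map_zero, mul_zero]
        exact zero_mem _
      · exact wordIdeal_mul hy (by simp; omega) (hk b) (subst_oddDeriv_word_mem hy b _)
    rw [hsum, word_cons, word_cons]
    have h2 : (y a + k a) * word (fun a => y a + k a) l - y a * word y l -
        (k a * word y l + y a * K) =
        y a * (word (fun a => y a + k a) l - word y l - K) +
          (k a * (word (fun a => y a + k a) l - word y l - K) + k a * K) := by
      noncomm_ring
    rw [h2, List.length_cons]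
    exact add_mem (wordIdeal_mul hy (by omega) (self_mem_wordIdeal a) ih)
      (add_mem (wordIdeal_mul hy (by omega) (hk a) ih)
        (wordIdeal_mul hy (by omega) (hk a) hKm))

/-- The words have `n - 2` letters, so the error of the first-order expansion has at least `n + 2`
and vanishes. This exact truncation reduces the dependence on the higher coefficients of `ξ(θ)` to
finitely few combinations. -/
theorem subst_add_gvol_two (hn : 2 < n) (hy : ∀ a, IsPar 1 (y a)) {k : Fin n → FreeSuper O E C}
    (hk : ∀ a, k a ∈ wordIdeal y 3) (hkp : ∀ a, IsPar 1 (k a)) (b c : Fin n) :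
    subst (fun a => y a + k a) (fun a => (hy a).add (hkp a)) (gvol (n - 2) [b, c]) =
      subst y hy (gvol (n - 2) [b, c]) +
        ∑ a, k a * subst y hy (gvol (n - 3) [b, c, a]) := by
  have h1 : ∀ x ∈ Submodule.span ℝ {x : Gr n | ∃ l : List (Fin n), l.length = n - 2 ∧
      x = word odd l}, subst (fun a => y a + k a) (fun a => (hy a).add (hkp a)) x =
      subst y hy x + ∑ a, k a * subst y hy (oddDeriv a x) := by
    intro x hx
    induction hx using Submodule.span_induction with
    | mem x hx =>
      obtain ⟨l, hl, rfl⟩ := hx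
      have := eq_zero_of_mem_wordIdeal hy (by omega) (subst_add_word hy hk hkp l)
      rw [subst_word, subst_word]
      rw [sub_sub, sub_eq_zero] at this
      exact this
    | zero => simp
    | add x y _ _ hx hy => simp only [map_add, mul_add, Finset.sum_add_distrib, hx, hy]; abel
    | smul r x _ hx => simp only [map_smul, mul_smul_comm, hx, Finset.smul_sum, smul_add]
  rw [h1 _ (gvol_mem_span _ _)]
  congr 1
  refine Finset.sum_congr rfl fun a _ => ?_
  have h := oddDeriv_gvol a (n - 3) [b, c] (by simp; omega)
  rw [show n - 3 + 1 = n - 2 by omega] at h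
  rw [h]
  rfl

end subst

end CartanWeyl

namespace CartanWeyl

open FreeSuper

variable {n : ℕ}

/-! ## Contractions of the generalized Kronecker symbol -/

theorem sum_kron3_first (f g b c : Fin n) : ∑ a, kron3 a f g a b c =
    ((n : ℝ) - 2) * ((if f = b then 1 else 0) * (if g = c then 1 else 0) -
      (if f = c then 1 else 0) * (if g = b then 1 else 0)) := by
  have h1 : ∀ a, kron3 a f g a b c =
      ((if f = b then 1 else 0) * (if g = c then 1 else 0) -
        (if f = c then 1 else 0) * (if g = b then 1 else 0)) -
      (if a = b then (if g = c then 1 else 0) * (if f = a then 1 else 0) else 0) +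
      (if a = c then (if g = b then 1 else 0) * (if f = a then 1 else 0) else 0) +
      (if a = b then (if g = a then 1 else 0) * (if f = c then 1 else 0) else 0) -
      (if a = c then (if g = a then 1 else 0) * (if f = b then (1 : ℝ) else 0) else 0) := by
    intro a
    simp only [kron3, if_true]
    split_ifs <;> norm_num
  rw [Finset.sum_congr rfl fun a _ => h1 a]
  simp only [Finset.sum_sub_distrib, Finset.sum_add_distrib, Finset.sum_ite_eq', Finset.mem_univ,
    if_true, Finset.sum_const, Finset.card_univ, Fintype.card_fin, nsmul_eq_mul]
  ring

theorem kron3_swap (d f g a b c : Fin n) : kron3 d f g a b c = kron3 f d g b a c := by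
  simp only [kron3]; ring

theorem sum_kron3_second (d g a c : Fin n) : ∑ b, kron3 d b g a b c =
    ((n : ℝ) - 2) * ((if d = a then 1 else 0) * (if g = c then 1 else 0) -
      (if d = c then 1 else 0) * (if g = a then 1 else 0)) := by
  rw [← sum_kron3_first]
  exact Finset.sum_congr rfl fun b _ => kron3_swap _ _ _ _ _ _

/-- Tracing over two pairs of indices yields `(n - 2)(n - 1) C d`. -/
theorem eq_zero_of_kron3_vector (hn : 2 < n) (C : Fin n → ℝ)
    (h : ∀ d f g b c, ∑ a, C a * kron3 d f g a b c = 0) : C = 0 := by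
  have hn' : (2 : ℝ) < n := by exact_mod_cast hn
  funext d
  have h1 : ∑ c, ∑ b, ∑ a, C a * kron3 d b c a b c = 0 :=
    Finset.sum_eq_zero fun c _ => Finset.sum_eq_zero fun b _ => h _ _ _ _ _
  have h2 : ∀ c, ∑ b, ∑ a, C a * kron3 d b c a b c =
      ((n : ℝ) - 2) * (C d - if d = c then C c else 0) := by
    intro c
    rw [Finset.sum_comm]
    simp_rw [← Finset.mul_sum, sum_kron3_second]
    simp only [mul_sub, mul_ite, mul_one, mul_zero, Finset.sum_sub_distrib, if_true,
      Finset.sum_ite_eq, Finset.mem_univ]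
    split_ifs <;> ring
  simp_rw [h2] at h1
  rw [← Finset.mul_sum, Finset.sum_sub_distrib, Finset.sum_ite_eq, if_pos (Finset.mem_univ d)] at h1
  simp only [Finset.sum_const, Finset.card_univ, Fintype.card_fin, nsmul_eq_mul] at h1
  have h3 : ((n : ℝ) - 2) * ((n - 1) * C d) = 0 := by linarith
  rcases mul_eq_zero.1 h3 with h3 | h3
  · linarith
  · rcases mul_eq_zero.1 h3 with h3 | h3
    · linarith
    · exact h3

/-- One trace yields `(n - 2)(δ tr C - C) = 0`, so `C` is its trace times the identity. Taking the
trace again gives `(n - 1) tr C = 0`. -/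
theorem eq_zero_of_kron3_matrix (hn : 2 < n) (C : Fin n → Fin n → ℝ)
    (h : ∀ f g b c, ∑ a, ∑ d, C a d * kron3 d f g a b c = 0) : C = 0 := by
  have hn' : (2 : ℝ) < n := by exact_mod_cast hn
  have h2 : ∀ g c, (if g = c then ∑ a, C a a else 0) = C g c := by
    intro g c
    have h1 : ∑ b, ∑ a, ∑ d, C a d * kron3 d b g a b c = 0 :=
      Finset.sum_eq_zero fun b _ => h _ _ _ _
    rw [Finset.sum_comm] at h1
    have h0 : ∀ a, ∑ b, ∑ d, C a d * kron3 d b g a b c = ∑ d, C a d * ∑ b, kron3 d b g a b c := by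
      intro a
      rw [Finset.sum_comm]
      simp_rw [Finset.mul_sum]
    simp_rw [h0, sum_kron3_second] at h1
    have h3 : ∀ a, ∑ d, C a d * (((n : ℝ) - 2) * ((if d = a then 1 else 0) *
        (if g = c then 1 else 0) - (if d = c then 1 else 0) * (if g = a then 1 else 0))) =
        ((n : ℝ) - 2) * ((if g = c then C a a else 0) - if g = a then C a c else 0) := by
      intro a
      simp only [mul_sub, mul_ite, mul_one, mul_zero,
        Finset.sum_sub_distrib, Finset.sum_ite_eq', Finset.sum_ite_irrel, Finset.mem_univ,
        if_true, Finset.sum_const_zero]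
      split_ifs <;> ring
    simp_rw [h3] at h1
    rw [← Finset.mul_sum, Finset.sum_sub_distrib, Finset.sum_ite_eq, if_pos (Finset.mem_univ g),
      Finset.sum_ite_irrel, Finset.sum_const_zero] at h1
    rcases mul_eq_zero.1 h1 with h4 | h4
    · linarith
    · linarith
  have h3 : ∑ a, C a a = 0 := by
    have h4 : ∑ a, C a a = ∑ a : Fin n, ∑ b, C b b := by
      refine Finset.sum_congr rfl fun a _ => ?_
      rw [← h2 a a, if_pos rfl]
    rw [Finset.sum_const, Finset.card_univ, Fintype.card_fin, nsmul_eq_mul] at h4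
    have h5 : ((n : ℝ) - 1) * ∑ a, C a a = 0 := by linarith
    rcases mul_eq_zero.1 h5 with h5 | h5
    · linarith
    · exact h5
  funext g c
  rw [← h2, h3, ite_self]
  rfl

/-- By antisymmetry, one trace yields `2 (n - 2) C`. -/
theorem eq_zero_of_kron3_form (hn : 2 < n) (C : Fin n → Fin n → ℝ) (hC : ∀ b c, C b c = -C c b)
    (h : ∀ d f g a, ∑ b, ∑ c, C b c * kron3 d f g a b c = 0) : C = 0 := by
  have hn' : (2 : ℝ) < n := by exact_mod_cast hn
  funext f g
  have h1 : ∑ a, ∑ b, ∑ c, C b c * kron3 a f g a b c = 0 :=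
    Finset.sum_eq_zero fun b _ => h _ _ _ _
  rw [Finset.sum_comm] at h1
  have h0 : ∀ b, ∑ a, ∑ c, C b c * kron3 a f g a b c = ∑ c, C b c * ∑ a, kron3 a f g a b c := by
    intro b
    rw [Finset.sum_comm]
    simp_rw [Finset.mul_sum]
  simp_rw [h0, sum_kron3_first] at h1
  have h3 : ∀ b, ∑ c, C b c * (((n : ℝ) - 2) * ((if f = b then 1 else 0) *
      (if g = c then 1 else 0) - (if f = c then 1 else 0) * (if g = b then 1 else 0))) =
      ((n : ℝ) - 2) * ((if f = b then C b g else 0) - if g = b then C b f else 0) := by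
    intro b
    simp only [mul_sub, mul_ite, mul_one, mul_zero,
      Finset.sum_sub_distrib, Finset.sum_ite_eq, Finset.sum_ite_irrel, Finset.mem_univ,
      if_true, Finset.sum_const_zero]
    split_ifs <;> ring
  simp_rw [h3] at h1
  rw [← Finset.mul_sum, Finset.sum_sub_distrib, Finset.sum_ite_eq, Finset.sum_ite_eq,
    if_pos (Finset.mem_univ f), if_pos (Finset.mem_univ g), hC g f] at h1
  have h3 : ((n : ℝ) - 2) * (2 * C f g) = 0 := by linarith
  rcases mul_eq_zero.1 h3 with h3 | h3
  · linarith
  · change C f g = 0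
    linarith

theorem sum_mul_kron3 (C : Fin n → Fin n → Fin n → ℝ) (hC : ∀ b c g, C b c g = -C c b g)
    (d f a : Fin n) : ∑ b, ∑ c, ∑ g, C b c g * kron3 d f g a b c =
      2 * ((if d = a then ∑ c, C f c c else 0) - (if f = a then ∑ c, C d c c else 0) +
        C d f a) := by
  have h1 : ∀ b c, ∑ g, C b c g * kron3 d f g a b c =
      C b c c * ((if f = b then 1 else 0) * (if d = a then 1 else 0) -
        (if f = a then 1 else 0) * (if d = b then 1 else 0)) -
      C b c b * ((if f = c then 1 else 0) * (if d = a then 1 else 0) -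
        (if f = a then 1 else 0) * (if d = c then 1 else 0)) +
      C b c a * ((if f = c then 1 else 0) * (if d = b then 1 else 0) -
        (if f = b then 1 else 0) * (if d = c then 1 else 0)) := by
    intro b c
    simp only [kron3, mul_sub, mul_add, Finset.sum_sub_distrib, Finset.sum_add_distrib,
      mul_ite, mul_one, mul_zero, Finset.sum_ite_irrel,
      Finset.sum_const_zero, Finset.sum_ite_eq', Finset.mem_univ, if_true]
  have h2 : ∀ b, ∑ c, ∑ g, C b c g * kron3 d f g a b c =
      (if f = b then if d = a then ∑ c, C b c c else 0 else 0) -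
      (if d = b then if f = a then ∑ c, C b c c else 0 else 0) -
      ((if d = a then C b f b else 0) - (if f = a then C b d b else 0)) +
      ((if d = b then C b f a else 0) - (if f = b then C b d a else 0)) := by
    intro b
    simp only [h1]
    simp only [mul_sub, Finset.sum_sub_distrib, Finset.sum_add_distrib,
      mul_ite, mul_one, mul_zero, Finset.sum_ite_irrel,
      Finset.sum_const_zero, Finset.sum_ite_eq, Finset.mem_univ, if_true]
    split_ifs <;> ring
  have h3 : ∀ f, ∑ b, C b f b = -∑ b, C f b b := by
    intro f
    rw [← Finset.sum_neg_distrib]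
    exact Finset.sum_congr rfl fun b _ => hC _ _ _
  simp only [h2, Finset.sum_sub_distrib, Finset.sum_add_distrib, Finset.sum_ite_irrel,
    Finset.sum_const_zero, Finset.sum_ite_eq, Finset.mem_univ, if_true, h3]
  rw [hC f d a]
  split_ifs <;> ring

/-- By `sum_mul_kron3` the condition says that `C` is built from its trace vector and Kronecker
symbols. Its trace reads `(n - 2) ∑ C f c c = 0`, so the trace vector vanishes, and then so does
`C`. -/
theorem eq_zero_of_kron3_tensor (hn : 2 < n) (C : Fin n → Fin n → Fin n → ℝ)
    (hC : ∀ b c g, C b c g = -C c b g)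
    (h : ∀ d f a, ∑ b, ∑ c, ∑ g, C b c g * kron3 d f g a b c = 0) : C = 0 := by
  have hn' : (2 : ℝ) < n := by exact_mod_cast hn
  have h1 : ∀ d f a, (if d = a then ∑ c, C f c c else 0) - (if f = a then ∑ c, C d c c else 0) +
      C d f a = 0 := by
    intro d f a
    have := h d f a
    rw [sum_mul_kron3 C hC] at this
    linarith
  have hT : ∀ f, ∑ c, C f c c = 0 := by
    intro f
    have h2 : ∑ a, ((if a = a then ∑ c, C f c c else 0) - (if f = a then ∑ c, C a c c else 0) +
      C a f a) = 0 := Finset.sum_eq_zero fun a _ => h1 a f a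
    have h3 : ∑ b, C b f b = -∑ b, C f b b := by
      rw [← Finset.sum_neg_distrib]
      exact Finset.sum_congr rfl fun b _ => hC _ _ _
    simp only [if_true, Finset.sum_sub_distrib, Finset.sum_add_distrib, Finset.sum_const,
      Finset.card_univ, Fintype.card_fin, nsmul_eq_mul, Finset.sum_ite_eq, Finset.mem_univ,
      h3] at h2
    have h4 : ((n : ℝ) - 2) * ∑ c, C f c c = 0 := by linarith
    rcases mul_eq_zero.1 h4 with h4 | h4
    · linarith
    · exact h4
  funext d f a
  have := h1 d f a
  rw [hT, hT, ite_self, ite_self, sub_zero, zero_add] at this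
  exact this

end CartanWeyl

namespace CartanWeyl

open FreeSuper

variable {n : ℕ}

/-! ## Nondegeneracy of the contractions of the volume element -/

theorem word_sum_smul_mem {I J A : Type} [Ring A] [Algebra ℝ A] [Fintype J] (c : I → J → ℝ)
    (z : J → A) (l : List I) : word (fun i => ∑ j, c i j • z j) l ∈
      Submodule.span ℝ {x | ∃ l' : List J, l'.length = l.length ∧ x = word z l'} := by
  induction l with
  | nil => exact Submodule.subset_span ⟨[], rfl, rfl⟩
  | cons i l ih =>
    rw [word_cons, Finset.sum_mul]
    refine sum_mem fun j _ => ?_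
    rw [smul_mul_assoc]
    refine Submodule.smul_mem _ _ ?_
    generalize word (fun i => ∑ j, c i j • z j) l = w at ih ⊢
    induction ih using Submodule.span_induction with
    | mem x hx =>
      obtain ⟨l', hl, rfl⟩ := hx
      exact Submodule.subset_span ⟨j :: l', by simp [hl], by rw [word_cons]⟩
    | zero => rw [mul_zero]; exact zero_mem _
    | add x y _ _ hx hy => rw [mul_add]; exact add_mem hx hy
    | smul r x _ hx => rw [mul_smul_comm]; exact Submodule.smul_mem _ r hx

theorem exists_word_odd_eq {l : List (Fin n)} (hl : l.length = n) :
    ∃ r : ℝ, (word odd l : Gr n) = r • word odd (List.finRange n) := by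
  obtain ⟨f, rfl⟩ : ∃ f : Fin n → Fin n, l = List.ofFn f := by
    have h : ∀ (k : ℕ), l.length = k → ∃ f : Fin k → Fin n, l = List.ofFn f := by
      rintro _ rfl
      exact ⟨l.get, (List.ofFn_get l).symm⟩
    exact h n hl
  exact ⟨_, word_ofFn f⟩

theorem berezin_word_of_length_ne {O E C : Type} [CommRing C] [Algebra ℝ C] {l : List (Fin n)}
    (hl : l.length ≠ n) : berezin n (word th l : FreeSuper (O ⊕ Fin n) E C) = 0 := by
  by_cases hd : l.Nodup
  · have : ∃ μ, μ ∉ l := by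
      by_contra! h
      have h2 : l.toFinset = Finset.univ := by ext μ; simp [h μ]
      have h3 := List.toFinset_card_of_nodup hd
      rw [h2, Finset.card_univ, Fintype.card_fin] at h3
      exact hl h3.symm
    obtain ⟨μ, hμ⟩ := this
    exact berezin_word_of_notMem hμ
  · rw [word_eq_zero isPar_th hd, map_zero]

theorem isPar_word_odd (l : List (Fin n)) : IsPar l.length (word odd l : Gr n) :=
  IsPar.word isPar_odd l

theorem isPar_gvol (k : ℕ) (I : List (Fin n)) : IsPar k (gvol k I) := by
  have h := gvol_mem_span k I
  generalize gvol k I = w at h ⊢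
  induction h using Submodule.span_induction with
  | mem x hx => obtain ⟨l, rfl, rfl⟩ := hx; exact isPar_word_odd l
  | zero => exact isPar_zero _
  | add x y _ _ hx hy => exact hx.add hy
  | smul r x _ hx => exact hx.smul r

theorem isPar_subst {O E C : Type} [CommRing C] [Algebra ℝ C] {y : Fin n → FreeSuper O E C}
    (hy : ∀ a, IsPar 1 (y a)) {k : ℤ} {x : Gr n} (hx : IsPar k x) : IsPar k (subst y hy x) := by
  rw [IsPar, ← inv_subst, hx, map_smul]

/-- The Grassmann algebra of the odd variables `θ`. -/
abbrev Th (n : ℕ) : Type := FreeSuper (Empty ⊕ Fin n) Empty ℝ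

/-- The coefficient of the top monomial. -/
def top (n : ℕ) : Th n →ₗ[ℝ] ℝ := (ord0 : FreeSuper Empty Empty ℝ →ₐ[ℝ] ℝ).toLinearMap ∘ₗ berezin n

theorem top_finRange : top n (word th (List.finRange n)) = 1 := by
  rw [top, LinearMap.comp_apply, berezin_finRange]
  simp

theorem top_word {l : List (Fin n)} (hl : l.length ≠ n) : top n (word th l) = 0 := by
  rw [top, LinearMap.comp_apply, berezin_word_of_length_ne hl, map_zero]

/-- The linear forms `e^a_μ θ^μ`. -/
def lin (e : Matrix (Fin n) (Fin n) ℝ) (a : Fin n) : Th n := ∑ μ, e a μ • th μ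

theorem isPar_lin (e : Matrix (Fin n) (Fin n) ℝ) (a : Fin n) : IsPar 1 (lin e a) :=
  IsPar.sum fun μ _ => (isPar_th μ).smul _

variable {e : Matrix (Fin n) (Fin n) ℝ}

/-- No determinant is computed: each `θ^μ` is a combination of the forms `e^a θ`, so the top
monomial in `θ` is a multiple of the substituted volume element, which therefore cannot integrate to
zero. -/
theorem top_subst_ne_zero (he : e.det ≠ 0) : top n (subst (lin e) (isPar_lin e) (gvol n [])) ≠ 0 := by
  have hθ : ∀ μ, th μ = subst (lin e) (isPar_lin e) (∑ a, e⁻¹ μ a • odd a) := by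
    intro μ
    have h1 : ∀ ν, ∑ a, e⁻¹ μ a * e a ν = if μ = ν then 1 else 0 := by
      intro ν
      have := congrFun (congrFun (Matrix.nonsing_inv_mul e (Ne.isUnit he)) μ) ν
      rw [Matrix.mul_apply, Matrix.one_apply] at this
      exact this
    simp_rw [map_sum, map_smul, subst_odd, lin, Finset.smul_sum, smul_smul]
    rw [Finset.sum_comm]
    simp_rw [← Finset.sum_smul, h1, ite_smul, one_smul, zero_smul]
    simp
  obtain ⟨c, hc, hv⟩ := exists_gvol_eq (n := n)
  have h1 : ∃ r : ℝ, word (fun μ => ∑ a, e⁻¹ μ a • (odd a : Gr n)) (List.finRange n) =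
      r • word odd (List.finRange n) := by
    have h := word_sum_smul_mem (fun μ a => e⁻¹ μ a) (odd : Fin n → Gr n) (List.finRange n)
    generalize word (fun μ => ∑ a, e⁻¹ μ a • (odd a : Gr n)) (List.finRange n) = w at h ⊢
    induction h using Submodule.span_induction with
    | mem x hx =>
      obtain ⟨l, hl, rfl⟩ := hx
      exact exists_word_odd_eq (by simpa using hl)
    | zero => exact ⟨0, by simp⟩
    | add x y _ _ hx hy =>
      obtain ⟨r, rfl⟩ := hx
      obtain ⟨s, rfl⟩ := hy
      exact ⟨r + s, by rw [add_smul]⟩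
    | smul t x _ hx =>
      obtain ⟨r, rfl⟩ := hx
      exact ⟨t * r, by rw [mul_smul]⟩
  obtain ⟨r, hr⟩ := h1
  have h2 : word th (List.finRange n) =
      r • subst (lin e) (isPar_lin e) (word odd (List.finRange n)) := by
    rw [← map_smul, ← hr, map_word, ← funext hθ]
  have h3 := top_finRange (n := n)
  rw [h2, map_smul] at h3
  rw [hv, map_smul, map_smul, smul_ne_zero_iff]
  refine ⟨hc, fun h => ?_⟩
  rw [h, smul_zero] at h3
  exact zero_ne_one h3

/-- The values of `∫ dⁿθ θ^l 𝒱_{abc}(e θ)`. -/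
def topVol (e : Matrix (Fin n) (Fin n) ℝ) (l : List (Fin n)) (a b c : Fin n) : ℝ :=
  top n (word th l * subst (lin e) (isPar_lin e) (gvol (n - 3) [a, b, c]))

theorem topVol_eq_zero (hn : 2 < n) {l : List (Fin n)} (hl : l.length ≠ 3) (a b c : Fin n) :
    topVol e l a b c = 0 := by
  have h1 : ∀ x ∈ Submodule.span ℝ {x : Gr n | ∃ l : List (Fin n), l.length = n - 3 ∧
      x = word odd l}, top n (word th l * subst (lin e) (isPar_lin e) x) = 0 := by
    intro x hx
    induction hx using Submodule.span_induction with
    | mem x hx =>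
      obtain ⟨l', hl', rfl⟩ := hx
      rw [subst_word]
      have h := word_sum_smul_mem (fun a μ => e a μ) (th : Fin n → Th n) l'
      change word (lin e) l' ∈ _ at h
      generalize word (lin e) l' = w at h ⊢
      induction h using Submodule.span_induction with
      | mem x hx =>
        obtain ⟨l'', hl'', rfl⟩ := hx
        rw [← word_append]
        exact top_word (by rw [List.length_append]; omega)
      | zero => rw [mul_zero, map_zero]
      | add x y _ _ hx hy => rw [mul_add, map_add, hx, hy, add_zero]
      | smul r x _ hx => rw [mul_smul_comm, map_smul, hx, smul_zero]
    | zero => rw [map_zero, mul_zero, map_zero]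
    | add x y _ _ hx hy => rw [map_add, mul_add, map_add, hx, hy, add_zero]
    | smul r x _ hx => rw [map_smul, mul_smul_comm, map_smul, hx, smul_zero]
  exact h1 _ (gvol_mem_span _ _)

theorem topVol_swap (hn : 2 < n) (l : List (Fin n)) (a b c : Fin n) :
    topVol e l a c b = -topVol e l a b c := by
  rw [topVol, show [a, c, b] = [a] ++ c :: b :: [] from rfl, gvol_swap _ _ _ _ (by simp; omega),
    map_neg, mul_neg, map_neg]
  rfl

theorem sum_comm_pair {I J K : Type*} [Fintype I] [Fintype J] [Fintype K] (F : I → J → K → ℝ) :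
    ∑ i, ∑ j, ∑ k, F i j k = ∑ k, ∑ i, ∑ j, F i j k := by
  rw [Finset.sum_congr rfl fun i _ => Finset.sum_comm, Finset.sum_comm]

/-- Contraction with the frame turns the letters `θ` into the linear forms `e^a θ`. Multiplication
of the volume contraction by these is computed in the abstract Grassmann algebra by
`word_mul_gvol_three`. -/
theorem sum_mul_topVol (hn : 2 < n) (d f g a b c : Fin n) :
    ∑ μ, ∑ ν, ∑ ρ, e d μ * (e f ν * (e g ρ * topVol e [μ, ν, ρ] a b c)) =
      kron3 d f g a b c * top n (subst (lin e) (isPar_lin e) (gvol n [])) := by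
  rw [← smul_eq_mul, ← map_smul, ← map_smul, ← word_mul_gvol_three hn, map_mul, subst_word]
  simp only [word_cons, word_nil, mul_one, topVol]
  generalize subst (lin e) (isPar_lin e) (gvol (n - 3) [a, b, c]) = v
  simp only [lin, Finset.sum_mul, Finset.mul_sum, smul_mul_assoc, mul_smul_comm, map_sum, map_smul,
    smul_eq_mul]
  rw [sum_comm_pair]
  refine Finset.sum_congr rfl fun ρ _ => ?_
  rw [Finset.sum_comm]
  refine Finset.sum_congr rfl fun ν _ => Finset.sum_congr rfl fun μ _ => ?_
  simp only [mul_assoc]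
  ring

/-- The values of `∫ dⁿθ θ^U 𝒱_{abc}(e θ) θ^S`. -/
def leadVol (e : Matrix (Fin n) (Fin n) ℝ) (U : Finset (Fin n)) (a b c : Fin n)
    (S : Finset (Fin n)) : ℝ :=
  top n (thetaSet U * subst (lin e) (isPar_lin e) (gvol (n - 3) [a, b, c]) * thetaSet S)

theorem leadVol_eq (e : Matrix (Fin n) (Fin n) ℝ) (U : Finset (Fin n)) (a b c : Fin n)
    (S : Finset (Fin n)) : leadVol e U a b c S = sg (((n - 3 : ℕ) : ℤ) * S.card) *
      topVol e (U.sort (· ≤ ·) ++ S.sort (· ≤ ·)) a b c := by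
  rw [leadVol, mul_assoc, (isPar_subst (isPar_lin e) (isPar_gvol (n - 3) [a, b, c])).comm_isPar
    (isPar_thetaSet S), mul_smul_comm, map_smul, topVol, word_append, mul_assoc]
  rfl

theorem leadVol_swap (hn : 2 < n) (U : Finset (Fin n)) (a b c : Fin n) (S : Finset (Fin n)) :
    leadVol e U a c b S = -leadVol e U a b c S := by
  rw [leadVol_eq, leadVol_eq, topVol_swap hn, mul_neg]

/-- An arbitrary word is a multiple of a sorted monomial. Equations indexed by subsets thereby
become equations for free indices, which can be contracted with the frame. -/
theorem exists_topVol_eq (e : Matrix (Fin n) (Fin n) ℝ) (l : List (Fin n)) :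
    (∃ (r : ℝ) (S : Finset (Fin n)), ∀ a b c U, topVol e (U.sort (· ≤ ·) ++ l) a b c =
      r * leadVol e U a b c S) := by
  obtain ⟨ε, S, h, -⟩ := exists_word_eq (O := Empty) (E := Empty) (C := ℝ) l
  refine ⟨ε * sg (((n - 3 : ℕ) : ℤ) * S.card), S, fun a b c U => ?_⟩
  rw [leadVol_eq, mul_assoc, ← mul_assoc (sg _), sg_mul_self, one_mul, topVol, topVol, word_append,
    word_append, h, mul_smul_comm, smul_mul_assoc, map_smul]
  rfl

theorem exists_topVol_eq' (e : Matrix (Fin n) (Fin n) ℝ) (l : List (Fin n)) :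
    (∃ (r : ℝ) (U : Finset (Fin n)), ∀ a b c S, topVol e (l ++ S.sort (· ≤ ·)) a b c =
      r * (sg (((n - 3 : ℕ) : ℤ) * S.card) * leadVol e U a b c S)) := by
  obtain ⟨ε, U, h, -⟩ := exists_word_eq (O := Empty) (E := Empty) (C := ℝ) l
  refine ⟨ε, U, fun a b c S => ?_⟩
  rw [leadVol_eq, ← mul_assoc (sg _), sg_mul_self, one_mul, topVol, topVol, word_append,
    word_append, h, smul_mul_assoc, smul_mul_assoc, map_smul]
  rfl

theorem sum_eq_sum_singleton {A : Type*} [AddCommMonoid A] {f : Finset (Fin n) → A} (hf : ∀ U, U.card ≠ 1 → f U = 0) :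
    ∑ U, f U = ∑ μ, f {μ} := by
  have h1 : (Finset.univ : Finset (Fin n)).map ⟨_, Finset.singleton_injective⟩ ⊆
      (Finset.univ : Finset (Finset (Fin n))) := Finset.subset_univ _
  rw [← Finset.sum_subset h1, Finset.sum_map]
  · rfl
  · intro U _ hU
    refine hf U fun h => hU ?_
    obtain ⟨μ, rfl⟩ := Finset.card_eq_one.1 h
    simp

theorem eq_zero_of_sum_mul_det {x : Fin n → ℝ} (he : e.det ≠ 0)
    (h : ∀ d, ∑ μ, x μ * e⁻¹ μ d = 0) : x = 0 := by
  have h1 : Matrix.vecMul x e⁻¹ = 0 := funext h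
  have h2 := congrArg (fun v => Matrix.vecMul v e) h1
  simpa [Matrix.vecMul_vecMul, Matrix.nonsing_inv_mul e (Ne.isUnit he)] using h2

theorem sum_inv_mul (he : e.det ≠ 0) (x : Fin n → ℝ) (μ : Fin n) :
    ∑ d, (∑ ν, x ν * e⁻¹ ν d) * e d μ = x μ := by
  have h2 : Matrix.vecMul (Matrix.vecMul x e⁻¹) e = x := by
    simp [Matrix.vecMul_vecMul, Matrix.nonsing_inv_mul e (Ne.isUnit he)]
  exact congrFun h2 μ

/-- The integrals are nonzero only for `|U| + |S| = 3`, so the unknowns with `|U| = 0` and `|U| = 1`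
decouple: they are tested with words of length three and two. Conversion of the indices `μ` by the
frame leaves `eq_zero_of_kron3_vector` and `eq_zero_of_kron3_matrix`. -/
theorem eq_zero_of_sum_leadVol_rows (hn : 2 < n) (he : e.det ≠ 0)
    (x : Fin n → Finset (Fin n) → ℝ) (hx : ∀ a U, 2 ≤ U.card → x a U = 0)
    (h : ∀ b c S, b < c → ∑ a, ∑ U, x a U * leadVol e U a b c S = 0) (a : Fin n)
    (U : Finset (Fin n)) : x a U = 0 := by
  have h' : ∀ b c S, ∑ a, ∑ U, x a U * leadVol e U a b c S = 0 := by
    intro b c S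
    rcases lt_trichotomy b c with hbc | rfl | hbc
    · exact h b c S hbc
    · refine Finset.sum_eq_zero fun a _ => Finset.sum_eq_zero fun U _ => ?_
      have := leadVol_swap (e := e) hn U a b b S
      rw [show leadVol e U a b b S = 0 by linarith, mul_zero]
    · rw [← neg_eq_zero, ← h c b S hbc, ← Finset.sum_neg_distrib]
      refine Finset.sum_congr rfl fun a _ => ?_
      rw [← Finset.sum_neg_distrib]
      refine Finset.sum_congr rfl fun U _ => ?_
      rw [leadVol_swap hn, mul_neg, neg_neg]
  have h1 : ∀ l b c, ∑ a, ∑ U, x a U * topVol e (U.sort (· ≤ ·) ++ l) a b c = 0 := by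
    intro l b c
    obtain ⟨r, S, hr⟩ := exists_topVol_eq e l
    have := h' b c S
    simp_rw [hr, mul_left_comm _ r, ← Finset.mul_sum, this, mul_zero]
  have hw := top_subst_ne_zero he
  have h0 : (fun a => x a ∅) = 0 := by
    refine eq_zero_of_kron3_vector hn _ fun d f g b c => ?_
    have h2 : ∀ μ ν ρ, ∑ a, x a ∅ * topVol e [μ, ν, ρ] a b c = 0 := by
      intro μ ν ρ
      rw [← h1 [μ, ν, ρ] b c]
      refine Finset.sum_congr rfl fun a _ => ?_
      rw [Finset.sum_eq_single ∅]
      · simp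
      · intro U _ hU
        rw [topVol_eq_zero hn, mul_zero]
        have := Finset.card_ne_zero.2 (Finset.nonempty_iff_ne_empty.2 hU)
        simp only [List.length_append, Finset.length_sort, List.length_cons, List.length_nil]
        omega
      · simp
    have h3 : ∑ a, x a ∅ * (kron3 d f g a b c *
        top n (subst (lin e) (isPar_lin e) (gvol n []))) = 0 := by
      simp_rw [← sum_mul_topVol hn, Finset.mul_sum]
      rw [Finset.sum_comm]
      refine Finset.sum_eq_zero fun μ _ => ?_
      rw [Finset.sum_comm]
      refine Finset.sum_eq_zero fun ν _ => ?_
      rw [Finset.sum_comm]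
      refine Finset.sum_eq_zero fun ρ _ => ?_
      have := h2 μ ν ρ
      calc _ = ∑ a, e d μ * (e f ν * e g ρ) * (x a ∅ * topVol e [μ, ν, ρ] a b c) :=
            Finset.sum_congr rfl fun a _ => by ring
        _ = 0 := by rw [← Finset.mul_sum, this, mul_zero]
    simp_rw [← mul_assoc, ← Finset.sum_mul] at h3
    exact (mul_eq_zero.1 h3).resolve_right hw
  have h01 : (fun a d => ∑ μ, x a {μ} * e⁻¹ μ d) = 0 := by
    refine eq_zero_of_kron3_matrix hn _ fun f g b c => ?_
    have h2 : ∀ ν ρ, ∑ a, ∑ μ, x a {μ} * topVol e [μ, ν, ρ] a b c = 0 := by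
      intro ν ρ
      rw [← h1 [ν, ρ] b c]
      refine Finset.sum_congr rfl fun a _ => ?_
      rw [sum_eq_sum_singleton]
      · simp
      · intro U hU
        rw [topVol_eq_zero hn, mul_zero]
        simp only [List.length_append, Finset.length_sort, List.length_cons, List.length_nil]
        omega
    have h3 : ∑ a, ∑ d, (∑ μ, x a {μ} * e⁻¹ μ d) * (kron3 d f g a b c *
        top n (subst (lin e) (isPar_lin e) (gvol n []))) = 0 := by
      have h4 : ∀ a, ∑ d, (∑ μ, x a {μ} * e⁻¹ μ d) * (kron3 d f g a b c *
          top n (subst (lin e) (isPar_lin e) (gvol n []))) =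
          ∑ ν, ∑ ρ, ∑ μ, e f ν * (e g ρ * (x a {μ} * topVol e [μ, ν, ρ] a b c)) := by
        intro a
        simp_rw [← sum_mul_topVol hn, Finset.mul_sum]
        -- Converting the index of `x` with `e⁻¹` and contracting it with the frame restores the
        -- original unknown.
        calc _ = ∑ μ, ∑ ν, ∑ ρ, ∑ d, (∑ μ, x a {μ} * e⁻¹ μ d) * e d μ *
              (e f ν * (e g ρ * topVol e [μ, ν, ρ] a b c)) := by
              rw [Finset.sum_comm]
              refine Finset.sum_congr rfl fun μ _ => ?_
              rw [Finset.sum_comm]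
              refine Finset.sum_congr rfl fun ν _ => ?_
              rw [Finset.sum_comm]
              refine Finset.sum_congr rfl fun ρ _ => ?_
              exact Finset.sum_congr rfl fun d _ => by ring
          _ = ∑ μ, ∑ ν, ∑ ρ, x a {μ} * (e f ν * (e g ρ * topVol e [μ, ν, ρ] a b c)) := by
              simp_rw [← Finset.sum_mul, sum_inv_mul he (fun μ => x a {μ})]
          _ = _ := by
              rw [Finset.sum_comm]
              refine Finset.sum_congr rfl fun ν _ => ?_
              rw [Finset.sum_comm]
              refine Finset.sum_congr rfl fun ρ _ => ?_
              exact Finset.sum_congr rfl fun d _ => by ring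
      simp_rw [h4]
      rw [Finset.sum_comm]
      refine Finset.sum_eq_zero fun ν _ => ?_
      rw [Finset.sum_comm]
      refine Finset.sum_eq_zero fun ρ _ => ?_
      simp_rw [← Finset.mul_sum, h2, mul_zero]
    simp_rw [← mul_assoc, ← Finset.sum_mul] at h3
    exact (mul_eq_zero.1 h3).resolve_right hw
  rcases Nat.lt_or_ge 1 U.card with hU | hU
  · exact hx a U hU
  · rcases Nat.le_one_iff_eq_zero_or_eq_one.1 hU with hU | hU
    · rw [Finset.card_eq_zero.1 hU]
      exact congrFun h0 a
    · obtain ⟨μ, rfl⟩ := Finset.card_eq_one.1 hU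
      exact congrFun (eq_zero_of_sum_mul_det (x := fun μ => x a {μ}) he
        fun d => congrFun (congrFun h01 a) d) μ

/-- The counterpart for the second argument: the unknowns are antisymmetric in `b, c`, those with
`|S| = 0` and `|S| = 1` decouple, and the frame leads to `eq_zero_of_kron3_form` and
`eq_zero_of_kron3_tensor`. -/
theorem eq_zero_of_sum_leadVol_columns (hn : 2 < n) (he : e.det ≠ 0)
    (x : Fin n → Fin n → Finset (Fin n) → ℝ) (hx : ∀ b c S, 2 ≤ S.card → x b c S = 0)
    (hx' : ∀ b c S, x b c S = -x c b S)
    (h : ∀ a U, ∑ b, ∑ c, ∑ S, x b c S * leadVol e U a b c S = 0) (b c : Fin n)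
    (S : Finset (Fin n)) : x b c S = 0 := by
  have hw := top_subst_ne_zero he
  have h1 : ∀ l a, ∑ b, ∑ c, ∑ S, x b c S * (sg (((n - 3 : ℕ) : ℤ) * S.card) *
      topVol e (l ++ S.sort (· ≤ ·)) a b c) = 0 := by
    intro l a
    obtain ⟨r, U, hr⟩ := exists_topVol_eq' e l
    have := h a U
    simp_rw [hr, mul_left_comm _ r, ← Finset.mul_sum, ← mul_assoc (sg _), sg_mul_self, one_mul,
      this, mul_zero]
  have h0 : (fun b c => x b c ∅) = 0 := by
    refine eq_zero_of_kron3_form hn _ (fun b c => hx' b c ∅) fun d f g a => ?_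
    have h2 : ∀ μ ν ρ, ∑ b, ∑ c, x b c ∅ * topVol e [μ, ν, ρ] a b c = 0 := by
      intro μ ν ρ
      rw [← h1 [μ, ν, ρ] a]
      refine Finset.sum_congr rfl fun b _ => Finset.sum_congr rfl fun c _ => ?_
      rw [Finset.sum_eq_single ∅]
      · simp [sg_zero]
      · intro U _ hU
        rw [topVol_eq_zero hn, mul_zero, mul_zero]
        have := Finset.card_ne_zero.2 (Finset.nonempty_iff_ne_empty.2 hU)
        simp only [List.length_append, Finset.length_sort, List.length_cons, List.length_nil]
        omega
      · simp
    have h3 : ∑ b, ∑ c, x b c ∅ * (kron3 d f g a b c *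
        top n (subst (lin e) (isPar_lin e) (gvol n []))) = 0 := by
      simp_rw [← sum_mul_topVol hn, Finset.mul_sum]
      calc _ = ∑ μ, ∑ ν, ∑ ρ, ∑ b, ∑ c, e d μ * (e f ν * (e g ρ *
            (x b c ∅ * topVol e [μ, ν, ρ] a b c))) := by
            simp_rw [fun b c μ ν ρ => show x b c ∅ * (e d μ * (e f ν * (e g ρ *
              topVol e [μ, ν, ρ] a b c))) = e d μ * (e f ν * (e g ρ *
              (x b c ∅ * topVol e [μ, ν, ρ] a b c))) by ring]
            rw [sum_comm_pair]
            refine Finset.sum_congr rfl fun μ _ => ?_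
            rw [sum_comm_pair]
            refine Finset.sum_congr rfl fun ν _ => ?_
            rw [sum_comm_pair]
        _ = 0 := by simp [← Finset.mul_sum, h2]
    simp_rw [← mul_assoc, ← Finset.sum_mul] at h3
    exact (mul_eq_zero.1 h3).resolve_right hw
  have h01 : (fun b c d => ∑ μ, x b c {μ} * e⁻¹ μ d) = 0 := by
    refine eq_zero_of_kron3_tensor hn _ (fun b c d => ?_) fun d f a => ?_
    · rw [← Finset.sum_neg_distrib]
      exact Finset.sum_congr rfl fun μ _ => by rw [hx' b c, neg_mul]
    have h2 : ∀ μ ν, ∑ b, ∑ c, ∑ ρ, x b c {ρ} * topVol e [μ, ν, ρ] a b c = 0 := by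
      intro μ ν
      have h5 : sg ((n - 3 : ℕ) : ℤ) * ∑ b, ∑ c, ∑ ρ, x b c {ρ} * topVol e [μ, ν, ρ] a b c = 0 := by
        rw [← h1 [μ, ν] a]
        simp_rw [Finset.mul_sum]
        refine Finset.sum_congr rfl fun b _ => Finset.sum_congr rfl fun c _ => ?_
        rw [sum_eq_sum_singleton]
        · refine Finset.sum_congr rfl fun ρ _ => ?_
          rw [Finset.sort_singleton, Finset.card_singleton, Nat.cast_one, mul_one]
          simp only [List.cons_append, List.nil_append]
          ring
        · intro U hU
          rw [topVol_eq_zero hn, mul_zero, mul_zero]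
          simp only [List.length_append, Finset.length_sort, List.length_cons, List.length_nil]
          omega
      exact (mul_eq_zero.1 h5).resolve_left (sg_ne_zero _)
    have h3 : ∑ b, ∑ c, ∑ g, (∑ μ, x b c {μ} * e⁻¹ μ g) * (kron3 d f g a b c *
        top n (subst (lin e) (isPar_lin e) (gvol n []))) = 0 := by
      have h4 : ∀ b c, ∑ g, (∑ μ, x b c {μ} * e⁻¹ μ g) * (kron3 d f g a b c *
          top n (subst (lin e) (isPar_lin e) (gvol n []))) =
          ∑ μ, ∑ ν, e d μ * (e f ν * ∑ ρ, x b c {ρ} * topVol e [μ, ν, ρ] a b c) := by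
        intro b c
        simp_rw [← sum_mul_topVol hn, Finset.mul_sum]
        rw [Finset.sum_comm]
        refine Finset.sum_congr rfl fun μ _ => ?_
        rw [Finset.sum_comm]
        refine Finset.sum_congr rfl fun ν _ => ?_
        rw [Finset.sum_comm]
        refine Finset.sum_congr rfl fun ρ _ => ?_
        rw [← sum_inv_mul he (fun μ => x b c {μ}) ρ, Finset.sum_mul, Finset.mul_sum, Finset.mul_sum]
        exact Finset.sum_congr rfl fun g _ => by ring
      simp_rw [h4]
      calc _ = ∑ μ, ∑ ν, ∑ b, ∑ c, e d μ * (e f ν *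
            ∑ ρ, x b c {ρ} * topVol e [μ, ν, ρ] a b c) := by
            rw [sum_comm_pair]
            refine Finset.sum_congr rfl fun μ _ => ?_
            rw [sum_comm_pair]
        _ = 0 := by simp [← Finset.mul_sum, h2]
    simp_rw [← mul_assoc, ← Finset.sum_mul] at h3
    exact (mul_eq_zero.1 h3).resolve_right hw
  rcases Nat.lt_or_ge 1 S.card with hU | hU
  · exact hx b c S hU
  · rcases Nat.le_one_iff_eq_zero_or_eq_one.1 hU with hU | hU
    · rw [Finset.card_eq_zero.1 hU]
      exact congrFun (congrFun h0 b) c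
    · obtain ⟨μ, rfl⟩ := Finset.card_eq_one.1 hU
      exact congrFun (eq_zero_of_sum_mul_det (x := fun μ => x b c {μ}) he
        fun d => congrFun (congrFun (congrFun h01 b) c) d) μ

end CartanWeyl

namespace GradedDomain

open FreeSuper

variable {G : GradedDomain}

theorem tw_mem_Fil {m : ℕ} {a : G.Forms} (ha : a ∈ G.Fil m) (k : ℤ) : tw k a ∈ G.Fil m := by
  have key : ∀ f l, tw k (G.monomial f l) ∈ G.Fil (l.map G.lord).sum := by
    intro f l
    induction l with
    | nil => exact Fil_zero _
    | cons a l ih =>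
      rw [monomial_cons, map_mul, (isPar_gen a).tw, List.map_cons, List.sum_cons, smul_mul_assoc]
      exact Submodule.smul_mem _ _ (Fil_mul (gen_mem_Fil a) ih)
  have : G.Fil m ≤ (G.Fil m).comap (tw k).toLinearMap := mspan_le fun f l hl => by
    rw [Submodule.mem_comap]; exact Fil_le hl (key f l)
  exact this ha

end GradedDomain

namespace CartanWeyl

open FreeSuper GradedDomain

variable {n : ℕ} {G : GradedDomain}

/-- Forms on `G` with coefficients in the functions of `θ`. -/
abbrev ThForms (n : ℕ) (G : GradedDomain) : Type :=
  FreeSuper (G.OddGen ⊕ Fin n) G.EvenGen (SmoothFun G.body)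

/-! ### Filtration and grading -/

/-- The elements with components of order at least `m`. -/
def thFil (n : ℕ) (G : GradedDomain) (m : ℕ) : Submodule ℝ (ThForms n G) :=
  thetaSpan fun _ => G.Fil m

theorem thFil_mul {k m m' : ℕ} (hk : k ≤ m + m') {x y : ThForms n G} (hx : x ∈ thFil n G m)
    (hy : y ∈ thFil n G m') : x * y ∈ thFil n G k :=
  mul_mem_thetaSpan (fun i _ _ ha _ hb => Fil_mul_le hk ha (tw_mem_Fil hb i)) hx hy

theorem thFil_zero (x : ThForms n G) : x ∈ thFil n G 0 := by
  rw [← sum_comp x]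
  exact sum_mem fun U _ => adjoin_mul_mem_thetaSpan U (Fil_zero _)

theorem adjoin_mem_thFil {m : ℕ} {a : G.Forms} (ha : a ∈ G.Fil m) :
    adjoin (Fin n) a ∈ thFil n G m := by
  have := adjoin_mul_mem_thetaSpan (n := n) (X := fun _ => G.Fil m) ∅ ha
  rw [thetaSet, Finset.sort_empty, word_nil, mul_one] at this
  exact this

/-- The functions of total degree `k`, the degree of `θ` being one. -/
def thDeg (n : ℕ) (G : GradedDomain) (k : ℤ) : Submodule ℝ (ThForms n G) :=
  thetaSpan fun i => G.homog 0 (k - i)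

theorem thDeg_mul {j k : ℤ} {x y : ThForms n G} (hx : x ∈ thDeg n G j) (hy : y ∈ thDeg n G k) :
    x * y ∈ thDeg n G (j + k) := by
  refine mul_mem_thetaSpan (fun i i' a ha b hb => ?_) hx hy
  have := homog_mul ha (tw_mem_homog hb i)
  rwa [show j - i + (k - i') = j + k - ((i + i' : ℕ) : ℤ) by push_cast; ring] at this

theorem adjoin_mem_thDeg {k : ℤ} {a : G.Forms} (ha : a ∈ G.homog 0 k) :
    adjoin (Fin n) a ∈ thDeg n G k := by
  have := adjoin_mul_mem_thetaSpan (n := n) (X := fun i => G.homog 0 (k - i)) ∅ (by simpa using ha)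
  rw [thetaSet, Finset.sort_empty, word_nil, mul_one] at this
  exact this

theorem thetaSet_mem_thDeg (S : Finset (Fin n)) : thetaSet S ∈ thDeg n G S.card := by
  have := adjoin_mul_mem_thetaSpan (X := fun i => G.homog 0 (S.card - i)) S
    (by simpa using one_mem_homog (G := G))
  rw [map_one, one_mul] at this
  exact this

theorem word_mem_thDeg {I : Type} {y : I → ThForms n G} (hy : ∀ i, y i ∈ thDeg n G 1)
    (l : List I) : word y l ∈ thDeg n G l.length := by
  induction l with
  | nil =>
    have := adjoin_mem_thDeg (n := n) (one_mem_homog (G := G))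
    simpa using this
  | cons a l ih =>
    have := thDeg_mul (hy a) ih
    rwa [add_comm] at this

theorem subst_mem_thDeg {y : Fin n → ThForms n G} (hy : ∀ i, IsPar 1 (y i))
    (hy' : ∀ i, y i ∈ thDeg n G 1) (k : ℕ) (I : List (Fin n)) :
    subst y hy (gvol k I) ∈ thDeg n G k := by
  have h := gvol_mem_span k I
  generalize gvol k I = w at h ⊢
  induction h using Submodule.span_induction with
  | mem x hx => obtain ⟨l, rfl, rfl⟩ := hx; rw [subst_word]; exact word_mem_thDeg hy' l
  | zero => rw [map_zero]; exact zero_mem _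
  | add x y _ _ hx hy => rw [map_add]; exact add_mem hx hy
  | smul r x _ hx => rw [map_smul]; exact Submodule.smul_mem _ r hx

theorem berezin_mem_homog {k : ℤ} {x : ThForms n G} (hx : x ∈ thDeg n G k) :
    berezin n x ∈ G.homog 0 (k - n) := by
  rw [berezin_eq_comp]
  have := tw_mem_homog (comp_mem hx Finset.univ) n
  rwa [Finset.card_univ, Fintype.card_fin] at this

/-- The generating function of a family of coefficients. -/
def series {O E C : Type} [CommRing C] [Algebra ℝ C] (c : Finset (Fin n) → FreeSuper O E C) :
    FreeSuper (O ⊕ Fin n) E C := ∑ U, adjoin (Fin n) (c U) * thetaSet U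

theorem comp_series {O E C : Type} [CommRing C] [Algebra ℝ C]
    (c : Finset (Fin n) → FreeSuper O E C) (U : Finset (Fin n)) : comp U (series c) = c U :=
  comp_sum c U

theorem extHom_series {O E C O' E' C' : Type} [CommRing C] [Algebra ℝ C] [CommRing C']
    [Algebra ℝ C'] {φ : FreeSuper O E C →ₐ[ℝ] FreeSuper O' E' C'}
    (hφ : ∀ a, φ (inv a) = inv (φ a)) (c : Finset (Fin n) → FreeSuper O E C) :
    extHom n φ hφ (series c) = series fun U => φ (c U) := by
  simp only [series, map_sum, map_mul, extHom_adjoin, extHom_thetaSet]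

theorem series_mem_thDeg {c : Finset (Fin n) → G.Forms} {k : ℤ}
    (hc : ∀ U, c U ∈ G.homog 0 (k - U.card)) : series c ∈ thDeg n G k :=
  sum_mem fun U _ => adjoin_mul_mem_thetaSpan U (hc U)

theorem series_sub_mem_thFil {c c' : Finset (Fin n) → G.Forms} {m : ℕ}
    (hc : ∀ U, c U - c' U ∈ G.Fil m) : series c - series c' ∈ thFil n G m := by
  rw [series, series, ← Finset.sum_sub_distrib]
  refine sum_mem fun U _ => ?_
  rw [← sub_mul, ← map_sub]
  exact adjoin_mul_mem_thetaSpan U (hc U)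

theorem isPar_of_mem_thDeg {k : ℤ} {x : ThForms n G} (hx : x ∈ thDeg n G k) : IsPar k x := by
  induction hx using Submodule.span_induction with
  | mem x hx =>
    obtain ⟨S, a, ha, rfl⟩ := hx
    have h := (isPar_of_mem_homog ha).adjoin (T := Fin n) |>.mul (isPar_thetaSet S)
    exact h.congr ⟨0, by simp⟩
  | zero => exact isPar_zero _
  | add x y _ _ hx hy => exact hx.add hy
  | smul r x _ hx => exact hx.smul r

/-! ### Values at a point of the body -/

/-- Evaluation at a point of the body, all other coordinates and differentials being set to zero. -/
def evalHom (x : G.body) : G.Forms →ₐ[ℝ] FreeSuper Empty Empty ℝ :=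
  (Algebra.ofId ℝ _).comp ((SmoothFun.eval x).comp FreeSuper.ord0)

theorem evalHom_apply (x : G.body) (a : G.Forms) :
    evalHom x a = FreeSuper.ord0 a x • (1 : FreeSuper Empty Empty ℝ) :=
  Algebra.algebraMap_eq_smul_one (A := FreeSuper Empty Empty ℝ) (FreeSuper.ord0 a x)

theorem ord0_inv {O E C : Type} [CommRing C] [Algebra ℝ C] (a : FreeSuper O E C) :
    FreeSuper.ord0 (inv a) = FreeSuper.ord0 a := by
  have : FreeSuper.ord0.comp inv = (FreeSuper.ord0 : FreeSuper O E C →ₐ[ℝ] C) :=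
    algHom_ext (fun c => by simp) (fun o => by simp) fun e => by simp
  exact DFunLike.congr_fun this a

theorem evalHom_inv (x : G.body) (a : G.Forms) : evalHom x (inv a) = inv (evalHom x a) := by
  rw [evalHom_apply, evalHom_apply, ord0_inv, map_smul, map_one]

/-- Evaluation of the coefficients at a point of the body. -/
def thEval (n : ℕ) (x : G.body) : ThForms n G →ₐ[ℝ] Th n := extHom n (evalHom x) (evalHom_inv x)

theorem top_thEval (x : G.body) (z : ThForms n G) :
    top n (thEval n x z) = FreeSuper.ord0 (berezin n z) x := by
  rw [top, LinearMap.comp_apply, thEval, berezin_extHom, evalHom_apply, map_smul,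
    AlgHom.toLinearMap_apply, map_one, smul_eq_mul, mul_one]

theorem thEval_series (x : G.body) {c : Finset (Fin n) → G.Forms} {e : Matrix (Fin n) (Fin n) ℝ}
    {a : Fin n} (h1 : ∀ μ, FreeSuper.ord0 (c {μ}) x = e a μ)
    (h0 : ∀ U, U.card ≠ 1 → FreeSuper.ord0 (c U) = 0) : thEval n x (series c) = lin e a := by
  rw [thEval, extHom_series, series, sum_eq_sum_singleton]
  · refine Finset.sum_congr rfl fun μ _ => ?_
    rw [evalHom_apply, h1, map_smul, map_one, smul_mul_assoc, one_mul, thetaSet,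
      Finset.sort_singleton, word_cons, word_nil, mul_one]
  · intro U hU
    rw [evalHom_apply, h0 U hU, SmoothFun.zero_apply, zero_smul, map_zero, zero_mul]

theorem thEval_subst (x : G.body) {ξ : Fin n → ThForms n G} (hξ : ∀ a, IsPar 1 (ξ a))
    {e : Matrix (Fin n) (Fin n) ℝ} (he : ∀ a, thEval n x (ξ a) = lin e a) (v : Gr n) :
    thEval n x (subst ξ hξ v) = subst (lin e) (isPar_lin e) v := by
  rw [algHom_comp_subst ξ hξ (thEval n x) (fun a => by rw [he]; exact isPar_lin e a)]
  exact congrArg (· v) (subst_congr he)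

/-- Evaluation on the body is multiplicative and commutes with substitution and integration, so the
leading terms of these functions are numbers that depend on the frame matrix alone. -/
theorem ord0_berezin_vol (x : G.body) {ξ : Fin n → ThForms n G} (hξ : ∀ a, IsPar 1 (ξ a))
    {e : Matrix (Fin n) (Fin n) ℝ} (he : ∀ a, thEval n x (ξ a) = lin e a) (U S : Finset (Fin n))
    (a b c : Fin n) : (FreeSuper.ord0 (berezin n
      (thetaSet U * subst ξ hξ (gvol (n - 3) [a, b, c]) * thetaSet S)) : SmoothFun G.body) x =
        leadVol e U a b c S := by
  rw [← top_thEval, map_mul (thEval n x), map_mul (thEval n x), thEval_subst x hξ he, thEval, extHom_thetaSet,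
    extHom_thetaSet, leadVol]

/-! ### The de Rham differential -/

/-- The coefficientwise de Rham differential. -/
def thD (n : ℕ) (G : GradedDomain) : ThForms n G →ₗ[ℝ] ThForms n G := extLin n G.dLin

theorem dLin_inv (a : G.Forms) : G.dLin (inv a) = -inv (G.dLin a) := by
  rw [dLin_apply, dLin_apply, d_inv]

theorem thD_mul (x y : ThForms n G) : thD n G (x * y) = thD n G x * y + inv x * thD n G y :=
  extLin_mul isDer_d dLin_inv x y

theorem thD_adjoin_mul_thetaSet (a : G.Forms) (S : Finset (Fin n)) :
    thD n G (adjoin (Fin n) a * thetaSet S) = adjoin (Fin n) (G.d a) * thetaSet S :=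
  by rw [thD, extLin_adjoin_mul_thetaSet, dLin_apply]

theorem thD_thetaSet (S : Finset (Fin n)) : thD n G (thetaSet S) = 0 := by
  have h := thD_adjoin_mul_thetaSet (G := G) 1 S
  have h1 : G.d 1 = 0 := by
    have := d_mul (G := G) 1 1
    simpa using this
  rwa [h1, map_zero, zero_mul, map_one, one_mul] at h

theorem d_berezin (x : ThForms n G) : G.d (berezin n x) = sg n • berezin n (thD n G x) := by
  have := berezin_extLin (n := n) (D := G.dLin) dLin_inv x
  rw [thD, this, smul_smul, sg_mul_self, one_smul, dLin_apply]

theorem thD_series (c : Finset (Fin n) → G.Forms) :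
    thD n G (series c) = series fun U => G.d (c U) := by
  rw [series, map_sum, series]
  exact Finset.sum_congr rfl fun U _ => thD_adjoin_mul_thetaSet _ _

theorem thD_subst {ξ : Fin n → ThForms n G} (hξ : ∀ a, IsPar 1 (ξ a))
    {c : Fin n → Finset (Fin n) → G.Forms} (hc : ∀ a, ξ a = series (c a))
    (hd : ∀ a U, c a U ∈ G.homog 0 (1 - U.card)) (v : Gr n) :
    thD n G (subst ξ hξ v) =
      ∑ a, (series fun U => G.d (c a U)) * subst ξ hξ (oddDeriv a v) := by
  rw [derivation_subst ξ hξ thD_mul]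
  · simp_rw [hc, thD_series]
  · intro a
    rw [hc, thD_series]
    refine IsPar.sum fun U _ => ?_
    have h := (isPar_of_mem_homog (d_mem_homog (hd a U))).adjoin (T := Fin n) |>.mul
      (isPar_thetaSet U)
    exact h.congr ⟨1, by push_cast; ring⟩

theorem berezin_series_mul (c : Finset (Fin n) → G.Forms) (x : ThForms n G) :
    berezin n (series c * x) = ∑ U, tw n (c U) * berezin n (thetaSet U * x) := by
  simp_rw [series, Finset.sum_mul, map_sum, mul_assoc, berezin_adjoin_mul]

/-- The functions `∫ dⁿθ θ^U 𝒱_{abc}(ξ(θ)) θ^S`. -/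
def berVol {ξ : Fin n → ThForms n G} (hξ : ∀ a, IsPar 1 (ξ a)) (U : Finset (Fin n))
    (a b c : Fin n) (S : Finset (Fin n)) : G.Forms :=
  berezin n (thetaSet U * subst ξ hξ (gvol (n - 3) [a, b, c]) * thetaSet S)

/-- Differentiation appends the index at the end; two transpositions bring it to the front without a
sign. -/
theorem gvol_deriv (hn : 2 < n) (b c a : Fin n) :
    oddDeriv a (gvol (n - 2) [b, c]) = gvol (n - 3) [a, b, c] := by
  have h := oddDeriv_gvol a (n - 3) [b, c] (by simp; omega)
  rw [show n - 3 + 1 = n - 2 by omega] at h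
  rw [h]
  have h1 := gvol_swap (k := n - 3) [b] [] c a (by simp; omega)
  have h2 := gvol_swap (k := n - 3) [] [c] b a (by simp; omega)
  simp only [List.nil_append, List.cons_append] at h1 h2 ⊢
  rw [h1, h2, neg_neg]

theorem berezin_thD_subst (hn : 2 < n) {ξ : Fin n → ThForms n G} (hξ : ∀ a, IsPar 1 (ξ a))
    {c : Fin n → Finset (Fin n) → G.Forms} (hc : ∀ a, ξ a = series (c a))
    (hd : ∀ a U, c a U ∈ G.homog 0 (1 - U.card)) (b b' : Fin n) (S : Finset (Fin n)) :
    berezin n (thD n G (subst ξ hξ (gvol (n - 2) [b, b'])) * thetaSet S) =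
      ∑ a, ∑ U, tw n (G.d (c a U)) * berVol hξ U a b b' S := by
  rw [thD_subst hξ hc hd, Finset.sum_mul, map_sum]
  refine Finset.sum_congr rfl fun a _ => ?_
  rw [mul_assoc, berezin_series_mul, gvol_deriv hn]
  simp only [berVol, mul_assoc]

/-- The chain rule under the integral. The signs come from moving `d` past the integral and the
differentials of the coefficients out of it. -/
theorem d_berezin_vol (hn : 2 < n) {ξ : Fin n → ThForms n G} (hξ : ∀ a, IsPar 1 (ξ a))
    {c : Fin n → Finset (Fin n) → G.Forms} (hc : ∀ a, ξ a = series (c a))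
    (hd : ∀ a U, c a U ∈ G.homog 0 (1 - U.card)) (b b' : Fin n) (S : Finset (Fin n)) :
    G.d (berezin n (subst ξ hξ (gvol (n - 2) [b, b']) * thetaSet S)) =
      ∑ a, ∑ U, G.d (c a U) * ((sg n * sg (n * U.card)) • berVol hξ U a b b' S) := by
  rw [d_berezin, thD_mul, thD_thetaSet, mul_zero, add_zero, berezin_thD_subst hn hξ hc hd,
    Finset.smul_sum]
  refine Finset.sum_congr rfl fun a _ => ?_
  rw [Finset.smul_sum]
  refine Finset.sum_congr rfl fun U _ => ?_
  have h := (isPar_of_mem_homog (d_mem_homog (hd a U))).tw n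
  have h' : sg (n * (((0 + 1 : ℕ) : ℤ) + (1 - (U.card : ℤ)))) = sg (n * U.card) :=
    sg_congr ⟨n * (1 - U.card), by push_cast; ring⟩
  rw [h, h', smul_mul_assoc, mul_smul_comm, smul_smul]

theorem berVol_mem {ξ : Fin n → ThForms n G} (hξ : ∀ a, IsPar 1 (ξ a))
    (hξ' : ∀ a, ξ a ∈ thDeg n G 1) (U : Finset (Fin n)) (a b c : Fin n) (S : Finset (Fin n)) :
    berVol hξ U a b c S ∈ G.functions := by
  have h := berezin_mem_homog (thDeg_mul (thDeg_mul (thetaSet_mem_thDeg U)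
    (subst_mem_thDeg hξ hξ' (n - 3) [a, b, c])) (thetaSet_mem_thDeg S))
  exact homog_le_formsOfDegree _ _ h

end CartanWeyl

namespace GradedDomain

open FreeSuper

theorem exists_nonnegInclusion (G : GradedDomain) (hG : ∀ i, G.deg i ≤ 1) :
    ∃ i : Hom G.nonneg G, G.IsNonnegInclusion i ∧
      i.Over (fun j => ⟨⟨j.1, j.2.ge⟩, j.2⟩) (fun _ hx => hx) := by
  classical
  let c : Components G.nonneg G :=
    { r := fun j => ⟨⟨j.1, j.2.ge⟩, j.2⟩
      body := fun _ hx => hx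
      fn := fun j => if h : 0 ≤ G.deg j then G.nonneg.z ⟨j, h⟩ else 0
      mem := fun j => by
        split_ifs with h
        · exact z_mem_homog (G := G.nonneg) ⟨j, h⟩
        · exact zero_mem _
      sub_mem := fun j => by
        rw [dif_pos j.2.ge, sub_self]
        exact zero_mem _ }
  obtain ⟨i, hi, hi'⟩ := c.exists_over fun j => hG j.1
  refine ⟨i, ⟨fun j => ?_, fun j hj => ?_⟩, hi'⟩
  · rw [hi]; exact dif_pos j.2
  · rw [hi]; exact dif_neg (not_le.2 hj)

end GradedDomain

/-! ### Labels and generating functions of the coordinates on `M`. -/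

namespace CartanWeyl

open FreeSuper GradedDomain

variable {n : ℕ}

/-- The ordered pairs labelling the independent components of an antisymmetric tensor. -/
abbrev Pairs (n : ℕ) : Type := {p : Fin n × Fin n // p.1 < p.2}

theorem sum_pairs {A : Type*} [AddCommMonoid A] (f : Fin n → Fin n → A) (hf : ∀ b, f b b = 0) :
    ∑ b, ∑ c, f b c = ∑ p : Pairs n, (f p.1.1 p.1.2 + f p.1.2 p.1.1) := by
  have h1 : ∀ g : Fin n × Fin n → A, ∑ p : Pairs n, g p.1 =
      ∑ q : Fin n × Fin n, if q.1 < q.2 then g q else 0 := by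
    intro g
    rw [← Finset.sum_filter]
    exact (Finset.sum_subtype (p := fun q : Fin n × Fin n => q.1 < q.2) _ (by simp) g).symm
  rw [h1 fun q => f q.1 q.2 + f q.2 q.1, ← Fintype.sum_prod_type' f]
  have h2 : ∑ q : Fin n × Fin n, (if q.1 < q.2 then f q.1 q.2 + f q.2 q.1 else 0) =
      ∑ q : Fin n × Fin n, (if q.1 < q.2 then f q.1 q.2 else 0) +
        ∑ q : Fin n × Fin n, (if q.1 < q.2 then f q.2 q.1 else 0) := by
    rw [← Finset.sum_add_distrib]
    exact Finset.sum_congr rfl fun q _ => by split_ifs <;> simp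
  rw [h2, ← (Equiv.prodComm (Fin n) (Fin n)).sum_comp
    (fun q : Fin n × Fin n => if q.1 < q.2 then f q.2 q.1 else 0), ← Finset.sum_add_distrib]
  refine Finset.sum_congr rfl fun q _ => ?_
  obtain ⟨a, b⟩ := q
  change f a b = (if a < b then f a b else 0) + if b < a then f a b else 0
  rcases lt_trichotomy a b with h | h | h
  · rw [if_pos h, if_neg (lt_asymm h), add_zero]
  · subst h; simp [hf]
  · rw [if_neg (lt_asymm h), if_pos h, zero_add]

theorem fiber_deg_le (i : (fiber n).ι) : (fiber n).deg i ≤ 1 := by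
  change 1 - (i.2.card : ℤ) ≤ 1
  omega

/-- The label of a coefficient of `ψ^A(θ)`. -/
def ix (A : Target n) (U : Finset (Fin n)) : (fiber n).ι := (A, U)

@[simp] theorem deg_ix (A : Target n) (U : Finset (Fin n)) :
    (fiber n).deg (ix A U) = 1 - (U.card : ℤ) := rfl

theorem sum_ix {A : Type*} [AddCommMonoid A] (f : (fiber n).ι → A) : ∑ i, f i =
    ∑ a, ∑ U, f (ix (Sum.inl a) U) + ∑ p : Pairs n, ∑ U, f (ix (Sum.inr p) U) := by
  refine (Fintype.sum_prod_type (γ := A) f).trans ?_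
  rw [Fintype.sum_sum_type]
  rfl

theorem forall_ix {P : (fiber n).ι → Prop} : (∀ i, P i) ↔
    (∀ a U, P (ix (Sum.inl a) U)) ∧ ∀ (p : Pairs n) U, P (ix (Sum.inr p) U) :=
  ⟨fun h => ⟨fun _ _ => h _, fun _ _ => h _⟩, fun h => by
    rintro ⟨a | p, U⟩
    · exact h.1 a U
    · exact h.2 p U⟩

theorem psi_eq (A : Target n) : psi A = series fun U => (fiber n).z (ix A U) := rfl

theorem dpsi_eq (A : Target n) : dpsi A = series fun U => (fiber n).dz (ix A U) := rfl

theorem psi_mem (A : Target n) : psi A ∈ thDeg n (fiber n) 1 :=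
  series_mem_thDeg fun U => z_mem_homog (G := fiber n) (ix A U)

theorem isPar_psi (a : Fin n) : IsPar 1 (psi (Sum.inl a : Target n)) :=
  isPar_of_mem_thDeg (psi_mem _)

theorem vol3_eq (a b c : Fin n) :
    vol3 a b c = subst (fun a => psi (Sum.inl a)) isPar_psi (gvol (n - 3) [a, b, c]) := by
  rw [gvol, map_smul, epsSum, map_sum, Finset.smul_sum, vol3]
  refine Finset.sum_congr rfl fun f _ => ?_
  rw [map_smul, subst_word, smul_smul, word, List.map_ofFn]
  rfl

/-! ### The presymplectic potential -/

/-- The functions `∫ dⁿθ 𝒱_{bc}(ξ(θ)) θ^S`, up to normalization. -/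
def potential (p : Pairs n) (S : Finset (Fin n)) : (fiber n).Forms :=
  (2 * sg (S.card + n)) • berezin n
    (subst (fun a => psi (Sum.inl a)) isPar_psi (gvol (n - 2) [p.1.1, p.1.2]) * thetaSet S)

theorem potential_mem (hn : 2 < n) (p : Pairs n) (S : Finset (Fin n)) :
    potential p S ∈ (fiber n).homog 0 (S.card - 2) := by
  have h := berezin_mem_homog (thDeg_mul (subst_mem_thDeg isPar_psi (fun a => psi_mem _) (n - 2)
    [p.1.1, p.1.2]) (thetaSet_mem_thDeg S))
  rw [show ((n - 2 : ℕ) : ℤ) + S.card - n = S.card - 2 by omega] at h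
  exact Submodule.smul_mem _ _ h

/-- The identity `V_{abc} dξ^a = dV_{bc}`. The generating function `dξ^a(θ)` is even, so the order
of the factors does not matter. -/
theorem sum_vol3_mul_dpsi (hn : 2 < n) (b c : Fin n) :
    ∑ a, vol3 a b c * dpsi (Sum.inl a) =
      thD n (fiber n) (subst (fun a => psi (Sum.inl a)) isPar_psi (gvol (n - 2) [b, c])) := by
  rw [thD_subst isPar_psi (fun a => psi_eq _) fun a U => z_mem_homog (G := fiber n) (ix _ U)]
  refine Finset.sum_congr rfl fun a _ => ?_
  rw [gvol_deriv hn, vol3_eq, dpsi_eq]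
  simp_rw [d_z]
  have h : IsPar 0 (series fun U => (fiber n).dz (ix (Sum.inl a) U)) := by
    refine IsPar.sum fun U _ => ?_
    have h := (isPar_dz (G := fiber n) (ix (Sum.inl a) U)).adjoin (T := Fin n) |>.mul (isPar_thetaSet U)
    exact h.congr ⟨1, by rw [deg_ix]; push_cast; ring⟩
  rw [h.comm_even (by decide)]

/-- Expand `∫ dV_{bc} dρ^{bc}` in the coefficients of `ρ(θ)`. The orderings `b < c` and `c < b`
contribute equally, whence the factor two in `potential`; its sign compensates moving `dρ_S` past
`θ^S` and `d` past the integral. -/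
theorem omegaM_eq (hn : 2 < n) : omegaM n =
    ∑ p : Pairs n, ∑ S, (fiber n).d (potential p S) * (fiber n).dz (ix (Sum.inr p) S) := by
  set X : Fin n → Fin n → SuperForms n := fun b c =>
    thD n (fiber n) (subst (fun a => psi (Sum.inl a)) isPar_psi (gvol (n - 2) [b, c])) with hX
  have h1 : ∑ a : Fin n, ∑ b : Fin n, ∑ c : Fin n, vol3 a b c * dpsi (Sum.inl a) * drho b c =
      ∑ b, ∑ c, X b c * drho b c := by
    rw [Finset.sum_comm]
    refine Finset.sum_congr rfl fun b _ => ?_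
    rw [Finset.sum_comm]
    refine Finset.sum_congr rfl fun c _ => ?_
    rw [← Finset.sum_mul, sum_vol3_mul_dpsi hn]
  have hXs : ∀ b c, X c b = -X b c := by
    intro b c
    have := gvol_swap (k := n - 2) [] [] c b (by simp; omega)
    simp only [List.nil_append] at this
    simp only [hX, this, map_neg]
  rw [omegaM, h1, sum_pairs _ (fun b => by simp [drho]), map_sum]
  refine Finset.sum_congr rfl fun p _ => ?_
  obtain ⟨⟨b, c⟩, hbc⟩ := p
  simp only at hbc
  have h2 : drho b c = dpsi (Sum.inr ⟨(b, c), hbc⟩) := by simp [drho, hbc]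
  have h3 : drho c b = -dpsi (Sum.inr ⟨(b, c), hbc⟩) := by simp [drho, hbc, lt_asymm hbc]
  simp only [h2, h3, hXs b c, neg_mul_neg]
  rw [dpsi_eq, series, Finset.mul_sum, ← Finset.sum_add_distrib, map_sum]
  refine Finset.sum_congr rfl fun S _ => ?_
  have h4 : adjoin (Fin n) ((fiber n).dz (ix (Sum.inr ⟨(b, c), hbc⟩) S)) * thetaSet S =
      sg S.card • (thetaSet S * adjoin (Fin n) ((fiber n).dz (ix (Sum.inr ⟨(b, c), hbc⟩) S))) := by
    rw [(isPar_dz (G := fiber n) (ix (Sum.inr ⟨(b, c), hbc⟩) S)).adjoin.comm_isPar (isPar_thetaSet S),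
      deg_ix]
    congr 1
    refine sg_congr ?_
    have := Int.even_mul_pred_self (S.card : ℤ)
    obtain ⟨r, hr⟩ := this
    exact ⟨-r, by linear_combination -hr⟩
  have h5 : X b c * thetaSet S = thD n (fiber n) (subst (fun a => psi (Sum.inl a)) isPar_psi
      (gvol (n - 2) [b, c]) * thetaSet S) := by
    rw [thD_mul, thD_thetaSet, mul_zero, add_zero]
  rw [← two_smul ℝ, h4, mul_smul_comm, ← mul_assoc, h5, map_smul, map_smul, berezin_mul_adjoin,
    potential, d_smul, d_berezin, smul_mul_assoc, smul_mul_assoc, smul_smul, smul_smul, sg_add,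
    mul_assoc, mul_assoc, sg_mul_self, mul_one]

/-- The partial derivatives of the potential. -/
theorem d_potential (hn : 2 < n) (p : Pairs n) (S : Finset (Fin n)) :
    (fiber n).d (potential p S) = ∑ a, ∑ U, (fiber n).dz (ix (Sum.inl a) U) *
      ((2 * sg (S.card + n) * (sg n * sg (n * U.card))) • berVol isPar_psi U a p.1.1 p.1.2 S) := by
  rw [potential, d_smul, d_berezin_vol hn isPar_psi (fun a => psi_eq _)
    fun a U => z_mem_homog (G := fiber n) (ix _ U), Finset.smul_sum]
  refine Finset.sum_congr rfl fun a _ => ?_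
  rw [Finset.smul_sum]
  refine Finset.sum_congr rfl fun U _ => ?_
  rw [d_z, ← mul_smul_comm, smul_smul]

theorem thEval_psi (x : (fiber n).body) (a : Fin n) :
    thEval n x (psi (Sum.inl a)) = lin (frame x.1) a := by
  rw [psi_eq]
  refine thEval_series x (fun μ => ?_) fun U hU => ?_
  · have h : (fiber n).deg (ix (Sum.inl a) {μ}) = 0 := by simp
    rw [ord0_z_zero h, SmoothFun.coord_apply]
    rfl
  · refine ord0_z_ne ?_
    rw [deg_ix]
    omega

theorem potential_mem_functions (hn : 2 < n) (p : Pairs n) (S : Finset (Fin n)) :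
    potential p S ∈ (fiber n).functions :=
  homog_le_formsOfDegree _ _ (potential_mem hn p S)

theorem pd_potential (hn : 2 < n) (p : Pairs n) (S : Finset (Fin n)) :
    (∀ a U, (fiber n).pd (ix (Sum.inl a) U) (potential p S) =
      (2 * sg (S.card + n) * (sg n * sg (n * U.card))) •
        berVol isPar_psi U a p.1.1 p.1.2 S) ∧
    ∀ (q : Pairs n) U, (fiber n).pd (ix (Sum.inr q) U) (potential p S) = 0 := by
  set g : (fiber n).ι → (fiber n).Forms := fun i => Sum.elim
      (fun a => (2 * sg (S.card + n) * (sg n * sg (n * i.2.card))) •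
        berVol isPar_psi i.2 a p.1.1 p.1.2 S) (fun _ => 0) i.1 with hg
  have h : (fiber n).d (potential p S) = ∑ i, (fiber n).dz i * g i := by
    rw [d_potential hn, sum_ix]
    simp [hg, ix]
  have hg' : ∀ i, g i ∈ (fiber n).functions := by
    rw [forall_ix]
    exact ⟨fun a U => Submodule.smul_mem _ _ (berVol_mem isPar_psi (fun a => psi_mem _) _ _ _ _ _),
      fun _ _ => zero_mem _⟩
  have h2 : ∀ i, (fiber n).pd i (potential p S) = g i := fun i => by
    rw [← pdd_d i (potential_mem_functions hn p S), h, pdd_sum_dz i hg']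
  exact ⟨fun a U => h2 _, fun q U => h2 _⟩

theorem ord0_pd_potential (hn : 2 < n) (x : (fiber n).body) (p : Pairs n) (S : Finset (Fin n))
    (a : Fin n) (U : Finset (Fin n)) :
    (ord0 ((fiber n).pd (ix (Sum.inl a) U) (potential p S)) : SmoothFun (fiber n).body) x =
      2 * sg (S.card + n) * (sg n * sg (n * U.card)) *
        leadVol (frame x.1) U a p.1.1 p.1.2 S := by
  rw [(pd_potential hn p S).1, map_smul, SmoothFun.smul_apply, berVol,
    ord0_berezin_vol x isPar_psi (thEval_psi x)]

end CartanWeyl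

/-! ### Straightening `ξ(θ)`: the part of degree at least three in terms of the truncation. -/

namespace CartanWeyl

open FreeSuper GradedDomain

variable {n : ℕ}

/-- The matrix of coordinate functions `e^a_μ`. -/
def frameFun (n : ℕ) : Matrix (Fin n) (Fin n) (SmoothFun (fiber n).body) :=
  Matrix.of fun a μ => SmoothFun.coord (fiber n).body (frameIdx a μ)

theorem isUnit_det_frameFun : IsUnit (frameFun n).det := by
  refine SmoothFun.isUnit_of_ne_zero _ fun x => ?_
  have h : SmoothFun.eval x (frameFun n).det = (frame x.1).det := by
    rw [AlgHom.map_det]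
    congr 1
  rw [← SmoothFun.eval_apply, h]
  exact x.2

/-- The part of `ξ^a(θ)` of degree at most two in `θ`. -/
def trunc (a : Fin n) : ThForms n (fiber n) :=
  series fun U => if U.card ≤ 2 then (fiber n).z (ix (Sum.inl a) U) else 0

theorem trunc_mem (a : Fin n) : trunc a ∈ thDeg n (fiber n) 1 := by
  refine series_mem_thDeg fun U => ?_
  split_ifs
  · rw [← deg_ix (Sum.inl a)]
    exact z_mem_homog _
  · exact zero_mem _

theorem isPar_trunc (a : Fin n) : IsPar 1 (trunc a) := isPar_of_mem_thDeg (trunc_mem a)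

/-- The odd functions `(e⁻¹)^μ_a ξ^a(θ)`, with `ξ^a(θ)` truncated. -/
def flat (μ : Fin n) : ThForms n (fiber n) :=
  ∑ a, adjoin (Fin n) (coeff ((frameFun n)⁻¹ μ a)) * trunc a

theorem flat_mem (μ : Fin n) : flat μ ∈ thDeg n (fiber n) 1 :=
  sum_mem fun a _ => by
    rw [← zero_add (1 : ℤ)]
    exact thDeg_mul (adjoin_mem_thDeg (coeff_mem_homog _)) (trunc_mem a)

theorem trunc_sub_mem (a : Fin n) :
    trunc a - ∑ ν, adjoin (Fin n) (coeff (frameFun n a ν)) * th ν ∈ thFil n (fiber n) 1 := by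
  have h : ∑ ν, adjoin (Fin n) (coeff (frameFun n a ν)) * th ν =
      (series fun U => if U.card = 1 then (fiber n).z (ix (Sum.inl a) U) else 0 :
        ThForms n (fiber n)) := by
    rw [series, sum_eq_sum_singleton fun U hU => by rw [if_neg hU, map_zero, zero_mul]]
    refine Finset.sum_congr rfl fun ν _ => ?_
    have h0 : (fiber n).deg (ix (Sum.inl a) {ν}) = 0 := by simp
    rw [if_pos (Finset.card_singleton ν), z_of_zero h0, thetaSet, Finset.sort_singleton,
      word_cons, word_nil, mul_one]
    rfl
  rw [h]
  refine series_sub_mem_thFil fun U => ?_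
  by_cases h1 : U.card = 1
  · rw [if_pos h1, if_pos (by omega), sub_self]
    exact zero_mem _
  · rw [if_neg h1, sub_zero]
    split_ifs
    · exact z_mem_Fil (by rw [deg_ix]; omega)
    · exact zero_mem _

theorem flat_sub_mem (μ : Fin n) : flat μ - th μ ∈ thFil n (fiber n) 1 := by
  have h : flat μ - th μ = ∑ a, adjoin (Fin n) (coeff ((frameFun n)⁻¹ μ a)) *
      (trunc a - ∑ ν, adjoin (Fin n) (coeff (frameFun n a ν)) * th ν) := by
    simp_rw [mul_sub, Finset.sum_sub_distrib, Finset.mul_sum]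
    rw [flat, Finset.sum_comm]
    congr 1
    simp_rw [← mul_assoc, ← map_mul, ← FreeSuper.coeff_mul, ← Finset.sum_mul, ← map_sum,
      ← FreeSuper.coeff_sum, ← Matrix.mul_apply, Matrix.nonsing_inv_mul _ isUnit_det_frameFun]
    rw [Finset.sum_eq_single μ]
    · rw [Matrix.one_apply_eq, FreeSuper.coeff_one, map_one, one_mul]
    · intro ν _ hν
      rw [Matrix.one_apply_ne hν.symm, FreeSuper.coeff_zero, map_zero, zero_mul]
    · simp
  rw [h]
  exact sum_mem fun a _ =>
    thFil_mul (Nat.zero_add 1).ge (thFil_zero _) (trunc_sub_mem a)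

theorem word_flat_sub_mem (l : List (Fin n)) :
    word flat l - word th l ∈ thFil n (fiber n) 1 := by
  induction l with
  | nil => simp [word_nil]
  | cons μ l ih =>
    have h : word flat (μ :: l) - word th (μ :: l) =
        (flat μ - th μ) * word flat l + th μ * (word flat l - word th l) := by
      rw [word_cons, word_cons]
      noncomm_ring
    rw [h]
    exact add_mem (thFil_mul (Nat.add_zero 1).ge (flat_sub_mem μ) (thFil_zero _))
      (thFil_mul (Nat.zero_add 1).ge (thFil_zero _) ih)

theorem word_flat_mem (l : List (Fin n)) : word flat l ∈ wordIdeal (n := n) trunc l.length := by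
  induction l with
  | nil =>
    rw [word_nil, ← one_mul (1 : ThForms n (fiber n)), ← word_nil trunc]
    exact word_mem_wordIdeal le_rfl 1
  | cons μ l ih =>
    rw [word_cons, List.length_cons, add_comm]
    exact wordIdeal_mul isPar_trunc le_rfl
      (sum_mem fun a _ => mul_mem_wordIdeal _ (self_mem_wordIdeal a)) ih

/-- The part of `ξ^a(θ)` of degree at least three in `θ`, as a polynomial in the functions
`(e⁻¹)^μ_a ξ^a(θ)`. -/
def tail (a : Fin n) : ThForms n (fiber n) :=
  ∑ S : Finset (Fin n), if 3 ≤ S.card then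
    adjoin (Fin n) ((fiber n).z (ix (Sum.inl a) S)) * word flat (S.sort (· ≤ ·)) else 0

theorem tail_mem (a : Fin n) : tail a ∈ thDeg n (fiber n) 1 := by
  refine sum_mem fun S _ => ?_
  split_ifs
  · have h := thDeg_mul (adjoin_mem_thDeg (n := n) (z_mem_homog (G := fiber n) (ix (Sum.inl a) S)))
      (word_mem_thDeg flat_mem (S.sort (· ≤ ·)))
    rwa [deg_ix, Finset.length_sort, sub_add_cancel] at h
  · exact zero_mem _

theorem isPar_tail (a : Fin n) : IsPar 1 (tail a) := isPar_of_mem_thDeg (tail_mem a)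

theorem tail_mem_wordIdeal (a : Fin n) : tail a ∈ wordIdeal (n := n) trunc 3 := by
  refine sum_mem fun S _ => ?_
  split_ifs with h
  · refine mul_mem_wordIdeal _ (wordIdeal_le h ?_)
    have h1 := word_flat_mem (S.sort (· ≤ ·))
    rwa [Finset.length_sort] at h1
  · exact zero_mem _

/-- Replacing `θ^S` by the word in the `flat μ` changes it by terms of positive order, and the
coefficient in front has nonzero degree because `|S| ≥ 3`; together this gives order two. The
substitution is therefore a unipotent change of coordinates. -/
theorem trunc_add_tail_sub_mem (a : Fin n) :
    trunc a + tail a - psi (Sum.inl a) ∈ thFil n (fiber n) 2 := by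
  have h : trunc a + tail a - psi (Sum.inl a) = ∑ S : Finset (Fin n), if 3 ≤ S.card then
      adjoin (Fin n) ((fiber n).z (ix (Sum.inl a) S)) *
        (word flat (S.sort (· ≤ ·)) - word th (S.sort (· ≤ ·))) else 0 := by
    rw [trunc, tail, psi_eq, series, series, ← Finset.sum_add_distrib, ← Finset.sum_sub_distrib]
    refine Finset.sum_congr rfl fun S _ => ?_
    by_cases hS : S.card ≤ 2
    · rw [if_pos hS, if_neg (by omega), if_neg (by omega), add_zero, sub_self]
    · rw [if_neg hS, if_pos (by omega), if_pos (by omega), map_zero, zero_mul, zero_add, mul_sub,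
        thetaSet]
  rw [h]
  refine sum_mem fun S _ => ?_
  split_ifs with hS
  · exact thFil_mul (m := 1) (m' := 1) le_rfl
      (adjoin_mem_thFil (z_mem_Fil (by rw [deg_ix]; omega))) (word_flat_sub_mem _)
  · exact zero_mem _

/-- The change of coordinates on `M` that replaces `ξ^a(θ)` by `trunc a + tail a`. -/
theorem exists_straightening (n : ℕ) : ∃ F : Hom (fiber n) (fiber n),
    F.Over id (fun _ hx => hx) ∧ Function.Bijective F.pullback ∧
    (∀ a U, F.pullback ((fiber n).z (ix (Sum.inl a) U)) = comp U (trunc a + tail a)) ∧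
    (∀ (p : Pairs n) U, F.pullback ((fiber n).z (ix (Sum.inr p) U)) =
      (fiber n).z (ix (Sum.inr p) U)) ∧
    ∀ i, F.pullback ((fiber n).z i) - (fiber n).z i ∈ (fiber n).Fil 2 := by
  set fn : (fiber n).ι → (fiber n).Forms := fun i => Sum.elim
    (fun a => comp i.2 (trunc a + tail a)) (fun _ => (fiber n).z i) i.1 with hfn
  have h1 : ∀ i, fn i ∈ (fiber n).homog 0 ((fiber n).deg i) := by
    rw [forall_ix]
    refine ⟨fun a U => ?_, fun p U => z_mem_homog (G := fiber n) _⟩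
    rw [deg_ix]
    exact comp_mem (add_mem (trunc_mem a) (tail_mem a)) U
  have h2 : ∀ i, fn i - (fiber n).z i ∈ (fiber n).Fil 2 := by
    rw [forall_ix]
    refine ⟨fun a U => ?_, fun p U => ?_⟩
    · have h := comp_mem (trunc_add_tail_sub_mem a) U
      rwa [map_sub, psi_eq, comp_series] at h
    · have h : fn (ix (Sum.inr p) U) = (fiber n).z (ix (Sum.inr p) U) := rfl
      rw [h, sub_self]
      exact zero_mem _
  obtain ⟨F, hF, hF'⟩ := Components.exists_over (G := fiber n) (H := fiber n)
    ⟨id, fun _ hx => hx, fn, h1, fun j => Fil_le one_le_two (h2 j)⟩ fiber_deg_le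
  have h3 : ∀ i, F.pullback ((fiber n).z i) - (fiber n).z i ∈ (fiber n).Fil 2 := fun i => by
    rw [hF]
    exact h2 i
  exact ⟨F, hF', (hF'.unipotent fun i _ => h3 i).bijective fiber_deg_le, fun a U => hF _,
    fun p U => hF _, h3⟩

/-- The linear combinations of words of length `k` in the `trunc a`, with coefficients in the
functions of `e^a_μ, ω^{ab}_μ`. -/
def truncSpan (n k : ℕ) : Submodule ℝ (ThForms n (fiber n)) :=
  Submodule.span ℝ {x | ∃ (f : SmoothFun (fiber n).body) (l : List (Fin n)), l.length = k ∧
    x = adjoin (Fin n) (coeff f) * word trunc l}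

theorem flat_mul_mem {k : ℕ} {x : ThForms n (fiber n)} (hx : x ∈ truncSpan n k) (μ : Fin n) :
    flat μ * x ∈ truncSpan n (k + 1) := by
  induction hx using Submodule.span_induction with
  | mem x hx =>
    obtain ⟨f, l, hl, rfl⟩ := hx
    rw [flat, Finset.sum_mul]
    refine sum_mem fun a _ => Submodule.subset_span
      ⟨(frameFun n)⁻¹ μ a * f, a :: l, by rw [List.length_cons, hl], ?_⟩
    rw [adjoin_coeff, adjoin_coeff, adjoin_coeff, mul_assoc, ← mul_assoc (trunc a),
      ← coeff_comm, FreeSuper.coeff_mul, word_cons, mul_assoc, mul_assoc]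
  | zero => simp
  | add x y _ _ hx hy => rw [mul_add]; exact add_mem hx hy
  | smul r x _ hx => rw [mul_smul_comm]; exact Submodule.smul_mem _ _ hx

theorem word_flat_mul_mem (l : List (Fin n)) {k : ℕ} {x : ThForms n (fiber n)}
    (hx : x ∈ truncSpan n k) : word flat l * x ∈ truncSpan n (l.length + k) := by
  induction l with
  | nil => simpa [word_nil] using hx
  | cons μ l ih =>
    rw [word_cons, mul_assoc, List.length_cons, add_right_comm]
    exact flat_mul_mem ih μ

theorem subst_gvol_mem (k : ℕ) (I : List (Fin n)) :
    subst trunc isPar_trunc (gvol k I) ∈ truncSpan n k := by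
  have h : Submodule.span ℝ {x : Gr n | ∃ l : List (Fin n), l.length = k ∧ x = word odd l} ≤
      (truncSpan n k).comap (subst trunc isPar_trunc).toLinearMap := by
    refine Submodule.span_le.2 ?_
    rintro _ ⟨l, hl, rfl⟩
    refine Submodule.subset_span ⟨1, l, hl, ?_⟩
    rw [FreeSuper.coeff_one, map_one, one_mul]
    exact subst_word trunc isPar_trunc l
  exact h (gvol_mem_span k I)

/-- There is only one top-degree word up to a factor, so every word of length `n` in the truncations
is a multiple of the substituted volume element. -/
theorem exists_eq_of_mem_truncSpan {x : ThForms n (fiber n)} (hx : x ∈ truncSpan n n) :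
    ∃ f : SmoothFun (fiber n).body,
      x = adjoin (Fin n) (coeff f) * subst trunc isPar_trunc (gvol n []) := by
  induction hx using Submodule.span_induction with
  | mem x hx =>
    obtain ⟨f, l, hl, rfl⟩ := hx
    obtain ⟨r, hr⟩ := exists_word_odd_eq hl
    obtain ⟨c, hc, hc'⟩ := exists_gvol_eq (n := n)
    refine ⟨(r * c⁻¹) • f, ?_⟩
    rw [← subst_word trunc isPar_trunc, hr, hc', map_smul, map_smul, FreeSuper.coeff_smul, map_smul,
      smul_mul_smul_comm, mul_assoc, inv_mul_cancel₀ hc, mul_one, mul_smul_comm]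
  | zero => exact ⟨0, by simp [FreeSuper.coeff_zero]⟩
  | add x y _ _ hx hy =>
    obtain ⟨f, rfl⟩ := hx
    obtain ⟨g, rfl⟩ := hy
    exact ⟨f + g, by rw [FreeSuper.coeff_add, map_add, add_mul]⟩
  | smul r x _ hx =>
    obtain ⟨f, rfl⟩ := hx
    exact ⟨r • f, by rw [FreeSuper.coeff_smul, map_smul, smul_mul_assoc]⟩

/-- Counting factors: for `|S| = 3` there are exactly `n` of them, giving a multiple of the volume
element, and for larger `S` more than `n`, giving zero. So the third coefficients of `ξ(θ)` enter
through one scalar function for each pair, and the higher ones not at all. -/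
theorem exists_word_flat_mul (hn : 2 < n) (b c a : Fin n) (S : Finset (Fin n)) (hS : 3 ≤ S.card) :
    ∃ f : SmoothFun (fiber n).body, word flat (S.sort (· ≤ ·)) *
        subst trunc isPar_trunc (gvol (n - 3) [b, c, a]) =
      adjoin (Fin n) (coeff f) * subst trunc isPar_trunc (gvol n []) ∧ (S.card ≠ 3 → f = 0) := by
  by_cases h : S.card = 3
  · have h1 := word_flat_mul_mem (S.sort (· ≤ ·)) (subst_gvol_mem (n - 3) [b, c, a])
    rw [Finset.length_sort, h, show 3 + (n - 3) = n by omega] at h1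
    obtain ⟨f, hf⟩ := exists_eq_of_mem_truncSpan h1
    exact ⟨f, hf, fun h' => absurd h h'⟩
  · refine ⟨0, ?_, fun _ => rfl⟩
    have h1 := word_flat_mem (S.sort (· ≤ ·))
    rw [Finset.length_sort] at h1
    have h2 : subst trunc isPar_trunc (gvol (n - 3) [b, c, a]) ∈ wordIdeal (n := n) trunc (n - 3) := by
      have h3 := subst_gvol_mem (n - 3) [b, c, a]
      refine Submodule.span_le.2 ?_ h3
      rintro _ ⟨f, l, hl, rfl⟩
      exact word_mem_wordIdeal hl.ge _
    rw [FreeSuper.coeff_zero, map_zero, zero_mul]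
    exact eq_zero_of_mem_wordIdeal isPar_trunc (m := n + 1) (by omega)
      (wordIdeal_mul isPar_trunc (by omega) h1 h2)

end CartanWeyl

namespace CartanWeyl

open FreeSuper GradedDomain

variable {n : ℕ}

/-! ### The reduced configuration space -/

/-- A graded manifold with a coordinate for each coordinate of `M` of nonnegative degree: those
with labels of `ξ^a, e^a_μ` have the degree of the latter, those with labels `(p, S)` of
`ρ^{ab}, ω^{ab}_μ` have the degree of `potential p S`. -/
def reduced (n : ℕ) : GradedDomain where
  ι := (fiber n).nonneg.ι
  fintype := (fiber n).nonneg.fintype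
  deg i := Sum.elim (fun _ => 1 - (i.1.2.card : ℤ)) (fun _ => (i.1.2.card : ℤ) - 2) i.1.1
  body := ⟨{x | (Matrix.of fun a μ => x ⟨⟨(Sum.inl a, {μ}), by simp [fiber]⟩, by simp⟩ :
      Matrix (Fin n) (Fin n) ℝ).det ≠ 0}, by
    refine isOpen_ne_fun ?_ continuous_const
    refine Continuous.matrix_det ?_
    exact continuous_matrix fun a μ => continuous_apply _⟩

/-- The label of a coordinate of nonnegative degree. -/
def rix (A : Target n) (U : Finset (Fin n)) (h : U.card ≤ 1) : (reduced n).ι :=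
  ⟨ix A U, by rw [deg_ix]; omega⟩

@[simp] theorem deg_rix_inl (a : Fin n) (U : Finset (Fin n)) (h : U.card ≤ 1) :
    (reduced n).deg (rix (Sum.inl a) U h) = 1 - (U.card : ℤ) := rfl

@[simp] theorem deg_rix_inr (p : Pairs n) (U : Finset (Fin n)) (h : U.card ≤ 1) :
    (reduced n).deg (rix (Sum.inr p) U h) = (U.card : ℤ) - 2 := rfl

theorem forall_rix {P : (reduced n).ι → Prop} : (∀ j, P j) ↔
    (∀ a U h, P (rix (Sum.inl a) U h)) ∧ ∀ (p : Pairs n) U h, P (rix (Sum.inr p) U h) :=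
  ⟨fun h => ⟨fun _ _ _ => h _, fun _ _ _ => h _⟩, fun h => by
    rintro ⟨⟨a | p, U⟩, hU⟩
    · exact h.1 a U (by change 0 ≤ 1 - (U.card : ℤ) at hU; omega)
    · exact h.2 p U (by change 0 ≤ 1 - (U.card : ℤ) at hU; omega)⟩

theorem sum_rix {A : Type*} [AddCommMonoid A] (f : (reduced n).ι → A) : ∑ j, f j =
    ∑ a, ∑ U, (if h : U.card ≤ 1 then f (rix (Sum.inl a) U h) else 0) +
      ∑ p : Pairs n, ∑ U, (if h : U.card ≤ 1 then f (rix (Sum.inr p) U h) else 0) := by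
  classical
  set g : (fiber n).ι → A := fun i => if h : i.2.card ≤ 1 then f (rix i.1 i.2 h) else 0 with hg
  have h1 : ∀ j : (reduced n).ι, f j = g j.1 := by
    rw [forall_rix]
    refine ⟨fun a U h => ?_, fun p U h => ?_⟩
    · change _ = if h : U.card ≤ 1 then f (rix (Sum.inl a) U h) else 0
      rw [dif_pos h]
    · change _ = if h : U.card ≤ 1 then f (rix (Sum.inr p) U h) else 0
      rw [dif_pos h]
  have h2 : ∑ i, g i = ∑ j : (reduced n).ι, g j.1 := by
    rw [← Finset.sum_filter_of_ne (p := fun i => 0 ≤ (fiber n).deg i)]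
    · exact Finset.sum_subtype _ (by simp) g
    · intro i _ hi
      by_contra h
      refine hi (dif_neg fun h' => h ?_)
      change 0 ≤ 1 - (i.2.card : ℤ)
      omega
  rw [Finset.sum_congr rfl fun j _ => h1 j, ← h2, sum_ix]
  rfl

theorem reduced_deg_le : ∀ j, (reduced n).deg j ≤ 1 := by
  rw [forall_rix]
  exact ⟨fun a U h => by rw [deg_rix_inl]; omega, fun p U h => by rw [deg_rix_inr]; omega⟩

/-- A coordinate function of the reduced space, extended by zero to all labels. -/
def rz (A : Target n) (U : Finset (Fin n)) : (reduced n).Forms :=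
  if h : U.card ≤ 1 then (reduced n).z (rix A U h) else 0

theorem rz_inl_mem (a : Fin n) (U : Finset (Fin n)) :
    rz (Sum.inl a) U ∈ (reduced n).homog 0 (1 - U.card) := by
  rw [rz]
  split_ifs with h
  · exact z_mem_homog (G := reduced n) (rix (Sum.inl a) U h)
  · exact zero_mem _

theorem rz_inr_mem (p : Pairs n) (U : Finset (Fin n)) :
    rz (Sum.inr p) U ∈ (reduced n).homog 0 (U.card - 2) := by
  rw [rz]
  split_ifs with h
  · exact z_mem_homog (G := reduced n) (rix (Sum.inr p) U h)
  · exact zero_mem _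

theorem pd_rz (A B : Target n) (U V : Finset (Fin n)) (h : U.card ≤ 1) :
    (reduced n).pd (rix A U h) (rz B V) = if B = A ∧ V = U then 1 else 0 := by
  rw [rz]
  split_ifs with h1 h2 h2
  · rw [pd_z, if_pos]
    obtain ⟨rfl, rfl⟩ := h2
    rfl
  · rw [pd_z, if_neg]
    intro h3
    have h4 : (B, V) = (A, U) := congrArg Subtype.val h3
    exact h2 (Prod.mk.inj h4)
  · exact absurd (h2.2 ▸ h) h1
  · exact map_zero _

/-- The index set of a coordinate of degree `-1`. -/
def pairSet (p : Pairs n) : Finset (Fin n) := {p.1.1, p.1.2}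

theorem card_pairSet (p : Pairs n) : (pairSet p).card = 2 := Finset.card_pair p.2.ne

theorem exists_pairSet_eq {U : Finset (Fin n)} (h : U.card = 2) : ∃ p : Pairs n, pairSet p = U := by
  obtain ⟨a, b, hab, rfl⟩ := Finset.card_eq_two.1 h
  rcases lt_or_gt_of_ne hab with h | h
  · exact ⟨⟨(a, b), h⟩, rfl⟩
  · exact ⟨⟨(b, a), h⟩, Finset.pair_comm _ _⟩

theorem pairSet_injective : Function.Injective (pairSet : Pairs n → Finset (Fin n)) := by
  rintro ⟨⟨a, b⟩, hab⟩ ⟨⟨c, d⟩, hcd⟩ h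
  simp only [pairSet] at h hab hcd
  have ha : a ∈ ({c, d} : Finset (Fin n)) := h ▸ Finset.mem_insert_self _ _
  have hb : b ∈ ({c, d} : Finset (Fin n)) := h ▸ by simp
  have hc : c ∈ ({a, b} : Finset (Fin n)) := h ▸ Finset.mem_insert_self _ _
  have hd : d ∈ ({a, b} : Finset (Fin n)) := h ▸ by simp
  simp only [Finset.mem_insert, Finset.mem_singleton] at ha hb hc hd
  simp only [Subtype.mk.injEq, Prod.mk.injEq]
  grind

/-- The coefficients of `redXi`. -/
def redCoeff (a : Fin n) (U : Finset (Fin n)) : (reduced n).Forms :=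
  -- The label `(p, {a})` carries the second coefficient of `ξ^a` with index set `pairSet p`. This
  -- borrows the labels of `ω^{ab}_μ`, of which there are equally many.
  rz (Sum.inl a) U + ∑ p : Pairs n, if pairSet p = U then rz (Sum.inr p) {a} else 0

theorem redCoeff_mem (a : Fin n) (U : Finset (Fin n)) :
    redCoeff a U ∈ (reduced n).homog 0 (1 - U.card) := by
  refine add_mem (rz_inl_mem a U) (sum_mem fun p _ => ?_)
  split_ifs with h
  · rw [← h, card_pairSet]
    exact rz_inr_mem p {a}
  · exact zero_mem _

/-- The truncation of `ξ^a(θ)`, on the reduced space. -/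
def redXi (a : Fin n) : ThForms n (reduced n) := series (redCoeff a)

theorem redXi_mem (a : Fin n) : redXi a ∈ thDeg n (reduced n) 1 := series_mem_thDeg (redCoeff_mem a)

theorem isPar_redXi (a : Fin n) : IsPar 1 (redXi a) := isPar_of_mem_thDeg (redXi_mem a)

/-- The function on the reduced space that corresponds to `potential p S`. -/
def redPotential (p : Pairs n) (S : Finset (Fin n)) : (reduced n).Forms :=
  -- The second summand represents the cubic tail: the coordinate labelled `(p, ∅)`, of degree `-2`,
  -- is the scalar in front of the volume element.
  (2 * sg (S.card + n)) • berezin n ((subst redXi isPar_redXi (gvol (n - 2) [p.1.1, p.1.2]) +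
    adjoin (Fin n) (rz (Sum.inr p) ∅) * subst redXi isPar_redXi (gvol n [])) * thetaSet S)

theorem redPotential_mem (hn : 2 < n) (p : Pairs n) (S : Finset (Fin n)) :
    redPotential p S ∈ (reduced n).homog 0 (S.card - 2) := by
  have h1 := subst_mem_thDeg isPar_redXi redXi_mem (n - 2) [p.1.1, p.1.2]
  have h2 := thDeg_mul (adjoin_mem_thDeg (rz_inr_mem p ∅))
    (subst_mem_thDeg isPar_redXi redXi_mem n [])
  rw [show ((∅ : Finset (Fin n)).card : ℤ) - 2 + n = (n - 2 : ℕ) by simp; omega] at h2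
  have h := berezin_mem_homog (thDeg_mul (add_mem h1 h2) (thetaSet_mem_thDeg S))
  rw [show ((n - 2 : ℕ) : ℤ) + S.card - n = S.card - 2 by omega] at h
  exact Submodule.smul_mem _ _ h

/-- The matrix `e^a_μ` at a point of the reduced space. -/
def redFrame (x : (reduced n).body) : Matrix (Fin n) (Fin n) ℝ :=
  Matrix.of fun a μ => x.1 ⟨rix (Sum.inl a) {μ} (Finset.card_singleton μ).le, by simp⟩

theorem det_redFrame_ne_zero (x : (reduced n).body) : (redFrame x).det ≠ 0 := x.2

theorem thEval_redXi (x : (reduced n).body) (a : Fin n) :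
    thEval n x (redXi a) = lin (redFrame x) a := by
  refine thEval_series x (fun μ => ?_) fun U hU => ?_
  · have h : ∀ p : Pairs n, pairSet p ≠ {μ} := fun p hp => by
      have := card_pairSet p
      rw [hp, Finset.card_singleton] at this
      omega
    have h0 : (reduced n).deg (rix (Sum.inl a) {μ} (Finset.card_singleton μ).le) = 0 := by simp
    simp only [redCoeff, h, if_false, Finset.sum_const_zero, add_zero]
    rw [rz, dif_pos (Finset.card_singleton μ).le, ord0_z_zero h0, SmoothFun.coord_apply]
    rfl
  · exact ord0_homog (by omega) (redCoeff_mem a U)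

theorem ord0_pd_redVol (hn : 2 < n) (x : (reduced n).body) (p : Pairs n) (S : Finset (Fin n))
    (j : (reduced n).ι) :
    (ord0 ((reduced n).pd j (berezin n (subst redXi isPar_redXi
      (gvol (n - 2) [p.1.1, p.1.2]) * thetaSet S))) : SmoothFun (reduced n).body) x =
    ∑ a, ∑ U, (ord0 ((reduced n).pd j (redCoeff a U)) : SmoothFun (reduced n).body) x *
      (sg n * sg (n * U.card) * leadVol (redFrame x) U a p.1.1 p.1.2 S) := by
  have h1 : berezin n (subst redXi isPar_redXi (gvol (n - 2) [p.1.1, p.1.2]) * thetaSet S) ∈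
      (reduced n).functions := homog_le_formsOfDegree _ _ (berezin_mem_homog (thDeg_mul
    (subst_mem_thDeg isPar_redXi redXi_mem (n - 2) [p.1.1, p.1.2]) (thetaSet_mem_thDeg S)))
  rw [← pdd_d j h1, d_berezin_vol hn isPar_redXi (fun a => rfl) redCoeff_mem]
  rw [← SmoothFun.eval_apply]
  simp only [map_sum]
  refine Finset.sum_congr rfl fun a _ => Finset.sum_congr rfl fun U _ => ?_
  rw [pdd_mul_function j _ (Submodule.smul_mem _ _ (berVol_mem isPar_redXi redXi_mem _ _ _ _ _)),
    pdd_d j (homog_le_formsOfDegree _ _ (redCoeff_mem a U)), map_mul, map_mul, map_smul, map_smul,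
    SmoothFun.eval_apply, SmoothFun.eval_apply, berVol,
    ord0_berezin_vol x isPar_redXi (thEval_redXi x), smul_eq_mul]

theorem ord0_pd_redPotential (hn : 2 < n) (x : (reduced n).body) (p : Pairs n)
    (S : Finset (Fin n)) (j : (reduced n).ι) :
    (ord0 ((reduced n).pd j (redPotential p S)) : SmoothFun (reduced n).body) x =
    2 * sg (S.card + n) * (
      ∑ a, ∑ U, (ord0 ((reduced n).pd j (redCoeff a U)) : SmoothFun (reduced n).body) x *
      (sg n * sg (n * U.card) * leadVol (redFrame x) U a p.1.1 p.1.2 S) +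
      (ord0 ((reduced n).pd j (rz (Sum.inr p) ∅)) : SmoothFun (reduced n).body) x *
        top n (subst (lin (redFrame x)) (isPar_lin _) (gvol n []) * thetaSet S)) := by
  have h1 : tw n (rz (Sum.inr p) ∅) = rz (Sum.inr p) ∅ := by
    have h := isPar_of_mem_homog (rz_inr_mem p ∅)
    rw [h.tw, sg_even, one_smul]
    refine Even.mul_left ⟨-1, ?_⟩ _
    simp
  have h2 : ord0 (tw ((reduced n).deg j) (rz (Sum.inr p) ∅)) = 0 :=
    ord0_homog (k := (∅ : Finset (Fin n)).card - 2) (by simp) (tw_mem_homog (rz_inr_mem p ∅) _)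
  rw [redPotential, add_mul, map_add (berezin n), map_smul ((reduced n).pd j), map_smul ord0,
    SmoothFun.smul_apply, map_add ((reduced n).pd j), map_add ord0, SmoothFun.add_apply, ord0_pd_redVol hn, mul_assoc (adjoin (Fin n) _), berezin_adjoin_mul, h1,
    pd_mul, map_add ord0, map_mul ord0, map_mul ord0, h2, zero_mul, add_zero, SmoothFun.mul_apply, ← top_thEval,
    map_mul (thEval n x), thEval_subst x isPar_redXi (thEval_redXi x), thEval, extHom_thetaSet]

theorem pd_redCoeff_inr (p : Pairs n) (a b : Fin n) (U : Finset (Fin n)) :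
    (reduced n).pd (rix (Sum.inr p) {b} (Finset.card_singleton b).le) (redCoeff a U) =
      if b = a ∧ pairSet p = U then 1 else 0 := by
  rw [redCoeff, map_add, pd_rz, if_neg (by simp), zero_add, map_sum]
  simp_rw [apply_ite ((reduced n).pd _), pd_rz, map_zero]
  rw [Finset.sum_eq_single p]
  · by_cases h1 : pairSet p = U <;> by_cases h2 : b = a <;> simp [h1, h2, Ne.symm]
  · intro q _ hq
    simp [hq]
  · simp

theorem pd_redCoeff_empty (p : Pairs n) (a : Fin n) (U : Finset (Fin n)) :
    (reduced n).pd (rix (Sum.inr p) ∅ (Finset.card_empty.trans_le zero_le_one)) (redCoeff a U) = 0 := by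
  rw [redCoeff, map_add, pd_rz, if_neg (by simp), zero_add, map_sum]
  simp_rw [apply_ite ((reduced n).pd _), pd_rz, map_zero]
  simp

/-- Extend the unknowns antisymmetrically to all `b, c`; since `leadVol` is antisymmetric too, the
full sum is twice the sum over pairs. -/
theorem eq_zero_of_sum_pairs_leadVol {e : Matrix (Fin n) (Fin n) ℝ} (hn : 2 < n) (he : e.det ≠ 0)
    (y : Pairs n → Finset (Fin n) → ℝ) (hy : ∀ p S, 2 ≤ S.card → y p S = 0)
    (h : ∀ a U, ∑ p : Pairs n, ∑ S, y p S * leadVol e U a p.1.1 p.1.2 S = 0) (p : Pairs n)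
    (S : Finset (Fin n)) : y p S = 0 := by
  set x : Fin n → Fin n → Finset (Fin n) → ℝ := fun b c S =>
    if h : b < c then y ⟨(b, c), h⟩ S else if h : c < b then -y ⟨(c, b), h⟩ S else 0 with hx
  have hx1 : ∀ p : Pairs n, ∀ S, x p.1.1 p.1.2 S = y p S := fun p S => dif_pos p.2
  have hx2 : ∀ b c S, x b c S = -x c b S := by
    intro b c S
    rcases lt_trichotomy b c with h | rfl | h
    · simp [hx, h, lt_asymm h]
    · simp [hx]
    · simp [hx, h, lt_asymm h]
  rw [← hx1]
  refine eq_zero_of_sum_leadVol_columns hn he x (fun b c S hS => ?_) hx2 (fun a U => ?_) _ _ _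
  · simp [hx, hy _ _ hS]
  · rw [sum_pairs]
    · have h1 : ∀ p : Pairs n, ∑ S, x p.1.1 p.1.2 S * leadVol e U a p.1.1 p.1.2 S +
          ∑ S, x p.1.2 p.1.1 S * leadVol e U a p.1.2 p.1.1 S =
          2 * ∑ S, y p S * leadVol e U a p.1.1 p.1.2 S := by
        intro p
        rw [← Finset.sum_add_distrib, Finset.mul_sum]
        refine Finset.sum_congr rfl fun S _ => ?_
        rw [hx2 p.1.2, leadVol_swap hn, hx1]
        ring
      rw [Finset.sum_congr rfl fun p _ => h1 p, ← Finset.mul_sum, h, mul_zero]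
    · intro b
      simp [hx]

theorem leadVol_eq_zero {e : Matrix (Fin n) (Fin n) ℝ} (hn : 2 < n) {U S : Finset (Fin n)}
    (h : U.card + S.card ≠ 3) (a b c : Fin n) : leadVol e U a b c S = 0 := by
  rw [leadVol_eq, topVol_eq_zero hn (by simpa using h), mul_zero]

end CartanWeyl

/-! ### The potentials as coordinates on the reduced space, and the map from `M` to it. -/

namespace CartanWeyl

open FreeSuper GradedDomain

variable {n : ℕ}

/-- The leading Jacobian splits by degree. In degree `-2` it is multiplication by the nonzero
integral of the volume element. In degree `-1` it is the square matrix of the `leadVol` with `|U| =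
2`, `|S| = 1`, which is injective by `eq_zero_of_sum_pairs_leadVol`. On the labels of `ξ, e` it is
the identity. -/
theorem eq_zero_of_lead_redPotential (hn : 2 < n) (κ : Hom (reduced n) (reduced n))
    (h1 : ∀ a U h, κ.pullback ((reduced n).z (rix (Sum.inl a) U h)) =
      (reduced n).z (rix (Sum.inl a) U h))
    (h2 : ∀ (p : Pairs n) U h, κ.pullback ((reduced n).z (rix (Sum.inr p) U h)) =
      redPotential p U) (x : (reduced n).body) (c : (reduced n).ι → ℝ)
    (hc : ∀ i, ∑ j, c j * κ.lead j i x = 0) : c = 0 := by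
  classical
  have hl1 : ∀ a U h i, κ.lead (rix (Sum.inl a) U h) i x = if rix (Sum.inl a) U h = i then 1 else 0 := by
    intro a U h i
    rw [Hom.lead, Matrix.of_apply, Hom.jac, h1, pd_z]
    split_ifs <;> simp [SmoothFun.one_apply, SmoothFun.zero_apply]
  have hl2 : ∀ (p : Pairs n) U h i, κ.lead (rix (Sum.inr p) U h) i x =
      (ord0 ((reduced n).pd i (redPotential p U)) : SmoothFun (reduced n).body) x := by
    intro p U h i
    rw [Hom.lead, Matrix.of_apply, Hom.jac, h2]
  have hl3 : ∀ i j, (reduced n).deg j ≠ (reduced n).deg i → κ.lead j i x = 0 := fun i j h => by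
    rw [κ.lead_eq_zero h, SmoothFun.zero_apply]
  have hA : ∀ p : Pairs n, c (rix (Sum.inr p) ∅ (Finset.card_empty.trans_le zero_le_one)) = 0 := by
    intro p
    have h := hc (rix (Sum.inr p) ∅ (Finset.card_empty.trans_le zero_le_one))
    rw [Finset.sum_eq_single (rix (Sum.inr p) ∅ (Finset.card_empty.trans_le zero_le_one)), hl2,
      ord0_pd_redPotential hn] at h
    · simp only [pd_redCoeff_empty, map_zero, SmoothFun.zero_apply, zero_mul,
        Finset.sum_const_zero, zero_add, pd_rz, and_self, if_true, map_one, SmoothFun.one_apply,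
        one_mul, thetaSet, Finset.sort_empty, word_nil, mul_one] at h
      refine (mul_eq_zero.1 h).resolve_right (mul_ne_zero (mul_ne_zero two_ne_zero (sg_ne_zero _))
        (top_subst_ne_zero (det_redFrame_ne_zero x)))
    · refine (forall_rix (P := fun j => j ∈ Finset.univ → j ≠ _ → _)).2
        ⟨fun a U h' _ hne => ?_, fun q U h' _ hne => ?_⟩
      · rw [hl1, if_neg hne, mul_zero]
      · by_cases hU : U = ∅
        · subst hU
          have hq : q ≠ p := fun hq => hne (by rw [hq])
          rw [hl2, ord0_pd_redPotential hn]
          simp [pd_redCoeff_empty, pd_rz, hq, SmoothFun.zero_apply]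
        · have := Finset.card_pos.2 (Finset.nonempty_iff_ne_empty.2 hU)
          rw [hl3 _ _ (by rw [deg_rix_inr, deg_rix_inr, Finset.card_empty]; omega), mul_zero]
    · simp
  have hB : ∀ (p : Pairs n) U h, c (rix (Sum.inr p) U h) = 0 := by
    set y : Pairs n → Finset (Fin n) → ℝ := fun p S => (if h : S.card ≤ 1 then
      c (rix (Sum.inr p) S h) else 0) * (2 * sg (S.card + n)) with hy
    have hy0 : ∀ p S, S.card ≠ 1 → y p S = 0 := by
      intro p S hS
      by_cases h : S.card ≤ 1
      · obtain rfl : S = ∅ := Finset.card_eq_zero.1 (by omega)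
        simp only [hy]
        rw [dif_pos h, hA, zero_mul]
      · simp only [hy]
        rw [dif_neg h, zero_mul]
    have h : ∀ p S, y p S = 0 := by
      refine eq_zero_of_sum_pairs_leadVol hn (det_redFrame_ne_zero x) y
        (fun p S hS => hy0 p S (by omega)) fun a U => ?_
      by_cases hU : U.card = 2
      · obtain ⟨p, rfl⟩ := exists_pairSet_eq hU
        have h := hc (rix (Sum.inr p) {a} (Finset.card_singleton a).le)
        rw [sum_rix] at h
        have h3 : ∑ b : Fin n, ∑ U : Finset (Fin n), (if h : U.card ≤ 1 then
            c (rix (Sum.inl b) U h) * κ.lead (rix (Sum.inl b) U h)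
              (rix (Sum.inr p) {a} (Finset.card_singleton a).le) x else 0) = 0 := by
          refine Finset.sum_eq_zero fun b _ => Finset.sum_eq_zero fun U _ => ?_
          split_ifs with h
          · rw [hl1, if_neg, mul_zero]
            intro h'
            exact Sum.inl_ne_inr (congrArg (fun i : (reduced n).ι => i.1.1) h')
          · rfl
        rw [h3, zero_add] at h
        have h4 : (∑ q : Pairs n, ∑ S, y q S * leadVol (redFrame x) (pairSet p) a q.1.1 q.1.2 S) *
            (sg n * sg (n * (pairSet p).card)) = 0 := by
          rw [← h, Finset.sum_mul]
          refine Finset.sum_congr rfl fun q _ => ?_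
          rw [Finset.sum_mul]
          refine Finset.sum_congr rfl fun S _ => ?_
          by_cases hS : S.card ≤ 1
          · simp only [hy]
            rw [dif_pos hS, dif_pos hS, hl2, ord0_pd_redPotential hn, pd_rz, if_neg, map_zero,
              SmoothFun.zero_apply, zero_mul, add_zero, Finset.sum_eq_single a,
              Finset.sum_eq_single (pairSet p), pd_redCoeff_inr, if_pos ⟨rfl, rfl⟩, map_one,
              SmoothFun.one_apply]
            · ring
            · intro V _ hV
              rw [pd_redCoeff_inr, if_neg fun h => hV h.2.symm, map_zero, SmoothFun.zero_apply,
                zero_mul]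
            · simp
            · intro b _ hb
              refine Finset.sum_eq_zero fun V _ => ?_
              rw [pd_redCoeff_inr, if_neg fun h => hb h.1.symm, map_zero, SmoothFun.zero_apply,
                zero_mul]
            · simp
            · simp
          · rw [hy0 _ _ (by omega), dif_neg hS, zero_mul, zero_mul]
        exact (mul_eq_zero.1 h4).resolve_right (mul_ne_zero (sg_ne_zero _) (sg_ne_zero _))
      · refine Finset.sum_eq_zero fun q _ => Finset.sum_eq_zero fun S _ => ?_
        by_cases hS : S.card = 1
        · rw [leadVol_eq_zero hn (by omega), mul_zero]
        · rw [hy0 _ _ hS, zero_mul]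
    intro p U hU
    have h3 := h p U
    simp only [hy] at h3
    rw [dif_pos hU] at h3
    exact (mul_eq_zero.1 h3).resolve_right (mul_ne_zero two_ne_zero (sg_ne_zero _))
  funext j
  revert j
  refine forall_rix.2 ⟨fun a U h => ?_, hB⟩
  have h3 := hc (rix (Sum.inl a) U h)
  rw [Finset.sum_eq_single (rix (Sum.inl a) U h), hl1, if_pos rfl, mul_one] at h3
  · exact h3
  · refine (forall_rix (P := fun j => j ∈ Finset.univ → j ≠ _ → _)).2
      ⟨fun b V h' _ hne => ?_, fun q V h' _ hne => ?_⟩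
    · rw [hl1, if_neg hne, mul_zero]
    · rw [hB, zero_mul]
  · simp

/-- The potentials with labels of coordinates of nonnegative degree are coordinates on the
reduced space. -/
theorem exists_redPotential_coordinates (hn : 2 < n) : ∃ κ : Hom (reduced n) (reduced n),
    Function.Bijective κ.pullback ∧
    (∀ a U h, κ.pullback ((reduced n).z (rix (Sum.inl a) U h)) =
      (reduced n).z (rix (Sum.inl a) U h)) ∧
    ∀ (p : Pairs n) U h, κ.pullback ((reduced n).z (rix (Sum.inr p) U h)) = redPotential p U := by
  set fn : (reduced n).ι → (reduced n).Forms := fun j => Sum.elim (fun _ => (reduced n).z j)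
    (fun p => redPotential p j.1.2) j.1.1 with hfn
  have h1 : ∀ j, fn j ∈ (reduced n).homog 0 ((reduced n).deg j) :=
    forall_rix.2 ⟨fun a U h => z_mem_homog (G := reduced n) (rix (Sum.inl a) U h),
      fun p U h => redPotential_mem hn p U⟩
  have h2 : ∀ j, (reduced n).deg j = 0 → fn j - (reduced n).z j ∈ (reduced n).Fil 1 := by
    refine forall_rix.2 ⟨fun a U h _ => ?_, fun p U h h0 => ?_⟩
    · have h : fn (rix (Sum.inl a) U h) = (reduced n).z (rix (Sum.inl a) U h) := rfl
      rw [h, sub_self]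
      exact zero_mem _
    · rw [deg_rix_inr] at h0
      omega
  obtain ⟨κ, hκ, hκ'⟩ := Components.exists_over (G := reduced n) (H := reduced n)
    ⟨id, fun _ hx => hx, fn, h1, fun j => h2 j j.2⟩ reduced_deg_le
  have h3 : ∀ a U h, κ.pullback ((reduced n).z (rix (Sum.inl a) U h)) =
      (reduced n).z (rix (Sum.inl a) U h) := fun a U h => hκ _
  have h4 : ∀ (p : Pairs n) U h, κ.pullback ((reduced n).z (rix (Sum.inr p) U h)) =
      redPotential p U := fun a U h => hκ _
  exact ⟨κ, κ.bijective_of_card reduced_deg_le reduced_deg_le (Equiv.refl _) (fun _ hx => hx)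
    (fun _ hx => hx) hκ' (eq_zero_of_lead_redPotential hn κ h3 h4) rfl, h3, h4⟩

/-- The map from `M` to the reduced space along which `redPotential` is pulled back to the
potentials, up to the straightening of `M`. -/
theorem exists_redProjection (hn : 2 < n) : ∃ η : Hom (fiber n) (reduced n),
    (∀ a U h, η.pullback ((reduced n).z (rix (Sum.inl a) U h)) = (fiber n).z (ix (Sum.inl a) U)) ∧
    ∀ p S, η.pullback (redPotential p S) = (2 * sg (S.card + n)) • berezin n (subst
      (fun a => trunc a + tail a) (fun a => (isPar_trunc a).add (isPar_tail a))
        (gvol (n - 2) [p.1.1, p.1.2]) * thetaSet S) := by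
  have hm : ∀ (p : Pairs n) (a : Fin n) (S : Finset (Fin n)), ∃ f : SmoothFun (fiber n).body,
      (3 ≤ S.card → word flat (S.sort (· ≤ ·)) *
        subst trunc isPar_trunc (gvol (n - 3) [p.1.1, p.1.2, a]) =
          adjoin (Fin n) (coeff f) * subst trunc isPar_trunc (gvol n [])) ∧
      (S.card ≠ 3 → f = 0) := by
    intro p a S
    by_cases hS : 3 ≤ S.card
    · obtain ⟨f, hf, hf'⟩ := exists_word_flat_mul hn p.1.1 p.1.2 a S hS
      exact ⟨f, fun _ => hf, hf'⟩
    · exact ⟨0, fun h => absurd h hS, fun _ => rfl⟩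
  choose m hm1 hm2 using hm
  -- This is the scalar by which the linear term in the tail multiplies the volume element; only
  -- `|S| = 3` contributes, which makes it of degree `-2`.
  set C : Pairs n → (fiber n).Forms := fun p => ∑ a, ∑ S, (fiber n).z (ix (Sum.inl a) S) *
    coeff (m p a S) with hC
  have hCmem : ∀ p, C p ∈ (fiber n).homog 0 (-2) := by
    refine fun p => sum_mem fun a _ => sum_mem fun S _ => ?_
    by_cases hS : S.card = 3
    · have h := homog_mul (z_mem_homog (G := fiber n) (ix (Sum.inl a) S)) (coeff_mem_homog (m p a S))
      rwa [deg_ix, hS] at h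
    · rw [hm2 p a S hS, FreeSuper.coeff_zero, mul_zero]
      exact zero_mem _
  set fn : (reduced n).ι → (fiber n).Forms := fun j => Sum.elim
    (fun a => (fiber n).z (ix (Sum.inl a) j.1.2))
    (fun p => if j.1.2 = ∅ then C p else
      ∑ a, if j.1.2 = {a} then (fiber n).z (ix (Sum.inl a) (pairSet p)) else 0) j.1.1 with hfn
  have h1 : ∀ j, fn j ∈ (fiber n).homog 0 ((reduced n).deg j) := by
    refine forall_rix.2 ⟨fun a U h => z_mem_homog (G := fiber n) (ix (Sum.inl a) U),
      fun p U h => ?_⟩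
    change (if U = ∅ then C p else
      ∑ a, if U = {a} then (fiber n).z (ix (Sum.inl a) (pairSet p)) else 0) ∈ _
    rw [deg_rix_inr]
    split_ifs with hU
    · rw [hU]
      exact hCmem p
    · refine sum_mem fun a _ => ?_
      split_ifs with hUa
      · have h := z_mem_homog (G := fiber n) (ix (Sum.inl a) (pairSet p))
        rw [deg_ix, card_pairSet] at h
        rw [hUa, Finset.card_singleton]
        exact h
      · exact zero_mem _
  have h0 : ∀ j : (reduced n).ι, (reduced n).deg j = 0 → (fiber n).deg j.1 = 0 :=
    forall_rix.2 ⟨fun a U h h' => h', fun p U h h' => by rw [deg_rix_inr] at h'; omega⟩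
  have h2 : ∀ j : (reduced n).ι, (reduced n).deg j = 0 →
      fn j - (fiber n).z j.1 ∈ (fiber n).Fil 1 := by
    refine forall_rix.2 ⟨fun a U h _ => ?_, fun p U h h0 => ?_⟩
    · have h : fn (rix (Sum.inl a) U h) = (fiber n).z (rix (Sum.inl a) U h).1 := rfl
      rw [h, sub_self]
      exact zero_mem _
    · rw [deg_rix_inr] at h0
      omega
  obtain ⟨η, hη, -⟩ := Components.exists_over (G := fiber n) (H := reduced n)
    ⟨fun j => ⟨j.1.1, h0 j j.2⟩, fun _ hx => hx, fn, h1, fun j => h2 j j.2⟩ fiber_deg_le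
  have hη1 : ∀ a U h, η.pullback ((reduced n).z (rix (Sum.inl a) U h)) =
      (fiber n).z (ix (Sum.inl a) U) := fun a U h => hη _
  refine ⟨η, hη1, fun p S => ?_⟩
  have hη2 : ∀ (q : Pairs n) U h, η.pullback ((reduced n).z (rix (Sum.inr q) U h)) =
      if U = ∅ then C q else
        ∑ a, if U = {a} then (fiber n).z (ix (Sum.inl a) (pairSet q)) else 0 := fun q U h => hη _
  have hrz0 : η.pullback (rz (Sum.inr p) ∅) = C p := by
    rw [rz, dif_pos (Finset.card_empty.trans_le zero_le_one), hη2, if_pos rfl]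
  have hrz1 : ∀ (q : Pairs n) a, η.pullback (rz (Sum.inr q) {a}) =
      (fiber n).z (ix (Sum.inl a) (pairSet q)) := by
    intro q a
    rw [rz, dif_pos (Finset.card_singleton a).le, hη2, if_neg (Finset.singleton_ne_empty a)]
    simp
  -- Every two-element set is `pairSet q` for a unique `q`, so the reduced coordinates reproduce the
  -- truncation coefficient by coefficient.
  have hred : ∀ a, extHom n η.pullback η.map_inv (redXi a) = trunc a := by
    intro a
    rw [redXi, extHom_series, trunc]
    congr 1
    funext U
    rw [redCoeff, map_add, map_sum, rz]
    simp_rw [apply_ite η.pullback, hrz1, map_zero]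
    by_cases hU : U.card = 2
    · obtain ⟨q, rfl⟩ := exists_pairSet_eq hU
      rw [dif_neg (by omega), map_zero, zero_add, if_pos hU.le,
        Finset.sum_eq_single q _ (by simp), if_pos rfl]
      exact fun q' _ h => if_neg fun h' => h (pairSet_injective h')
    · rw [Finset.sum_eq_zero fun q _ => if_neg fun (h : pairSet q = U) => hU (h ▸ card_pairSet q),
        add_zero]
      split_ifs with h3 h4 h4
      · exact hη1 a U h3
      · omega
      · omega
      · exact map_zero _
  have hsub : ∀ v : Gr n, extHom n η.pullback η.map_inv (subst redXi isPar_redXi v) =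
      subst trunc isPar_trunc v := by
    intro v
    rw [algHom_comp_subst redXi isPar_redXi _ (fun a => by rw [hred]; exact isPar_trunc a),
      subst_congr hred]
  rw [redPotential, map_smul, ← berezin_extHom η.map_inv, map_mul (extHom n _ _),
    map_add (extHom n _ _), map_mul (extHom n _ _), hsub, hsub, extHom_adjoin, extHom_thetaSet,
    hrz0, subst_add_gvol_two hn isPar_trunc tail_mem_wordIdeal isPar_tail]
  congr 5
  rw [hC, map_sum, Finset.sum_mul]
  refine Finset.sum_congr rfl fun a _ => ?_
  rw [tail, map_sum, Finset.sum_mul, Finset.sum_mul]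
  refine Finset.sum_congr rfl fun T _ => ?_
  split_ifs with hT
  · rw [mul_assoc, hm1 p a T hT, map_mul, mul_assoc]
  · rw [hm2 p a T (by omega), FreeSuper.coeff_zero, mul_zero, map_zero, zero_mul, zero_mul]

end CartanWeyl

/-! ### Reductions of `M` and their restriction to nonnegative degrees. -/

namespace CartanWeyl

open FreeSuper GradedDomain

variable {n : ℕ}

theorem nonneg_deg_le : ∀ i, (fiber n).nonneg.deg i ≤ 1 := fun i => fiber_deg_le i.1

/-- The straightening is invisible where the coordinates of negative degree vanish: each term of the
tail contains a coefficient with `|S| ≥ 3`, which restricts to zero. -/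
theorem straightening_comp_inclusion {F : Hom (fiber n) (fiber n)} (hF : F.Over id (fun _ hx => hx))
    (hF1 : ∀ a U, F.pullback ((fiber n).z (ix (Sum.inl a) U)) = comp U (trunc a + tail a))
    (hF2 : ∀ (p : Pairs n) U, F.pullback ((fiber n).z (ix (Sum.inr p) U)) =
      (fiber n).z (ix (Sum.inr p) U)) {i : Hom (fiber n).nonneg (fiber n)}
    (hi : (fiber n).IsNonnegInclusion i)
    {r : {j : (fiber n).ι // (fiber n).deg j = 0} →
      {j : (fiber n).nonneg.ι // (fiber n).nonneg.deg j = 0}}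
    {h : ∀ x ∈ (fiber n).nonneg.body, x ∘ r ∈ (fiber n).body} (hi' : i.Over r h)
    (a : (fiber n).Forms) : i.pullback (F.pullback a) = i.pullback a := by
  have hneg : ∀ A U, 2 ≤ U.card → i.pullback ((fiber n).z (ix A U)) = 0 := fun A U hU =>
    hi.2 _ (by rw [deg_ix]; omega)
  have h1 : (F.comp i).pullback = i.pullback := by
    refine (hF.comp hi').pullback_eq nonneg_deg_le hi' ?_
    refine forall_ix.2 ⟨fun a U => ?_, fun p U => ?_⟩
    · rw [Hom.comp_apply, hF1, ← comp_extHom i.map_inv, map_add (extHom n _ _)]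
      have h2 : extHom n i.pullback i.map_inv (tail a) = 0 := by
        rw [tail, map_sum]
        refine Finset.sum_eq_zero fun S _ => ?_
        split_ifs with hS
        · rw [map_mul, extHom_adjoin, hneg _ _ (by omega), map_zero, zero_mul]
        · exact map_zero _
      rw [h2, add_zero, trunc, extHom_series, comp_series]
      split_ifs with hU
      · rfl
      · rw [map_zero, hneg _ _ (by omega)]
    · rw [Hom.comp_apply, hF2]
  rw [← Hom.comp_apply, h1]

/-- A map from `M` to the reduced space with leading coordinates as components, along which all
potentials are pulled back. -/
structure Reduction (n : ℕ) where
  map : Hom (fiber n) (reduced n)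
  F : Pairs n → Finset (Fin n) → (reduced n).Forms
  map_F : ∀ p S, map.pullback (F p S) = potential p S
  F_mem : ∀ p S, F p S ∈ (reduced n).homog 0 (S.card - 2)
  F_eq : ∀ p S h, F p S = (reduced n).z (rix (Sum.inr p) S h)
  sub_mem : ∀ a U h, map.pullback ((reduced n).z (rix (Sum.inl a) U h)) -
    (fiber n).z (ix (Sum.inl a) U) ∈ (fiber n).Fil 2
  restrict : ∀ i : Hom (fiber n).nonneg (fiber n), (fiber n).IsNonnegInclusion i →
    ∀ r h, i.Over r h → ∀ a U h, i.pullback (map.pullback ((reduced n).z (rix (Sum.inl a) U h))) =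
      (fiber n).nonneg.z (rix (Sum.inl a) U h)

/-- Undo the straightening, project to the reduced space, and there pass to the potentials with `|S|
≤ 1` as coordinates. The remaining potentials become the functions `F p S` of these. -/
theorem nonempty_reduction (hn : 2 < n) : Nonempty (Reduction n) := by
  obtain ⟨F₁, hF, hbij, hF1, hF2, hF3⟩ := exists_straightening n
  obtain ⟨κ, hκ, hκ1, hκ2⟩ := exists_redPotential_coordinates hn
  obtain ⟨η₀, hη1, hη2⟩ := exists_redProjection hn
  have hpsi : ∀ a, extHom n F₁.pullback F₁.map_inv (psi (Sum.inl a)) = trunc a + tail a := by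
    intro a
    rw [psi_eq, extHom_series]
    simp_rw [hF1]
    exact sum_comp _
  have hpot : ∀ p S, F₁.pullback (potential p S) = η₀.pullback (redPotential p S) := by
    intro p S
    rw [hη2, potential, map_smul, ← berezin_extHom F₁.map_inv, map_mul (extHom n _ _),
      extHom_thetaSet, algHom_comp_subst _ isPar_psi _ (fun a => by
        rw [hpsi]; exact (isPar_trunc a).add (isPar_tail a)), subst_congr hpsi]
  have hu : ∀ a U h, (κ.comp (η₀.comp (F₁.symm hbij))).pullback
      ((reduced n).z (rix (Sum.inl a) U h)) =
        (F₁.symm hbij).pullback ((fiber n).z (ix (Sum.inl a) U)) := by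
    intro a U h
    rw [Hom.comp_apply, Hom.comp_apply, hκ1, hη1]
  refine ⟨⟨κ.comp (η₀.comp (F₁.symm hbij)), fun p S => (κ.symm hκ).pullback (redPotential p S),
    fun p S => ?_, fun p S => (κ.symm hκ).map_homog _ _ _ (redPotential_mem hn p S),
    fun p S h => ?_, fun a U h => ?_, fun i hi r h hi' a U h' => ?_⟩⟩
  · rw [Hom.comp_apply, Hom.comp_apply, κ.pullback_symm hκ, ← hpot, F₁.symm_pullback hbij]
  · rw [← hκ2 p S h, κ.symm_pullback hκ]
  · rw [hu, ← neg_mem_iff, neg_sub]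
    have h1 := (F₁.symm hbij).map_Fil (hF3 (ix (Sum.inl a) U))
    rwa [map_sub, F₁.symm_pullback hbij] at h1
  · rw [hu, ← straightening_comp_inclusion hF hF1 hF2 hi hi', F₁.pullback_symm hbij]
    exact hi.1 (rix (Sum.inl a) U h')

end CartanWeyl

namespace GradedDomain

open FreeSuper

variable {G H : GradedDomain}

/-! ### Values and first derivatives at a point of the body -/

/-- The value of a function at a point of the body. -/
def valAt (x : G.body) : G.Forms →ₐ[ℝ] ℝ := (SmoothFun.eval x).comp ord0

/-- The value of a partial derivative at a point of the body. -/
def leadAt (x : G.body) (i : G.ι) : G.Forms →ₗ[ℝ] ℝ := (valAt x).toLinearMap ∘ₗ G.pd i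

theorem leadAt_apply (x : G.body) (i : G.ι) (a : G.Forms) :
    leadAt x i a = (ord0 (G.pd i a) : SmoothFun G.body) x := rfl

theorem ord0_tw (k : ℤ) (a : G.Forms) : ord0 (tw k a) = ord0 a := by
  by_cases h : Even k
  · rw [tw_even h]
  · rw [tw_odd h, CartanWeyl.ord0_inv]

theorem leadAt_mul (x : G.body) (i : G.ι) (a b : G.Forms) :
    leadAt x i (a * b) = leadAt x i a * valAt x b + valAt x a * leadAt x i b := by
  have h : valAt x (tw (G.deg i) a) = valAt x a := congrArg (SmoothFun.eval x) (ord0_tw _ a)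
  change valAt x (G.pd i (a * b)) = _
  rw [pd_mul, map_add, map_mul, map_mul, h]
  rfl

theorem leadAt_z (x : G.body) (i j : G.ι) :
    leadAt x i (G.z j) = open Classical in if j = i then 1 else 0 := by
  change valAt x (G.pd i (G.z j)) = _
  rw [pd_z]
  split_ifs
  · exact map_one _
  · exact map_zero _

theorem ord0_pd_monomial (i : G.ι) (f : SmoothFun G.body) {l : List (G.ι ⊕ G.ι)}
    (h : 2 ≤ (l.map G.lord).sum) : ord0 (G.pd i (G.monomial f l)) = 0 := by
  induction l with
  | nil => simp at h
  | cons a l ih =>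
    have ha : G.lord a ≤ 1 := by
      rcases a with j | j
      · change (if G.deg j = 0 then 0 else 1) ≤ 1
        split_ifs <;> omega
      · exact le_rfl
    rw [List.map_cons, List.sum_cons] at h
    rw [monomial_cons, pd_mul, map_add, map_mul, map_mul, ord0_monomial f (by omega), mul_zero,
      zero_add, ord0_tw]
    by_cases h0 : G.lord a = 0
    · rw [ih (by omega), mul_zero]
    · rw [ord0_gen h0, zero_mul]

theorem leadAt_Fil (x : G.body) (i : G.ι) {a : G.Forms} (ha : a ∈ G.Fil 2) : leadAt x i a = 0 := by
  have h : G.Fil 2 ≤ LinearMap.ker (leadAt x i) := mspan_le fun f l hl => by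
    rw [LinearMap.mem_ker, leadAt_apply, ord0_pd_monomial i f hl, SmoothFun.zero_apply]
  exact h ha

theorem leadAt_pullback (φ : Hom G H) (x : G.body) (i : G.ι) {f : H.Forms} (hf : f ∈ H.functions) :
    leadAt x i (φ.pullback f) =
      ∑ j, leadAt x i (φ.pullback (H.z j)) * valAt x (φ.pullback (H.pd j f)) := by
  change valAt x (G.pd i (φ.pullback f)) = _
  rw [φ.pd_pullback i hf, map_sum]
  exact Finset.sum_congr rfl fun j _ => map_mul _ _ _

/-- The coordinates of degree zero of a graded manifold and of its nonnegative part. -/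
def nonnegDegZeroEquiv (G : GradedDomain) :
    {i : G.nonneg.ι // G.nonneg.deg i = 0} ≃ {i : G.ι // G.deg i = 0} where
  toFun i := ⟨i.1.1, i.2⟩
  invFun j := ⟨⟨j.1, j.2.ge⟩, j.2⟩
  left_inv _ := rfl
  right_inv _ := rfl

end GradedDomain

/-! ### Darboux functions on `M` and their independence. -/

namespace CartanWeyl

open FreeSuper GradedDomain

variable {n : ℕ}

namespace Reduction

variable (R : Reduction n)

theorem F_mem_functions (p : Pairs n) (S : Finset (Fin n)) : R.F p S ∈ (reduced n).functions :=
  homog_le_formsOfDegree _ _ (R.F_mem p S)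

/-- The pullbacks of the derivatives of the potentials. -/
def deriv (j : (reduced n).ι) (p : Pairs n) (S : Finset (Fin n)) : (fiber n).Forms :=
  R.map.pullback ((reduced n).pd j (R.F p S))

theorem deriv_mem (j : (reduced n).ι) (p : Pairs n) (S : Finset (Fin n)) :
    R.deriv j p S ∈ (fiber n).homog 0 (S.card - 2 - (reduced n).deg j) :=
  R.map.map_homog _ _ _ (pd_mem_homog j (R.F_mem p S))

/-- The function conjugate to the component `j` of the map to the reduced space. -/
def conj (j : (reduced n).ι) : (fiber n).Forms :=
  ∑ p, ∑ S : Finset (Fin n), sg (S.card + (reduced n).deg j) •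
    (R.deriv j p S * (fiber n).z (ix (Sum.inr p) S))

theorem conj_mem (j : (reduced n).ι) : R.conj j ∈ (fiber n).homog 0 (-1 - (reduced n).deg j) := by
  refine sum_mem fun p _ => sum_mem fun S _ => Submodule.smul_mem _ _ ?_
  have h := homog_mul (R.deriv_mem j p S) (z_mem_homog (G := fiber n) (ix (Sum.inr p) S))
  rw [deg_ix, show (S.card : ℤ) - 2 - (reduced n).deg j + (1 - S.card) = -1 - (reduced n).deg j by
    ring] at h
  exact h

/-- This is the pullback of `d(dF) = 0`, i.e. the symmetry of the second derivatives of `F p S`. -/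
theorem sum_dz_mul_d_deriv (p : Pairs n) (S : Finset (Fin n)) :
    ∑ j, sg ((reduced n).deg j) • (R.map.pullback ((reduced n).dz j) *
      (fiber n).d (R.deriv j p S)) = 0 := by
  have h := congrArg R.map.pullback (d_d (R.F p S))
  have h1 : (reduced n).d (R.F p S) = ∑ j, (reduced n).dz j * (reduced n).pd j (R.F p S) := rfl
  rw [h1, d_sum, map_sum, map_zero] at h
  rw [← neg_eq_zero, ← h, ← Finset.sum_neg_distrib]
  refine Finset.sum_congr rfl fun j _ => ?_
  have h2 : inv ((reduced n).dz j) = -(sg ((reduced n).deg j) • (reduced n).dz j) := by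
    rw [← tw_one, (isPar_dz j).tw, one_mul, sg_add, sg_odd (k := 1) (by decide), mul_neg_one, neg_smul]
  rw [d_mul, d_dz, zero_mul, zero_add, h2, neg_mul, smul_mul_assoc, map_neg, map_smul, map_mul,
    R.map.map_d]
  rfl

/-- The presymplectic form in terms of the components of the map to the reduced space and their
conjugates. -/
theorem omegaM_eq_sum (hn : 2 < n) :
    omegaM n = ∑ j, R.map.pullback ((reduced n).dz j) * (fiber n).d (R.conj j) := by
  have h1 : ∀ p S, (fiber n).d (potential p S) =
      ∑ j, R.map.pullback ((reduced n).dz j) * R.deriv j p S := by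
    intro p S
    rw [← R.map_F, ← R.map.map_d]
    change R.map.pullback (∑ j, (reduced n).dz j * (reduced n).pd j (R.F p S)) = _
    rw [map_sum]
    exact Finset.sum_congr rfl fun j _ => map_mul _ _ _
  have h2 : ∀ j, R.map.pullback ((reduced n).dz j) * (fiber n).d (R.conj j) =
      ∑ p, ∑ S : Finset (Fin n), (sg S.card • (sg ((reduced n).deg j) •
        (R.map.pullback ((reduced n).dz j) * (fiber n).d (R.deriv j p S))) *
          (fiber n).z (ix (Sum.inr p) S) +
        R.map.pullback ((reduced n).dz j) * R.deriv j p S * (fiber n).dz (ix (Sum.inr p) S)) := by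
    intro j
    rw [conj, d_sum, Finset.mul_sum]
    refine Finset.sum_congr rfl fun p _ => ?_
    rw [d_sum, Finset.mul_sum]
    refine Finset.sum_congr rfl fun S _ => ?_
    have h3 : inv (R.deriv j p S) = sg (S.card + (reduced n).deg j) • R.deriv j p S := by
      rw [← tw_one, (isPar_of_mem_homog (R.deriv_mem j p S)).tw]
      congr 1
      refine sg_congr ⟨-1 - (reduced n).deg j, ?_⟩
      push_cast
      ring
    rw [d_smul, d_mul, d_z, h3, smul_add, smul_mul_assoc, smul_smul, sg_mul_self, one_smul, mul_add,
      mul_smul_comm, smul_smul, ← sg_add, smul_mul_assoc, mul_assoc, mul_assoc]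
  simp_rw [h2]
  rw [omegaM_eq hn]
  symm
  rw [Finset.sum_comm]
  refine Finset.sum_congr rfl fun p _ => ?_
  rw [Finset.sum_comm]
  refine Finset.sum_congr rfl fun S _ => ?_
  -- The terms in which `d` acts on the derivatives of `F` cancel by `sum_dz_mul_d_deriv`. What
  -- remains is the chain rule for the differential of the potential.
  rw [Finset.sum_add_distrib, ← Finset.sum_mul, ← Finset.sum_mul, ← Finset.smul_sum,
    R.sum_dz_mul_d_deriv, smul_zero, zero_mul, zero_add, h1]

/-- For `|T| ≤ 1` the function `F q T` is itself a coordinate, so its derivatives are Kronecker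
symbols and isolate one coefficient of `ρ(θ)`. Only the coefficients with `|T| ≥ 2`, of negative
degree, remain. -/
theorem conj_inr_sub (p : Pairs n) (S : Finset (Fin n)) (h : S.card ≤ 1) :
    R.conj (rix (Sum.inr p) S h) - (fiber n).z (ix (Sum.inr p) S) =
      ∑ q, ∑ T : Finset (Fin n), if 2 ≤ T.card then
        sg (T.card + (reduced n).deg (rix (Sum.inr p) S h)) •
          (R.deriv (rix (Sum.inr p) S h) q T * (fiber n).z (ix (Sum.inr q) T)) else 0 := by
  classical
  have h1 : (fiber n).z (ix (Sum.inr p) S) = ∑ q : Pairs n, ∑ T : Finset (Fin n),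
      if q = p ∧ T = S then (fiber n).z (ix (Sum.inr p) S) else 0 := by
    rw [Finset.sum_eq_single p, Finset.sum_eq_single S, if_pos ⟨rfl, rfl⟩]
    · exact fun T _ hT => if_neg fun h => hT h.2
    · simp
    · exact fun q _ hq => Finset.sum_eq_zero fun T _ => if_neg fun h => hq h.1
    · simp
  rw [conj, h1, ← Finset.sum_sub_distrib]
  refine Finset.sum_congr rfl fun q _ => ?_
  rw [← Finset.sum_sub_distrib]
  refine Finset.sum_congr rfl fun T _ => ?_
  by_cases hT : T.card ≤ 1
  · rw [if_neg (c := 2 ≤ T.card) (by omega), deriv, R.F_eq q T hT, pd_z]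
    by_cases hq : q = p ∧ T = S
    · obtain ⟨rfl, rfl⟩ := hq
      rw [if_pos rfl, if_pos ⟨rfl, rfl⟩, map_one, one_mul, deg_rix_inr, sg_even ⟨T.card - 1, by ring⟩,
        one_smul, sub_self]
    · rw [if_neg, if_neg hq, map_zero, zero_mul, smul_zero, sub_self]
      intro h3
      have h4 : ((Sum.inr q, T) : Target n × Finset (Fin n)) = (Sum.inr p, S) :=
        congrArg Subtype.val h3
      exact hq ⟨Sum.inr.inj (Prod.mk.inj h4).1, (Prod.mk.inj h4).2⟩
  · rw [if_pos (c := 2 ≤ T.card) (by omega), if_neg, sub_zero]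
    rintro ⟨-, rfl⟩
    exact hT h

theorem conj_inr_sub_mem (p : Pairs n) (S : Finset (Fin n)) (h : S.card ≤ 1) :
    R.conj (rix (Sum.inr p) S h) - (fiber n).z (ix (Sum.inr p) S) ∈ (fiber n).Fil 1 := by
  rw [conj_inr_sub]
  refine sum_mem fun q _ => sum_mem fun T _ => ?_
  split_ifs with hT
  · exact Submodule.smul_mem _ _ (Fil_mul_left _ (z_mem_Fil (by rw [deg_ix]; omega)))
  · exact zero_mem _

theorem restrict_conj_inr {i : Hom (fiber n).nonneg (fiber n)} (hi : (fiber n).IsNonnegInclusion i)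
    (p : Pairs n) (S : Finset (Fin n)) (h : S.card ≤ 1) :
    i.pullback (R.conj (rix (Sum.inr p) S h)) = (fiber n).nonneg.z (rix (Sum.inr p) S h) := by
  have h1 : i.pullback (R.conj (rix (Sum.inr p) S h) - (fiber n).z (ix (Sum.inr p) S)) = 0 := by
    rw [conj_inr_sub, map_sum]
    refine Finset.sum_eq_zero fun q _ => ?_
    rw [map_sum]
    refine Finset.sum_eq_zero fun T _ => ?_
    split_ifs with hT
    · rw [map_smul, map_mul, hi.2 (ix (Sum.inr q) T) (by rw [deg_ix]; omega), mul_zero, smul_zero]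
    · exact map_zero _
  rw [map_sub, sub_eq_zero] at h1
  rw [h1]
  exact hi.1 (rix (Sum.inr p) S h)

theorem map_inr (p : Pairs n) (S : Finset (Fin n)) (h : S.card ≤ 1) :
    R.map.pullback ((reduced n).z (rix (Sum.inr p) S h)) = potential p S := by
  rw [← R.F_eq, R.map_F]

theorem leadAt_map_inl (x : (fiber n).body) (i : (fiber n).ι) (a : Fin n) (U : Finset (Fin n))
    (h : U.card ≤ 1) : leadAt x i (R.map.pullback ((reduced n).z (rix (Sum.inl a) U h))) =
      open Classical in if ix (Sum.inl a) U = i then 1 else 0 := by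
  rw [← leadAt_z x, ← sub_eq_zero, ← map_sub, leadAt_Fil x i (R.sub_mem a U h)]

theorem leadAt_map_rho (hn : 2 < n) (x : (fiber n).body) (p : Pairs n) (S : Finset (Fin n)) :
    ∀ j, leadAt x (ix (Sum.inr p) S) (R.map.pullback ((reduced n).z j)) = 0 := by
  refine forall_rix.2 ⟨fun a U h => ?_, fun q U h => ?_⟩
  · rw [leadAt_map_inl, if_neg]
    intro h1
    exact Sum.inl_ne_inr (Prod.mk.inj (h1 : (Sum.inl a, U) = (Sum.inr p, S))).1
  · rw [map_inr, leadAt_apply, (pd_potential hn q U).2, map_zero, SmoothFun.zero_apply]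

/-- The components of the reduction have zero first derivatives along the coefficients of `ρ(θ)` at
the body, so by the chain rule only the explicit factor in `conj` is differentiated. -/
theorem leadAt_conj_rho (hn : 2 < n) (x : (fiber n).body) (p : Pairs n) (S : Finset (Fin n))
    (j : (reduced n).ι) : leadAt x (ix (Sum.inr p) S) (R.conj j) =
      sg (S.card + (reduced n).deg j) * valAt x (R.deriv j p S) := by
  classical
  have h : ∀ q T, leadAt x (ix (Sum.inr p) S) (R.deriv j q T * (fiber n).z (ix (Sum.inr q) T)) =
      if ix (Sum.inr q) T = ix (Sum.inr p) S then valAt x (R.deriv j q T) else 0 := by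
    intro q T
    rw [leadAt_mul, deriv, leadAt_pullback _ _ _ (pd_mem_formsOfDegree j (R.F_mem_functions q T)),
      Finset.sum_eq_zero fun k _ => by rw [R.leadAt_map_rho hn, zero_mul], zero_mul, zero_add,
      leadAt_z]
    split_ifs
    · rw [mul_one]
    · rw [mul_zero]
  rw [conj, map_sum, Finset.sum_eq_single p, map_sum, Finset.sum_eq_single S, map_smul, h,
    if_pos rfl, smul_eq_mul]
  · intro T _ hT
    rw [map_smul, h, if_neg, smul_zero]
    exact fun h1 => hT (Prod.mk.inj (h1 : (Sum.inr p, T) = (Sum.inr p, S))).2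
  · simp
  · intro q _ hq
    rw [map_sum]
    refine Finset.sum_eq_zero fun T _ => ?_
    rw [map_smul, h, if_neg, smul_zero]
    exact fun h1 => hq (Sum.inr.inj (Prod.mk.inj (h1 : (Sum.inr q, T) = (Sum.inr p, S))).1)
  · simp

theorem leadAt_potential (hn : 2 < n) (x : (fiber n).body) (p : Pairs n) (S : Finset (Fin n))
    (a : Fin n) (U : Finset (Fin n)) : leadAt x (ix (Sum.inl a) U) (potential p S) =
      2 * sg (S.card + n) * (sg n * sg (n * U.card)) * leadVol (frame x.1) U a p.1.1 p.1.2 S :=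
  ord0_pd_potential hn x p S a U

/-- Apply the chain rule to a potential written as `F` of the reduced coordinates. Those reduced
coordinates that are potentials do not contribute: their leading derivative along a `ξ_U` with `|U|
≤ 1` vanishes, since the sizes of the two sets cannot add up to three. -/
theorem valAt_deriv (hn : 2 < n) (x : (fiber n).body) (p : Pairs n) (S : Finset (Fin n))
    (a : Fin n) (U : Finset (Fin n)) (h : U.card ≤ 1) :
    valAt x (R.deriv (rix (Sum.inl a) U h) p S) =
      2 * sg (S.card + n) * (sg n * sg (n * U.card)) * leadVol (frame x.1) U a p.1.1 p.1.2 S := by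
  classical
  rw [← leadAt_potential hn, ← R.map_F, leadAt_pullback _ _ _ (R.F_mem_functions p S),
    Finset.sum_eq_single (rix (Sum.inl a) U h), leadAt_map_inl, if_pos rfl, one_mul, deriv]
  · refine (forall_rix (P := fun j => j ∈ Finset.univ → j ≠ _ → _)).2
      ⟨fun b V h' _ hne => ?_, fun q V h' _ _ => ?_⟩
    · rw [leadAt_map_inl, if_neg, zero_mul]
      exact fun h1 => hne (Subtype.ext h1)
    · rw [map_inr, leadAt_potential hn, leadVol_eq_zero hn (by omega), mul_zero, zero_mul]
  · simp

/-- The components of the map to the reduced space and their conjugates are independent to first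
order. -/
theorem eq_zero_of_leads (hn : 2 < n) (x : (fiber n).body) (c c' : (reduced n).ι → ℝ)
    (h : ∀ i, ∑ j, (c j * leadAt x i (R.map.pullback ((reduced n).z j)) +
      c' j * leadAt x i (R.conj j)) = 0) : c = 0 ∧ c' = 0 := by
  classical
  -- Derivatives along the coefficients of `ρ(θ)` see only the conjugates, so they give equations
  -- for `c'` alone.
  have h1 : ∀ p S, ∑ j, c' j * (sg (S.card + (reduced n).deg j) * valAt x (R.deriv j p S)) = 0 := by
    intro p S
    rw [← h (ix (Sum.inr p) S)]
    refine Finset.sum_congr rfl fun j _ => ?_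
    rw [R.leadAt_map_rho hn, mul_zero, zero_add, R.leadAt_conj_rho hn]
  have h2 : ∀ (p : Pairs n) S hS, c' (rix (Sum.inr p) S hS) = 0 := by
    intro p S hS
    have h3 := h1 p S
    rw [Finset.sum_eq_single (rix (Sum.inr p) S hS), deriv, R.F_eq p S hS, pd_z, if_pos rfl, map_one,
      map_one, mul_one] at h3
    · exact (mul_eq_zero.1 h3).resolve_right (sg_ne_zero _)
    · intro j _ hj
      rw [deriv, R.F_eq p S hS, pd_z, if_neg hj.symm, map_zero, map_zero, mul_zero, mul_zero]
    · simp
  -- With the labels of pairs removed, the equations state that a combination of rows of `leadVol`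
  -- vanishes; the signs are absorbed into `y`.
  have h3 : ∀ a U hU, c' (rix (Sum.inl a) U hU) = 0 := by
    set y : Fin n → Finset (Fin n) → ℝ := fun a U => (if h : U.card ≤ 1 then
      c' (rix (Sum.inl a) U h) else 0) * (sg (1 - U.card) * sg (n * U.card)) with hy
    have h4 : ∀ a U, y a U = 0 := by
      refine eq_zero_of_sum_leadVol_rows hn (e := frame x.1) x.2 y (fun a U hU => ?_)
        fun b c S hbc => ?_
      · simp only [hy]
        rw [dif_neg (by omega), zero_mul]
      · have h5 := h1 ⟨(b, c), hbc⟩ S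
        rw [sum_rix, add_eq_left.2] at h5
        · have h6 : (∑ a, ∑ U, y a U * leadVol (frame x.1) U a b c S) *
              (sg S.card * (2 * sg (S.card + n) * sg n)) = 0 := by
            rw [← h5, Finset.sum_mul]
            refine Finset.sum_congr rfl fun a _ => ?_
            rw [Finset.sum_mul]
            refine Finset.sum_congr rfl fun U _ => ?_
            simp only [hy]
            by_cases hU : U.card ≤ 1
            · rw [dif_pos hU, dif_pos hU, R.valAt_deriv hn, deg_rix_inl, sg_add (S.card : ℤ) (1 - U.card)]
              ring
            · rw [dif_neg hU, dif_neg hU, zero_mul, zero_mul, zero_mul]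
          exact (mul_eq_zero.1 h6).resolve_right (mul_ne_zero (sg_ne_zero _)
            (mul_ne_zero (mul_ne_zero two_ne_zero (sg_ne_zero _)) (sg_ne_zero _)))
        · refine Finset.sum_eq_zero fun p _ => Finset.sum_eq_zero fun T _ => ?_
          split_ifs with hT
          · rw [h2, zero_mul]
          · rfl
    intro a U hU
    have h5 := h4 a U
    simp only [hy] at h5
    rw [dif_pos hU] at h5
    exact (mul_eq_zero.1 h5).resolve_right (mul_ne_zero (sg_ne_zero _) (sg_ne_zero _))
  have hc' : c' = 0 := funext (forall_rix.2 ⟨h3, h2⟩)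
  subst hc'
  -- With `c' = 0`, derivatives along the coefficients of `ξ(θ)` involve only the reduced
  -- coordinates. For `|U| ≤ 1` the potentials drop out and `c` vanishes on the labels of `ξ, e`;
  -- the remaining equations concern columns of `leadVol`.
  have h4 : ∀ a U, (if h : U.card ≤ 1 then c (rix (Sum.inl a) U h) else 0) +
      ∑ p : Pairs n, ∑ S : Finset (Fin n), (if h : S.card ≤ 1 then c (rix (Sum.inr p) S h) *
        (2 * sg (S.card + n) * (sg n * sg (n * U.card)) * leadVol (frame x.1) U a p.1.1 p.1.2 S)
          else 0) = 0 := by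
    intro a U
    have h5 := h (ix (Sum.inl a) U)
    simp only [Pi.zero_apply, zero_mul, add_zero] at h5
    rw [sum_rix] at h5
    refine Eq.trans ?_ h5
    congr 1
    · rw [Finset.sum_eq_single a, Finset.sum_eq_single U]
      · simp only [leadAt_map_inl, if_true, mul_one]
      · intro V _ hV
        split_ifs with hV'
        · rw [leadAt_map_inl, if_neg, mul_zero]
          exact fun h1 => hV (Prod.mk.inj (h1 : (Sum.inl a, V) = (Sum.inl a, U))).2
        · rfl
      · simp
      · intro b _ hb
        refine Finset.sum_eq_zero fun V _ => ?_
        split_ifs with hV'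
        · rw [leadAt_map_inl, if_neg, mul_zero]
          exact fun h1 => hb (Sum.inl.inj (Prod.mk.inj (h1 : (Sum.inl b, V) = (Sum.inl a, U))).1)
        · rfl
      · simp
    · refine Finset.sum_congr rfl fun p _ => Finset.sum_congr rfl fun S _ => ?_
      split_ifs with hS
      · rw [map_inr, leadAt_potential hn]
      · rfl
  have h5 : ∀ a U hU, c (rix (Sum.inl a) U hU) = 0 := by
    intro a U hU
    have h6 := h4 a U
    rw [dif_pos hU, add_eq_left.2] at h6
    · exact h6
    · refine Finset.sum_eq_zero fun p _ => Finset.sum_eq_zero fun S _ => ?_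
      split_ifs with hS
      · rw [leadVol_eq_zero hn (by omega), mul_zero, mul_zero]
      · rfl
  refine ⟨funext (forall_rix.2 ⟨h5, ?_⟩), rfl⟩
  set y : Pairs n → Finset (Fin n) → ℝ := fun p S => (if h : S.card ≤ 1 then
    c (rix (Sum.inr p) S h) else 0) * (2 * sg (S.card + n)) with hy
  have h6 : ∀ p S, y p S = 0 := by
    refine eq_zero_of_sum_pairs_leadVol hn (e := frame x.1) x.2 y (fun p S hS => ?_) fun a U => ?_
    · simp only [hy]
      rw [dif_neg (by omega), zero_mul]
    · have h7 := h4 a U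
      rw [add_eq_right.2] at h7
      · have h8 : (∑ p : Pairs n, ∑ S, y p S * leadVol (frame x.1) U a p.1.1 p.1.2 S) *
            (sg n * sg (n * U.card)) = 0 := by
          rw [← h7, Finset.sum_mul]
          refine Finset.sum_congr rfl fun p _ => ?_
          rw [Finset.sum_mul]
          refine Finset.sum_congr rfl fun S _ => ?_
          simp only [hy]
          by_cases hS : S.card ≤ 1
          · rw [dif_pos hS, dif_pos hS]
            ring
          · rw [dif_neg hS, dif_neg hS, zero_mul, zero_mul, zero_mul]
        exact (mul_eq_zero.1 h8).resolve_right (mul_ne_zero (sg_ne_zero _) (sg_ne_zero _))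
      · split_ifs with hU
        · exact h5 a U hU
        · rfl
  intro p S hS
  have h7 := h6 p S
  simp only [hy] at h7
  rw [dif_pos hS] at h7
  exact (mul_eq_zero.1 h7).resolve_right (mul_ne_zero two_ne_zero (sg_ne_zero _))

end Reduction

end CartanWeyl

/-! ### Fields, antifields and the projection to the shifted cotangent bundle. -/

namespace CartanWeyl

open FreeSuper GradedDomain

variable {n : ℕ}

theorem nonneg_deg_nonneg : ∀ i, 0 ≤ (fiber n).nonneg.deg i := fun i => i.2

namespace Reduction

variable (R : Reduction n)

/-- Whether a label is that of one of the coordinates `ξ^a, e^a_μ`. -/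
def isXi (j : (fiber n).nonneg.ι) : Bool := j.1.1.isLeft

/-- The Darboux coordinates: fields and ghosts. -/
def field (j : (fiber n).nonneg.ι) : (fiber n).Forms :=
  if isXi j then R.map.pullback ((reduced n).z j) else R.conj j

/-- The Darboux coordinates: antifields. -/
def antifield (j : (fiber n).nonneg.ι) : (fiber n).Forms :=
  if isXi j then R.conj j else R.map.pullback ((reduced n).z j)

theorem field_mem : ∀ j, R.field j ∈ (fiber n).homog 0 ((fiber n).nonneg.deg j) := by
  refine (forall_rix (P := fun j => R.field j ∈ _)).2 ⟨fun a U h => ?_, fun p U h => ?_⟩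
  · exact R.map.map_homog _ _ _ (z_mem_homog (G := reduced n) (rix (Sum.inl a) U h))
  · have h1 := R.conj_mem (rix (Sum.inr p) U h)
    rw [deg_rix_inr, show -1 - ((U.card : ℤ) - 2) = 1 - U.card by ring] at h1
    exact h1

theorem antifield_mem : ∀ j, R.antifield j ∈
    (fiber n).homog 0 (-1 - (fiber n).nonneg.deg j) := by
  refine (forall_rix (P := fun j => R.antifield j ∈ _)).2 ⟨fun a U h => ?_, fun p U h => ?_⟩
  · exact R.conj_mem (rix (Sum.inl a) U h)
  · have h1 := R.map.map_homog _ _ _ (z_mem_homog (G := reduced n) (rix (Sum.inr p) U h))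
    rw [deg_rix_inr, show ((U.card : ℤ) - 2) = -1 - (1 - U.card) by ring] at h1
    exact h1

theorem field_sub_mem : ∀ j, R.field j - (fiber n).z j.1 ∈ (fiber n).Fil 1 :=
  (forall_rix (P := fun j => R.field j - (fiber n).z j.1 ∈ (fiber n).Fil 1)).2
    ⟨fun a U h => Fil_le one_le_two (R.sub_mem a U h), fun p U h => R.conj_inr_sub_mem p U h⟩

/-- For the labels of `ρ, ω` the reduced coordinate is the antifield and its conjugate the field.
Exchanging their differentials costs no sign, again because a product of consecutive integers is
even. -/
theorem omegaM_eq_sum_field (hn : 2 < n) :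
    omegaM n = ∑ j, (fiber n).d (R.field j) * (fiber n).d (R.antifield j) := by
  rw [R.omegaM_eq_sum hn]
  refine Finset.sum_congr rfl fun j _ => ?_
  unfold field antifield
  rw [R.map.map_dz]
  split_ifs
  · rfl
  · have h1 := isPar_of_mem_homog (d_mem_homog (R.conj_mem j))
    have h2 := isPar_of_mem_homog (d_mem_homog
      (R.map.map_homog _ _ _ (z_mem_homog (G := reduced n) j)))
    rw [h2.comm_isPar h1, sg_even, one_smul]
    have h3 := Int.even_mul_succ_self ((reduced n).deg j)
    obtain ⟨r, hr⟩ := h3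
    refine ⟨-r, ?_⟩
    push_cast
    linear_combination -hr

theorem sum_lead (x : (fiber n).body) (i : (fiber n).ι) (c c' : (fiber n).nonneg.ι → ℝ) :
    ∑ j, (c j * leadAt x i (R.field j) + c' j * leadAt x i (R.antifield j)) =
      ∑ j, ((if isXi j then c j else c' j) * leadAt x i (R.map.pullback ((reduced n).z j)) +
        (if isXi j then c' j else c j) * leadAt x i (R.conj j)) := by
  refine Finset.sum_congr rfl fun j _ => ?_
  unfold field antifield
  split_ifs
  · rfl
  · exact add_comm _ _

/-- `M` projects to the shifted cotangent bundle by the fields and antifields. -/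
theorem exists_projection (hn : 2 < n) :
    ∃ π : Hom (fiber n) (fiber n).nonneg.shiftedCotangent,
      IsSymplecticQuotient (-1) (omegaM n) (fiber n).nonneg.shiftedCotangent
        (fiber n).nonneg.canonicalForm π ∧
      (∃ h, π.Over ((degZeroEquiv nonneg_deg_nonneg).symm.trans (nonnegDegZeroEquiv (fiber n))) h) ∧
      (∀ j, π.pullback ((fiber n).nonneg.shiftedCotangent.z ((fiber n).nonneg.q j)) =
        R.field j) ∧
      ∀ j, π.pullback ((fiber n).nonneg.shiftedCotangent.z ((fiber n).nonneg.qs j)) =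
        R.antifield j := by
  set e := (degZeroEquiv (L := (fiber n).nonneg) nonneg_deg_nonneg).symm.trans
    (nonnegDegZeroEquiv (fiber n)) with he
  have h : ∀ x ∈ (fiber n).body, x ∘ e ∈ (fiber n).nonneg.shiftedCotangent.body := fun x hx =>
    comp_degZeroEquiv_symm_mem (L := (fiber n).nonneg) nonneg_deg_nonneg
      (x ∘ nonnegDegZeroEquiv (fiber n)) hx
  have h' : ∀ x ∈ (fiber n).nonneg.shiftedCotangent.body, x ∘ e.symm ∈ (fiber n).body :=
    fun x hx => comp_degZeroEquiv_mem (L := (fiber n).nonneg) nonneg_deg_nonneg x hx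
  have hdeg := shiftedCotangent_deg_le (L := (fiber n).nonneg) nonneg_deg_nonneg nonneg_deg_le
  obtain ⟨π, hπ, hπ'⟩ := Components.exists_over (G := fiber n)
    (H := (fiber n).nonneg.shiftedCotangent) ⟨e, h, Sum.elim R.field R.antifield,
      (forall_shiftedCotangent _).2 ⟨R.field_mem, R.antifield_mem⟩, fun j => by
        obtain ⟨k, rfl⟩ := (degZeroEquiv (L := (fiber n).nonneg) nonneg_deg_nonneg).surjective j
        rw [he, Equiv.trans_apply, Equiv.symm_apply_apply]
        exact R.field_sub_mem k.1⟩ fiber_deg_le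
  have h1 : ∀ j, π.pullback ((fiber n).nonneg.shiftedCotangent.z ((fiber n).nonneg.q j)) =
      R.field j := fun j => hπ _
  have h2 : ∀ j, π.pullback ((fiber n).nonneg.shiftedCotangent.z ((fiber n).nonneg.qs j)) =
      R.antifield j := fun j => hπ _
  have h3 : π.pullback (fiber n).nonneg.canonicalForm = omegaM n := by
    rw [canonicalForm_eq, map_sum, R.omegaM_eq_sum_field hn]
    refine Finset.sum_congr rfl fun j _ => ?_
    rw [map_mul, π.map_dz, π.map_dz, h1, h2]
  refine ⟨π, ?_, ⟨h, hπ'⟩, h1, h2⟩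
  rw [← h3]
  refine isSymplecticQuotient_shiftedCotangent fiber_deg_le hdeg π e h h' hπ' fun x c hc => ?_
  -- The coefficients are redistributed according to which member of each conjugate pair is the
  -- field and which the antifield.
  have h4 := R.eq_zero_of_leads hn x
    (fun j => if isXi j then c ((fiber n).nonneg.q j) else c ((fiber n).nonneg.qs j))
    (fun j => if isXi j then c ((fiber n).nonneg.qs j) else c ((fiber n).nonneg.q j)) fun i => by
      refine (R.sum_lead x i (fun j => c ((fiber n).nonneg.q j))
        fun j => c ((fiber n).nonneg.qs j)).symm.trans ?_
      rw [← hc i, sum_shiftedCotangent, ← Finset.sum_add_distrib]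
      refine Finset.sum_congr rfl fun j _ => ?_
      rw [← h1, ← h2]
      rfl
  refine funext ((forall_shiftedCotangent _).2 ⟨fun j => ?_, fun j => ?_⟩)
  · by_cases hj : isXi j
    · exact (if_pos hj).symm.trans (congrFun h4.1 j)
    · exact (if_neg hj).symm.trans (congrFun h4.2 j)
  · by_cases hj : isXi j
    · exact (if_pos hj).symm.trans (congrFun h4.2 j)
    · exact (if_neg hj).symm.trans (congrFun h4.1 j)

theorem restrict_field {i : Hom (fiber n).nonneg (fiber n)} (hi : (fiber n).IsNonnegInclusion i)
    {r : {j : (fiber n).ι // (fiber n).deg j = 0} →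
      {j : (fiber n).nonneg.ι // (fiber n).nonneg.deg j = 0}}
    {h : ∀ x ∈ (fiber n).nonneg.body, x ∘ r ∈ (fiber n).body} (hi' : i.Over r h) :
    ∀ j, i.pullback (R.field j) = (fiber n).nonneg.z j :=
  (forall_rix (P := fun j => i.pullback (R.field j) = (fiber n).nonneg.z j)).2
    ⟨fun a U h' => R.restrict i hi r h hi' a U h', fun p U h' => R.restrict_conj_inr hi p U h'⟩

/-- Antifields have negative degree, and a graded manifold with coordinates of nonnegative degree
has no nonzero functions of negative degree. -/
theorem restrict_antifield (i : Hom (fiber n).nonneg (fiber n)) (j : (fiber n).nonneg.ι) :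
    i.pullback (R.antifield j) = 0 := by
  have h := i.map_homog _ _ _ (R.antifield_mem j)
  rwa [homog_eq_bot_of_neg nonneg_deg_nonneg (by have := nonneg_deg_nonneg j; omega),
    Submodule.mem_bot] at h

end Reduction

end CartanWeyl

end

/-! ### The theorem for an arbitrary symplectic quotient. -/

theorem mainTheorem4 (n : ℕ) (hn : 2 < n) :
    ∃ i : GradedDomain.Hom (CartanWeyl.fiber n).nonneg (CartanWeyl.fiber n),
      (CartanWeyl.fiber n).IsNonnegInclusion i ∧
      (∃ (N : GradedDomain) (σN : N.Forms) (π : GradedDomain.Hom (CartanWeyl.fiber n) N),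
        GradedDomain.IsSymplecticQuotient (-1) (CartanWeyl.omegaM n) N σN π) ∧
      ∀ (N : GradedDomain) (σN : N.Forms) (π : GradedDomain.Hom (CartanWeyl.fiber n) N),
        GradedDomain.IsSymplecticQuotient (-1) (CartanWeyl.omegaM n) N σN π →
          GradedDomain.IsClosedEmbedding (π.comp i) N.negIdeal ∧
          N.IsLagrangian σN N.negIdeal ∧
          ∃ Φ : GradedDomain.Hom N (CartanWeyl.fiber n).nonneg.shiftedCotangent,
            Function.Bijective Φ.pullback ∧
            Φ.pullback (CartanWeyl.fiber n).nonneg.canonicalForm = σN ∧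
            (CartanWeyl.fiber n).nonneg.IsZeroSection (Φ.comp (π.comp i)) := by
  obtain ⟨R⟩ := CartanWeyl.nonempty_reduction hn
  obtain ⟨i, hi, hi'⟩ := (CartanWeyl.fiber n).exists_nonnegInclusion CartanWeyl.fiber_deg_le
  obtain ⟨π₀, Q₀, ⟨h, hπ⟩, h1, h2⟩ := R.exists_projection hn
  have hs : (CartanWeyl.fiber n).nonneg.IsZeroSection (π₀.comp i) := by
    refine ⟨fun j => ?_, fun j => ?_⟩
    · exact (congrArg i.pullback (h1 j)).trans (R.restrict_field hi hi' j)
    · exact (congrArg i.pullback (h2 j)).trans (R.restrict_antifield i j)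
  have hs' : (π₀.comp i).Over (GradedDomain.degZeroEquiv CartanWeyl.nonneg_deg_nonneg).symm
      (GradedDomain.comp_degZeroEquiv_symm_mem CartanWeyl.nonneg_deg_nonneg) := hπ.comp hi'
  refine ⟨i, hi, ⟨_, _, π₀, Q₀⟩, fun N σN π Q => ?_⟩
  -- All assertions hold in the model `T^*[-1]N_{01}`. The isomorphism of quotients is compatible
  -- with the projections from `M`, so it transports them to `N` and is itself the required
  -- symplectomorphism.
  obtain ⟨Φ, hΦ, hΦ', hσ⟩ := Q₀.exists_iso Q
  have hc : ∀ a, (π.comp i).pullback (Φ.pullback a) = (π₀.comp i).pullback a := fun a =>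
    congrArg i.pullback (hΦ' a)
  refine ⟨GradedDomain.IsClosedEmbedding.transport hΦ hc
    (hs.isClosedEmbedding CartanWeyl.nonneg_deg_nonneg CartanWeyl.nonneg_deg_le hs'), ?_, Φ, hΦ, hσ,
    fun j => (hc _).trans (hs.1 j), fun j => (hc _).trans (hs.2 j)⟩
  rw [← hσ]
  exact GradedDomain.IsLagrangian.transport hΦ
    (hs.isLagrangian CartanWeyl.nonneg_deg_nonneg CartanWeyl.nonneg_deg_le hs')
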